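/- **Setting.** Let $G$ be a compact Lie group with Lie algebra $\mathfrak g$, and let $M$ be an oriented smooth (Hausdorff, second countable) manifold without boundary, of even dimension, with a smooth $G$-action. For $X\in\mathfrak g$ let $X^\sharp$ be the induced vector field, $X^\sharp|_x=\frac{d}{dt}\big|_{0}\exp(tX)\cdot x$. A *Hamiltonian $G$-manifold* $(N,\omega,\Phi)$ is an oriented manifold $N$ with a smooth $G$-action, a $G$-invariant closed (possibly degenerate) $2$-form $\omega$, and a smooth $G$-equivariant map $\Phi:N\to\mathfrak g^*$ such that $d\langle\Phi,X\rangle=\iota(X^\sharp)\omega$ for all $X\in\mathfrak g$. Equivariant cohomology $H_G^*(N)$ is the cohomology of the Cartan complex $\Omega_G^*(N)=(\Omega^*(N)\otimes S(\mathfrak g^*))^G$ with $(d_G\eta)(X)=d(\eta(X))-\iota(X^\sharp)\eta(X)$. *Twisted Duistermaat–Heckman distribution.* Let $\beta_1,\dots,\beta_r$ be a basis of $\mathfrak g^*$. For $\eta=\sum_{\mathbf a}\eta_{\mathbf a}\beta^{\mathbf a}\in\Omega^*_G(N)$ and $\varphi\in C_c^\infty(\mathfrak g^*)$ put $D_{\eta,\Phi}(\varphi)=\sum_{\mathbf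 a}(D_{\beta^{\mathbf a}}\varphi\circ\Phi)\,\eta_{\mathbf a}$, where $D_{\beta^{\mathbf a}}$ is the constant coefficient differential operator on $\mathfrak g^*$ given by the iterated derivatives in the directions $\beta_i$. If $\Phi$ is proper and $A\in H^*_G(N)$ is represented by the closed equivariant form $\eta$, then $$\mathrm{DH}_{(N,\omega,\Phi)}(A):\ \varphi\longmapsto\int_N e^{\omega}\wedge D_{\eta,\Phi}(\varphi).$$ *Taming maps and polarizations.* A *taming map* is a smooth $G$-equivariant map $v:M\to\mathfrak g$; its *localizing set* is $Z=\{x: v(x)^\sharp|_x=0\}$. A map $\Phi:N\to\mathfrak g^*$ on a subset $N\subseteq M$ is *$v$-polarized* if $\langle\Phi,v\rangle:N\to\mathbb R$ is proper and bounded from below. A *smooth equivariant weak deformation retraction* of a $G$-invariant open set $U$ to an invariant closed subset $C\subseteq U$ is a smooth equivariant homotopy $p_t:U\to U$, $0\le t\le1$, with $p_0=\mathrm{id}$, $p_1(U)\subseteq C$ and $p_t(C)\subseteq C$ for all $t$. A *$v$-polarized completion* of $(U,\omega|_U,\Phi|_U)$ relative to $C$ is a Hamiltonian $G$-manifold $(U,\omega',\Phi')$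 on the same oriented $G$-manifold $U$ such that $\Phi'$ is $v$-polarized on $U$ and $\omega'+\Phi'$ agrees with $\omega+\Phi$ on $C$, i.e. has the same pullback under every smooth map from an open subset of some $\mathbb R^k$, $k>0$, to $U$ with image in $C$. **Theorem.** Let $(M,\omega,\Phi)$ be an even-dimensional Hamiltonian $G$-manifold without boundary and $A\in H_G^*(M)$. Let $v:M\to\mathfrak g$ be a bounded taming map with localizing set $Z$, and suppose that $\Phi$ is $v$-polarized on $M$. Let $Z=\bigsqcup_{i\in\mathcal I}Z_i$ be the decomposition of $Z$ into its connected components, and suppose that each $Z_i$ is open in $Z$ and that every neighbourhood of $Z_i$ contains a $G$-invariant open neighbourhood of $Z_i$ that admits a smooth equivariant weak deformation retraction to $Z_i$. Then: 1. For every $i$ there are a $G$-invariant open neighbourhood $U_i$ of $Z_i$ with $U_i\cap Z=Z_i$ that admits a smooth equivariant weak deformation retraction to $Z_i$, and a $v$-polarized completion $(U_i,\omega_i,\Phi_i)$ of $(U_i,\omega|_{U_i},\Phi|_{U_i})$ relative to $Z_i$. 2. The distribution $\mathrm{DH}^v_{\mathrm{germ}_{Z_i}(M,\omega,\Phi)}(A|_{Z_i}):=\mathrm{DH}_{(U_i,\omega_i,\Phi_i)}(A|_{U_i})$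 does not depend on the choice of $U_i$ and $(\omega_i,\Phi_i)$ as in 1, nor on the closed equivariant form representing $A|_{U_i}$. 3. For every test function $\varphi\in C_c^\infty(\mathfrak g^*)$ and every choice of representatives of $A$ and of the $A|_{U_i}$, only finitely many local terms are nonzero on $\varphi$, and $$\mathrm{DH}_{(M,\omega,\Phi)}(A)(\varphi)=\sum_{i\in\mathcal I}\mathrm{DH}^v_{\mathrm{germ}_{Z_i}(M,\omega,\Phi)}(A|_{Z_i})(\varphi).$$ -/

import Mathlib

open scoped Manifold ContDiff Topology

noncomputable section

namespace TwistedDH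

/-- The model space `ℝⁿ`. -/
abbrev E (n : ℕ) : Type := EuclideanSpace ℝ (Fin n)

/-! ### Exterior algebra of a vector space -/

section Exterior

variable {V : Type*} [AddCommGroup V] [Module ℝ V] [TopologicalSpace V]

/-- Elements of `Λ⁎V⁎`, possibly of mixed degree, given by their homogeneous components. (If `V` is
finite dimensional then the components of large degree vanish automatically.) -/
abbrev Cov (V : Type*) [AddCommGroup V] [Module ℝ V] [TopologicalSpace V] : Type _ :=
  (k : ℕ) → V [⋀^Fin k]→L[ℝ] ℝ

/-- The interior product `ι(w) a = a(w, ·, …, ·)`. -/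
def interior {k : ℕ} (w : V) (a : V [⋀^Fin (k + 1)]→L[ℝ] ℝ) : V [⋀^Fin k]→L[ℝ] ℝ :=
  { a.toAlternatingMap.curryLeft w with
    cont := by
      refine a.cont.comp (continuous_pi fun i => ?_)
      refine Fin.cases ?_ (fun j => ?_) i
      · exact continuous_const
      · exact continuous_apply j }

@[simp] lemma interior_apply {k : ℕ} (w : V) (a : V [⋀^Fin (k + 1)]→L[ℝ] ℝ) (u : Fin k → V) :
    interior w a u = a (Matrix.vecCons w u) := rfl

/-- The interior product of a vector with a covector of mixed degree. -/
def interiorM (w : V) (a : Cov V) : Cov V := fun k => interior w (a (k + 1))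

/-- The exterior product of an `i`-covector and a `j`-covector, `i + j = k`: the sum over
`(i, j)`-shuffles, without further normalisation. -/
def wedge {i j k : ℕ} (h : i + j = k) (a : V [⋀^Fin i]→L[ℝ] ℝ) (b : V [⋀^Fin j]→L[ℝ] ℝ) :
    V [⋀^Fin k]→L[ℝ] ℝ :=
  { ((LinearMap.mul' ℝ ℝ).compAlternatingMap
      (a.toAlternatingMap.domCoprod b.toAlternatingMap)).domDomCongr
        (finSumFinEquiv.trans (finCongr h)) with
    cont := by
      have : ∀ u : Fin k → V, ((LinearMap.mul' ℝ ℝ).compAlternatingMap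
          (a.toAlternatingMap.domCoprod b.toAlternatingMap)).domDomCongr
          (finSumFinEquiv.trans (finCongr h)) u =
          ∑ σ : Equiv.Perm.ModSumCongr (Fin i) (Fin j), LinearMap.mul' ℝ ℝ
            (AlternatingMap.domCoprod.summand a.toAlternatingMap b.toAlternatingMap σ
              fun l => u (finSumFinEquiv.trans (finCongr h) l)) := by
        intro u
        simp [AlternatingMap.domCoprod_apply, Function.comp_def]
      refine (continuous_congr this).mpr (continuous_finsetSum _ fun σ _ => ?_)
      induction σ using Quotient.inductionOn' with
      | _ σ =>
        simp only [AlternatingMap.domCoprod.summand_mk'', smul_apply,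
          MultilinearMap.domDomCongr_apply, MultilinearMap.domCoprod_apply, map_zsmul_unit,
          LinearMap.mul'_apply]
        refine Continuous.const_smul (Continuous.mul ?_ ?_) _
        · exact a.cont.comp (continuous_pi fun _ => continuous_apply _)
        · exact b.cont.comp (continuous_pi fun _ => continuous_apply _) }

/-- The exterior product in `Λ⁎V⁎`. -/
def wedgeM (a b : Cov V) : Cov V := fun k =>
  ∑ i : Fin (k + 1), wedge (Nat.add_sub_of_le (Nat.lt_succ_iff.mp i.2)) (a i) (b (k - i))

/-- The unit `1 ∈ Λ⁰V⁎`. -/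
def oneM : Cov V := Pi.single 0 (ContinuousAlternatingMap.constOfIsEmpty ℝ V (Fin 0) 1)

/-- Powers in `Λ⁎V⁎`. -/
def powM (a : Cov V) : ℕ → Cov V
  | 0 => oneM
  | p + 1 => wedgeM a (powM a p)

/-- `e^σ = ∑ₚ σ^p / p!` for `σ ∈ Λ²V⁎`. The sum is taken over `p ≤ m`; if `dim V = m`, then the
other powers of `σ` vanish. -/
def expM (m : ℕ) (σ : V [⋀^Fin 2]→L[ℝ] ℝ) : Cov V :=
  ∑ p ∈ Finset.range (m + 1), ((p.factorial : ℝ)⁻¹) • powM (Pi.single 2 σ : Cov V) p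

end Exterior

/-! ### Differential forms on a manifold -/

section Forms

/-! In what follows `σ` denotes a `2`-form (the form `ω` of a Hamiltonian manifold). -/

variable {m : ℕ} {M : Type*} [TopologicalSpace M] [ChartedSpace (E m) M]

/-- (Not necessarily smooth) differential forms of degree `k`.

Forms on an open subset `U` of `M` are represented by such functions on all of `M` whose values
outside `U` are disregarded: every notion below is relative to `U` and looks only at points of
`U`. -/
abbrev DForm (m k : ℕ) (M : Type*) [TopologicalSpace M] [ChartedSpace (E m) M] : Type _ :=
  (x : M) → TangentSpace (𝓡 m) x [⋀^Fin k]→L[ℝ] ℝ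

/-- (Not necessarily smooth) differential forms of mixed degree. -/
def MForm (m : ℕ) (M : Type*) [TopologicalSpace M] [ChartedSpace (E m) M] : Type _ :=
  (k : ℕ) → DForm m k M

instance : AddCommGroup (MForm m M) := inferInstanceAs (AddCommGroup ((k : ℕ) → DForm m k M))

instance : Module ℝ (MForm m M) := inferInstanceAs (Module ℝ ((k : ℕ) → DForm m k M))

lemma MForm.add_apply (α β : MForm m M) (k : ℕ) : (α + β) k = α k + β k := rfl

lemma MForm.smul_apply (t : ℝ) (α : MForm m M) (k : ℕ) : (t • α) k = t • α k := rfl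

lemma MForm.zero_apply (k : ℕ) : (0 : MForm m M) k = 0 := rfl

/-- The coordinate expression of `σ` in the preferred chart `e` at `c`, i.e. the pullback of `σ`
under `e⁻¹`. -/
def chartRep {k : ℕ} (c : M) (σ : DForm m k M) (y : E m) : E m [⋀^Fin k]→L[ℝ] ℝ :=
  (σ ((chartAt (E m) c).symm y)).compContinuousLinearMap
    (mfderiv (𝓡 m) (𝓡 m) (chartAt (E m) c).symm y : E m →L[ℝ] _)

/-- Smoothness of a differential form on the open set `U`. -/
def SmoothFormOn {k : ℕ} (U : Set M) (σ : DForm m k M) : Prop :=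
  ∀ c : M, ContDiffOn ℝ ∞ (chartRep c σ)
    ((chartAt (E m) c).target ∩ (chartAt (E m) c).symm ⁻¹' U)

/-- The exterior derivative: at `x`, it is computed in the preferred chart at `x`. -/
def extd {k : ℕ} (σ : DForm m k M) : DForm m (k + 1) M := fun x =>
  (extDeriv (chartRep x σ) (chartAt (E m) x x)).compContinuousLinearMap
    (mfderiv (𝓡 m) (𝓡 m) (chartAt (E m) x) x : TangentSpace (𝓡 m) x →L[ℝ] E m)

/-- The exterior derivative of a form of mixed degree. -/
def extdM (α : MForm m M) : MForm m M := fun k =>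
  match k with
  | 0 => 0
  | k + 1 => extd (α k)

/-- The pullback of a form under a map `f : M → M`. -/
def pullback {k : ℕ} (f : M → M) (σ : DForm m k M) : DForm m k M := fun x =>
  (σ (f x)).compContinuousLinearMap (mfderiv (𝓡 m) (𝓡 m) f x)

/-- The coordinate frame `∂₁, …, ∂ₘ` of the preferred chart `e` at `c`, at the point `e⁻¹ y`. -/
def coordFrame (c : M) (y : E m) (i : Fin m) :
    TangentSpace (𝓡 m) ((chartAt (E m) c).symm y) :=
  (mfderiv (𝓡 m) (𝓡 m) (chartAt (E m) c).symm y : E m →L[ℝ] _) (EuclideanSpace.single i 1)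

/-- `μ` is a smooth nowhere vanishing form of top degree. Such a form determines an orientation of
`M`, and every orientation arises in this way; only the orientation determined by `μ` (a frame is
positive iff `μ` is positive on it) matters below. -/
def IsOrientationForm (μ : DForm m m M) : Prop :=
  SmoothFormOn Set.univ μ ∧ ∀ x, μ x ≠ 0

section Integral

variable [T2Space M] [SecondCountableTopology M] [IsManifold (𝓡 m) ∞ M]

variable (m M) in
lemma exists_subordinate : ∃ f : SmoothPartitionOfUnity M (𝓡 m) M Set.univ,
    f.IsSubordinate fun x => (chartAt (E m) x).source := by
  have : LocallyCompactSpace M := Manifold.locallyCompact_of_finiteDimensional (𝓡 m)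
  exact SmoothPartitionOfUnity.exists_isSubordinate_chartAt_source (𝓡 m) M

variable (m M) in
/-- A smooth partition of unity `(ρ_c)`, where `ρ_c` is supported in the domain of the preferred
chart at `c`. -/
def partUnity : SmoothPartitionOfUnity M (𝓡 m) M Set.univ := (exists_subordinate m M).choose

open Classical in
/-- The integral `∫_U τ` of a top degree form `τ` with compact support in the open set `U`, where
`M` is oriented by `μ`: the sum over `c` of the integrals of `ρ_c τ` in the preferred chart at `c`,
with a sign that accounts for the orientation of the chart. -/
def integralOn (μ : DForm m m M) (U : Set M) (τ : DForm m m M) : ℝ :=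
  ∑ᶠ c : M, ∫ y in (chartAt (E m) c).target,
    if (chartAt (E m) c).symm y ∈ U then
      partUnity m M c ((chartAt (E m) c).symm y) *
        (Real.sign (μ ((chartAt (E m) c).symm y) (coordFrame c y)) *
          τ ((chartAt (E m) c).symm y) (coordFrame c y))
    else 0

end Integral

/-- `σ₀ + Φ₀` and `σ₁ + Φ₁` agree on the subset `Y`: their pullbacks coincide under every smooth map
`p : V → M` from an open subset `V` of some `ℝˡ`, `l > 0`, with image in `Y`. -/
def AgreeOn {F : Type*} (Y : Set M) (σ₀ : DForm m 2 M) (Φ₀ : M → F) (σ₁ : DForm m 2 M)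
    (Φ₁ : M → F) : Prop :=
  ∀ l : ℕ, 0 < l → ∀ (V : Set (E l)) (p : E l → M), IsOpen V →
    ContMDiffOn (𝓡 l) (𝓡 m) ∞ p V → Set.MapsTo p V Y → ∀ q ∈ V,
      Φ₀ (p q) = Φ₁ (p q) ∧
      (σ₀ (p q)).compContinuousLinearMap (mfderiv (𝓡 l) (𝓡 m) p q) =
        (σ₁ (p q)).compContinuousLinearMap (mfderiv (𝓡 l) (𝓡 m) p q)

lemma chartRep_add {k : ℕ} (c : M) (σ σ' : DForm m k M) :
    chartRep c (σ + σ') = chartRep c σ + chartRep c σ' := rfl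

lemma chartRep_smul {k : ℕ} (c : M) (t : ℝ) (σ : DForm m k M) :
    chartRep c (t • σ) = t • chartRep c σ := rfl

lemma chartRep_zero {k : ℕ} (c : M) : chartRep c (0 : DForm m k M) = 0 := rfl

lemma SmoothFormOn.add {k : ℕ} {U : Set M} {σ σ' : DForm m k M} (h : SmoothFormOn U σ)
    (h' : SmoothFormOn U σ') : SmoothFormOn U (σ + σ') := fun c => by
  rw [chartRep_add]; exact (h c).add (h' c)

lemma SmoothFormOn.smul {k : ℕ} {U : Set M} {σ : DForm m k M} (t : ℝ) (h : SmoothFormOn U σ) :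
    SmoothFormOn U (t • σ) := fun c => by
  rw [chartRep_smul]; exact contDiffOn_const.smul (h c)

lemma SmoothFormOn.zero {k : ℕ} {U : Set M} : SmoothFormOn U (0 : DForm m k M) := fun c => by
  rw [chartRep_zero]; exact contDiffOn_const

lemma SmoothFormOn.mono {k : ℕ} {U V : Set M} {σ : DForm m k M} (h : SmoothFormOn V σ)
    (hUV : U ⊆ V) : SmoothFormOn U σ := fun c =>
  (h c).mono (Set.inter_subset_inter_right _ (Set.preimage_mono hUV))

lemma SmoothFormOn.differentiableAt {k : ℕ} {U : Set M} (hU : IsOpen U) {σ : DForm m k M}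
    (h : SmoothFormOn U σ) {x : M} (hx : x ∈ U) :
    DifferentiableAt ℝ (chartRep x σ) (chartAt (E m) x x) := by
  refine ((h x).contDiffAt ?_).differentiableAt (by simp)
  refine ((chartAt (E m) x).isOpen_inter_preimage_symm hU).mem_nhds ⟨?_, ?_⟩
  · exact mem_chart_target (E m) x
  · simpa using hx

lemma extd_add {k : ℕ} {U : Set M} (hU : IsOpen U) {σ σ' : DForm m k M} (h : SmoothFormOn U σ)
    (h' : SmoothFormOn U σ') {x : M} (hx : x ∈ U) :
    extd (σ + σ') x = extd σ x + extd σ' x := by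
  rw [extd, chartRep_add, extDeriv_add (h.differentiableAt hU hx) (h'.differentiableAt hU hx)]
  rfl

lemma extd_smul {k : ℕ} (t : ℝ) (σ : DForm m k M) (x : M) :
    extd (t • σ) x = t • extd σ x := by
  rw [extd, chartRep_smul, extDeriv_smul]
  rfl

lemma extd_zero {k : ℕ} (x : M) : extd (0 : DForm m k M) x = 0 := by
  simpa using extd_smul (0 : ℝ) (0 : DForm m k M) x

lemma extdM_add {U : Set M} (hU : IsOpen U) {α β : MForm m M} (h : ∀ k, SmoothFormOn U (α k))
    (h' : ∀ k, SmoothFormOn U (β k)) (k : ℕ) {x : M} (hx : x ∈ U) :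
    extdM (α + β) k x = extdM α k x + extdM β k x := by
  cases k with
  | zero => simp [extdM]
  | succ k => exact extd_add hU (h k) (h' k) hx

lemma extdM_smul (t : ℝ) (α : MForm m M) (k : ℕ) (x : M) :
    extdM (t • α) k x = t • extdM α k x := by
  cases k with
  | zero => simp [extdM]
  | succ k => exact extd_smul t (α k) x

lemma extdM_zero (k : ℕ) (x : M) : extdM (0 : MForm m M) k x = 0 := by
  simpa using extdM_smul (0 : ℝ) (0 : MForm m M) k x

end Forms

/-! ### `G`-manifolds, equivariant forms and equivariant cohomology

`G` is a Lie group of dimension `r`. Its Lie algebra `𝔤 = T₁G` is, as for every tangent space in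
Mathlib, the model space `E r`, via the preferred chart at `1`; its dual `𝔤⁎` is `E r →L[ℝ] ℝ`. -/

section Equivariant

variable {r m : ℕ} (G : Type*) [TopologicalSpace G] [ChartedSpace (E r) G] [Group G]
  {M : Type*} [TopologicalSpace M] [ChartedSpace (E m) M] [MulAction G M]

variable {G} in
/-- The adjoint action of `g` on `𝔤`: the derivative at `1` of conjugation by `g`. (It takes values
in the tangent space at `g * 1 * g⁻¹ = 1`.) -/
def Ad (g : G) : E r →L[ℝ] E r := mfderiv (𝓡 r) (𝓡 r) (fun h : G => g * h * g⁻¹) 1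

variable {G} in
/-- The coadjoint action of `g` on `𝔤⁎`, `⟨Ad⁎_g ξ, X⟩ = ⟨ξ, Ad_{g⁻¹} X⟩`. -/
def coAd (g : G) (ξ : E r →L[ℝ] ℝ) : E r →L[ℝ] ℝ := ξ.comp (Ad g⁻¹)

/-- The vector field `X♯` on `M`: its value at `x` is the derivative at `1 ∈ G` of the orbit map
`g ↦ g • x` in the direction `X`, that is, `d/dt|₀ exp(tX) • x`. (The derivative takes values in
the tangent space at `1 • x = x`.) -/
def sharp (X : E r) (x : M) : TangentSpace (𝓡 m) x :=
  (mfderiv (𝓡 r) (𝓡 m) (fun g : G => g • x) 1 : E r →L[ℝ] E m) X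

/-- The zero set of the vector field `v♯`, `v♯|ₓ = v(x)♯|ₓ`. -/
def localizingSet (v : M → E r) : Set M := {x | sharp G (m := m) (v x) x = 0}

/-- A taming map: a smooth `G`-equivariant map `M → 𝔤`. -/
structure IsTamingMap (v : M → E r) : Prop where
  smooth : ContMDiff (𝓡 m) (𝓡 r) ∞ v
  equivariant : ∀ (g : G) (x : M), v (g • x) = Ad g (v x)

/-- `U` (an open subset) is invariant. -/
def IsInvariant (U : Set M) : Prop := ∀ (g : G), ∀ x ∈ U, g • x ∈ U

/-- `(U, σ, Φ)` is a Hamiltonian `G`-manifold, where `U` is an invariant open subset of the oriented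
manifold `M`: `σ` is an invariant closed `2`-form, `Φ` is smooth and equivariant, and Hamilton's
equation `dΦ^X = ι(X♯) σ` holds for all `X ∈ 𝔤`. -/
structure IsHamiltonian (U : Set M) (σ : DForm m 2 M) (Φ : M → E r →L[ℝ] ℝ) : Prop where
  smooth_form : SmoothFormOn U σ
  closed : ∀ x ∈ U, extd σ x = 0
  invariant : ∀ (g : G), ∀ x ∈ U, pullback (fun y => g • y) σ x = σ x
  smooth_map : ContMDiffOn (𝓡 m) 𝓘(ℝ, E r →L[ℝ] ℝ) ∞ Φ U
  equivariant : ∀ (g : G), ∀ x ∈ U, Φ (g • x) = coAd g (Φ x)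
  hamilton : ∀ X : E r, ∀ x ∈ U, ∀ u : TangentSpace (𝓡 m) x,
    (mfderiv (𝓡 m) 𝓘(ℝ, ℝ) (fun y => Φ y X) x : TangentSpace (𝓡 m) x →L[ℝ] ℝ) u =
      σ x ![sharp G X x, u]

/-- `Φ` is `v`-polarized on `U`: the function `Φ^v = ⟨Φ, v⟩ : U → ℝ` is proper and bounded from
below. -/
def IsPolarizedOn (U : Set M) (v : M → E r) (Φ : M → E r →L[ℝ] ℝ) : Prop :=
  IsProperMap (fun x : U => Φ x (v x)) ∧ BddBelow (Set.range fun x : U => Φ x (v x))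

/-- There is a smooth equivariant weak deformation retraction of the invariant open set `U` to its
subset `C`: a smooth homotopy `p_t : U → U`, `0 ≤ t ≤ 1`, through equivariant maps, such that `p₀`
is the identity, `p₁` maps `U` to `C`, and every `p_t` maps `C` to `C`. -/
def HasWeakRetraction (U C : Set M) : Prop :=
  ∃ p : ℝ → M → M,
    ContMDiffOn (𝓘(ℝ, ℝ).prod (𝓡 m)) (𝓡 m) ∞ (fun q : ℝ × M => p q.1 q.2)
      (Set.Icc 0 1 ×ˢ U) ∧
    (∀ t ∈ Set.Icc (0 : ℝ) 1, Set.MapsTo (p t) U U) ∧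
    (∀ t ∈ Set.Icc (0 : ℝ) 1, ∀ (g : G), ∀ x ∈ U, p t (g • x) = g • p t x) ∧
    (∀ x ∈ U, p 0 x = x) ∧
    Set.MapsTo (p 1) U C ∧
    ∀ t ∈ Set.Icc (0 : ℝ) 1, Set.MapsTo (p t) C C

/-- Elements `η = ∑ₐ ηₐ βᵃ` of `Ω⁎(M) ⊗ S(𝔤⁎)` (without smoothness), given by the finitely supported
family of coefficients `ηₐ`. Here `β₁, …, β_r ∈ 𝔤⁎` are the coordinate functions on `𝔤 = E r` and
`βᵃ = β₁^{a₁} ⋯ β_r^{a_r}`. -/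
abbrev EForm (r m : ℕ) (M : Type*) [TopologicalSpace M] [ChartedSpace (E m) M] : Type _ :=
  (Fin r →₀ ℕ) →₀ MForm m M

/-- The value `η(X) = ∑ₐ βᵃ(X) ηₐ` of `η`, seen as a polynomial map `𝔤 → Ω⁎(M)`, at `X ∈ 𝔤`. -/
def EForm.eval (η : EForm r m M) (X : E r) : MForm m M :=
  η.sum fun a α => (∏ i, X i ^ a i) • α

lemma EForm.eval_add (η η' : EForm r m M) (X : E r) :
    EForm.eval (η + η') X = EForm.eval η X + EForm.eval η' X :=
  Finsupp.sum_add_index' (by simp) (by simp)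

lemma EForm.eval_smul (t : ℝ) (η : EForm r m M) (X : E r) :
    EForm.eval (t • η) X = t • EForm.eval η X := by
  rw [EForm.eval, Finsupp.sum_smul_index' (by simp), EForm.eval, Finsupp.smul_sum]
  exact Finsupp.sum_congr fun a _ => smul_comm _ _ _

lemma EForm.eval_zero (X : E r) : EForm.eval (0 : EForm r m M) X = 0 := Finsupp.sum_zero_index

lemma EForm.smooth_eval {U : Set M} {η : EForm r m M} (h : ∀ a k, SmoothFormOn U (η a k))
    (X : E r) (k : ℕ) : SmoothFormOn U (η.eval X k) := by
  rw [EForm.eval, Finsupp.sum]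
  exact Finset.sum_induction _ (fun α : MForm m M => SmoothFormOn U (α k))
    (fun _ _ h h' => h.add h') SmoothFormOn.zero fun a _ => (h a k).smul _

/-- The value at `X ∈ 𝔤` of the equivariant differential,
`(d_G η)(X) = d(η(X)) - ι(X♯) η(X)`, in degree `k` and at the point `x`. -/
def dG (η : EForm r m M) (X : E r) : MForm m M := fun k x =>
  extdM (η.eval X) k x - interiorM (sharp G X x) (fun j => η.eval X j x) k

lemma dG_add {U : Set M} (hU : IsOpen U) {η η' : EForm r m M}
    (h : ∀ a k, SmoothFormOn U (η a k)) (h' : ∀ a k, SmoothFormOn U (η' a k)) (X : E r) (k : ℕ)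
    {x : M} (hx : x ∈ U) :
    dG G (η + η') X k x = dG G η X k x + dG G η' X k x := by
  simp only [dG, EForm.eval_add]
  rw [extdM_add hU (EForm.smooth_eval h X) (EForm.smooth_eval h' X) k hx]
  have hι : interiorM (sharp G X x) (fun j => (η.eval X + η'.eval X) j x) k =
      interiorM (sharp G X x) (fun j => η.eval X j x) k +
        interiorM (sharp G X x) (fun j => η'.eval X j x) k := rfl
  rw [hι]
  abel

lemma dG_smul (t : ℝ) (η : EForm r m M) (X : E r) (k : ℕ) (x : M) :
    dG G (t • η) X k x = t • dG G η X k x := by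
  simp only [dG, EForm.eval_smul]
  rw [extdM_smul, smul_sub]
  rfl

lemma dG_zero (X : E r) (k : ℕ) (x : M) : dG G (0 : EForm r m M) X k x = 0 := by
  simpa using dG_smul G (0 : ℝ) (0 : EForm r m M) X k x

/-- The equivariant differential forms on the open invariant set `U`: the elements of
`Ω⁎(U) ⊗ S(𝔤⁎)` that are equivariant as polynomial maps `𝔤 → Ω⁎(U)`, i.e. `g⁎(η(Ad_g X)) = η(X)`. -/
def equivariantForms (U : Set M) : Submodule ℝ (EForm r m M) where
  carrier := {η | (∀ a k, SmoothFormOn U (η a k)) ∧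
    ∀ (g : G) (X : E r) (k : ℕ), ∀ x ∈ U,
      pullback (fun y => g • y) (η.eval (Ad g X) k) x = η.eval X k x}
  zero_mem' := by
    refine ⟨fun a k => SmoothFormOn.zero, fun g X k x _ => ?_⟩
    rw [EForm.eval_zero, EForm.eval_zero]; rfl
  add_mem' := by
    rintro η η' ⟨h1, h2⟩ ⟨h1', h2'⟩
    refine ⟨fun a k => (h1 a k).add (h1' a k), fun g X k x hx => ?_⟩
    rw [EForm.eval_add, EForm.eval_add, MForm.add_apply, MForm.add_apply, Pi.add_apply,
      ← h2 g X k x hx, ← h2' g X k x hx]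
    rfl
  smul_mem' := by
    rintro t η ⟨h1, h2⟩
    refine ⟨fun a k => (h1 a k).smul t, fun g X k x hx => ?_⟩
    rw [EForm.eval_smul, EForm.eval_smul, MForm.smul_apply, MForm.smul_apply, Pi.smul_apply,
      ← h2 g X k x hx]
    rfl

/-- The equivariantly closed equivariant forms on `U`. -/
def closedForms {U : Set M} (hU : IsOpen U) : Submodule ℝ (EForm r m M) where
  carrier := {η | η ∈ equivariantForms G U ∧ ∀ (X : E r) (k : ℕ), ∀ x ∈ U, dG G η X k x = 0}
  zero_mem' := ⟨zero_mem _, fun X k x _ => dG_zero G X k x⟩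
  add_mem' := by
    rintro η η' ⟨h1, h2⟩ ⟨h1', h2'⟩
    refine ⟨add_mem h1 h1', fun X k x hx => ?_⟩
    rw [dG_add G hU h1.1 h1'.1 X k hx, h2 X k x hx, h2' X k x hx, add_zero]
  smul_mem' := by
    rintro t η ⟨h1, h2⟩
    refine ⟨Submodule.smul_mem _ t h1, fun X k x hx => ?_⟩
    rw [dG_smul, h2 X k x hx, smul_zero]

/-- The elements that coincide on `U` with `d_G γ` for an equivariant form `γ` on `U`. -/
def exactForms {U : Set M} (hU : IsOpen U) : Submodule ℝ (EForm r m M) where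
  carrier := {η | ∃ γ ∈ equivariantForms G U, ∀ (X : E r) (k : ℕ), ∀ x ∈ U,
    η.eval X k x = dG G γ X k x}
  zero_mem' := ⟨0, zero_mem _, fun X k x _ => by rw [dG_zero, EForm.eval_zero]; rfl⟩
  add_mem' := by
    rintro η η' ⟨γ, h1, h2⟩ ⟨γ', h1', h2'⟩
    refine ⟨γ + γ', add_mem h1 h1', fun X k x hx => ?_⟩
    rw [dG_add G hU h1.1 h1'.1 X k hx, ← h2 X k x hx, ← h2' X k x hx, EForm.eval_add]
    rfl
  smul_mem' := by
    rintro t η ⟨γ, h1, h2⟩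
    refine ⟨t • γ, Submodule.smul_mem _ t h1, fun X k x hx => ?_⟩
    rw [dG_smul, ← h2 X k x hx, EForm.eval_smul]
    rfl

/-- The equivariant cohomology `H_G⁎(U)` in the Cartan model: equivariantly closed equivariant forms
modulo exact ones. -/
abbrev EqCohomology {U : Set M} (hU : IsOpen U) : Type _ :=
  closedForms (r := r) (m := m) G hU ⧸ (exactForms (r := r) (m := m) G hU).submoduleOf
    (closedForms (r := r) (m := m) G hU)

lemma equivariantForms_mono {U V : Set M} (h : U ⊆ V) :
    equivariantForms (r := r) (m := m) G V ≤ equivariantForms G U := fun _ hη =>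
  ⟨fun a k => (hη.1 a k).mono h, fun g X k x hx => hη.2 g X k x (h hx)⟩

lemma closedForms_mono {U V : Set M} (hU : IsOpen U) (hV : IsOpen V) (h : U ⊆ V) :
    closedForms (r := r) (m := m) G hV ≤ closedForms G hU := fun _ hη =>
  ⟨equivariantForms_mono G h hη.1, fun X k x hx => hη.2 X k x (h hx)⟩

variable {G} in
/-- The restriction map `H_G⁎(V) → H_G⁎(U)`, for `U ⊆ V`. -/
def EqCohomology.restrict {U V : Set M} (hU : IsOpen U) (hV : IsOpen V) (h : U ⊆ V) :
    EqCohomology (r := r) (m := m) G hV →ₗ[ℝ] EqCohomology (r := r) (m := m) G hU :=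
  Submodule.mapQ _ _ (Submodule.inclusion (closedForms_mono G hU hV h)) <| by
    rintro ⟨η, hη⟩ ⟨γ, h1, h2⟩
    exact ⟨γ, equivariantForms_mono G h h1, fun X k x hx => h2 X k x (h hx)⟩

variable {G} in
/-- The closed equivariant form `η` represents the class `A`. -/
def Represents {U : Set M} {hU : IsOpen U} (η : EForm r m M)
    (A : EqCohomology (r := r) (m := m) G hU) : Prop :=
  ∃ h : η ∈ closedForms G hU, (Submodule.Quotient.mk ⟨η, h⟩ : EqCohomology G hU) = A

/-! ### Twisted Duistermaat–Heckman distributions -/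

/-- The partial derivative `D_{βᵢ} φ` of a function on `𝔤⁎` in the direction `βᵢ ∈ 𝔤⁎`. -/
def partialD (i : Fin r) (φ : (E r →L[ℝ] ℝ) → ℝ) : (E r →L[ℝ] ℝ) → ℝ := fun ξ =>
  fderiv ℝ φ ξ (EuclideanSpace.proj i : E r →L[ℝ] ℝ)

/-- `D_{βᵃ} φ`, where `D_{βᵃ} = D_{β₁}^{a₁} ⋯ D_{β_r}^{a_r}`. -/
def multiD (a : Fin r →₀ ℕ) (φ : (E r →L[ℝ] ℝ) → ℝ) : (E r →L[ℝ] ℝ) → ℝ :=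
  (List.finRange r).foldr (fun i f => (partialD i)^[a i] f) φ

/-- The form of mixed degree `D_{η,Φ}(φ) = ∑ₐ (D_{βᵃ} φ ∘ Φ) ηₐ`, at the point `x`. -/
def DetaPhi (η : EForm r m M) (Φ : M → E r →L[ℝ] ℝ) (φ : (E r →L[ℝ] ℝ) → ℝ) (x : M) :
    Cov (TangentSpace (𝓡 m) x) :=
  ∑ a ∈ η.support, multiD a φ (Φ x) • (fun k => η a k x : Cov (TangentSpace (𝓡 m) x))

/-- The twisted Duistermaat–Heckman distribution `DH_{(U,σ,Φ)}(η) : φ ↦ ∫_U e^σ ∧ D_{η,Φ}(φ)`, where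
`M` is oriented by `μ`. (Only the component of degree `m = dim M` contributes to the integral.) -/
def DH [T2Space M] [SecondCountableTopology M] [IsManifold (𝓡 m) ∞ M] (μ : DForm m m M)
    (U : Set M) (σ : DForm m 2 M) (Φ : M → E r →L[ℝ] ℝ) (η : EForm r m M)
    (φ : (E r →L[ℝ] ℝ) → ℝ) : ℝ :=
  integralOn μ U fun x => wedgeM (expM m (σ x)) (DetaPhi η Φ φ x) m

/-- Test functions on `𝔤⁎`. -/
structure IsTestFunction (φ : (E r →L[ℝ] ℝ) → ℝ) : Prop where
  smooth : ContDiff ℝ ∞ φ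
  compact : HasCompactSupport φ

/-! ### Local data near the components of the localizing set -/

/-- The connected component of the subset `Z` of `M` that is labelled by `i`, as a subset of `M`. -/
def component {Z : Set M} (i : ConnectedComponents Z) : Set M :=
  Subtype.val '' {z : Z | (z : ConnectedComponents Z) = i}

/-- The data that compute the local contribution of `C`, a component of the localizing set `Z` of
`v`: an invariant open neighbourhood `U` of `C`, so small that `U ∩ Z = C`, that admits a smooth
equivariant weak deformation retraction to `C`; and a `v|_U`-polarized completion `(U, σ', Φ')` of
`(U, σ|_U, Φ|_U)` relative to `C`. -/
structure LocalCompletion (σ : DForm m 2 M) (Φ : M → E r →L[ℝ] ℝ) (v : M → E r) (C : Set M) where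
  U : Set M
  isOpen : IsOpen U
  invariant : IsInvariant G U
  subset : C ⊆ U
  inter : U ∩ localizingSet G (m := m) v = C
  retraction : HasWeakRetraction G (m := m) U C
  σ' : DForm m 2 M
  Φ' : M → E r →L[ℝ] ℝ
  hamiltonian : IsHamiltonian G U σ' Φ'
  polarized : IsPolarizedOn U v Φ'
  agree : AgreeOn C σ' Φ' σ Φ

end Equivariant

end TwistedDH

end

open scoped Manifold ContDiff Topology
noncomputable section
namespace TwistedDH

/-! ### The exterior product as a sum over permutations. -/

section WedgeFormula

variable {V : Type*} [NormedAddCommGroup V] [NormedSpace ℝ V]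

/-! Hamilton's equation says that `ω + Φ` is equivariantly closed, and the Duistermaat–Heckman
distribution is insensitive to adding `d_G γ` to `ω + Φ`, for an invariant `1`-form `γ`, as long as
supports stay in a fixed compact set. The proof chooses `γ` so that everything away from the
localizing set `Z` leaves the support of the test function `φ`.

Support control is elementary. Since `v` is bounded and `φ` has compact support, some `c` satisfies
`⟨ξ, v(x)⟩ ≤ c` for all `ξ ∈ supp φ` and all `x` (`exists_boundsPairing`). Hence `e^ω D_{η,Φ}(φ)`
vanishes wherever `⟨Φ, v⟩ > c`, and the remaining sublevel set is compact because `Φ` is polarized.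

The algebra is the identity `d(e^σ D_{η,Φ}(φ)) = ∑ᵢ ι(eᵢ♯) e^σ D_{η,Φ}(∂ᵢφ) + e^σ D_{d_G η,Φ}(φ)`
(`extDerivM_mulExp_twistSum`). In top degree the contractions vanish. So changing `η` by a
`d_G`-exact form changes the integrand by an exact form. If `σ + Φ` varies with derivative `d_G γ`,
the derivative of the integrand in top degree is `d(γ ∧ e^σ D_{η,Φ}(φ))` (`derivM_homotopy_top`).
Integration over the segment and Stokes' theorem give `DH_eq_of_homotopy` and `DH_eq_of_exact`.

The geometric input is an invariant `1`-form `Θ` with `Θ(v♯) ≥ 0` that vanishes on `Z`, and with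
`Θ(v♯) > 0` off `Z` (`exists_invariant_tamingForm`). It is built from the Euclidean duals of `v♯` in
charts, by a partition of unity and averaging over `G`. Passing from `ω + Φ` to `ω + Φ - s d_G Θ`
replaces `⟨Φ, v⟩` by `⟨Φ, v⟩ + s Θ(v♯)`. For `s ≥ 0` this preserves the distribution
(`IsTamingForm.DH_twist`); for large `s` it lifts `⟨Φ, v⟩` above `c` outside any given neighbourhood
of the part of `Z` in the sublevel set. So the integral is concentrated there
(`IsTamingForm.eventually_DH_eq`).

Completions come from the same device: twist by `u⁻¹ Θ`, where `u` is an invariant function positive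
exactly on a small neighbourhood `U` of a component. The extra term blows up at the boundary of `U`,
which makes the moment map polarized on `U`, and it vanishes on the component since `Θ` does
(`exists_localCompletion`).

To compare two Hamiltonian structures that agree on a component, the retraction provides an
equivariant Poincaré lemma: their difference is `d_G γ` near the component
(`exists_primitive_of_agreeOn`). After a large twist both integrands, and those along the segment
between them, have support in one compact set, so the integrals agree
(`IsTamingForm.eventually_DH_eq_of_agreeOn`). Applied to two completions this is independence of
choices; applied to a completion and the global structure, on disjoint neighbourhoods of the
finitely many components meeting the sublevel set, it is the localization formula. -/

lemma wedge_eq_sum_sumPerm {i j k : ℕ} (h : i + j = k) (a : V [⋀^Fin i]→L[ℝ] ℝ)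
    (b : V [⋀^Fin j]→L[ℝ] ℝ) (u : Fin k → V) :
    ((i.factorial * j.factorial : ℕ) : ℝ) * wedge h a b u =
      ∑ τ : Equiv.Perm (Fin i ⊕ Fin j), ((Equiv.Perm.sign τ : ℤ) : ℝ) *
        (a (fun p => u (finCongr h (finSumFinEquiv (τ (Sum.inl p))))) *
          b (fun q => u (finCongr h (finSumFinEquiv (τ (Sum.inr q)))))) := by
  -- A shuffle is a coset of `S_i × S_j`, so the sum over all permutations counts every shuffle `i!
  -- j!` times.
  have key := MultilinearMap.domCoprod_alternization_eq a.toAlternatingMap b.toAlternatingMap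
  have key2 := congrArg (fun F => LinearMap.mul' ℝ ℝ
    (F (fun l => u ((finSumFinEquiv.trans (finCongr h)) l)))) key
  simp only [Fintype.card_fin, AlternatingMap.smul_apply] at key2
  rw [map_nsmul, nsmul_eq_mul] at key2
  have hw : wedge h a b u = LinearMap.mul' ℝ ℝ ((a.toAlternatingMap.domCoprod b.toAlternatingMap)
      (fun l => u ((finSumFinEquiv.trans (finCongr h)) l))) := rfl
  rw [hw, ← key2, MultilinearMap.alternatization_apply, map_sum]
  refine Finset.sum_congr rfl fun τ _ => ?_
  rw [Units.smul_def, map_zsmul, zsmul_eq_mul]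
  simp [MultilinearMap.domCoprod_apply]

lemma wedge_eq_sum_perm {i j k : ℕ} (h : i + j = k) (a : V [⋀^Fin i]→L[ℝ] ℝ)
    (b : V [⋀^Fin j]→L[ℝ] ℝ) (u : Fin k → V) :
    ((i.factorial * j.factorial : ℕ) : ℝ) * wedge h a b u =
      ∑ τ : Equiv.Perm (Fin k), ((Equiv.Perm.sign τ : ℤ) : ℝ) *
        (a (fun p => u (τ (finCongr h (finSumFinEquiv (Sum.inl p))))) *
          b (fun q => u (τ (finCongr h (finSumFinEquiv (Sum.inr q)))))) := by
  rw [wedge_eq_sum_sumPerm]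
  refine Fintype.sum_equiv (finSumFinEquiv.trans (finCongr h)).permCongr _ _ fun τ => ?_
  rw [Equiv.Perm.sign_permCongr]
  simp

/-- Permutations of `{0, …, n}` are determined by the image `p` of `0` and a permutation of the
remaining elements. -/
lemma sum_perm_succ {n : ℕ} (F : Equiv.Perm (Fin (n + 1)) → ℝ) :
    ∑ τ, F τ = ∑ p : Fin (n + 1), ∑ τ : Equiv.Perm (Fin n),
      F (p.cycleRange.symm * Equiv.Perm.decomposeFin.symm (0, τ)) := by
  rw [← Fintype.sum_prod_type']
  symm
  refine Function.Bijective.sum_comp (g := F) (e := fun x : Fin (n + 1) × Equiv.Perm (Fin n) =>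
    (x.1.cycleRange.symm * Equiv.Perm.decomposeFin.symm (0, x.2))) ?_
  rw [Fintype.bijective_iff_injective_and_card]
  constructor
  · rintro ⟨p, τ⟩ ⟨p', τ'⟩ h
    -- `decomposeFin.symm (0, τ)` fixes `0` and the inverse cycle sends `0` to `p`, so the value at
    -- `0` recovers `p`. Surjectivity then follows by counting.
    have h0 := Equiv.congr_fun h 0
    simp at h0
    subst h0
    simp at h
    simpa using h
  · simp [Fintype.card_perm, Nat.factorial_succ]

/-- Exterior multiplication from the left by the covector `l`. -/
def extMul {k : ℕ} (l : V →L[ℝ] ℝ) (a : V [⋀^Fin k]→L[ℝ] ℝ) : V [⋀^Fin (k + 1)]→L[ℝ] ℝ :=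
  ContinuousAlternatingMap.alternatizeUncurryFin (l.smulRight a)

lemma extMul_apply {k : ℕ} (l : V →L[ℝ] ℝ) (a : V [⋀^Fin k]→L[ℝ] ℝ) (u : Fin (k + 1) → V) :
    extMul l a u = ∑ p : Fin (k + 1), (-1) ^ (p : ℕ) * (l (u p) * a (p.removeNth u)) := by
  simp [extMul, ContinuousAlternatingMap.alternatizeUncurryFin_apply]

/-- The one case of associativity that is needed, since forms are generated by covectors. After
multiplication by `(i + 1)! j!` both sides are `(i + 1) S`, with `S` an alternating sum over all
permutations. On the left each of the `i + 1` slots of `l` contributes `S`; on the right `S` is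
split according to the image of `0`. -/
lemma wedge_extMul {i j k : ℕ} (h : i + j = k) (h' : i + 1 + j = k + 1) (l : V →L[ℝ] ℝ)
    (a : V [⋀^Fin i]→L[ℝ] ℝ) (b : V [⋀^Fin j]→L[ℝ] ℝ) :
    wedge h' (extMul l a) b = extMul l (wedge h a b) := by
  ext u
  have hN : (((i + 1).factorial * j.factorial : ℕ) : ℝ) ≠ 0 := by positivity
  refine mul_left_cancel₀ hN ?_
  rw [wedge_eq_sum_sumPerm]
  set S : ℝ := ∑ τ : Equiv.Perm (Fin (i + 1) ⊕ Fin j), ((Equiv.Perm.sign τ : ℤ) : ℝ) *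
      (l (u (finCongr h' (finSumFinEquiv (τ (Sum.inl 0))))) *
        a (fun p => u (finCongr h' (finSumFinEquiv (τ (Sum.inl p.succ))))) *
        b (fun q => u (finCongr h' (finSumFinEquiv (τ (Sum.inr q)))))) with hS
  have h1 : ∀ p : Fin (i + 1), ∑ τ : Equiv.Perm (Fin (i + 1) ⊕ Fin j),
      ((Equiv.Perm.sign τ : ℤ) : ℝ) * ((-1) ^ (p : ℕ) *
      (l (u (finCongr h' (finSumFinEquiv (τ (Sum.inl p))))) *
        a (fun q => u (finCongr h' (finSumFinEquiv (τ (Sum.inl (p.succAbove q)))))) *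
        b (fun q => u (finCongr h' (finSumFinEquiv (τ (Sum.inr q))))))) = S := by
    intro p
    rw [hS]
    -- The cycle that brings position `p` to the front and keeps the order of the others has sign
    -- `(-1)^p`, which cancels the sign in `extMul`.
    refine Fintype.sum_equiv (Equiv.mulRight (Equiv.Perm.sumCongr p.cycleRange.symm 1)) _ _
      fun τ => ?_
    simp [Equiv.Perm.sign_mul, Fin.sign_cycleRange, mul_assoc]
  have h2 : ∑ τ : Equiv.Perm (Fin (i + 1) ⊕ Fin j), ((Equiv.Perm.sign τ : ℤ) : ℝ) *
        (extMul l a (fun p => u (finCongr h' (finSumFinEquiv (τ (Sum.inl p))))) *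
          b (fun q => u (finCongr h' (finSumFinEquiv (τ (Sum.inr q)))))) = (i + 1) * S := by
    simp_rw [extMul_apply, Finset.sum_mul, Finset.mul_sum]
    rw [Finset.sum_comm]
    have : ((i : ℝ) + 1) * S = ∑ _p : Fin (i + 1), S := by simp
    rw [this]
    refine Finset.sum_congr rfl fun p _ => ?_
    rw [← h1 p]
    refine Finset.sum_congr rfl fun τ _ => ?_
    simp only [mul_assoc]
    rfl
  have h3 : S = ∑ τ : Equiv.Perm (Fin (k + 1)), ((Equiv.Perm.sign τ : ℤ) : ℝ) *
      (l (u (τ 0)) * a (fun p => u (τ (finCongr h (finSumFinEquiv (Sum.inl p))).succ)) *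
        b (fun q => u (τ (finCongr h (finSumFinEquiv (Sum.inr q))).succ))) := by
    rw [hS]
    refine Fintype.sum_equiv (finSumFinEquiv.trans (finCongr h')).permCongr _ _ fun τ => ?_
    rw [Equiv.Perm.sign_permCongr]
    have e0 : (finSumFinEquiv.trans (finCongr h')).symm 0 = Sum.inl (0 : Fin (i + 1)) := by
      rw [Equiv.symm_apply_eq]; ext; simp
    have e1 : ∀ p : Fin i, (finSumFinEquiv.trans (finCongr h')).symm
        (finCongr h (finSumFinEquiv (Sum.inl p))).succ = Sum.inl p.succ := by
      intro p; rw [Equiv.symm_apply_eq]; ext; simp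
    have e2 : ∀ q : Fin j, (finSumFinEquiv.trans (finCongr h')).symm
        (finCongr h (finSumFinEquiv (Sum.inr q))).succ = Sum.inr q := by
      intro p; rw [Equiv.symm_apply_eq]; ext; simp; omega
    simp only [Equiv.permCongr_apply, e0, e1, e2]
    rfl
  rw [h2, h3, sum_perm_succ, extMul_apply, Finset.mul_sum, Finset.mul_sum]
  refine Finset.sum_congr rfl fun p _ => ?_
  have h4 := wedge_eq_sum_perm h a b (p.removeNth u)
  rw [show (((i + 1).factorial * j.factorial : ℕ) : ℝ) * ((-1) ^ (p : ℕ) * (l (u p) *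
      wedge h a b (p.removeNth u))) = (i + 1) * ((-1) ^ (p : ℕ) * l (u p) *
      (((i.factorial * j.factorial : ℕ) : ℝ) * wedge h a b (p.removeNth u))) by
    rw [Nat.factorial_succ]; push_cast; ring, h4]
  simp only [Finset.mul_sum]
  refine Finset.sum_congr rfl fun τ _ => ?_
  simp [Equiv.Perm.sign_mul, Fin.sign_cycleRange, Fin.removeNth, -mul_eq_mul_left_iff]
  ring

end WedgeFormula
end TwistedDH
end

open scoped Manifold ContDiff Topology
noncomputable section
namespace TwistedDH

/-! ### Bilinearity of the exterior product, contraction and anticommutation. -/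

section WedgeAlgebra

variable {V : Type*} [NormedAddCommGroup V] [NormedSpace ℝ V]

/-- Multiplying by the nonzero number `i! j!` replaces shuffles by all permutations, so that
identities for the exterior product can be checked summand by summand. -/
lemma wedge_ext {i j k : ℕ} (h : i + j = k) {a : V [⋀^Fin i]→L[ℝ] ℝ} {b : V [⋀^Fin j]→L[ℝ] ℝ}
    {c : V [⋀^Fin k]→L[ℝ] ℝ}
    (H : ∀ u : Fin k → V, ∑ τ : Equiv.Perm (Fin k), ((Equiv.Perm.sign τ : ℤ) : ℝ) *
        (a (fun p => u (τ (finCongr h (finSumFinEquiv (Sum.inl p))))) *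
          b (fun q => u (τ (finCongr h (finSumFinEquiv (Sum.inr q)))))) =
      ((i.factorial * j.factorial : ℕ) : ℝ) * c u) : wedge h a b = c := by
  ext u
  have hN : ((i.factorial * j.factorial : ℕ) : ℝ) ≠ 0 := by positivity
  refine mul_left_cancel₀ hN ?_
  rw [wedge_eq_sum_perm, H]

lemma wedge_add_left {i j k : ℕ} (h : i + j = k) (a a' : V [⋀^Fin i]→L[ℝ] ℝ)
    (b : V [⋀^Fin j]→L[ℝ] ℝ) : wedge h (a + a') b = wedge h a b + wedge h a' b := by
  refine wedge_ext h fun u => ?_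
  rw [ContinuousAlternatingMap.add_apply, mul_add, wedge_eq_sum_perm, wedge_eq_sum_perm, ← Finset.sum_add_distrib]
  exact Finset.sum_congr rfl fun τ _ => by simp only [ContinuousAlternatingMap.add_apply]; ring

lemma wedge_add_right {i j k : ℕ} (h : i + j = k) (a : V [⋀^Fin i]→L[ℝ] ℝ)
    (b b' : V [⋀^Fin j]→L[ℝ] ℝ) : wedge h a (b + b') = wedge h a b + wedge h a b' := by
  refine wedge_ext h fun u => ?_
  rw [ContinuousAlternatingMap.add_apply, mul_add, wedge_eq_sum_perm, wedge_eq_sum_perm, ← Finset.sum_add_distrib]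
  exact Finset.sum_congr rfl fun τ _ => by simp only [ContinuousAlternatingMap.add_apply]; ring

lemma wedge_smul_left {i j k : ℕ} (h : i + j = k) (t : ℝ) (a : V [⋀^Fin i]→L[ℝ] ℝ)
    (b : V [⋀^Fin j]→L[ℝ] ℝ) : wedge h (t • a) b = t • wedge h a b := by
  refine wedge_ext h fun u => ?_
  rw [ContinuousAlternatingMap.smul_apply, smul_eq_mul, mul_left_comm, wedge_eq_sum_perm, Finset.mul_sum]
  exact Finset.sum_congr rfl fun τ _ => by simp only [ContinuousAlternatingMap.smul_apply, smul_eq_mul]; ring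

lemma wedge_smul_right {i j k : ℕ} (h : i + j = k) (t : ℝ) (a : V [⋀^Fin i]→L[ℝ] ℝ)
    (b : V [⋀^Fin j]→L[ℝ] ℝ) : wedge h a (t • b) = t • wedge h a b := by
  refine wedge_ext h fun u => ?_
  rw [ContinuousAlternatingMap.smul_apply, smul_eq_mul, mul_left_comm, wedge_eq_sum_perm, Finset.mul_sum]
  exact Finset.sum_congr rfl fun τ _ => by simp only [ContinuousAlternatingMap.smul_apply, smul_eq_mul]; ring

/-- The exterior product as a bilinear map. -/
def wedgeL {i j k : ℕ} (h : i + j = k) :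
    (V [⋀^Fin i]→L[ℝ] ℝ) →ₗ[ℝ] (V [⋀^Fin j]→L[ℝ] ℝ) →ₗ[ℝ] V [⋀^Fin k]→L[ℝ] ℝ :=
  LinearMap.mk₂ ℝ (wedge h) (wedge_add_left h) (wedge_smul_left h) (wedge_add_right h)
    (wedge_smul_right h)

@[simp] lemma wedgeL_apply {i j k : ℕ} (h : i + j = k) (a : V [⋀^Fin i]→L[ℝ] ℝ)
    (b : V [⋀^Fin j]→L[ℝ] ℝ) : wedgeL h a b = wedge h a b := rfl

lemma wedge_zero_left {i j k : ℕ} (h : i + j = k) (b : V [⋀^Fin j]→L[ℝ] ℝ) :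
    wedge h (0 : V [⋀^Fin i]→L[ℝ] ℝ) b = 0 := by
  rw [← wedgeL_apply, map_zero, LinearMap.zero_apply]

lemma wedge_zero_right {i j k : ℕ} (h : i + j = k) (a : V [⋀^Fin i]→L[ℝ] ℝ) :
    wedge h a (0 : V [⋀^Fin j]→L[ℝ] ℝ) = 0 := by
  rw [← wedgeL_apply, map_zero]

lemma wedge_compContinuousLinearMap {W : Type*} [NormedAddCommGroup W] [NormedSpace ℝ W]
    {i j k : ℕ} (h : i + j = k) (a : V [⋀^Fin i]→L[ℝ] ℝ) (b : V [⋀^Fin j]→L[ℝ] ℝ)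
    (f : W →L[ℝ] V) : (wedge h a b).compContinuousLinearMap f =
      wedge h (a.compContinuousLinearMap f) (b.compContinuousLinearMap f) := by
  symm
  refine wedge_ext h fun u => ?_
  rw [ContinuousAlternatingMap.compContinuousLinearMap_apply, wedge_eq_sum_perm]
  rfl

/-- All `k!` permutations contribute equally: the sign of the permutation and the sign from
alternation of `b` cancel. -/
lemma wedge_const {k : ℕ} (h : 0 + k = k) (t : ℝ) (b : V [⋀^Fin k]→L[ℝ] ℝ) :
    wedge h (ContinuousAlternatingMap.constOfIsEmpty ℝ V (Fin 0) t) b = t • b := by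
  refine wedge_ext h fun u => ?_
  have : ∀ τ : Equiv.Perm (Fin k), ((Equiv.Perm.sign τ : ℤ) : ℝ) *
      (t * b (fun q => u (τ (finCongr h (finSumFinEquiv (Sum.inr q)))))) = t * b u := by
    intro τ
    have h1 : (fun q => u (τ (finCongr h (finSumFinEquiv (Sum.inr q))))) = fun q => u (τ q) := by
      ext q; congr 3; ext; simp
    have h2 := b.toAlternatingMap.map_perm u τ
    have h3 : b (fun q => u (τ q)) = ((Equiv.Perm.sign τ : ℤ) : ℝ) * b u := by
      have : b (fun q => u (τ q)) = Equiv.Perm.sign τ • b u := h2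
      rw [this, Units.smul_def, zsmul_eq_mul]
    rw [h1, h3]
    have h4 : ((Equiv.Perm.sign τ : ℤ) : ℝ) * ((Equiv.Perm.sign τ : ℤ) : ℝ) = 1 := by
      rcases Int.units_eq_one_or (Equiv.Perm.sign τ) with h | h <;> simp [h]
    linear_combination t * b u * h4
  simp only [ContinuousAlternatingMap.constOfIsEmpty_apply]
  rw [Finset.sum_congr rfl fun τ _ => this τ]
  simp [Fintype.card_perm]

/-! Interior multiplication and exterior multiplication by covectors. -/

lemma interior_add_right {k : ℕ} (w : V) (a b : V [⋀^Fin (k + 1)]→L[ℝ] ℝ) :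
    interior w (a + b) = interior w a + interior w b := rfl

lemma interior_smul_right {k : ℕ} (w : V) (t : ℝ) (a : V [⋀^Fin (k + 1)]→L[ℝ] ℝ) :
    interior w (t • a) = t • interior w a := rfl

/-- Together with the contraction rule for `extMul` this allows identities to be proved by induction
on the degree. -/
lemma ext_interior {k : ℕ} {a b : V [⋀^Fin (k + 1)]→L[ℝ] ℝ}
    (h : ∀ w, interior w a = interior w b) : a = b := by
  ext u
  have := congrArg (fun f => f (Fin.tail u)) (h (u 0))
  simp only [interior_apply] at this
  have hu : Matrix.vecCons (u 0) (Fin.tail u) = u := Fin.cons_self_tail u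
  rwa [hu] at this

lemma interior_extMul_zero (w : V) (l : V →L[ℝ] ℝ) (a : V [⋀^Fin 0]→L[ℝ] ℝ) :
    interior w (extMul l a) = l w • a := by
  ext u
  rw [interior_apply, extMul_apply]
  simp

/-- In the alternating sum the term in which `l` receives `w` gives the first summand; in the others
the position is shifted by one, which produces the minus sign. -/
lemma interior_extMul {k : ℕ} (w : V) (l : V →L[ℝ] ℝ) (a : V [⋀^Fin (k + 1)]→L[ℝ] ℝ) :
    interior w (extMul l a) = l w • a - extMul l (interior w a) := by
  ext u
  rw [interior_apply, extMul_apply, Fin.sum_univ_succ, ContinuousAlternatingMap.sub_apply, extMul_apply,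
    ContinuousAlternatingMap.smul_apply, smul_eq_mul, sub_eq_add_neg, ← Finset.sum_neg_distrib]
  congr 1
  · simp
  · refine Finset.sum_congr rfl fun p _ => ?_
    rw [interior_apply]
    have : (p.succ.removeNth (Matrix.vecCons w u) : Fin (k + 1) → V) =
        Matrix.vecCons w (p.removeNth u) := by
      ext q
      refine Fin.cases ?_ (fun q => ?_) q
      · simp [Fin.removeNth]
      · simp [Fin.removeNth]
    rw [this]
    simp [pow_succ]

lemma extMul_add_right {k : ℕ} (l : V →L[ℝ] ℝ) (a b : V [⋀^Fin k]→L[ℝ] ℝ) :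
    extMul l (a + b) = extMul l a + extMul l b := by
  ext u; simp only [extMul_apply, ContinuousAlternatingMap.add_apply, mul_add, Finset.sum_add_distrib]

lemma extMul_smul_right {k : ℕ} (l : V →L[ℝ] ℝ) (t : ℝ) (a : V [⋀^Fin k]→L[ℝ] ℝ) :
    extMul l (t • a) = t • extMul l a := by
  ext u; simp only [extMul_apply, ContinuousAlternatingMap.smul_apply, smul_eq_mul, Finset.mul_sum]
  exact Finset.sum_congr rfl fun p _ => by ring

lemma extMul_add_left {k : ℕ} (l l' : V →L[ℝ] ℝ) (a : V [⋀^Fin k]→L[ℝ] ℝ) :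
    extMul (l + l') a = extMul l a + extMul l' a := by
  ext u; simp only [extMul_apply, ContinuousAlternatingMap.add_apply, _root_.add_apply, add_mul, mul_add, Finset.sum_add_distrib]

lemma extMul_smul_left {k : ℕ} (t : ℝ) (l : V →L[ℝ] ℝ) (a : V [⋀^Fin k]→L[ℝ] ℝ) :
    extMul (t • l) a = t • extMul l a := by
  ext u; simp only [extMul_apply, ContinuousAlternatingMap.smul_apply, _root_.smul_apply, smul_eq_mul, Finset.mul_sum]
  exact Finset.sum_congr rfl fun p _ => by ring

/-- Contraction with an arbitrary vector turns the claim into the same claim one degree lower. -/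
lemma extMul_extMul {k : ℕ} (l l' : V →L[ℝ] ℝ) (a : V [⋀^Fin k]→L[ℝ] ℝ) :
    extMul l (extMul l' a) = - extMul l' (extMul l a) := by
  induction k with
  | zero =>
    refine ext_interior fun w => ?_
    have hn : interior w (-extMul l' (extMul l a)) = -interior w (extMul l' (extMul l a)) := rfl
    rw [hn, interior_extMul, interior_extMul, interior_extMul_zero, interior_extMul_zero,
      extMul_smul_right, extMul_smul_right]
    abel
  | succ k ih =>
    refine ext_interior fun w => ?_
    have hn : interior w (-extMul l' (extMul l a)) = -interior w (extMul l' (extMul l a)) := rfl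
    have hs : ∀ (l : V →L[ℝ] ℝ) (x y : V [⋀^Fin (k + 1)]→L[ℝ] ℝ),
        extMul l (x - y) = extMul l x - extMul l y := fun l x y => by
      rw [sub_eq_add_neg, ← neg_one_smul ℝ y, extMul_add_right, extMul_smul_right,
        neg_one_smul ℝ (extMul l y), ← sub_eq_add_neg]
    rw [hn, interior_extMul, interior_extMul, interior_extMul, interior_extMul, hs, hs,
      extMul_smul_right, extMul_smul_right, ih]
    abel

variable (V) in
/-- Covectors as elements of `Λ¹V⁎`. -/
def oneCov (l : V →L[ℝ] ℝ) : V [⋀^Fin 1]→L[ℝ] ℝ :=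
  extMul l (ContinuousAlternatingMap.constOfIsEmpty ℝ V (Fin 0) 1)

end WedgeAlgebra

end TwistedDH
end

open scoped Manifold ContDiff Topology
noncomputable section
namespace TwistedDH

/-! ### Exterior and interior multiplication as operators on forms of mixed degree. -/

section Operators

variable {V : Type*} [NormedAddCommGroup V] [NormedSpace ℝ V]

/-- Exterior multiplication by a covector on `Λ⁎V⁎`. -/
def extMulM (l : V →L[ℝ] ℝ) : Cov V →ₗ[ℝ] Cov V where
  toFun a k := match k with
    | 0 => 0
    | k + 1 => extMul l (a k)
  map_add' a b := by
    funext k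
    cases k with
    | zero => simp
    | succ k => exact extMul_add_right l (a k) (b k)
  map_smul' t a := by
    funext k
    cases k with
    | zero => simp
    | succ k => exact extMul_smul_right l t (a k)

@[simp] lemma extMulM_zero (l : V →L[ℝ] ℝ) (a : Cov V) : extMulM l a 0 = 0 := rfl

@[simp] lemma extMulM_succ (l : V →L[ℝ] ℝ) (a : Cov V) (k : ℕ) :
    extMulM l a (k + 1) = extMul l (a k) := rfl

/-- The interior product on `Λ⁎V⁎` as a linear map. -/
def interiorL (w : V) : Cov V →ₗ[ℝ] Cov V where
  toFun := interiorM w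
  map_add' _ _ := rfl
  map_smul' _ _ := rfl

@[simp] lemma interiorL_apply (w : V) (a : Cov V) (k : ℕ) :
    interiorL w a k = interior w (a (k + 1)) := rfl

lemma interiorL_extMulM (w : V) (l : V →L[ℝ] ℝ) (a : Cov V) :
    interiorL w (extMulM l a) = l w • a - extMulM l (interiorL w a) := by
  funext k
  cases k with
  | zero =>
    have : (l w • a - extMulM l (interiorL w a)) 0 = l w • a 0 - 0 := rfl
    rw [this, sub_zero]
    exact interior_extMul_zero w l (a 0)
  | succ k => exact interior_extMul w l (a (k + 1))

lemma extMulM_extMulM (l l' : V →L[ℝ] ℝ) (a : Cov V) :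
    extMulM l (extMulM l' a) = - extMulM l' (extMulM l a) := by
  funext k
  match k with
  | 0 => exact neg_zero.symm
  | 1 =>
    have e : ∀ l : V →L[ℝ] ℝ, extMul l (0 : V [⋀^Fin 0]→L[ℝ] ℝ) = 0 := fun l => by
      rw [← zero_smul ℝ (0 : V [⋀^Fin 0]→L[ℝ] ℝ), extMul_smul_right, zero_smul]
    change extMul l (0 : V [⋀^Fin 0]→L[ℝ] ℝ) = - extMul l' (0 : V [⋀^Fin 0]→L[ℝ] ℝ)
    rw [e, e, neg_zero]
  | k + 2 => exact extMul_extMul l l' (a k)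

lemma extMulM_add_left (l l' : V →L[ℝ] ℝ) (a : Cov V) :
    extMulM (l + l') a = extMulM l a + extMulM l' a := by
  funext k
  cases k with
  | zero => exact (add_zero 0).symm
  | succ k => exact extMul_add_left l l' (a k)

lemma extMulM_smul_left (t : ℝ) (l : V →L[ℝ] ℝ) (a : Cov V) :
    extMulM (t • l) a = t • extMulM l a := by
  funext k
  cases k with
  | zero => exact (smul_zero t).symm
  | succ k => exact extMul_smul_left t l (a k)

/-- The degree of the second factor arises as a difference of natural numbers, in several equal but
differently written ways. -/
lemma wedge_congr_right {i j j' k : ℕ} (h : i + j = k) (h' : i + j' = k)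
    (a : V [⋀^Fin i]→L[ℝ] ℝ) (b : Cov V) : wedge h a (b j) = wedge h' a (b j') := by
  obtain rfl : j = j' := by omega
  rfl

lemma wedgeM_extMulM (l : V →L[ℝ] ℝ) (a b : Cov V) :
    wedgeM (extMulM l a) b = extMulM l (wedgeM a b) := by
  funext k
  cases k with
  | zero =>
    simp only [wedgeM, extMulM_zero]
    rw [Fin.sum_univ_one]
    exact wedge_zero_left _ _
  | succ k =>
    simp only [wedgeM, extMulM_succ]
    rw [Fin.sum_univ_succ]
    -- A multiple of a covector has no component of degree `0`, so the sum over bidegrees starts at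
    -- `1` and matches the shifted sum on the right.
    have h0 : wedge (Nat.add_sub_of_le (Nat.lt_succ_iff.mp (0 : Fin (k + 1 + 1)).2))
        (extMulM l a (0 : Fin (k + 1 + 1))) (b (k + 1 - (0 : Fin (k + 1 + 1)))) = 0 :=
      wedge_zero_left _ _
    rw [h0, zero_add]
    let T : (V [⋀^Fin k]→L[ℝ] ℝ) →ₗ[ℝ] V [⋀^Fin (k + 1)]→L[ℝ] ℝ :=
      { toFun := extMul l
        map_add' := extMul_add_right l
        map_smul' := extMul_smul_right l }
    change _ = T _
    rw [map_sum]
    refine Finset.sum_congr rfl fun i _ => ?_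
    change _ = extMul l _
    have hi : (i : ℕ) + (k - i) = k := Nat.add_sub_of_le (Nat.lt_succ_iff.mp i.2)
    have hi' : (i : ℕ) + 1 + (k - i) = k + 1 := by omega
    rw [← wedge_extMul hi hi']
    exact wedge_congr_right _ hi' _ b

lemma wedgeM_oneM (b : Cov V) : wedgeM oneM b = b := by
  funext k
  rw [wedgeM, Fin.sum_univ_succ]
  have h : ∀ i : Fin k, wedge (Nat.add_sub_of_le (Nat.lt_succ_iff.mp i.succ.2))
      ((oneM : Cov V) i.succ) (b (k - i.succ)) = 0 := fun i => by
    have : (oneM : Cov V) i.succ = 0 := Pi.single_eq_of_ne (Nat.succ_ne_zero _) _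
    rw [this]
    exact wedge_zero_left _ _
  rw [Finset.sum_eq_zero fun i _ => h i, add_zero]
  have h0 : wedge (Nat.add_sub_of_le (Nat.lt_succ_iff.mp (0 : Fin (k + 1)).2))
      ((oneM : Cov V) (0 : Fin (k + 1))) (b (k - (0 : Fin (k + 1)))) =
      wedge (zero_add k) (ContinuousAlternatingMap.constOfIsEmpty ℝ V (Fin 0) 1) (b k) := rfl
  rw [h0, wedge_const, one_smul]

lemma wedgeM_add_left (a a' b : Cov V) : wedgeM (a + a') b = wedgeM a b + wedgeM a' b := by
  funext k
  simp only [wedgeM, Pi.add_apply, wedge_add_left, Finset.sum_add_distrib]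

lemma wedgeM_add_right (a b b' : Cov V) : wedgeM a (b + b') = wedgeM a b + wedgeM a b' := by
  funext k
  simp only [wedgeM, Pi.add_apply, wedge_add_right, Finset.sum_add_distrib]

lemma wedgeM_smul_left (t : ℝ) (a b : Cov V) : wedgeM (t • a) b = t • wedgeM a b := by
  funext k
  simp only [wedgeM, Pi.smul_apply, wedge_smul_left, Finset.smul_sum]

lemma wedgeM_smul_right (t : ℝ) (a b : Cov V) : wedgeM a (t • b) = t • wedgeM a b := by
  funext k
  simp only [wedgeM, Pi.smul_apply, wedge_smul_right, Finset.smul_sum]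

/-- The exterior product of `Λ⁎V⁎` as a bilinear map. -/
def wedgeML : Cov V →ₗ[ℝ] Cov V →ₗ[ℝ] Cov V :=
  LinearMap.mk₂ ℝ wedgeM wedgeM_add_left wedgeM_smul_left wedgeM_add_right wedgeM_smul_right

@[simp] lemma wedgeML_apply (a b : Cov V) : wedgeML a b = wedgeM a b := rfl

/-- Covectors of degree `k` as covectors of mixed degree. -/
def homog (k : ℕ) : (V [⋀^Fin k]→L[ℝ] ℝ) →ₗ[ℝ] Cov V :=
  LinearMap.single ℝ (fun k : ℕ => V [⋀^Fin k]→L[ℝ] ℝ) k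

lemma homog_apply {k : ℕ} (a : V [⋀^Fin k]→L[ℝ] ℝ) : homog k a = (Pi.single k a : Cov V) := rfl

lemma homog_self {k : ℕ} (a : V [⋀^Fin k]→L[ℝ] ℝ) : homog k a k = a := by
  rw [homog_apply, Pi.single_eq_same]

lemma homog_of_ne {k j : ℕ} (h : j ≠ k) (a : V [⋀^Fin k]→L[ℝ] ℝ) : homog k a j = 0 := by
  rw [homog_apply, Pi.single_eq_of_ne h]

lemma homog_extMul {k : ℕ} (l : V →L[ℝ] ℝ) (a : V [⋀^Fin k]→L[ℝ] ℝ) :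
    homog (k + 1) (extMul l a) = extMulM l (homog k a) := by
  funext j
  match j with
  | 0 => exact homog_of_ne (Nat.succ_ne_zero k).symm _
  | j + 1 =>
    rw [extMulM_succ]
    by_cases h : j = k
    · subst h; rw [homog_self, homog_self]
    · rw [homog_of_ne (by omega), homog_of_ne h, ← zero_smul ℝ (0 : V [⋀^Fin j]→L[ℝ] ℝ),
        extMul_smul_right, zero_smul]

lemma homog_const (t : ℝ) :
    homog 0 (ContinuousAlternatingMap.constOfIsEmpty ℝ V (Fin 0) t) = t • (oneM : Cov V) := by
  have : ContinuousAlternatingMap.constOfIsEmpty ℝ V (Fin 0) t =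
    t • ContinuousAlternatingMap.constOfIsEmpty ℝ V (Fin 0) (1 : ℝ) := by
    ext u; simp
  rw [this, map_smul]
  rfl

end Operators

/-! ### Multiplication by two-covectors and by their exponentials. -/

section Operators2

variable {n : ℕ}

/-- The coordinate covector `eʲ` on `ℝⁿ`. -/
def coordCov (j : Fin n) : E n →L[ℝ] ℝ := EuclideanSpace.proj j

/-- The coordinate vector `e_j` of `ℝⁿ`. -/
def coordVec (j : Fin n) : E n := EuclideanSpace.single j 1

lemma sum_coord (w : E n) : ∑ j, coordCov j w • coordVec j = w := by
  ext i
  simp [coordCov, coordVec, Finset.sum_apply, Pi.single_apply]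

lemma sum_clm {F : Type*} [NormedAddCommGroup F] [NormedSpace ℝ F] (f : E n →L[ℝ] F) :
    f = ∑ j, (coordCov j).smulRight (f (coordVec j)) := by
  ext w
  conv_lhs => rw [← sum_coord w]
  simp [map_sum]

/-- `alternatizeUncurryFin` in coordinates. -/
lemma alternatizeUncurryFin_eq_sum {k : ℕ} (f : E n →L[ℝ] E n [⋀^Fin k]→L[ℝ] ℝ) :
    ContinuousAlternatingMap.alternatizeUncurryFin f =
      ∑ j, extMul (coordCov j) (f (coordVec j)) := by
  conv_lhs => rw [sum_clm f]
  rw [← ContinuousAlternatingMap.alternatizeUncurryFinCLM_apply, map_sum]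
  rfl

/-- The operator on the left counts the degree. Dividing by the degree writes a form as a
combination of products with covectors, which is the source of `two_induction`. -/
lemma sum_extMul_interior {k : ℕ} (a : E n [⋀^Fin (k + 1)]→L[ℝ] ℝ) :
    ∑ j, extMul (coordCov j) (interior (coordVec j) a) = ((k + 1 : ℕ) : ℝ) • a := by
  have h := ContinuousAlternatingMap.alternatizeUncurryFin_curryLeft a
  rw [alternatizeUncurryFin_eq_sum] at h
  rw [Nat.cast_smul_eq_nsmul, ← h]
  rfl

lemma eq_zero_of_lt {k : ℕ} (h : n < k) (a : E n [⋀^Fin k]→L[ℝ] ℝ) : a = 0 := by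
  ext u
  refine a.toAlternatingMap.map_linearDependent u fun hu => ?_
  have := hu.fintype_card_le_finrank
  simp at this
  omega

/-- Left multiplication by `σ ∈ Λ²`. -/
def mulTwo (σ : E n [⋀^Fin 2]→L[ℝ] ℝ) : Cov (E n) →ₗ[ℝ] Cov (E n) := wedgeML (homog 2 σ)

lemma mulTwo_apply (σ : E n [⋀^Fin 2]→L[ℝ] ℝ) (b : Cov (E n)) :
    mulTwo σ b = wedgeM (homog 2 σ) b := rfl

lemma mulTwo_add (σ τ : E n [⋀^Fin 2]→L[ℝ] ℝ) : mulTwo (σ + τ) = mulTwo σ + mulTwo τ := by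
  rw [mulTwo, map_add, map_add]; rfl

lemma mulTwo_smul (t : ℝ) (σ : E n [⋀^Fin 2]→L[ℝ] ℝ) : mulTwo (t • σ) = t • mulTwo σ := by
  rw [mulTwo, map_smul, map_smul]; rfl

/-- The element of `V⁎` corresponding to an element of `Λ¹V⁎`. -/
def covOf {V : Type*} [AddCommGroup V] [Module ℝ V] [TopologicalSpace V]
    (a : V [⋀^Fin 1]→L[ℝ] ℝ) : V →L[ℝ] ℝ :=
  { toFun := fun w => a ![w]
    map_add' := fun w w' => a.toAlternatingMap.map_vecCons_add ![] w w'
    map_smul' := fun t w => a.toAlternatingMap.map_vecCons_smul ![] t w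
    cont := a.cont.comp (continuous_pi fun i => by
      rw [Subsingleton.elim i 0]; exact continuous_id) }

@[simp] lemma covOf_apply {V : Type*} [AddCommGroup V] [Module ℝ V] [TopologicalSpace V]
    (a : V [⋀^Fin 1]→L[ℝ] ℝ) (w : V) : covOf a w = a ![w] := rfl

lemma extMul_covOf (a : E n [⋀^Fin 1]→L[ℝ] ℝ) :
    extMul (covOf a) (ContinuousAlternatingMap.constOfIsEmpty ℝ (E n) (Fin 0) 1) = a := by
  ext u
  rw [extMul_apply]
  simp
  congr 1
  ext i; rw [Subsingleton.elim i 0]; rfl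

lemma wedgeM_homog_one (a : E n [⋀^Fin 1]→L[ℝ] ℝ) (b : Cov (E n)) :
    wedgeM (homog 1 a) b = extMulM (covOf a) b := by
  conv_lhs => rw [← extMul_covOf a, homog_extMul, wedgeM_extMulM, homog_const, one_smul,
    wedgeM_oneM]

lemma mulTwo_extMul (l l' : E n →L[ℝ] ℝ) (b : Cov (E n)) :
    mulTwo (extMul l (extMul l' (ContinuousAlternatingMap.constOfIsEmpty ℝ (E n) (Fin 0) 1))) b =
      extMulM l (extMulM l' b) := by
  rw [mulTwo_apply, homog_extMul, homog_extMul, wedgeM_extMulM, wedgeM_extMulM, homog_const,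
    one_smul, wedgeM_oneM]

/-- Induction principle for elements of `Λ²`. -/
lemma two_induction {P : (E n [⋀^Fin 2]→L[ℝ] ℝ) → Prop}
    (hadd : ∀ a b, P a → P b → P (a + b)) (hsmul : ∀ (t : ℝ) a, P a → P (t • a))
    (hext : ∀ l l', P (extMul l (extMul l'
      (ContinuousAlternatingMap.constOfIsEmpty ℝ (E n) (Fin 0) 1))))
    (a : E n [⋀^Fin 2]→L[ℝ] ℝ) : P a := by
  have h0 : (((1 + 1 : ℕ) : ℝ)) ≠ 0 := by positivity
  have : a = (((1 + 1 : ℕ) : ℝ))⁻¹ • ∑ j, extMul (coordCov j) (interior (coordVec j) a) := by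
    rw [sum_extMul_interior, smul_smul, inv_mul_cancel₀ h0, one_smul]
  rw [this]
  refine hsmul _ _ (Finset.sum_induction _ P hadd ?_ fun j _ => ?_)
  -- The empty sum is obtained as the multiple by `0` of a generator.
  · have := hsmul 0 _ (hext 0 0)
    rwa [zero_smul] at this
  · rw [← extMul_covOf (interior (coordVec j) a)]
    exact hext _ _

/-- On a product of two covectors, moving `l` past both costs two signs. -/
lemma mulTwo_extMulM (σ : E n [⋀^Fin 2]→L[ℝ] ℝ) (l : E n →L[ℝ] ℝ) (b : Cov (E n)) :
    mulTwo σ (extMulM l b) = extMulM l (mulTwo σ b) := by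
  refine two_induction (P := fun σ => mulTwo σ (extMulM l b) = extMulM l (mulTwo σ b))
    (fun a a' h h' => ?_) (fun t a h => ?_) (fun p q => ?_) σ
  · rw [mulTwo_add, LinearMap.add_apply, LinearMap.add_apply, h, h', map_add]
  · rw [mulTwo_smul, LinearMap.smul_apply, LinearMap.smul_apply, h, map_smul]
  · rw [mulTwo_extMul, mulTwo_extMul, extMulM_extMulM q l, map_neg, extMulM_extMulM p l, neg_neg]

lemma mulTwo_comm (σ τ : E n [⋀^Fin 2]→L[ℝ] ℝ) : Commute (mulTwo σ) (mulTwo τ) := by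
  refine LinearMap.ext fun b => ?_
  change mulTwo σ (mulTwo τ b) = mulTwo τ (mulTwo σ b)
  refine two_induction (P := fun σ => mulTwo σ (mulTwo τ b) = mulTwo τ (mulTwo σ b))
    (fun a a' h h' => ?_) (fun t a h => ?_) (fun p q => ?_) σ
  · rw [mulTwo_add, LinearMap.add_apply, LinearMap.add_apply, h, h', map_add]
  · rw [mulTwo_smul, LinearMap.smul_apply, LinearMap.smul_apply, h, map_smul]
  · rw [mulTwo_extMul, mulTwo_extMul, mulTwo_extMulM, mulTwo_extMulM]

/-- Contraction is an antiderivation, and passing a two-covector costs no sign; for `p ∧ q` the two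
contractions combine to `p(w) q - q(w) p`, which is the contraction of `p ∧ q` itself. -/
lemma interiorL_mulTwo (w : E n) (σ : E n [⋀^Fin 2]→L[ℝ] ℝ) (b : Cov (E n)) :
    interiorL w (mulTwo σ b) =
      extMulM (covOf (interior w σ)) b + mulTwo σ (interiorL w b) := by
  have hcadd : ∀ a a' : E n [⋀^Fin 1]→L[ℝ] ℝ, covOf (a + a') = covOf a + covOf a' :=
    fun a a' => rfl
  have hcsmul : ∀ (t : ℝ) (a : E n [⋀^Fin 1]→L[ℝ] ℝ), covOf (t • a) = t • covOf a :=
    fun t a => rfl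
  refine two_induction (P := fun σ => interiorL w (mulTwo σ b) =
      extMulM (covOf (interior w σ)) b + mulTwo σ (interiorL w b))
    (fun a a' h h' => ?_) (fun t a h => ?_) (fun p q => ?_) σ
  · rw [mulTwo_add, LinearMap.add_apply, LinearMap.add_apply, map_add, h, h', interior_add_right,
      hcadd, extMulM_add_left]
    abel
  · rw [mulTwo_smul, LinearMap.smul_apply, LinearMap.smul_apply, map_smul, h, interior_smul_right,
      hcsmul, extMulM_smul_left, smul_add]
  · rw [mulTwo_extMul, mulTwo_extMul, interiorL_extMulM, interiorL_extMulM, map_sub, map_smul]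
    have : covOf (interior w (extMul p (extMul q
        (ContinuousAlternatingMap.constOfIsEmpty ℝ (E n) (Fin 0) 1)))) = p w • q - q w • p := by
      ext u
      rw [interior_extMul, interior_extMul_zero]
      have h1 : ∀ l : E n →L[ℝ] ℝ, covOf (extMul l
          (ContinuousAlternatingMap.constOfIsEmpty ℝ (E n) (Fin 0) 1)) = l := by
        intro l; ext u; rw [covOf_apply, extMul_apply]; simp
      rw [extMul_smul_right]
      have h2 := congrArg (fun f => p w * f u) (h1 q)
      have h3 := congrArg (fun f => q w * f u) (h1 p)
      exact congrArg₂ (· - ·) h2 h3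
    have h3 : p w • q - q w • p = p w • q + (-q w) • p := by module
    rw [this, h3, extMulM_add_left, extMulM_smul_left, extMulM_smul_left]
    module

/-- With `f j = ∂_j σ` the sum on the right becomes `dσ`: this is how closedness of `σ` enters the
Leibniz rule for `e^σ`. -/
lemma sum_extMulM_mulTwo (f : Fin n → E n [⋀^Fin 2]→L[ℝ] ℝ) (b : Cov (E n)) :
    ∑ j, extMulM (coordCov j) (mulTwo (f j) b) =
      wedgeM (homog 3 (∑ j, extMul (coordCov j) (f j))) b := by
  rw [map_sum, ← wedgeML_apply, map_sum, LinearMap.sum_apply]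
  refine Finset.sum_congr rfl fun j _ => ?_
  rw [wedgeML_apply, homog_extMul, wedgeM_extMulM, mulTwo_apply]

lemma sum_extMulM_extMulM (f : Fin n → E n [⋀^Fin 1]→L[ℝ] ℝ) (b : Cov (E n)) :
    ∑ j, extMulM (coordCov j) (extMulM (covOf (f j)) b) =
      mulTwo (∑ j, extMul (coordCov j) (f j)) b := by
  rw [mulTwo_apply, map_sum, ← wedgeML_apply, map_sum, LinearMap.sum_apply]
  refine Finset.sum_congr rfl fun j _ => ?_
  rw [wedgeML_apply, homog_extMul, wedgeM_extMulM, wedgeM_homog_one]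

lemma mulTwo_succ_succ (σ : E n [⋀^Fin 2]→L[ℝ] ℝ) (b : Cov (E n)) (k : ℕ) :
    mulTwo σ b (k + 2) = wedge (Nat.add_comm 2 k) σ (b k) := by
  rw [mulTwo_apply, wedgeM]
  rw [Finset.sum_eq_single (⟨2, by omega⟩ : Fin (k + 2 + 1))]
  · have := homog_self σ
    simp only [this]
    rfl
  · intro i _ hi
    rw [homog_of_ne, wedge_zero_left]
    intro h; apply hi; ext; exact h
  · simp

lemma mulTwo_of_lt_two (σ : E n [⋀^Fin 2]→L[ℝ] ℝ) (b : Cov (E n)) {k : ℕ} (hk : k < 2) :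
    mulTwo σ b k = 0 := by
  rw [mulTwo_apply, wedgeM]
  refine Finset.sum_eq_zero fun i _ => ?_
  rw [homog_of_ne (by omega), wedge_zero_left]

lemma mulTwo_pow_eq_zero (σ : E n [⋀^Fin 2]→L[ℝ] ℝ) (p : ℕ) (b : Cov (E n)) {k : ℕ}
    (hk : k < 2 * p) : ((mulTwo σ) ^ p) b k = 0 := by
  induction p generalizing k with
  | zero => omega
  | succ p ih =>
    rw [pow_succ']
    change mulTwo σ (((mulTwo σ) ^ p) b) k = 0
    match k with
    | 0 => exact mulTwo_of_lt_two _ _ (by omega)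
    | 1 => exact mulTwo_of_lt_two _ _ (by omega)
    | k + 2 => rw [mulTwo_succ_succ, ih (by omega), wedge_zero_right]

/-- For degree reasons: the product raises degrees by `2n + 2`, and nothing survives above degree
`n`. Hence truncating the exponential series at `p ≤ n` does no harm when it is differentiated or
contracted. -/
lemma mulTwo_mul_pow (σ τ : E n [⋀^Fin 2]→L[ℝ] ℝ) : mulTwo τ * mulTwo σ ^ n = 0 := by
  refine LinearMap.ext fun b => funext fun k => ?_
  by_cases hk : n < k
  · exact eq_zero_of_lt hk _
  change mulTwo τ ((mulTwo σ ^ n) b) k = 0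
  match k with
  | 0 => exact mulTwo_of_lt_two _ _ (by omega)
  | 1 => exact mulTwo_of_lt_two _ _ (by omega)
  | k + 2 => rw [mulTwo_succ_succ, mulTwo_pow_eq_zero _ _ _ (by omega), wedge_zero_right]

lemma extMulM_mulTwo_pow (σ : E n [⋀^Fin 2]→L[ℝ] ℝ) (l : E n →L[ℝ] ℝ) (b : Cov (E n)) :
    extMulM l ((mulTwo σ ^ n) b) = 0 := by
  refine funext fun k => ?_
  by_cases hk : n < k
  · exact eq_zero_of_lt hk _
  match k with
  | 0 => rfl
  | k + 1 =>
    rw [extMulM_succ, mulTwo_pow_eq_zero _ _ _ (by omega), ← zero_smul ℝ (0 : _ [⋀^Fin k]→L[ℝ] ℝ),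
      extMul_smul_right, zero_smul]
    rfl

/-- Left multiplication by `e^σ`. -/
def mulExp (σ : E n [⋀^Fin 2]→L[ℝ] ℝ) : Cov (E n) →ₗ[ℝ] Cov (E n) :=
  ∑ p ∈ Finset.range (n + 1), ((p.factorial : ℝ)⁻¹) • mulTwo σ ^ p

lemma wedgeM_mulTwo (σ : E n [⋀^Fin 2]→L[ℝ] ℝ) (a b : Cov (E n)) :
    wedgeM (mulTwo σ a) b = mulTwo σ (wedgeM a b) := by
  refine two_induction (P := fun σ => wedgeM (mulTwo σ a) b = mulTwo σ (wedgeM a b))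
    (fun a a' h h' => ?_) (fun t a h => ?_) (fun p q => ?_) σ
  · rw [mulTwo_add, LinearMap.add_apply, LinearMap.add_apply, wedgeM_add_left, h, h']
  · rw [mulTwo_smul, LinearMap.smul_apply, LinearMap.smul_apply, wedgeM_smul_left, h]
  · rw [mulTwo_extMul, mulTwo_extMul, wedgeM_extMulM, wedgeM_extMulM]

lemma wedgeM_powM (σ : E n [⋀^Fin 2]→L[ℝ] ℝ) (p : ℕ) (b : Cov (E n)) :
    wedgeM (powM (Pi.single 2 σ : Cov (E n)) p) b = (mulTwo σ ^ p) b := by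
  induction p with
  | zero => exact wedgeM_oneM b
  | succ p ih =>
    have : powM (Pi.single 2 σ : Cov (E n)) (p + 1) = mulTwo σ (powM (Pi.single 2 σ) p) := rfl
    rw [this, wedgeM_mulTwo, ih, pow_succ']
    rfl

lemma wedgeM_expM (σ : E n [⋀^Fin 2]→L[ℝ] ℝ) (b : Cov (E n)) :
    wedgeM (expM n σ) b = mulExp σ b := by
  rw [expM, ← wedgeML_apply, map_sum, LinearMap.sum_apply, mulExp, LinearMap.sum_apply]
  refine Finset.sum_congr rfl fun p _ => ?_
  rw [map_smul, LinearMap.smul_apply, wedgeML_apply, wedgeM_powM]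
  rfl

lemma mulExp_extMulM (σ : E n [⋀^Fin 2]→L[ℝ] ℝ) (l : E n →L[ℝ] ℝ) (b : Cov (E n)) :
    mulExp σ (extMulM l b) = extMulM l (mulExp σ b) := by
  have h : Commute (mulTwo σ) (extMulM l) := LinearMap.ext fun b => mulTwo_extMulM σ l b
  have h2 : Commute (mulExp σ) (extMulM l) :=
    Commute.sum_left _ _ _ fun p _ => (h.pow_left p).smul_left _
  exact LinearMap.congr_fun h2.eq b

lemma interiorL_mulTwo_pow (w : E n) (σ : E n [⋀^Fin 2]→L[ℝ] ℝ) (p : ℕ) (b : Cov (E n)) :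
    interiorL w ((mulTwo σ ^ (p + 1)) b) =
      ((p + 1 : ℕ) : ℝ) • extMulM (covOf (interior w σ)) ((mulTwo σ ^ p) b) +
        (mulTwo σ ^ (p + 1)) (interiorL w b) := by
  induction p with
  | zero =>
    simp only [zero_add, pow_one, pow_zero, Nat.cast_one, one_smul]
    exact interiorL_mulTwo w σ b
  | succ p ih =>
    have e : ∀ (q : ℕ) (c : Cov (E n)), (mulTwo σ ^ (q + 1)) c = mulTwo σ ((mulTwo σ ^ q) c) :=
      fun q c => by rw [pow_succ']; rfl
    rw [e (p + 1), interiorL_mulTwo, ih, map_add, map_smul, mulTwo_extMulM, ← e p b,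
      ← e (p + 1), ← add_assoc]
    congr 1
    push_cast
    module

/-- Contraction acts on powers of `σ` as a derivation, and the factor `p + 1` turns `1 / (p + 1)!`
into `1 / p!`. So `ι(w)` reproduces the exponential series with a factor `ι(w)σ`. -/
lemma interiorL_mulExp (w : E n) (σ : E n [⋀^Fin 2]→L[ℝ] ℝ) (b : Cov (E n)) :
    interiorL w (mulExp σ b) =
      extMulM (covOf (interior w σ)) (mulExp σ b) + mulExp σ (interiorL w b) := by
  have e1 : ∀ c : Cov (E n), mulExp σ c = ∑ p ∈ Finset.range (n + 1),
      ((p.factorial : ℝ)⁻¹) • (mulTwo σ ^ p) c := fun c => by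
    rw [mulExp, LinearMap.sum_apply]; rfl
  -- The last term of the truncated series is killed by multiplication with a covector, which makes
  -- room for the index shift.
  have h1 : extMulM (covOf (interior w σ)) (mulExp σ b) = ∑ p ∈ Finset.range n,
      ((p.factorial : ℝ)⁻¹) • extMulM (covOf (interior w σ)) ((mulTwo σ ^ p) b) := by
    rw [e1, map_sum, Finset.sum_range_succ, map_smul, extMulM_mulTwo_pow, smul_zero, add_zero]
    exact Finset.sum_congr rfl fun p _ => map_smul _ _ _
  have h2 : ∀ c : Cov (E n), mulExp σ c = ∑ p ∈ Finset.range n,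
      (((p + 1).factorial : ℝ)⁻¹) • (mulTwo σ ^ (p + 1)) c + c := fun c => by
    rw [e1, Finset.sum_range_succ']
    simp
  rw [h1, h2 b, h2 (interiorL w b), map_add, map_sum, ← add_assoc, ← Finset.sum_add_distrib]
  congr 1
  refine Finset.sum_congr rfl fun p _ => ?_
  rw [map_smul, interiorL_mulTwo_pow, smul_add, smul_smul]
  congr 2
  rw [Nat.factorial_succ]
  push_cast
  have : (p.factorial : ℝ) ≠ 0 := by positivity
  field_simp

end Operators2
end TwistedDH
end

open scoped Manifold ContDiff Topology
noncomputable section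
namespace TwistedDH

/-! ### Differential calculus for maps into the exterior algebra. -/

section FiniteDimensional

variable {V : Type*} [NormedAddCommGroup V] [NormedSpace ℝ V] [FiniteDimensional ℝ V]

instance finiteDimensional_alternating (k : ℕ) : FiniteDimensional ℝ (V [⋀^Fin k]→L[ℝ] ℝ) := by
  let T : (V [⋀^Fin k]→L[ℝ] ℝ) →ₗ[ℝ] MultilinearMap ℝ (fun _ : Fin k => V) ℝ :=
    { toFun := fun a => a.toMultilinearMap
      map_add' := fun _ _ => rfl
      map_smul' := fun _ _ => rfl }
  refine Module.Finite.of_injective T fun a b h => ?_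
  ext u
  exact congrArg (fun f : MultilinearMap ℝ (fun _ : Fin k => V) ℝ => f u) h

/-- The exterior product as a continuous bilinear map. -/
def wedgeCL {i j k : ℕ} (h : i + j = k) :
    (V [⋀^Fin i]→L[ℝ] ℝ) →L[ℝ] (V [⋀^Fin j]→L[ℝ] ℝ) →L[ℝ] V [⋀^Fin k]→L[ℝ] ℝ :=
  (wedgeL h).toContinuousBilinearMap

@[simp] lemma wedgeCL_apply {i j k : ℕ} (h : i + j = k) (a : V [⋀^Fin i]→L[ℝ] ℝ)
    (b : V [⋀^Fin j]→L[ℝ] ℝ) : wedgeCL h a b = wedge h a b := rfl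

/-- Exterior multiplication by covectors as a continuous bilinear map. -/
def extMulCL (k : ℕ) :
    (V →L[ℝ] ℝ) →L[ℝ] (V [⋀^Fin k]→L[ℝ] ℝ) →L[ℝ] V [⋀^Fin (k + 1)]→L[ℝ] ℝ :=
  (LinearMap.mk₂ ℝ extMul extMul_add_left extMul_smul_left extMul_add_right
    (fun t l a => extMul_smul_right l t a)).toContinuousBilinearMap

@[simp] lemma extMulCL_apply {k : ℕ} (l : V →L[ℝ] ℝ) (a : V [⋀^Fin k]→L[ℝ] ℝ) :
    extMulCL k l a = extMul l a := rfl

variable (V) in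
/-- `covOf` as a continuous linear map. -/
def covOfCL : (V [⋀^Fin 1]→L[ℝ] ℝ) →L[ℝ] V →L[ℝ] ℝ :=
  LinearMap.toContinuousLinearMap
    { toFun := covOf
      map_add' := fun _ _ => rfl
      map_smul' := fun _ _ => rfl }

@[simp] lemma covOfCL_apply (a : V [⋀^Fin 1]→L[ℝ] ℝ) : covOfCL V a = covOf a := rfl

end FiniteDimensional

section Bilinear

variable {W X Y Z : Type*} [NormedAddCommGroup W] [NormedSpace ℝ W] [NormedAddCommGroup X]
  [NormedSpace ℝ X] [NormedAddCommGroup Y] [NormedSpace ℝ Y] [NormedAddCommGroup Z]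
  [NormedSpace ℝ Z]

lemma differentiableAt_bilin (B : X →L[ℝ] Y →L[ℝ] Z) {f : W → X} {g : W → Y} {y : W}
    (hf : DifferentiableAt ℝ f y) (hg : DifferentiableAt ℝ g y) :
    DifferentiableAt ℝ (fun z => B (f z) (g z)) y :=
  (B.hasFDerivAt_of_bilinear hf.hasFDerivAt hg.hasFDerivAt).differentiableAt

lemma fderiv_bilin (B : X →L[ℝ] Y →L[ℝ] Z) {f : W → X} {g : W → Y} {y : W}
    (hf : DifferentiableAt ℝ f y) (hg : DifferentiableAt ℝ g y) (w : W) :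
    fderiv ℝ (fun z => B (f z) (g z)) y w = B (fderiv ℝ f y w) (g y) + B (f y) (fderiv ℝ g y w) := by
  rw [(B.hasFDerivAt_of_bilinear hf.hasFDerivAt hg.hasFDerivAt).fderiv]
  simp [add_comm]

lemma fderiv_sum_apply {ι : Type*} {s : Finset ι} {f : ι → W → Z} {y : W}
    (h : ∀ i ∈ s, DifferentiableAt ℝ (f i) y) (w : W) :
    fderiv ℝ (fun z => ∑ i ∈ s, f i z) y w = ∑ i ∈ s, fderiv ℝ (f i) y w := by
  rw [fderiv_fun_sum h]
  simp

end Bilinear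

section Calculus

variable {W : Type*} [NormedAddCommGroup W] [NormedSpace ℝ W] {n : ℕ}

/-- Differentiability of all components of a map to `Λ⁎`. -/
def DiffM (b : W → Cov (E n)) (y : W) : Prop := ∀ k, DifferentiableAt ℝ (fun z => b z k) y

/-- The componentwise derivative of a map to `Λ⁎`. -/
def derivM (b : W → Cov (E n)) (y w : W) : Cov (E n) := fun k => fderiv ℝ (fun z => b z k) y w

lemma derivM_add {b c : W → Cov (E n)} {y : W} (hb : DiffM b y) (hc : DiffM c y) (w : W) :
    derivM (fun z => b z + c z) y w = derivM b y w + derivM c y w :=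
  funext fun k => congrArg (fun f => f w) (fderiv_fun_add (hb k) (hc k))

lemma DiffM.sum {ι : Type*} {s : Finset ι} {b : ι → W → Cov (E n)} {y : W}
    (hb : ∀ i ∈ s, DiffM (b i) y) : DiffM (fun z => ∑ i ∈ s, b i z) y := fun k => by
  simp only [Finset.sum_apply]
  exact DifferentiableAt.fun_sum fun i hi => hb i hi k

lemma derivM_sum {ι : Type*} {s : Finset ι} {b : ι → W → Cov (E n)} {y : W}
    (hb : ∀ i ∈ s, DiffM (b i) y) (w : W) :
    derivM (fun z => ∑ i ∈ s, b i z) y w = ∑ i ∈ s, derivM (b i) y w := funext fun k => by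
  simp only [derivM, Finset.sum_apply]
  exact fderiv_sum_apply (fun i hi => hb i hi k) w

lemma DiffM.smul {f : W → ℝ} {b : W → Cov (E n)} {y : W} (hf : DifferentiableAt ℝ f y)
    (hb : DiffM b y) : DiffM (fun z => f z • b z) y := fun k => hf.smul (hb k)

lemma derivM_smul {f : W → ℝ} {b : W → Cov (E n)} {y : W} (hf : DifferentiableAt ℝ f y)
    (hb : DiffM b y) (w : W) :
    derivM (fun z => f z • b z) y w = f y • derivM b y w + fderiv ℝ f y w • b y :=
  funext fun k => by
    simp only [derivM, Pi.smul_apply, Pi.add_apply]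
    rw [fderiv_fun_smul hf (hb k)]
    simp

lemma DiffM.const_smul {b : W → Cov (E n)} {y : W} (t : ℝ) (hb : DiffM b y) :
    DiffM (fun z => t • b z) y := fun k => (hb k).const_smul t

lemma derivM_const_smul {b : W → Cov (E n)} {y : W} (t : ℝ) (hb : DiffM b y) (w : W) :
    derivM (fun z => t • b z) y w = t • derivM b y w := funext fun k => by
  simp only [derivM, Pi.smul_apply]
  rw [fderiv_fun_const_smul (hb k)]
  simp

lemma DiffM.mulTwo {s : W → E n [⋀^Fin 2]→L[ℝ] ℝ} {b : W → Cov (E n)} {y : W}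
    (hs : DifferentiableAt ℝ s y) (hb : DiffM b y) : DiffM (fun z => mulTwo (s z) (b z)) y
  | 0 => by simp only [mulTwo_of_lt_two _ _ (Nat.zero_lt_two)]; exact differentiableAt_const _
  | 1 => by simp only [mulTwo_of_lt_two _ _ (Nat.one_lt_two)]; exact differentiableAt_const _
  | k + 2 => by
    simp only [mulTwo_succ_succ]
    exact differentiableAt_bilin (wedgeCL (V := E n) (Nat.add_comm 2 k)) hs (hb k)

lemma derivM_mulTwo {s : W → E n [⋀^Fin 2]→L[ℝ] ℝ} {b : W → Cov (E n)} {y : W}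
    (hs : DifferentiableAt ℝ s y) (hb : DiffM b y) (w : W) :
    derivM (fun z => mulTwo (s z) (b z)) y w =
      mulTwo (fderiv ℝ s y w) (b y) + mulTwo (s y) (derivM b y w) := by
  funext k
  have h01 : ∀ k, k < 2 → derivM (fun z => mulTwo (s z) (b z)) y w k =
      (mulTwo (fderiv ℝ s y w) (b y) + mulTwo (s y) (derivM b y w)) k := fun k hk => by
    simp only [derivM, Pi.add_apply, mulTwo_of_lt_two _ _ hk]
    simp
  match k with
  | 0 => exact h01 0 (by omega)
  | 1 => exact h01 1 (by omega)
  | k + 2 =>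
    simp only [derivM, Pi.add_apply, mulTwo_succ_succ]
    exact fderiv_bilin (wedgeCL (V := E n) (Nat.add_comm 2 k)) hs (hb k) w

lemma derivM_extMulM {l : W → E n →L[ℝ] ℝ} {b : W → Cov (E n)} {y : W}
    (hl : DifferentiableAt ℝ l y) (hb : DiffM b y) (w : W) :
    derivM (fun z => extMulM (l z) (b z)) y w =
      extMulM (fderiv ℝ l y w) (b y) + extMulM (l y) (derivM b y w) := by
  funext k
  match k with
  | 0 => simp [derivM]
  | k + 1 =>
    simp only [derivM, Pi.add_apply, extMulM_succ]
    exact fderiv_bilin (extMulCL (V := E n) k) hl (hb k) w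

lemma mulTwo_pow_succ (σ : E n [⋀^Fin 2]→L[ℝ] ℝ) (q : ℕ) (c : Cov (E n)) :
    (mulTwo σ ^ (q + 1)) c = mulTwo σ ((mulTwo σ ^ q) c) := by
  rw [pow_succ']; rfl

lemma DiffM.mulTwo_pow {s : W → E n [⋀^Fin 2]→L[ℝ] ℝ} {b : W → Cov (E n)} {y : W}
    (hs : DifferentiableAt ℝ s y) (hb : DiffM b y) (p : ℕ) :
    DiffM (fun z => (TwistedDH.mulTwo (s z) ^ p) (b z)) y := by
  induction p with
  | zero => simpa using hb
  | succ p ih =>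
    simp only [mulTwo_pow_succ]
    exact DiffM.mulTwo hs ih

/-- Multiplications by two-covectors commute, so powers are differentiated as in a commutative
algebra. -/
lemma derivM_mulTwo_pow {s : W → E n [⋀^Fin 2]→L[ℝ] ℝ} {b : W → Cov (E n)} {y : W}
    (hs : DifferentiableAt ℝ s y) (hb : DiffM b y) (w : W) (p : ℕ) :
    derivM (fun z => (mulTwo (s z) ^ (p + 1)) (b z)) y w =
      ((p + 1 : ℕ) : ℝ) • mulTwo (fderiv ℝ s y w) ((mulTwo (s y) ^ p) (b y)) +
        (mulTwo (s y) ^ (p + 1)) (derivM b y w) := by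
  induction p with
  | zero => simpa using derivM_mulTwo hs hb w
  | succ p ih =>
    simp only [mulTwo_pow_succ _ (p + 1)]
    rw [derivM_mulTwo hs (hb.mulTwo_pow hs (p + 1)), ih, map_add, map_smul]
    have hc : mulTwo (s y) (mulTwo (fderiv ℝ s y w) ((mulTwo (s y) ^ p) (b y))) =
        mulTwo (fderiv ℝ s y w) (mulTwo (s y) ((mulTwo (s y) ^ p) (b y))) :=
      LinearMap.congr_fun (mulTwo_comm (s y) (fderiv ℝ s y w)).eq _
    rw [hc, ← mulTwo_pow_succ, ← add_assoc]
    congr 1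
    push_cast
    module

lemma mulExp_apply (σ : E n [⋀^Fin 2]→L[ℝ] ℝ) (c : Cov (E n)) :
    mulExp σ c = ∑ p ∈ Finset.range (n + 1), ((p.factorial : ℝ)⁻¹) • (mulTwo σ ^ p) c := by
  rw [mulExp, LinearMap.sum_apply]; rfl

lemma mulExp_apply' (σ : E n [⋀^Fin 2]→L[ℝ] ℝ) (c : Cov (E n)) :
    mulExp σ c = ∑ p ∈ Finset.range n,
      (((p + 1).factorial : ℝ)⁻¹) • (mulTwo σ ^ (p + 1)) c + c := by
  rw [mulExp_apply, Finset.sum_range_succ']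
  simp

lemma mulTwo_mulExp (τ σ : E n [⋀^Fin 2]→L[ℝ] ℝ) (c : Cov (E n)) :
    mulTwo τ (mulExp σ c) =
      ∑ p ∈ Finset.range n, ((p.factorial : ℝ)⁻¹) • mulTwo τ ((mulTwo σ ^ p) c) := by
  have h0 : mulTwo τ ((mulTwo σ ^ n) c) = 0 := LinearMap.congr_fun (mulTwo_mul_pow σ τ) c
  rw [mulExp_apply, map_sum, Finset.sum_range_succ, map_smul, h0, smul_zero, add_zero]
  exact Finset.sum_congr rfl fun p _ => map_smul _ _ _

lemma DiffM.mulExp {s : W → E n [⋀^Fin 2]→L[ℝ] ℝ} {b : W → Cov (E n)} {y : W}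
    (hs : DifferentiableAt ℝ s y) (hb : DiffM b y) :
    DiffM (fun z => TwistedDH.mulExp (s z) (b z)) y := by
  simp only [mulExp_apply]
  exact DiffM.sum fun p _ => (hb.mulTwo_pow hs p).const_smul _

/-- As for contraction, the factor from differentiating a power cancels against the factorial, and
the term lost in the shift vanishes by `mulTwo_mul_pow`. -/
lemma derivM_mulExp {s : W → E n [⋀^Fin 2]→L[ℝ] ℝ} {b : W → Cov (E n)} {y : W}
    (hs : DifferentiableAt ℝ s y) (hb : DiffM b y) (w : W) :
    derivM (fun z => mulExp (s z) (b z)) y w =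
      mulTwo (fderiv ℝ s y w) (mulExp (s y) (b y)) + mulExp (s y) (derivM b y w) := by
  rw [mulTwo_mulExp]
  simp only [mulExp_apply']
  rw [derivM_add (DiffM.sum fun p _ => (hb.mulTwo_pow hs (p + 1)).const_smul _) hb,
    derivM_sum fun p _ => (hb.mulTwo_pow hs (p + 1)).const_smul _, ← add_assoc, ← Finset.sum_add_distrib]
  congr 1
  refine Finset.sum_congr rfl fun p _ => ?_
  rw [derivM_const_smul _ (hb.mulTwo_pow hs (p + 1)), derivM_mulTwo_pow hs hb, smul_add, smul_smul]
  congr 2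
  rw [Nat.factorial_succ]
  push_cast
  have : (p.factorial : ℝ) ≠ 0 := by positivity
  field_simp

/-- The exterior derivative of a form of mixed degree on `ℝⁿ`. -/
def extDerivM (b : E n → Cov (E n)) (y : E n) : Cov (E n) :=
  ∑ j, extMulM (coordCov j) (derivM b y (coordVec j))

lemma extDerivM_zero (b : E n → Cov (E n)) (y : E n) : extDerivM b y 0 = 0 := by
  simp [extDerivM, Finset.sum_apply]

lemma extDeriv_eq_sum {k : ℕ} (b : E n → E n [⋀^Fin k]→L[ℝ] ℝ) (y : E n) :
    extDeriv b y = ∑ j, extMul (coordCov j) (fderiv ℝ b y (coordVec j)) :=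
  alternatizeUncurryFin_eq_sum _

lemma extDerivM_succ (b : E n → Cov (E n)) (y : E n) (k : ℕ) :
    extDerivM b y (k + 1) = extDeriv (fun z => b z k) y := by
  rw [extDeriv_eq_sum, extDerivM, Finset.sum_apply]
  rfl

/-- The Leibniz rule has a second term with the factor `ds`, which vanishes because `s` is closed;
no sign occurs since `e^s` is even. -/
lemma extDerivM_mulExp {s : E n → E n [⋀^Fin 2]→L[ℝ] ℝ} {b : E n → Cov (E n)} {y : E n}
    (hs : DifferentiableAt ℝ s y) (hb : DiffM b y) (hds : extDeriv s y = 0) :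
    extDerivM (fun z => mulExp (s z) (b z)) y = mulExp (s y) (extDerivM b y) := by
  simp only [extDerivM, derivM_mulExp hs hb, map_add, Finset.sum_add_distrib, map_sum,
    mulExp_extMulM]
  rw [sum_extMulM_mulTwo, ← extDeriv_eq_sum, hds, map_zero, ← wedgeML_apply, map_zero]
  simp

/-- The minus sign comes from moving the coordinate covectors of `d` past `g`. -/
lemma extDerivM_extMulM {g : E n → E n [⋀^Fin 1]→L[ℝ] ℝ} {b : E n → Cov (E n)} {y : E n}
    (hg : DifferentiableAt ℝ g y) (hb : DiffM b y) :
    extDerivM (fun z => extMulM (covOf (g z)) (b z)) y =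
      mulTwo (extDeriv g y) (b y) - extMulM (covOf (g y)) (extDerivM b y) := by
  have hl : DifferentiableAt ℝ (fun z => covOf (g z)) y :=
    (covOfCL (E n)).differentiableAt.comp y hg
  have h2 : ∀ w, fderiv ℝ (fun z => covOf (g z)) y w = covOf (fderiv ℝ g y w) := fun w =>
    congrArg (fun f => f w) ((covOfCL (E n)).hasFDerivAt.comp y hg.hasFDerivAt).fderiv
  simp only [extDerivM, derivM_extMulM hl hb, map_add, Finset.sum_add_distrib, h2, map_sum]
  rw [sum_extMulM_extMulM, ← extDeriv_eq_sum, sub_eq_add_neg, ← Finset.sum_neg_distrib]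
  congr 1
  exact Finset.sum_congr rfl fun j _ => extMulM_extMulM _ _ _

end Calculus

end TwistedDH
end

open scoped Manifold ContDiff Topology
noncomputable section
namespace TwistedDH

/-! ### Constant coefficient operators on the dual of the Lie algebra. -/

section DiffOp

variable {r : ℕ}

/-- The coordinate function `βᵢ` on `𝔤`, as an element of `𝔤⁎`. -/
lemma partialD_eq (i : Fin r) (φ : (E r →L[ℝ] ℝ) → ℝ) (ξ : E r →L[ℝ] ℝ) :
    partialD i φ ξ = fderiv ℝ φ ξ (coordCov i) := rfl

lemma contDiff_partialD (i : Fin r) {φ : (E r →L[ℝ] ℝ) → ℝ} (h : ContDiff ℝ ∞ φ) :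
    ContDiff ℝ ∞ (partialD i φ) := by
  have : ContDiff ℝ ∞ (fderiv ℝ φ) := h.fderiv_right (by simp)
  exact this.clm_apply contDiff_const

lemma contDiff_partialD_iterate (i : Fin r) {φ : (E r →L[ℝ] ℝ) → ℝ} (h : ContDiff ℝ ∞ φ) (p : ℕ) :
    ContDiff ℝ ∞ ((partialD i)^[p] φ) := by
  induction p generalizing φ with
  | zero => exact h
  | succ p ih => exact ih (contDiff_partialD i h)

lemma partialD_comm (i j : Fin r) {φ : (E r →L[ℝ] ℝ) → ℝ} (h : ContDiff ℝ ∞ φ) :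
    partialD i (partialD j φ) = partialD j (partialD i φ) := by
  funext ξ
  have h1 : ContDiff ℝ ∞ (fderiv ℝ φ) := h.fderiv_right (by simp)
  have h2 : ∀ (i j : Fin r), partialD i (partialD j φ) ξ =
      fderiv ℝ (fderiv ℝ φ) ξ (coordCov i) (coordCov j) := by
    intro i j
    have : partialD j φ = fun ζ => fderiv ℝ φ ζ (coordCov j) := rfl
    rw [this, partialD_eq]
    rw [fderiv_clm_apply (h1.differentiable (by simp) ξ) (differentiableAt_const _)]
    simp
  rw [h2, h2]
  exact ((h.of_le (m := 2) (WithTop.coe_le_coe.2 le_top)).contDiffAt.isSymmSndFDerivAt (by simp)) _ _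

lemma partialD_comm_iterate (i j : Fin r) {φ : (E r →L[ℝ] ℝ) → ℝ} (h : ContDiff ℝ ∞ φ) (p : ℕ) :
    partialD i ((partialD j)^[p] φ) = (partialD j)^[p] (partialD i φ) := by
  induction p generalizing φ with
  | zero => rfl
  | succ p ih =>
    rw [Function.iterate_succ_apply, ih (contDiff_partialD j h), partialD_comm i j h]
    rfl

lemma contDiff_foldr (L : List (Fin r)) (a : Fin r → ℕ) {φ : (E r →L[ℝ] ℝ) → ℝ}
    (h : ContDiff ℝ ∞ φ) :
    ContDiff ℝ ∞ (L.foldr (fun i f => (partialD i)^[a i] f) φ) := by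
  induction L with
  | nil => exact h
  | cons i L ih => exact contDiff_partialD_iterate i ih _

lemma partialD_foldr (L : List (Fin r)) (a : Fin r → ℕ) (j : Fin r) {φ : (E r →L[ℝ] ℝ) → ℝ}
    (h : ContDiff ℝ ∞ φ) :
    partialD j (L.foldr (fun i f => (partialD i)^[a i] f) φ) =
      L.foldr (fun i f => (partialD i)^[a i] f) (partialD j φ) := by
  induction L with
  | nil => rfl
  | cons i L ih =>
    rw [List.foldr_cons, List.foldr_cons, partialD_comm_iterate j i (contDiff_foldr L a h), ih]

lemma foldr_add_single_of_notMem (L : List (Fin r)) (a : Fin r →₀ ℕ) (j : Fin r)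
    (φ : (E r →L[ℝ] ℝ) → ℝ) (hj : j ∉ L) :
    L.foldr (fun i f => (partialD i)^[(a + Finsupp.single j 1 : Fin r →₀ ℕ) i] f) φ =
      L.foldr (fun i f => (partialD i)^[a i] f) φ := by
  induction L with
  | nil => rfl
  | cons i L ih =>
    simp only [List.mem_cons, not_or] at hj
    rw [List.foldr_cons, List.foldr_cons, ih hj.2]
    simp [hj.1]

/-- The index `j` occurs exactly once in the list, so exactly one iterate acquires an additional
derivative; by symmetry of second derivatives it can be moved to the front. -/
lemma foldr_add_single (L : List (Fin r)) (a : Fin r →₀ ℕ) (j : Fin r)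
    {φ : (E r →L[ℝ] ℝ) → ℝ} (h : ContDiff ℝ ∞ φ) (hj : j ∈ L) (hL : L.Nodup) :
    L.foldr (fun i f => (partialD i)^[(a + Finsupp.single j 1 : Fin r →₀ ℕ) i] f) φ =
      partialD j (L.foldr (fun i f => (partialD i)^[a i] f) φ) := by
  induction L with
  | nil => simp at hj
  | cons i L ih =>
    rw [List.foldr_cons, List.foldr_cons]
    rw [List.nodup_cons] at hL
    by_cases hi : j = i
    · subst hi
      rw [foldr_add_single_of_notMem L a j φ hL.1]
      simp [Function.iterate_succ_apply']
    · rw [ih (by simpa [hi] using hj) hL.2,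
        partialD_comm_iterate j i (contDiff_foldr L a h)]
      simp [hi]

lemma contDiff_multiD (a : Fin r →₀ ℕ) {φ : (E r →L[ℝ] ℝ) → ℝ} (h : ContDiff ℝ ∞ φ) :
    ContDiff ℝ ∞ (multiD a φ) := contDiff_foldr _ _ h

lemma partialD_multiD (a : Fin r →₀ ℕ) (j : Fin r) {φ : (E r →L[ℝ] ℝ) → ℝ}
    (h : ContDiff ℝ ∞ φ) : partialD j (multiD a φ) = multiD a (partialD j φ) :=
  partialD_foldr _ _ _ h

lemma multiD_add_single (a : Fin r →₀ ℕ) (j : Fin r) {φ : (E r →L[ℝ] ℝ) → ℝ}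
    (h : ContDiff ℝ ∞ φ) : multiD (a + Finsupp.single j 1) φ = multiD a (partialD j φ) := by
  rw [← partialD_multiD a j h]
  exact foldr_add_single _ _ _ h (List.mem_finRange _) (List.nodup_finRange _)

lemma partialD_eq_zero (i : Fin r) {φ : (E r →L[ℝ] ℝ) → ℝ} {ξ : E r →L[ℝ] ℝ}
    (h : ξ ∉ tsupport φ) : partialD i φ ξ = 0 := by
  rw [partialD, fderiv_of_notMem_tsupport ℝ h]
  rfl

lemma tsupport_partialD (i : Fin r) (φ : (E r →L[ℝ] ℝ) → ℝ) :
    tsupport (partialD i φ) ⊆ tsupport φ := by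
  refine closure_minimal (fun ξ hξ => ?_) (isClosed_tsupport φ)
  by_contra h
  exact hξ (partialD_eq_zero i h)

lemma tsupport_foldr (L : List (Fin r)) (a : Fin r → ℕ) (φ : (E r →L[ℝ] ℝ) → ℝ) :
    tsupport (L.foldr (fun i f => (partialD i)^[a i] f) φ) ⊆ tsupport φ := by
  induction L with
  | nil => exact subset_rfl
  | cons i L ih =>
    have : ∀ (p : ℕ) (ψ : (E r →L[ℝ] ℝ) → ℝ), tsupport ((partialD i)^[p] ψ) ⊆ tsupport ψ := by
      intro p
      induction p with
      | zero => exact fun ψ => subset_rfl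
      | succ p ih => exact fun ψ => (ih _).trans (tsupport_partialD i ψ)
    exact (this _ _).trans ih

lemma multiD_eq_zero (a : Fin r →₀ ℕ) {φ : (E r →L[ℝ] ℝ) → ℝ} {ξ : E r →L[ℝ] ℝ}
    (h : ξ ∉ tsupport φ) : multiD a φ ξ = 0 := by
  by_contra h0
  exact h (tsupport_foldr _ _ φ (subset_closure h0))

/-- The pairing of the constant coefficient differential operators `p(D)` with `φ` at `ξ`. -/
def opEval (φ : (E r →L[ℝ] ℝ) → ℝ) (ξ : E r →L[ℝ] ℝ) : MvPolynomial (Fin r) ℝ →ₗ[ℝ] ℝ :=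
  (MvPolynomial.basisMonomials (Fin r) ℝ).constr ℝ fun a => multiD a φ ξ

lemma opEval_monomial (φ : (E r →L[ℝ] ℝ) → ℝ) (ξ : E r →L[ℝ] ℝ) (a : Fin r →₀ ℕ) (t : ℝ) :
    opEval φ ξ (MvPolynomial.monomial a t) = t * multiD a φ ξ := by
  have : MvPolynomial.monomial a t = t • MvPolynomial.basisMonomials (Fin r) ℝ a := by
    rw [MvPolynomial.coe_basisMonomials, MvPolynomial.smul_monomial, smul_eq_mul, mul_one]
  rw [this, map_smul, opEval, Module.Basis.constr_basis, smul_eq_mul]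

/-- Multiplication by a variable on the symbol side is a derivative of the test function; this
converts the factor in front of `ι(X♯)` in `d_G` into `∂ᵢ`. -/
lemma opEval_X_mul_monomial {φ : (E r →L[ℝ] ℝ) → ℝ} (h : ContDiff ℝ ∞ φ) (ξ : E r →L[ℝ] ℝ)
    (i : Fin r) (a : Fin r →₀ ℕ) (t : ℝ) :
    opEval φ ξ (MvPolynomial.X i * MvPolynomial.monomial a t) =
      t * multiD a (partialD i φ) ξ := by
  rw [MvPolynomial.X, MvPolynomial.monomial_mul, one_mul, opEval_monomial, add_comm,
    multiD_add_single a i h]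

/-- A polynomial identity in `X ∈ 𝔤` yields an identity of differential operators. -/
lemma sum_multiD_of_forall_eval {S : Finset (Fin r →₀ ℕ)} {P R : (Fin r →₀ ℕ) → ℝ}
    {Q : Fin r → (Fin r →₀ ℕ) → ℝ}
    (H : ∀ X : E r, ∑ a ∈ S, (∏ i, X i ^ a i) * P a -
      ∑ i, X i * ∑ a ∈ S, (∏ i, X i ^ a i) * Q i a = ∑ a ∈ S, (∏ i, X i ^ a i) * R a)
    {φ : (E r →L[ℝ] ℝ) → ℝ} (h : ContDiff ℝ ∞ φ) (ξ : E r →L[ℝ] ℝ) :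
    ∑ a ∈ S, multiD a φ ξ * P a = ∑ i, ∑ a ∈ S, multiD a (partialD i φ) ξ * Q i a +
      ∑ a ∈ S, multiD a φ ξ * R a := by
  -- Polynomials over `ℝ` with equal values are equal. After this the linear map `opEval` can be
  -- applied, which is not possible for an identity between values.
  have key : ∑ a ∈ S, MvPolynomial.monomial a (P a) -
      ∑ i, MvPolynomial.X i * ∑ a ∈ S, MvPolynomial.monomial a (Q i a) =
      ∑ a ∈ S, MvPolynomial.monomial a (R a) := by
    refine MvPolynomial.funext fun x => ?_
    have := H (WithLp.toLp 2 x)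
    simp only [map_sub, map_sum, map_mul, MvPolynomial.eval_monomial, MvPolynomial.eval_X,
      Finsupp.prod_fintype _ _ (fun i => pow_zero _)]
    simp only at this
    simp only [mul_comm (P _), mul_comm (Q _ _), mul_comm (R _)]
    exact this
  have k2 := congrArg (opEval φ ξ) key
  simp only [map_sub, map_sum, Finset.mul_sum, opEval_monomial, opEval_X_mul_monomial h] at k2
  simp only [mul_comm (multiD _ _ _)]
  linarith

end DiffOp

/-! ### The differential of `e^σ D_{η,Φ}(φ)` in coordinates. -/

section LocalFormula

variable {r n : ℕ} {W : Type*} [NormedAddCommGroup W] [NormedSpace ℝ W]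

/-- The coordinate expression of `D_{η,Φ}(φ)`. -/
def twistSum (S : Finset (Fin r →₀ ℕ)) (f : W → E r →L[ℝ] ℝ) (N : (Fin r →₀ ℕ) → W → Cov (E n))
    (φ : (E r →L[ℝ] ℝ) → ℝ) (z : W) : Cov (E n) := ∑ a ∈ S, multiD a φ (f z) • N a z

variable {S : Finset (Fin r →₀ ℕ)} {f : W → E r →L[ℝ] ℝ} {N : (Fin r →₀ ℕ) → W → Cov (E n)}
  {φ : (E r →L[ℝ] ℝ) → ℝ} {y : W}

lemma differentiableAt_multiD_comp (hφ : ContDiff ℝ ∞ φ) (hf : DifferentiableAt ℝ f y)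
    (a : Fin r →₀ ℕ) : DifferentiableAt ℝ (fun z => multiD a φ (f z)) y :=
  ((contDiff_multiD a hφ).differentiable (by simp) (f y)).comp y hf

/-- The chain rule, with the derivative of the moment map expanded in the basis `βᵢ`: its
coefficients are the derivatives of the components `Φ^{eᵢ}`, to which Hamilton's equation applies.
-/
lemma fderiv_multiD_comp (hφ : ContDiff ℝ ∞ φ) (hf : DifferentiableAt ℝ f y)
    (a : Fin r →₀ ℕ) (w : W) : fderiv ℝ (fun z => multiD a φ (f z)) y w =
      ∑ i, fderiv ℝ f y w (coordVec i) * multiD a (partialD i φ) (f y) := by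
  have h1 : fderiv ℝ (fun z => multiD a φ (f z)) y w =
      fderiv ℝ (multiD a φ) (f y) (fderiv ℝ f y w) :=
    congrArg (fun g => g w) (fderiv_comp y ((contDiff_multiD a hφ).differentiable (by simp) (f y))
      hf)
  have h2 : fderiv ℝ f y w = ∑ i, fderiv ℝ f y w (coordVec i) • coordCov i := by
    conv_lhs => rw [sum_clm (fderiv ℝ f y w)]
    refine Finset.sum_congr rfl fun i _ => ?_
    ext u
    simp [mul_comm]
  rw [h1, h2, map_sum]
  refine Finset.sum_congr rfl fun i _ => ?_
  rw [map_smul, ← h2, smul_eq_mul, ← partialD_eq, partialD_multiD a i hφ]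

lemma diffM_twistSum (hφ : ContDiff ℝ ∞ φ) (hf : DifferentiableAt ℝ f y)
    (hN : ∀ a ∈ S, DiffM (N a) y) : DiffM (twistSum S f N φ) y :=
  DiffM.sum fun a ha => (hN a ha).smul (differentiableAt_multiD_comp hφ hf a)

lemma derivM_twistSum (hφ : ContDiff ℝ ∞ φ) (hf : DifferentiableAt ℝ f y)
    (hN : ∀ a ∈ S, DiffM (N a) y) (w : W) :
    derivM (twistSum S f N φ) y w =
      ∑ i, fderiv ℝ f y w (coordVec i) • twistSum S f N (partialD i φ) y +
        ∑ a ∈ S, multiD a φ (f y) • derivM (N a) y w := by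
  have h0 : derivM (twistSum S f N φ) y w =
      ∑ a ∈ S, derivM (fun z => multiD a φ (f z) • N a z) y w :=
    derivM_sum (fun a ha => (hN a ha).smul (differentiableAt_multiD_comp hφ hf a)) w
  rw [h0, Finset.sum_congr rfl fun a ha => derivM_smul
    (differentiableAt_multiD_comp hφ hf a) (hN a ha) w, Finset.sum_add_distrib, add_comm]
  congr 1
  simp only [twistSum, Finset.smul_sum]
  rw [Finset.sum_comm]
  refine Finset.sum_congr rfl fun a _ => ?_
  rw [fderiv_multiD_comp hφ hf, Finset.sum_smul]
  exact Finset.sum_congr rfl fun i _ => mul_smul _ _ _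

end LocalFormula

section LocalFormula2

variable {r n : ℕ} {S : Finset (Fin r →₀ ℕ)} {f : E n → E r →L[ℝ] ℝ}
  {N : (Fin r →₀ ℕ) → E n → Cov (E n)} {φ : (E r →L[ℝ] ℝ) → ℝ} {y : E n}
  {s : E n → E n [⋀^Fin 2]→L[ℝ] ℝ} {ξ : Fin r → E n} {R : (Fin r →₀ ℕ) → Cov (E n)}

/-- Two sources of terms. Differentiating `D_{βᵃ}φ ∘ Φ` gives `dΦ^{eᵢ} = ι(eᵢ♯)σ` with a further
derivative of `φ`. Differentiating the coefficients of `η` gives, by the equation for `d_G η`, a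
contraction with `eᵢ♯` whose factor `Xᵢ` becomes `∂ᵢ` on `φ`, and the remainder `R`. -/
lemma extDerivM_twistSum (hφ : ContDiff ℝ ∞ φ) (hf : DifferentiableAt ℝ f y)
    (hN : ∀ a ∈ S, DiffM (N a) y)
    (hham : ∀ i w, fderiv ℝ f y w (coordVec i) = s y ![ξ i, w])
    (H : ∀ X : E r, ∑ a ∈ S, (∏ i, X i ^ a i) • extDerivM (N a) y -
      ∑ i, X i • ∑ a ∈ S, (∏ i, X i ^ a i) • interiorL (ξ i) (N a y) =
        ∑ a ∈ S, (∏ i, X i ^ a i) • R a) :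
    extDerivM (twistSum S f N φ) y =
      ∑ i, (extMulM (covOf (interior (ξ i) (s y))) (twistSum S f N (partialD i φ) y) +
        interiorL (ξ i) (twistSum S f N (partialD i φ) y)) + ∑ a ∈ S, multiD a φ (f y) • R a := by
  have h1 : extDerivM (twistSum S f N φ) y =
      ∑ i, extMulM (covOf (interior (ξ i) (s y))) (twistSum S f N (partialD i φ) y) +
      ∑ a ∈ S, multiD a φ (f y) • extDerivM (N a) y := by
    simp only [extDerivM, derivM_twistSum hφ hf hN, map_add, map_sum, Finset.sum_add_distrib,
      map_smul, Finset.smul_sum]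
    rw [Finset.sum_comm, Finset.sum_comm (s := Finset.univ) (t := S)]
    congr 1
    refine Finset.sum_congr rfl fun i _ => ?_
    -- Hamilton's equation: this is the coordinate expansion of `dΦ^{eᵢ}`.
    have : covOf (interior (ξ i) (s y)) =
        ∑ j, fderiv ℝ f y (coordVec j) (coordVec i) • coordCov j := by
      rw [sum_clm (covOf (interior (ξ i) (s y)))]
      refine Finset.sum_congr rfl fun j _ => ?_
      ext u
      have e : s y ![ξ i, coordVec j] = covOf (interior (ξ i) (s y)) (coordVec j) := rfl
      simp only [hham, e]
      simp [mul_comm]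
    rw [this]
    have e2 : ∀ (c : Fin n → ℝ) (b : Cov (E n)), extMulM (∑ j, c j • coordCov j) b =
        ∑ j, c j • extMulM (coordCov j) b := by
      intro c b
      let T : (E n →L[ℝ] ℝ) →ₗ[ℝ] Cov (E n) :=
        { toFun := fun l => extMulM l b
          map_add' := fun l l' => extMulM_add_left l l' b
          map_smul' := fun t l => extMulM_smul_left t l b }
      change T _ = _
      rw [map_sum]
      exact Finset.sum_congr rfl fun j _ => map_smul T _ _
    rw [e2]
  -- Evaluation on vectors reduces the claim to the scalar statement about polynomials in `X`.
  have h2 : ∑ a ∈ S, multiD a φ (f y) • extDerivM (N a) y =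
      ∑ i, interiorL (ξ i) (twistSum S f N (partialD i φ) y) +
        ∑ a ∈ S, multiD a φ (f y) • R a := by
    funext k
    ext u
    have := sum_multiD_of_forall_eval (S := S) (P := fun a => extDerivM (N a) y k u)
      (Q := fun i a => interiorL (ξ i) (N a y) k u) (R := fun a => R a k u)
      (fun X => by
        have := congrArg (fun c : Cov (E n) => c k u) (H X)
        simpa [Finset.sum_apply, ContinuousAlternatingMap.sum_apply] using this) hφ (f y)
    simpa [Finset.sum_apply, ContinuousAlternatingMap.sum_apply, twistSum, map_sum] using this
  rw [h1, h2, Finset.sum_add_distrib, add_assoc]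

/-- `d (e^σ D_{η,Φ}(φ)) = ∑ᵢ ι(eᵢ♯) e^σ D_{η,Φ}(∂ᵢφ) + e^σ D_{d_G η,Φ}(φ)`. -/
lemma extDerivM_mulExp_twistSum (hφ : ContDiff ℝ ∞ φ) (hf : DifferentiableAt ℝ f y)
    (hN : ∀ a ∈ S, DiffM (N a) y) (hs : DifferentiableAt ℝ s y) (hds : extDeriv s y = 0)
    (hham : ∀ i w, fderiv ℝ f y w (coordVec i) = s y ![ξ i, w])
    (H : ∀ X : E r, ∑ a ∈ S, (∏ i, X i ^ a i) • extDerivM (N a) y -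
      ∑ i, X i • ∑ a ∈ S, (∏ i, X i ^ a i) • interiorL (ξ i) (N a y) =
        ∑ a ∈ S, (∏ i, X i ^ a i) • R a) :
    extDerivM (fun z => mulExp (s z) (twistSum S f N φ z)) y =
      ∑ i, interiorL (ξ i) (mulExp (s y) (twistSum S f N (partialD i φ) y)) +
        mulExp (s y) (∑ a ∈ S, multiD a φ (f y) • R a) := by
  rw [extDerivM_mulExp hs (diffM_twistSum hφ hf hN) hds, extDerivM_twistSum hφ hf hN hham H,
    map_add, map_sum]
  congr 1
  refine Finset.sum_congr rfl fun i _ => ?_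
  rw [interiorL_mulExp, map_add, mulExp_extMulM]

/-- A component of degree `n` of a contraction comes from degree `n + 1`. For this reason all the
contraction terms disappear from integrands. -/
lemma interiorL_top (w : E n) (b : Cov (E n)) : interiorL w b n = 0 := by
  rw [interiorL_apply, eq_zero_of_lt (Nat.lt_succ_self n) (b (n + 1))]
  rfl

/-- The variation of `e^σ D_{η,Φ}(φ)` in top degree under a change of `σ + Φ` by the equivariant
differential of a `1`-form `g` is exact. -/
lemma derivM_homotopy_top (hφ : ContDiff ℝ ∞ φ) (hf : DifferentiableAt ℝ f y)
    (hN : ∀ a ∈ S, DiffM (N a) y) (hs : DifferentiableAt ℝ s y) (hds : extDeriv s y = 0)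
    (hham : ∀ i w, fderiv ℝ f y w (coordVec i) = s y ![ξ i, w])
    (H : ∀ X : E r, ∑ a ∈ S, (∏ i, X i ^ a i) • extDerivM (N a) y -
      ∑ i, X i • ∑ a ∈ S, (∏ i, X i ^ a i) • interiorL (ξ i) (N a y) = 0)
    {g : E n → E n [⋀^Fin 1]→L[ℝ] ℝ} (hg : DifferentiableAt ℝ g y) {h : E r →L[ℝ] ℝ}
    (hh : ∀ i, h (coordVec i) = - g y ![ξ i]) {t₀ : ℝ}
    {S' : ℝ → E n [⋀^Fin 2]→L[ℝ] ℝ} {F : ℝ → E r →L[ℝ] ℝ}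
    (hS : HasDerivAt S' (extDeriv g y) t₀) (hS0 : S' t₀ = s y)
    (hF : HasDerivAt F h t₀) (hF0 : F t₀ = f y) :
    derivM (fun t => mulExp (S' t) (twistSum S F (fun a _ => N a y) φ t)) t₀ 1 n =
      extDerivM (fun z => extMulM (covOf (g z)) (mulExp (s z) (twistSum S f N φ z))) y n := by
  have hNc : ∀ a ∈ S, DiffM (fun _ : ℝ => N a y) t₀ := fun a _ k => differentiableAt_const _
  have hc0 : ∀ ψ : (E r →L[ℝ] ℝ) → ℝ, twistSum S F (fun a _ => N a y) ψ t₀ =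
      twistSum S f N ψ y := fun ψ => by simp only [twistSum, hF0]
  rw [derivM_mulExp hS.differentiableAt (diffM_twistSum hφ hF.differentiableAt hNc),
    derivM_twistSum hφ hF.differentiableAt hNc,
    extDerivM_extMulM hg ((diffM_twistSum hφ hf hN).mulExp hs),
    extDerivM_mulExp_twistSum (R := 0) hφ hf hN hs hds hham (by simpa using H)]
  have hd0 : ∀ a, derivM (fun _ : ℝ => N a y) t₀ 1 = 0 := fun a => funext fun k => by
    simp [derivM]
  have e1 : fderiv ℝ S' t₀ 1 = extDeriv g y := by rw [fderiv_apply_one_eq_deriv, hS.deriv]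
  have e2 : fderiv ℝ F t₀ 1 = h := by rw [fderiv_apply_one_eq_deriv, hF.deriv]
  simp only [hd0, hc0, e1, e2, hS0, hh, smul_zero, Finset.sum_const_zero, add_zero, map_sum,
    Pi.zero_apply, map_zero, map_smul]
  rw [sub_eq_add_neg, ← Finset.sum_neg_distrib, Pi.add_apply, Pi.add_apply, Finset.sum_apply,
    Finset.sum_apply]
  congr 1
  refine Finset.sum_congr rfl fun i _ => ?_
  -- Contracting `g ∧ β` gives `0` in degree `n`, so there `g ∧ ι(ξᵢ)β = g(ξᵢ) β`. This matches the
  -- derivative of the moment map, `-g(ξᵢ)`.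
  have h1 := interiorL_extMulM (ξ i) (covOf (g y))
    (mulExp (s y) (twistSum S f N (partialD i φ) y))
  have h2 := congrFun h1 n
  rw [interiorL_top, Pi.sub_apply, Pi.smul_apply, covOf_apply] at h2
  rw [Pi.smul_apply, Pi.neg_apply, ← sub_eq_zero.mp h2.symm]
  exact neg_smul (R := ℝ) (M := E n [⋀^Fin n]→L[ℝ] ℝ) (g y ![ξ i])
    (mulExp (s y) (twistSum S f N (partialD i φ) y) n)

end LocalFormula2

end TwistedDH
end

open scoped Manifold ContDiff Topology
noncomputable section
namespace TwistedDH

/-! ### Smoothness of families of alternating forms. -/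

section Evaluation

variable {V : Type*} [NormedAddCommGroup V] [NormedSpace ℝ V] [FiniteDimensional ℝ V]
  {W : Type*} [NormedAddCommGroup W] [NormedSpace ℝ W]

lemma interior_add_left {k : ℕ} (w w' : V) (a : V [⋀^Fin (k + 1)]→L[ℝ] ℝ) :
    interior (w + w') a = interior w a + interior w' a := by
  ext u; exact a.toAlternatingMap.map_vecCons_add u w w'

lemma interior_smul_left {k : ℕ} (t : ℝ) (w : V) (a : V [⋀^Fin (k + 1)]→L[ℝ] ℝ) :
    interior (t • w) a = t • interior w a := by
  ext u; exact a.toAlternatingMap.map_vecCons_smul u t w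

/-- The interior product as a continuous bilinear map. -/
def interiorBL (k : ℕ) : V →L[ℝ] (V [⋀^Fin (k + 1)]→L[ℝ] ℝ) →L[ℝ] V [⋀^Fin k]→L[ℝ] ℝ :=
  (LinearMap.mk₂ ℝ interior interior_add_left interior_smul_left
    (fun w a b => interior_add_right w a b)
    (fun t w a => interior_smul_right w t a)).toContinuousBilinearMap

@[simp] lemma interiorBL_apply {k : ℕ} (w : V) (a : V [⋀^Fin (k + 1)]→L[ℝ] ℝ) :
    interiorBL k w a = interior w a := rfl

lemma contDiffWithinAt_bilin {X Y Z : Type*} [NormedAddCommGroup X] [NormedSpace ℝ X]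
    [NormedAddCommGroup Y] [NormedSpace ℝ Y] [NormedAddCommGroup Z] [NormedSpace ℝ Z]
    (B : X →L[ℝ] Y →L[ℝ] Z) {f : W → X} {g : W → Y} {s : Set W} {y : W}
    (hf : ContDiffWithinAt ℝ ∞ f s y) (hg : ContDiffWithinAt ℝ ∞ g s y) :
    ContDiffWithinAt ℝ ∞ (fun z => B (f z) (g z)) s y :=
  (B.contDiff.contDiffAt.comp_contDiffWithinAt y hf).clm_apply hg

/-- Contracting with the first vector is a bilinear operation that lowers the degree, so the claim
follows by induction. -/
lemma ContDiffWithinAt.alternating_apply {k : ℕ} {a : W → V [⋀^Fin k]→L[ℝ] ℝ}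
    {u : W → Fin k → V} {s : Set W} {y : W} (ha : ContDiffWithinAt ℝ ∞ a s y)
    (hu : ∀ i, ContDiffWithinAt ℝ ∞ (fun z => u z i) s y) :
    ContDiffWithinAt ℝ ∞ (fun z => a z (u z)) s y := by
  induction k with
  | zero =>
    let T : (V [⋀^Fin 0]→L[ℝ] ℝ) →ₗ[ℝ] ℝ :=
      { toFun := fun a => a 0
        map_add' := fun _ _ => rfl
        map_smul' := fun _ _ => rfl }
    have : (fun z => a z (u z)) = fun z => T.toContinuousLinearMap (a z) := by
      funext z
      rw [Subsingleton.elim (u z) 0]; rfl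
    rw [this]
    exact T.toContinuousLinearMap.contDiff.contDiffAt.comp_contDiffWithinAt y ha
  | succ k ih =>
    have : (fun z => a z (u z)) = fun z => interiorBL k (u z 0) (a z) (Fin.tail (u z)) := by
      funext z
      rw [interiorBL_apply, interior_apply]
      exact congrArg (a z) (Fin.cons_self_tail (u z)).symm
    rw [this]
    exact ih (contDiffWithinAt_bilin (interiorBL k) (hu 0) ha) fun i => hu i.succ

/-- An injective linear map between finite dimensional spaces has a linear left inverse, so
smoothness may be tested on finitely many functionals. -/
lemma contDiffWithinAt_of_separating {F : Type*} [NormedAddCommGroup F] [NormedSpace ℝ F]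
    [FiniteDimensional ℝ F] {ι : Type*} [Fintype ι] (T : F →ₗ[ℝ] ι → ℝ)
    (hT : Function.Injective T) {f : W → F} {s : Set W} {y : W}
    (h : ∀ i, ContDiffWithinAt ℝ ∞ (fun z => T (f z) i) s y) : ContDiffWithinAt ℝ ∞ f s y := by
  obtain ⟨L, hL⟩ := T.exists_leftInverse_of_injective (LinearMap.ker_eq_bot.mpr hT)
  have : f = fun z => L.toContinuousLinearMap (T (f z)) := by
    funext z; exact (LinearMap.congr_fun hL (f z)).symm
  rw [this]
  exact L.toContinuousLinearMap.contDiff.contDiffAt.comp_contDiffWithinAt y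
    (contDiffWithinAt_pi.mpr h)

lemma contDiffWithinAt_alternating {k : ℕ} {a : W → V [⋀^Fin k]→L[ℝ] ℝ} {s : Set W} {y : W}
    (h : ∀ u, ContDiffWithinAt ℝ ∞ (fun z => a z u) s y) : ContDiffWithinAt ℝ ∞ a s y := by
  let e := Module.finBasis ℝ V
  let T : (V [⋀^Fin k]→L[ℝ] ℝ) →ₗ[ℝ] (Fin k → Fin (Module.finrank ℝ V)) → ℝ :=
    { toFun := fun a i => a fun j => e (i j)
      map_add' := fun _ _ => rfl
      map_smul' := fun _ _ => rfl }
  refine contDiffWithinAt_of_separating T (fun a b hab => ?_) fun i => h _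
  have : a.toAlternatingMap = b.toAlternatingMap := by
    refine e.ext_alternating fun i _ => congrFun hab i
  ext u
  exact congrArg (fun f : V [⋀^Fin k]→ₗ[ℝ] ℝ => f u) this

lemma ContDiffWithinAt.compContinuousLinearMap {V' : Type*} [NormedAddCommGroup V']
    [NormedSpace ℝ V'] [FiniteDimensional ℝ V'] {k : ℕ} {a : W → V [⋀^Fin k]→L[ℝ] ℝ}
    {f : W → V' →L[ℝ] V} {s : Set W} {y : W} (ha : ContDiffWithinAt ℝ ∞ a s y)
    (hf : ContDiffWithinAt ℝ ∞ f s y) :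
    ContDiffWithinAt ℝ ∞ (fun z => (a z).compContinuousLinearMap (f z)) s y :=
  contDiffWithinAt_alternating fun u =>
    ContDiffWithinAt.alternating_apply (u := fun z i => f z (u i)) ha
      fun i => hf.clm_apply contDiffWithinAt_const

end Evaluation

lemma minSmoothness_two_le : minSmoothness ℝ 2 ≤ (∞ : WithTop ℕ∞) := by
  rw [minSmoothness_of_isRCLikeNormedField]
  exact WithTop.coe_le_coe.2 le_top

/-! ### Pullback of forms to vector spaces, and naturality of `d`. -/

section PullbackToVectorSpace

variable {m : ℕ} {M : Type*} [TopologicalSpace M] [ChartedSpace (E m) M]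
  {N : Type*} [NormedAddCommGroup N] [NormedSpace ℝ N]
  {N' : Type*} [NormedAddCommGroup N'] [NormedSpace ℝ N']

/-- The pullback of a form under a map from a vector space to `M`. -/
def pb {k : ℕ} (F : N → M) (σ : DForm m k M) (y : N) : N [⋀^Fin k]→L[ℝ] ℝ :=
  (σ (F y)).compContinuousLinearMap (mfderiv 𝓘(ℝ, N) (𝓡 m) F y : N →L[ℝ] _)

lemma chartRep_eq_pb {k : ℕ} (c : M) (σ : DForm m k M) :
    chartRep c σ = pb (chartAt (E m) c).symm σ := rfl

lemma pb_congr {k : ℕ} {F F' : N → M} {σ : DForm m k M} {y : N} (h : F =ᶠ[𝓝 y] F') :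
    pb F σ y = pb F' σ y := by
  have h1 : (mfderiv 𝓘(ℝ, N) (𝓡 m) F y : N →L[ℝ] E m) = mfderiv 𝓘(ℝ, N) (𝓡 m) F' y :=
    h.mfderiv_eq
  have h2 : (σ (F y) : E m [⋀^Fin k]→L[ℝ] ℝ) = σ (F' y) := by rw [h.self_of_nhds]
  change ContinuousAlternatingMap.compContinuousLinearMap
    (σ (F y) : E m [⋀^Fin k]→L[ℝ] ℝ) _ = _
  rw [h2, h1]
  rfl

lemma pb_comp {k : ℕ} {F : N → M} {ψ : N' → N} {σ : DForm m k M} {y : N'}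
    (hF : MDifferentiableAt 𝓘(ℝ, N) (𝓡 m) F (ψ y)) (hψ : DifferentiableAt ℝ ψ y) :
    pb (F ∘ ψ) σ y = (pb F σ (ψ y)).compContinuousLinearMap (fderiv ℝ ψ y) := by
  have h : mfderiv 𝓘(ℝ, N') (𝓡 m) (F ∘ ψ) y =
      (mfderiv 𝓘(ℝ, N) (𝓡 m) F (ψ y)).comp (fderiv ℝ ψ y) := by
    rw [mfderiv_comp y hF hψ.mdifferentiableAt, mfderiv_eq_fderiv]
    rfl
  rw [pb, h]
  rfl

variable [IsManifold (𝓡 m) ∞ M]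

lemma contMDiffAt_chart {c x : M} (hx : x ∈ (chartAt (E m) c).source) :
    ContMDiffAt (𝓡 m) (𝓡 m) ∞ (chartAt (E m) c) x :=
  contMDiffOn_chart.contMDiffAt ((chartAt (E m) c).open_source.mem_nhds hx)

lemma contMDiffAt_chart_symm {c : M} {y : E m} (hy : y ∈ (chartAt (E m) c).target) :
    ContMDiffAt (𝓡 m) (𝓡 m) ∞ (chartAt (E m) c).symm y :=
  contMDiffOn_chart_symm.contMDiffAt ((chartAt (E m) c).open_target.mem_nhds hy)

lemma contDiffAt_chart_comp {c : M} {F : N → M} {y : N}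
    (hF : ContMDiffAt 𝓘(ℝ, N) (𝓡 m) ∞ F y) (hy : F y ∈ (chartAt (E m) c).source) :
    ContDiffAt ℝ ∞ (chartAt (E m) c ∘ F) y :=
  ((contMDiffAt_chart hy).comp y hF).contDiffAt

/-- Near `y` the map factors as the inverse chart after its own coordinate expression. This reduces
statements about pullbacks from `M` to statements between vector spaces. -/
lemma pb_eq_chartRep {k : ℕ} {c : M} {F : N → M} (σ : DForm m k M) {y : N}
    (hF : ContMDiffAt 𝓘(ℝ, N) (𝓡 m) ∞ F y) (hy : F y ∈ (chartAt (E m) c).source) :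
    pb F σ y = (chartRep c σ (chartAt (E m) c (F y))).compContinuousLinearMap
      (fderiv ℝ (chartAt (E m) c ∘ F) y) := by
  have h : F =ᶠ[𝓝 y] (chartAt (E m) c).symm ∘ (chartAt (E m) c ∘ F) := by
    filter_upwards [hF.continuousAt.preimage_mem_nhds
      ((chartAt (E m) c).open_source.mem_nhds hy)] with z hz
    exact ((chartAt (E m) c).left_inv hz).symm
  rw [pb_congr h, pb_comp, chartRep_eq_pb]
  · rfl
  · exact (contMDiffAt_chart_symm ((chartAt (E m) c).map_source hy)).mdifferentiableAt (by simp)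
  · exact (contDiffAt_chart_comp hF hy).differentiableAt (by simp)

lemma eventually_pb_eq_chartRep {k : ℕ} {c : M} {F : N → M} (σ : DForm m k M) {W : Set N} {y : N}
    (hW : IsOpen W) (hF : ContMDiffOn 𝓘(ℝ, N) (𝓡 m) ∞ F W) (hyW : y ∈ W)
    (hy : F y ∈ (chartAt (E m) c).source) :
    pb F σ =ᶠ[𝓝 y] fun z => (chartRep c σ ((chartAt (E m) c ∘ F) z)).compContinuousLinearMap
      (fderiv ℝ (chartAt (E m) c ∘ F) z) := by
  have hc := (hF.contMDiffAt (hW.mem_nhds hyW)).continuousAt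
  filter_upwards [hW.mem_nhds hyW,
    hc.preimage_mem_nhds ((chartAt (E m) c).open_source.mem_nhds hy)] with z hz hz'
  exact pb_eq_chartRep σ (hF.contMDiffAt (hW.mem_nhds hz)) hz'

lemma SmoothFormOn.contDiffAt {k : ℕ} {U : Set M} (hU : IsOpen U) {σ : DForm m k M}
    (h : SmoothFormOn U σ) {c : M} {y : E m} (hy : y ∈ (chartAt (E m) c).target)
    (hy' : (chartAt (E m) c).symm y ∈ U) : ContDiffAt ℝ ∞ (chartRep c σ) y :=
  (h c).contDiffAt (((chartAt (E m) c).isOpen_inter_preimage_symm hU).mem_nhds ⟨hy, hy'⟩)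

lemma contDiffOn_pb [FiniteDimensional ℝ N] {k : ℕ} {U : Set M} (hU : IsOpen U)
    {σ : DForm m k M} (h : SmoothFormOn U σ) {F : N → M} {W : Set N} (hW : IsOpen W)
    (hF : ContMDiffOn 𝓘(ℝ, N) (𝓡 m) ∞ F W) (hWU : Set.MapsTo F W U) :
    ContDiffOn ℝ ∞ (pb F σ) W := by
  intro y hy
  refine ContDiffAt.contDiffWithinAt ?_
  have hs := mem_chart_source (E m) (F y)
  refine ContDiffAt.congr_of_eventuallyEq ?_ (eventually_pb_eq_chartRep σ hW hF hy hs)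
  have h1 := contDiffAt_chart_comp (hF.contMDiffAt (hW.mem_nhds hy)) hs
  have h2 : ContDiffAt ℝ ∞ (chartRep (F y) σ) ((chartAt (E m) (F y) ∘ F) y) :=
    h.contDiffAt hU ((chartAt (E m) (F y)).map_source hs) (by simpa using hWU hy)
  have h3 : ContDiffAt ℝ ∞ (fderiv ℝ (chartAt (E m) (F y) ∘ F)) y :=
    h1.fderiv_right (by simp)
  exact ContDiffWithinAt.compContinuousLinearMap (s := Set.univ)
    (h2.comp y h1).contDiffWithinAt h3.contDiffWithinAt

/-- The chart at `F y` is the one in which `extd` is computed at `F y`, and between vector spaces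
`d` is known to commute with pullback. -/
lemma extDeriv_pb {k : ℕ} {U : Set M} (hU : IsOpen U) {σ : DForm m k M} (h : SmoothFormOn U σ)
    {F : N → M} {W : Set N} (hW : IsOpen W) (hF : ContMDiffOn 𝓘(ℝ, N) (𝓡 m) ∞ F W)
    (hWU : Set.MapsTo F W U) {y : N} (hy : y ∈ W) :
    extDeriv (pb F σ) y = pb F (extd σ) y := by
  have hs := mem_chart_source (E m) (F y)
  have hFy := hF.contMDiffAt (hW.mem_nhds hy)
  have h1 := contDiffAt_chart_comp hFy hs
  have h2 : ContDiffAt ℝ ∞ (chartRep (F y) σ) ((chartAt (E m) (F y) ∘ F) y) :=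
    h.contDiffAt hU ((chartAt (E m) (F y)).map_source hs) (by simpa using hWU hy)
  rw [(eventually_pb_eq_chartRep σ hW hF hy hs).extDeriv_eq,
    extDeriv_pullback (h2.differentiableAt (by simp)) h1 minSmoothness_two_le]
  have h3 : mfderiv 𝓘(ℝ, N) (𝓡 m) (chartAt (E m) (F y) ∘ F) y =
      (mfderiv (𝓡 m) (𝓡 m) (chartAt (E m) (F y)) (F y)).comp (mfderiv 𝓘(ℝ, N) (𝓡 m) F y) :=
    mfderiv_comp y ((contMDiffAt_chart hs).mdifferentiableAt (by simp))
      (hFy.mdifferentiableAt (by simp))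
  rw [mfderiv_eq_fderiv] at h3
  rw [h3]
  rfl

/-- The case of an inverse chart: `d` may be computed in any preferred chart, not only in the one at
the point. -/
lemma chartRep_extd {k : ℕ} {U : Set M} (hU : IsOpen U) {σ : DForm m k M} (h : SmoothFormOn U σ)
    {c : M} {y : E m} (hy : y ∈ (chartAt (E m) c).target)
    (hy' : (chartAt (E m) c).symm y ∈ U) :
    chartRep c (extd σ) y = extDeriv (chartRep c σ) y :=
  (extDeriv_pb hU h ((chartAt (E m) c).isOpen_inter_preimage_symm hU)
    (contMDiffOn_chart_symm.mono Set.inter_subset_left) (fun _ hz => hz.2) ⟨hy, hy'⟩).symm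

lemma contDiffAt_extDeriv {k : ℕ} {a : N → N [⋀^Fin k]→L[ℝ] ℝ} {y : N}
    (h : ContDiffAt ℝ ∞ a y) : ContDiffAt ℝ ∞ (extDeriv a) y := by
  have h1 : ContDiffAt ℝ ∞ (fderiv ℝ a) y := h.fderiv_right (by simp)
  have h2 : extDeriv a = fun z =>
    (ContinuousAlternatingMap.alternatizeUncurryFinCLM (n := k) ℝ N ℝ) (fderiv ℝ a z) := rfl
  rw [h2]
  exact (ContinuousAlternatingMap.alternatizeUncurryFinCLM ℝ N ℝ).contDiff.contDiffAt.comp y h1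

lemma SmoothFormOn.extd {k : ℕ} {U : Set M} (hU : IsOpen U) {σ : DForm m k M}
    (h : SmoothFormOn U σ) : SmoothFormOn U (extd σ) := by
  intro c y hy
  refine ContDiffAt.contDiffWithinAt ?_
  refine (contDiffAt_extDeriv (h.contDiffAt hU hy.1 hy.2)).congr_of_eventuallyEq ?_
  filter_upwards [((chartAt (E m) c).isOpen_inter_preimage_symm hU).mem_nhds hy] with z hz
  exact chartRep_extd hU h hz.1 hz.2

/-- The tangent space at `x` is identified with the model space by means of this very chart. -/
lemma mfderiv_chartAt_self (x : M) :
    (mfderiv (𝓡 m) (𝓡 m) (chartAt (E m) x) x : E m →L[ℝ] E m) = ContinuousLinearMap.id ℝ _ := by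
  have := mfderiv_extChartAt_self (I := 𝓡 m) (x := x)
  simp only [mfld_simps] at this
  exact this

lemma extd_eq {k : ℕ} (σ : DForm m k M) (x : M) :
    extd σ x = extDeriv (chartRep x σ) (chartAt (E m) x x) := by
  have : extd σ x = (extDeriv (chartRep x σ) (chartAt (E m) x x)).compContinuousLinearMap
    (mfderiv (𝓡 m) (𝓡 m) (chartAt (E m) x) x : E m →L[ℝ] E m) := rfl
  rw [this, mfderiv_chartAt_self]
  rfl

lemma chartRep_self {k : ℕ} (σ : DForm m k M) (x : M) :
    chartRep x σ (chartAt (E m) x x) = σ x := by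
  have h1 := pb_eq_chartRep (c := x) (F := (chartAt (E m) x).symm) σ
    (contMDiffAt_chart_symm (mem_chart_target (E m) x)) (by simp)
  have hx : (chartAt (E m) x).symm (chartAt (E m) x x) = x := by simp
  have h2 : (mfderiv (𝓡 m) (𝓡 m) (chartAt (E m) x).symm (chartAt (E m) x x) : E m →L[ℝ] E m) =
      ContinuousLinearMap.id ℝ _ := by
    have h3 := (mdifferentiable_chart (I := 𝓡 m) x).comp_symm_deriv (mem_chart_target (E m) x)
    have h4 : (mfderiv (𝓡 m) (𝓡 m) (chartAt (E m) x)
      ((chartAt (E m) x).symm (chartAt (E m) x x)) : E m →L[ℝ] E m) =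
        ContinuousLinearMap.id ℝ _ := by rw [hx]; exact mfderiv_chartAt_self x
    have h5 : ((mfderiv (𝓡 m) (𝓡 m) (chartAt (E m) x)
      ((chartAt (E m) x).symm (chartAt (E m) x x)) : E m →L[ℝ] E m)).comp
      (mfderiv (𝓡 m) (𝓡 m) (chartAt (E m) x).symm (chartAt (E m) x x) : E m →L[ℝ] E m) =
        ContinuousLinearMap.id ℝ _ := h3
    rw [h4] at h5
    exact h5
  have h6 : chartRep x σ (chartAt (E m) x x) =
    (show E m [⋀^Fin k]→L[ℝ] ℝ from
      σ ((chartAt (E m) x).symm (chartAt (E m) x x))).compContinuousLinearMap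
      (mfderiv (𝓡 m) (𝓡 m) (chartAt (E m) x).symm (chartAt (E m) x x) : E m →L[ℝ] E m) := rfl
  rw [h6, h2, hx]
  rfl

lemma extd_congr {k : ℕ} {σ τ : DForm m k M} {U : Set M} (hU : IsOpen U)
    (h : ∀ x ∈ U, σ x = τ x) {x : M} (hx : x ∈ U) : extd σ x = extd τ x := by
  rw [extd_eq, extd_eq]
  refine Filter.EventuallyEq.extDeriv_eq ?_
  filter_upwards [((chartAt (E m) x).isOpen_inter_preimage_symm hU).mem_nhds
    ⟨mem_chart_target (E m) x, by simpa using hx⟩] with z hz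
  have : (σ ((chartAt (E m) x).symm z) : E m [⋀^Fin k]→L[ℝ] ℝ) =
    τ ((chartAt (E m) x).symm z) := h _ hz.2
  exact congrArg (fun f : E m [⋀^Fin k]→L[ℝ] ℝ => f.compContinuousLinearMap
    (mfderiv (𝓡 m) (𝓡 m) (chartAt (E m) x).symm z : E m →L[ℝ] E m)) this

lemma extd_extd {k : ℕ} {U : Set M} (hU : IsOpen U) {σ : DForm m k M} (h : SmoothFormOn U σ)
    {x : M} (hx : x ∈ U) : extd (extd σ) x = 0 := by
  rw [extd_eq]
  have hm : chartAt (E m) x x ∈ (chartAt (E m) x).target ∩ (chartAt (E m) x).symm ⁻¹' U :=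
    ⟨mem_chart_target (E m) x, by simpa using hx⟩
  have : chartRep x (extd σ) =ᶠ[𝓝 (chartAt (E m) x x)] extDeriv (chartRep x σ) := by
    filter_upwards [((chartAt (E m) x).isOpen_inter_preimage_symm hU).mem_nhds hm] with z hz
    exact chartRep_extd hU h hz.1 hz.2
  rw [this.extDeriv_eq]
  exact extDeriv_extDeriv_apply (h.contDiffAt hU hm.1 hm.2) minSmoothness_two_le

lemma SmoothFormOn.congr {k : ℕ} {U : Set M} {σ τ : DForm m k M} (h : SmoothFormOn U σ)
    (hst : ∀ x ∈ U, τ x = σ x) : SmoothFormOn U τ := fun c =>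
  (h c).congr fun z hz =>
    congrArg (fun f : E m [⋀^Fin k]→L[ℝ] ℝ => f.compContinuousLinearMap
    (mfderiv (𝓡 m) (𝓡 m) (chartAt (E m) c).symm z : E m →L[ℝ] E m)) (hst _ hz.2)

/-- It suffices to check smoothness of a form near every point. -/
lemma SmoothFormOn.of_locally {k : ℕ} {U : Set M} {σ : DForm m k M}
    (h : ∀ x ∈ U, ∃ V, IsOpen V ∧ x ∈ V ∧ SmoothFormOn V σ) : SmoothFormOn U σ := by
  intro c y hy
  obtain ⟨V, hV, hyV, hσ⟩ := h _ hy.2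
  exact (hσ.contDiffAt hV hy.1 hyV).contDiffWithinAt

end PullbackToVectorSpace

section PullbackOfForms

variable {m : ℕ} {M : Type*} [TopologicalSpace M] [ChartedSpace (E m) M] [IsManifold (𝓡 m) ∞ M]
  {N : Type*} [NormedAddCommGroup N] [NormedSpace ℝ N]

lemma pb_pullback {k : ℕ} {f : M → M} {F : N → M} {σ : DForm m k M} {y : N}
    (hf : MDifferentiableAt (𝓡 m) (𝓡 m) f (F y)) (hF : MDifferentiableAt 𝓘(ℝ, N) (𝓡 m) F y) :
    pb F (pullback f σ) y = pb (f ∘ F) σ y := by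
  have h : mfderiv 𝓘(ℝ, N) (𝓡 m) (f ∘ F) y =
      (mfderiv (𝓡 m) (𝓡 m) f (F y)).comp (mfderiv 𝓘(ℝ, N) (𝓡 m) F y) := mfderiv_comp y hf hF
  rw [pb, pb, h]
  rfl

lemma extd_pullback {k : ℕ} {U V : Set M} (hU : IsOpen U) (hV : IsOpen V) {f : M → M}
    (hf : ContMDiffOn (𝓡 m) (𝓡 m) ∞ f V) (hVU : Set.MapsTo f V U) {σ : DForm m k M}
    (h : SmoothFormOn U σ) {x : M} (hx : x ∈ V) :
    extd (TwistedDH.pullback f σ) x = TwistedDH.pullback f (extd σ) x := by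
  have ho := (chartAt (E m) x).isOpen_inter_preimage_symm hV
  have hm : chartAt (E m) x x ∈ (chartAt (E m) x).target ∩ (chartAt (E m) x).symm ⁻¹' V :=
    ⟨mem_chart_target (E m) x, by simpa using hx⟩
  have h1 : ∀ (l : ℕ) (τ : DForm m l M), Set.EqOn (chartRep x (TwistedDH.pullback f τ))
      (pb (f ∘ (chartAt (E m) x).symm) τ)
      ((chartAt (E m) x).target ∩ (chartAt (E m) x).symm ⁻¹' V) := fun l τ z hz =>
    pb_pullback ((hf.contMDiffAt (hV.mem_nhds hz.2)).mdifferentiableAt (by simp))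
      ((contMDiffAt_chart_symm hz.1).mdifferentiableAt (by simp))
  rw [extd_eq, ← chartRep_self (TwistedDH.pullback f (extd σ)) x, h1 _ _ hm,
    ((h1 _ σ).eventuallyEq_of_mem (ho.mem_nhds hm)).extDeriv_eq]
  exact extDeriv_pb hU h ho (hf.comp (contMDiffOn_chart_symm.mono Set.inter_subset_left)
    fun z hz => hz.2) (fun z hz => hVU hz.2) hm

end PullbackOfForms

end TwistedDH
end

open scoped Manifold ContDiff Topology
noncomputable section
namespace TwistedDH

/-! ### Integrals depending smoothly on parameters. -/

section ParametricIntegral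

open MeasureTheory

variable {X : Type*} [TopologicalSpace X] [T2Space X] {H : Type} [NormedAddCommGroup H]
  [NormedSpace ℝ H] [ChartedSpace H X] [IsManifold 𝓘(ℝ, H) ∞ X]
  {N : Type} [NormedAddCommGroup N] [NormedSpace ℝ N]
  {F : Type} [NormedAddCommGroup F] [NormedSpace ℝ F]

/-- Joint smoothness on `X × V` of a family of functions on the open set `V`. -/
abbrev SmoothFamily (V : Set N) (f : X → N → F) : Prop :=
  ContMDiffOn (𝓘(ℝ, H).prod 𝓘(ℝ, N)) 𝓘(ℝ, F) ∞ (fun q : X × N => f q.1 q.2) (Set.univ ×ˢ V)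

omit [T2Space X] [IsManifold 𝓘(ℝ, H) ∞ X] in
lemma SmoothFamily.contMDiffAt {V : Set N} (hV : IsOpen V) {f : X → N → F}
    (hf : SmoothFamily (H := H) V f) (x : X) {y : N} (hy : y ∈ V) :
    ContMDiffAt (𝓘(ℝ, H).prod 𝓘(ℝ, N)) 𝓘(ℝ, F) ∞ (fun q : X × N => f q.1 q.2) (x, y) :=
  ContMDiffOn.contMDiffAt hf ((isOpen_univ.prod hV).mem_nhds ⟨Set.mem_univ _, hy⟩)

omit [T2Space X] [IsManifold 𝓘(ℝ, H) ∞ X] in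
lemma SmoothFamily.contDiffAt {V : Set N} (hV : IsOpen V) {f : X → N → F}
    (hf : SmoothFamily (H := H) V f) (x : X) {y : N} (hy : y ∈ V) :
    ContDiffAt ℝ ∞ (f x) y :=
  ((hf.contMDiffAt hV x hy).comp y (contMDiffAt_const.prodMk contMDiffAt_id)).contDiffAt

omit [T2Space X] in
lemma contMDiffAt_fderiv_family {f : X → N → F} {x : X} {y : N}
    (hf : ContMDiffAt (𝓘(ℝ, H).prod 𝓘(ℝ, N)) 𝓘(ℝ, F) ∞ (fun q : X × N => f q.1 q.2) (x, y)) :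
    ContMDiffAt (𝓘(ℝ, H).prod 𝓘(ℝ, N)) 𝓘(ℝ, N →L[ℝ] F) ∞
      (fun q : X × N => fderiv ℝ (f q.1) q.2) (x, y) := by
  have h1 : ContMDiffAt ((𝓘(ℝ, H).prod 𝓘(ℝ, N)).prod 𝓘(ℝ, N)) 𝓘(ℝ, F) ∞
      (Function.uncurry fun (q : X × N) (z : N) => f q.1 z) ((x, y), y) :=
    ContMDiffAt.comp (f := fun q : (X × N) × N => (q.1.1, q.2))
      (g := fun q : X × N => f q.1 q.2) ((x, y), y) hf
      ((contMDiff_fst.comp contMDiff_fst).prodMk contMDiff_snd).contMDiffAt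
  have h2 := ContMDiffAt.mfderiv (x₀ := (x, y)) (fun (q : X × N) (z : N) => f q.1 z)
    (fun q => q.2) h1 contMDiffAt_snd (m := ∞) (by simp)
  simp only [mfderiv_eq_fderiv] at h2
  exact h2.congr_of_eventuallyEq (Filter.Eventually.of_forall fun q => by
    rw [inTangentCoordinates_model_space])

omit [T2Space X] in
lemma SmoothFamily.fderiv {V : Set N} (hV : IsOpen V) {f : X → N → F}
    (hf : SmoothFamily (H := H) V f) :
    SmoothFamily (H := H) V fun x y => fderiv ℝ (f x) y := fun q hq =>
  (contMDiffAt_fderiv_family (hf.contMDiffAt hV q.1 hq.2)).contMDiffWithinAt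

variable [MeasurableSpace X] [BorelSpace X] {ν : Measure X} [IsFiniteMeasureOnCompacts ν]
  {K : Set X}

omit [IsManifold 𝓘(ℝ, H) ∞ X] in
lemma SmoothFamily.integrableOn (hK : IsCompact K) {V : Set N}
    {f : X → N → F} (hf : SmoothFamily (H := H) V f) {y : N} (hy : y ∈ V) :
    IntegrableOn (fun x => f x y) K ν := by
  refine ContinuousOn.integrableOn_compact hK ?_
  have : ContinuousOn (fun x : X => (x, y)) K := by fun_prop
  exact hf.continuousOn.comp this fun x _ => ⟨Set.mem_univ _, hy⟩

/-- Differentiation under the integral sign: the derivative is continuous on the product of `K` with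
a closed ball, which is compact, so a constant dominates it. -/
lemma SmoothFamily.hasFDerivAt_integral [FiniteDimensional ℝ N] (hK : IsCompact K) {V : Set N}
    (hV : IsOpen V) {f : X → N → F} (hf : SmoothFamily (H := H) V f) {y : N} (hy : y ∈ V) :
    HasFDerivAt (fun z => ∫ x in K, f x z ∂ν) (∫ x in K, _root_.fderiv ℝ (f x) y ∂ν) y := by
  have hf' := hf.fderiv hV
  obtain ⟨ε, hε, hb⟩ := Metric.nhds_basis_closedBall.mem_iff.mp (hV.mem_nhds hy)
  have hc : ContinuousOn (fun q : X × N => _root_.fderiv ℝ (f q.1) q.2)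
      (K ×ˢ Metric.closedBall y ε) :=
    hf'.continuousOn.mono (Set.prod_mono (Set.subset_univ _) hb)
  obtain ⟨C, hC⟩ := (hK.prod (isCompact_closedBall y ε)).exists_bound_of_continuousOn hc
  refine hasFDerivAt_integral_of_dominated_of_fderiv_le (𝕜 := ℝ) (bound := fun _ => C)
    (F' := fun z x => _root_.fderiv ℝ (f x) z) (Metric.closedBall_mem_nhds y hε)
    ?_ (hf.integrableOn hK hy) (hf'.integrableOn hK hy).1 ?_ ?_ ?_
  · filter_upwards [hV.mem_nhds hy] with z hz using (hf.integrableOn hK hz).1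
  · exact (ae_restrict_iff' hK.measurableSet).mpr
      (Filter.Eventually.of_forall fun x hx z hz => hC (x, z) ⟨hx, hz⟩)
  · exact integrableOn_const hK.measure_ne_top
  · exact Filter.Eventually.of_forall fun x z hz =>
      ((hf.contDiffAt hV x (hb hz)).differentiableAt (by simp)).hasFDerivAt

lemma SmoothFamily.contDiffOn_integral [FiniteDimensional ℝ N] (hK : IsCompact K) {V : Set N}
    (hV : IsOpen V) {f : X → N → F} (hf : SmoothFamily (H := H) V f) :
    ContDiffOn ℝ ∞ (fun z => ∫ x in K, f x z ∂ν) V := by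
  refine contDiffOn_infty.mpr fun n => ?_
  -- The derivative is an integral of the same kind with values in `N →L[ℝ] F`, so the target has to
  -- vary in the induction.
  induction n generalizing F with
  | zero =>
    exact contDiffOn_zero.mpr fun y hy =>
      (hf.hasFDerivAt_integral hK hV hy).continuousAt.continuousWithinAt
  | succ n ih =>
    rw [Nat.cast_succ]
    refine (contDiffOn_succ_iff_fderiv_of_isOpen hV).mpr ⟨fun y hy =>
      (hf.hasFDerivAt_integral hK hV hy).differentiableAt.differentiableWithinAt, fun h => absurd h (by simp), ?_⟩
    exact (ih (hf.fderiv hV)).congr fun y hy => (hf.hasFDerivAt_integral hK hV hy).fderiv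

end ParametricIntegral

section FamiliesOfMaps

variable {m : ℕ} {M : Type*} [TopologicalSpace M] [ChartedSpace (E m) M] [IsManifold (𝓡 m) ∞ M]
  {X : Type*} [TopologicalSpace X] {H : Type} [NormedAddCommGroup H]
  [NormedSpace ℝ H] [ChartedSpace H X] [IsManifold 𝓘(ℝ, H) ∞ X]
  {N : Type} [NormedAddCommGroup N] [NormedSpace ℝ N] [FiniteDimensional ℝ N]

/-- Smooth families of maps `N → M` pull smooth forms back to smooth families of forms. -/
lemma contMDiffAt_pb_family {k : ℕ} {U : Set M} (hU : IsOpen U) {σ : DForm m k M}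
    (h : SmoothFormOn U σ) {f : X → N → M} {S : Set (X × N)} (hS : IsOpen S)
    (hf : ContMDiffOn (𝓘(ℝ, H).prod 𝓘(ℝ, N)) (𝓡 m) ∞ (fun q : X × N => f q.1 q.2) S)
    {x : X} {y : N} (hxy : (x, y) ∈ S) (hxU : f x y ∈ U) :
    ContMDiffAt (𝓘(ℝ, H).prod 𝓘(ℝ, N)) 𝓘(ℝ, N [⋀^Fin k]→L[ℝ] ℝ) ∞
      (fun q : X × N => pb (f q.1) σ q.2) (x, y) := by
  have hfa : ∀ q ∈ S, ContMDiffAt (𝓘(ℝ, H).prod 𝓘(ℝ, N)) (𝓡 m) ∞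
      (fun q : X × N => f q.1 q.2) q := fun q hq => hf.contMDiffAt (hS.mem_nhds hq)
  have hs := mem_chart_source (E m) (f x y)
  set e := chartAt (E m) (f x y) with he
  have hev : (fun q : X × N => pb (f q.1) σ q.2) =ᶠ[𝓝 (x, y)] fun q =>
      (chartRep (f x y) σ ((e ∘ f q.1) q.2)).compContinuousLinearMap
        (fderiv ℝ (e ∘ f q.1) q.2) := by
    have hc : ContinuousAt (fun q : X × N => f q.1 q.2) (x, y) := (hfa _ hxy).continuousAt
    filter_upwards [hS.mem_nhds hxy, hc.preimage_mem_nhds (e.open_source.mem_nhds hs)] with q hq hq'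
    refine pb_eq_chartRep (F := f q.1) (y := q.2) σ ?_ hq'
    exact (hfa q hq).comp q.2 (f := fun z : N => (q.1, z)) (contMDiffAt_const.prodMk contMDiffAt_id)
  refine ContMDiffAt.congr_of_eventuallyEq ?_ hev
  have h1 : ContMDiffAt (𝓘(ℝ, H).prod 𝓘(ℝ, N)) 𝓘(ℝ, E m) ∞
      (fun q : X × N => (e ∘ f q.1) q.2) (x, y) :=
    (contMDiffAt_chart (c := f x y) hs).comp (x, y) (hfa _ hxy)
  have h2 : ContDiffAt ℝ ∞ (chartRep (f x y) σ) (e (f x y)) :=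
    h.contDiffAt hU (e.map_source hs) (by simpa [he] using hxU)
  have h3 := contMDiffAt_fderiv_family (f := fun x => e ∘ f x) h1
  have h4 : ContDiffAt ℝ ∞ (fun p : E m × (N →L[ℝ] E m) =>
      (chartRep (f x y) σ p.1).compContinuousLinearMap p.2)
      (e (f x y), fderiv ℝ (e ∘ f x) y) :=
    ContDiffWithinAt.compContinuousLinearMap (s := Set.univ)
      (ContDiffAt.comp (f := Prod.fst) (e (f x y), fderiv ℝ (e ∘ f x) y) h2
        contDiffAt_fst).contDiffWithinAt contDiffAt_snd.contDiffWithinAt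
  exact ContMDiffAt.comp (f := fun q : X × N => ((e ∘ f q.1) q.2, fderiv ℝ (e ∘ f q.1) q.2))
    (x, y) h4.contMDiffAt (h1.prodMk_space h3)

end FamiliesOfMaps

end TwistedDH
end

open scoped Manifold ContDiff Topology
noncomputable section
namespace TwistedDH

/-! ### Stokes' theorem for compactly supported forms on a vector space. -/

section LocalIntegral

open MeasureTheory

lemma integral_fderiv_eq_zero {N : Type*} [NormedAddCommGroup N] [NormedSpace ℝ N]
    [FiniteDimensional ℝ N] [MeasurableSpace N] [BorelSpace N] {ν : Measure N}
    [ν.IsAddHaarMeasure] {f : N → ℝ} (hf : ContDiff ℝ 1 f) (hc : HasCompactSupport f) (w : N) :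
    ∫ y, fderiv ℝ f y w ∂ν = 0 := by
  have h1 : Continuous fun y => fderiv ℝ f y w :=
    (hf.continuous_fderiv (by simp)).clm_apply continuous_const
  have h2 : HasCompactSupport fun y => fderiv ℝ f y w := hc.fderiv_apply ℝ w
  -- Integration by parts against the constant function `1`, whose derivative is zero.
  have := integral_mul_fderiv_eq_neg_fderiv_mul_of_integrable (μ := ν) (f := fun _ => (1 : ℝ))
    (g := f) (v := w) (by simp) (by simpa using h1.integrable_of_hasCompactSupport h2)
    (by simpa using hf.continuous.integrable_of_hasCompactSupport hc)
    (fun x _ => differentiableAt_const _) (fun x _ => (hf.differentiable (by simp)) x)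
  simpa using this

/-- The value of a form of top degree on the standard frame. -/
def topValue (n : ℕ) : (E n [⋀^Fin n]→L[ℝ] ℝ) →ₗ[ℝ] ℝ where
  toFun a := a fun i => EuclideanSpace.single i 1
  map_add' _ _ := rfl
  map_smul' _ _ := rfl

/-- On the standard frame the differential is a sum of partial derivatives of compactly supported
functions, each of integral zero. -/
lemma integral_topValue_extDeriv {k : ℕ} {a : E (k + 1) → E (k + 1) [⋀^Fin k]→L[ℝ] ℝ}
    (ha : ContDiff ℝ 1 a) (hc : HasCompactSupport a) :
    ∫ y, topValue (k + 1) (extDeriv a y) = 0 := by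
  let T : Fin (k + 1) → (E (k + 1) [⋀^Fin k]→L[ℝ] ℝ) →L[ℝ] ℝ := fun j =>
    (topValue (k + 1)).toContinuousLinearMap.comp (extMulCL k (coordCov j))
  have h1 : ∀ y, topValue (k + 1) (extDeriv a y) =
      ∑ j, fderiv ℝ (fun z => T j (a z)) y (coordVec j) := by
    intro y
    rw [extDeriv_eq_sum, map_sum]
    refine Finset.sum_congr rfl fun j _ => ?_
    have := ((T j).hasFDerivAt.comp y (ha.differentiable (by simp) y).hasFDerivAt).fderiv
    exact (congrArg (fun f => f (coordVec j)) this).symm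
  have h2 : ∀ j, ContDiff ℝ 1 (fun z => T j (a z)) := fun j => (T j).contDiff.comp ha
  have h3 : ∀ j, HasCompactSupport (fun z => T j (a z)) := fun j =>
    hc.comp_left (map_zero (T j))
  simp only [h1]
  rw [integral_finsetSum _ fun j _ => ?_]
  · exact Finset.sum_eq_zero fun j _ => integral_fderiv_eq_zero (h2 j) (h3 j) _
  · exact (((h2 j).continuous_fderiv (by simp)).clm_apply
      continuous_const).integrable_of_hasCompactSupport ((h3 j).fderiv_apply ℝ _)

lemma topValue_eq_basis {n : ℕ} (a : E n [⋀^Fin n]→L[ℝ] ℝ) :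
    topValue n a = a.toAlternatingMap (EuclideanSpace.basisFun (Fin n) ℝ).toBasis := by
  refine congrArg (fun u => a u) (funext fun i => ?_)
  simp

lemma topValue_eq_zero_iff {n : ℕ} (a : E n [⋀^Fin n]→L[ℝ] ℝ) : topValue n a = 0 ↔ a = 0 := by
  rw [topValue_eq_basis, AlternatingMap.map_basis_eq_zero_iff]
  constructor
  · intro h; ext u; exact congrArg (fun f : E n [⋀^Fin n]→ₗ[ℝ] ℝ => f u) h
  · rintro rfl; rfl

lemma topValue_comp {n : ℕ} (a : E n [⋀^Fin n]→L[ℝ] ℝ) (f : E n →L[ℝ] E n) :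
    topValue n (a.compContinuousLinearMap f) = f.det * topValue n a := by
  set e := (EuclideanSpace.basisFun (Fin n) ℝ).toBasis with he
  have h1 := a.toAlternatingMap.eq_smul_basis_det e
  have h2 : topValue n (a.compContinuousLinearMap f) = a.toAlternatingMap (f ∘ e) := by
    rw [topValue_eq_basis]; rfl
  rw [h2, h1, topValue_eq_basis, ← he]
  have h3 := Module.Basis.det_comp e (f : E n →ₗ[ℝ] E n) e
  rw [Module.Basis.det_self, mul_one] at h3
  have h4 : e.det (⇑f ∘ ⇑e) = f.det := h3
  simp [h4, mul_comm]

end LocalIntegral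

end TwistedDH
end

open scoped Manifold ContDiff Topology
noncomputable section
namespace TwistedDH

/-! ### Integration in charts: change of variables, orientation and Stokes. -/

section FunctionTimesForm

variable {m : ℕ} {M : Type*} [TopologicalSpace M] [ChartedSpace (E m) M]

/-- The product of a function and a form. -/
def smulForm {k : ℕ} (f : M → ℝ) (τ : DForm m k M) : DForm m k M := fun x => f x • τ x

lemma chartRep_congr_apply {k : ℕ} {σ τ : DForm m k M} {c : M} {y : E m}
    (h : σ ((chartAt (E m) c).symm y) = τ ((chartAt (E m) c).symm y)) :
    chartRep c σ y = chartRep c τ y :=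
  congrArg (fun f : E m [⋀^Fin k]→L[ℝ] ℝ => f.compContinuousLinearMap
    (mfderiv (𝓡 m) (𝓡 m) (chartAt (E m) c).symm y : E m →L[ℝ] E m)) h

lemma chartRep_eq_zero {k : ℕ} {σ : DForm m k M} {c : M} {y : E m}
    (h : σ ((chartAt (E m) c).symm y) = 0) : chartRep c σ y = 0 :=
  chartRep_congr_apply (τ := 0) h

variable [IsManifold (𝓡 m) ∞ M]

lemma SmoothFormOn.smulForm {k : ℕ} {U : Set M} {f : M → ℝ} {τ : DForm m k M}
    (hf : ContMDiffOn (𝓡 m) 𝓘(ℝ, ℝ) ∞ f U) (hτ : SmoothFormOn U τ) :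
    SmoothFormOn U (smulForm f τ) := by
  intro c
  have h1 : ContDiffOn ℝ ∞ (f ∘ (chartAt (E m) c).symm)
      ((chartAt (E m) c).target ∩ (chartAt (E m) c).symm ⁻¹' U) :=
    (hf.comp (contMDiffOn_chart_symm.mono Set.inter_subset_left) fun z hz => hz.2).contDiffOn
  exact h1.smul (hτ c)

lemma chartRep_ne_zero {k : ℕ} {σ : DForm m k M} {c : M} {y : E m}
    (hy : y ∈ (chartAt (E m) c).target) (h : σ ((chartAt (E m) c).symm y) ≠ 0) :
    chartRep c σ y ≠ 0 := by
  intro h0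
  refine h ?_
  set x := (chartAt (E m) c).symm y with hx
  have hxs : x ∈ (chartAt (E m) c).source := (chartAt (E m) c).map_target hy
  have h1 := pb_eq_chartRep (c := c) (F := (chartAt (E m) x).symm) σ
    (contMDiffAt_chart_symm (mem_chart_target (E m) x)) (by simpa using hxs)
  have h2 : chartAt (E m) c ((chartAt (E m) x).symm (chartAt (E m) x x)) = y := by
    rw [(chartAt (E m) x).left_inv (mem_chart_source (E m) x), hx,
      (chartAt (E m) c).right_inv hy]
  rw [h2, h0, ← chartRep_eq_pb, chartRep_self] at h1
  exact h1

end FunctionTimesForm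

section ManifoldIntegral

open MeasureTheory

variable {m : ℕ} {M : Type*} [TopologicalSpace M] [ChartedSpace (E m) M] [IsManifold (𝓡 m) ∞ M]

/-- The sign of the orientation in the preferred chart at `c`. -/
def orientSign (μ : DForm m m M) (c : M) (y : E m) : ℝ := Real.sign (topValue m (chartRep c μ y))

/-- The integral in the preferred chart at `c`. -/
def chartIntegral (μ : DForm m m M) (c : M) (τ : DForm m m M) : ℝ :=
  ∫ y in (chartAt (E m) c).target, orientSign μ c y * topValue m (chartRep c τ y)

/-- Both the orientation form and the integrand are multiplied by the determinant of the transition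
map; together with the sign this yields the absolute value in the change of variables formula. -/
lemma sign_mul_mul (d x b : ℝ) :
    Real.sign (d * x) * (d * b) = |d| * (Real.sign x * b) := by
  have h : Real.sign (d * x) * d = |d| * Real.sign x := by
    rcases lt_trichotomy d 0 with hd | rfl | hd
    · rcases lt_trichotomy x 0 with hx | rfl | hx
      · rw [Real.sign_of_pos (mul_pos_of_neg_of_neg hd hx), Real.sign_of_neg hx, abs_of_neg hd]
        ring
      · simp
      · rw [Real.sign_of_neg (mul_neg_of_neg_of_pos hd hx), Real.sign_of_pos hx, abs_of_neg hd]
        ring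
    · simp
    · rcases lt_trichotomy x 0 with hx | rfl | hx
      · rw [Real.sign_of_neg (mul_neg_of_pos_of_neg hd hx), Real.sign_of_neg hx, abs_of_pos hd]
        ring
      · simp
      · rw [Real.sign_of_pos (mul_pos hd hx), Real.sign_of_pos hx, abs_of_pos hd]
        ring
  rw [← mul_assoc, h, mul_assoc]

/-- The change of variables formula for the transition between charts. -/
lemma chartIntegral_eq_chartIntegral (μ : DForm m m M) {c c' : M} {τ : DForm m m M}
    (h : ∀ x, x ∉ (chartAt (E m) c).source ∩ (chartAt (E m) c').source → τ x = 0) :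
    chartIntegral μ c τ = chartIntegral μ c' τ := by
  set e := chartAt (E m) c with he
  set e' := chartAt (E m) c' with he'
  have hz : ∀ (d : M) (y : E m), τ ((chartAt (E m) d).symm y) = 0 →
      orientSign μ d y * topValue m (chartRep d τ y) = 0 := by
    intro d y hy
    rw [chartRep_eq_zero hy, map_zero, mul_zero]
  have hS : IsOpen (e.target ∩ e.symm ⁻¹' e'.source) :=
    e.isOpen_inter_preimage_symm e'.open_source
  have hS' : IsOpen (e'.target ∩ e'.symm ⁻¹' e.source) :=
    e'.isOpen_inter_preimage_symm e.open_source
  have himg : (e' ∘ e.symm) '' (e.target ∩ e.symm ⁻¹' e'.source) =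
      e'.target ∩ e'.symm ⁻¹' e.source := by
    ext z
    constructor
    · rintro ⟨y, ⟨hy, hy'⟩, rfl⟩
      refine ⟨e'.map_source hy', ?_⟩
      simp only [Function.comp, Set.mem_preimage]
      rw [e'.left_inv hy']
      exact e.map_target hy
    · rintro ⟨hz, hz'⟩
      refine ⟨e (e'.symm z), ⟨e.map_source hz', ?_⟩, ?_⟩
      · simp only [Set.mem_preimage]
        rw [e.left_inv hz']
        exact e'.map_target hz
      · simp only [Function.comp]
        rw [e.left_inv hz', e'.right_inv hz]
  have hψ : ∀ y ∈ e.target ∩ e.symm ⁻¹' e'.source, ContDiffAt ℝ ∞ (e' ∘ e.symm) y := fun y hy =>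
    contDiffAt_chart_comp (contMDiffAt_chart_symm hy.1) hy.2
  have hinj : Set.InjOn (e' ∘ e.symm) (e.target ∩ e.symm ⁻¹' e'.source) := by
    intro y hy z hz hyz
    have := e'.injOn hy.2 hz.2 hyz
    exact e.symm.injOn hy.1 hz.1 this
  -- Change of variables for the transition map on the overlap. Outside the overlap the form
  -- vanishes, so both integrals may be restricted to it.
  have key := integral_image_eq_integral_abs_det_fderiv_smul volume hS.measurableSet
    (fun y hy => ((hψ y hy).differentiableAt (by simp)).hasFDerivAt.hasFDerivWithinAt) hinj
    (fun z => orientSign μ c' z * topValue m (chartRep c' τ z))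
  rw [himg] at key
  rw [chartIntegral, chartIntegral,
    setIntegral_eq_of_subset_of_forall_sdiff_eq_zero e.open_target.measurableSet
      (Set.inter_subset_left : e.target ∩ e.symm ⁻¹' e'.source ⊆ e.target)
      (fun y hy => hz c y (h _ fun h' => hy.2 ⟨hy.1, h'.2⟩)),
    setIntegral_eq_of_subset_of_forall_sdiff_eq_zero e'.open_target.measurableSet
      (Set.inter_subset_left : e'.target ∩ e'.symm ⁻¹' e.source ⊆ e'.target)
      (fun y hy => hz c' y (h _ fun h' => hy.2 ⟨hy.1, h'.1⟩)), key]
  refine setIntegral_congr_fun hS.measurableSet fun y hy => ?_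
  have hrep : ∀ β : DForm m m M, topValue m (chartRep c β y) =
      (fderiv ℝ (e' ∘ e.symm) y).det * topValue m (chartRep c' β ((e' ∘ e.symm) y)) := by
    intro β
    rw [← topValue_comp]
    exact congrArg _ (pb_eq_chartRep (c := c') (F := e.symm) β (contMDiffAt_chart_symm hy.1) hy.2)
  simp only [orientSign, hrep, smul_eq_mul]
  exact sign_mul_mul _ _ _

/-- The orientation form is continuous and does not vanish, so its value on the coordinate frame
keeps its sign locally. Thus the sign behaves as a constant under differentiation. -/
lemma eventually_orientSign_eq {μ : DForm m m M} (hμ : IsOrientationForm μ) {c : M} {y : E m}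
    (hy : y ∈ (chartAt (E m) c).target) : ∀ᶠ z in 𝓝 y, orientSign μ c z = orientSign μ c y := by
  have h1 : ContinuousAt (fun z => topValue m (chartRep c μ z)) y :=
    ((topValue m).toContinuousLinearMap.continuous.continuousAt).comp
      (hμ.1.contDiffAt isOpen_univ hy (Set.mem_univ _)).continuousAt
  have h2 : topValue m (chartRep c μ y) ≠ 0 := fun h =>
    chartRep_ne_zero hy (hμ.2 _) ((topValue_eq_zero_iff _).mp h)
  rcases lt_or_gt_of_ne h2 with h | h
  · filter_upwards [h1.eventually (gt_mem_nhds h)] with z hz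
    rw [orientSign, orientSign, Real.sign_of_neg hz, Real.sign_of_neg h]
  · filter_upwards [h1.eventually (lt_mem_nhds h)] with z hz
    rw [orientSign, orientSign, Real.sign_of_pos hz, Real.sign_of_pos h]

variable [T2Space M]

lemma isClosed_image_chart {c : M} {L : Set M} (hL : IsCompact L)
    (hLc : L ⊆ (chartAt (E m) c).source) : IsCompact (chartAt (E m) c '' L) :=
  hL.image_of_continuousOn ((chartAt (E m) c).continuousOn.mono hLc)

lemma symm_notMem {c : M} {L : Set M} {y : E m} (hy : y ∈ (chartAt (E m) c).target)
    (h : y ∉ chartAt (E m) c '' L) : (chartAt (E m) c).symm y ∉ L := fun h' =>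
  h ⟨_, h', (chartAt (E m) c).right_inv hy⟩

lemma integrableOn_chart {μ : DForm m m M} (hμ : IsOrientationForm μ) {c : M} {τ : DForm m m M}
    (hτ : SmoothFormOn Set.univ τ) {L : Set M} (hL : IsCompact L)
    (hLc : L ⊆ (chartAt (E m) c).source) (h0 : ∀ x, x ∉ L → τ x = 0) :
    IntegrableOn (fun y => orientSign μ c y * topValue m (chartRep c τ y))
      (chartAt (E m) c).target := by
  have hK := isClosed_image_chart hL hLc
  have hKt : chartAt (E m) c '' L ⊆ (chartAt (E m) c).target := by
    rintro _ ⟨x, hx, rfl⟩; exact (chartAt (E m) c).map_source (hLc hx)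
  have hc : ContinuousOn (fun y => orientSign μ c y * topValue m (chartRep c τ y))
      (chartAt (E m) c).target := by
    intro y hy
    refine ContinuousAt.continuousWithinAt (ContinuousAt.mul ?_ ?_)
    · exact (continuousAt_const (y := orientSign μ c y)).congr
        ((eventually_orientSign_eq hμ hy).mono fun _ h => h.symm)
    · exact ((topValue m).toContinuousLinearMap.continuous.continuousAt).comp
        (hτ.contDiffAt isOpen_univ hy (Set.mem_univ _)).continuousAt
  refine IntegrableOn.of_forall_sdiff_eq_zero
    ((hc.mono hKt).integrableOn_compact hK)
    (chartAt (E m) c).open_target.measurableSet fun y hy => ?_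
  rw [chartRep_eq_zero (h0 _ (symm_notMem hy.1 hy.2)), map_zero, mul_zero]

end ManifoldIntegral

section LocalStokes

open MeasureTheory

variable {k : ℕ} {M : Type*} [TopologicalSpace M] [ChartedSpace (E (k + 1)) M]
  [IsManifold (𝓡 (k + 1)) ∞ M] [T2Space M]

open Classical in
lemma chartIntegral_extd {μ : DForm (k + 1) (k + 1) M} (hμ : IsOrientationForm μ) {c : M}
    {α : DForm (k + 1) k M} (hα : SmoothFormOn Set.univ α) {L : Set M} (hL : IsCompact L)
    (hLc : L ⊆ (chartAt (E (k + 1)) c).source) (h0 : ∀ x, x ∉ L → α x = 0) :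
    chartIntegral μ c (extd α) = 0 := by
  set e := chartAt (E (k + 1)) c with he
  have hK := isClosed_image_chart hL hLc
  -- Extension by zero of the coordinate expression, with the locally constant sign included. It is
  -- smooth on the whole space because the support of `α` has compact image inside the chart.
  let a : E (k + 1) → E (k + 1) [⋀^Fin k]→L[ℝ] ℝ := fun y =>
    if y ∈ e.target then orientSign μ c y • chartRep c α y else 0
  have ha1 : ∀ y ∈ e.target, a =ᶠ[𝓝 y] orientSign μ c y • chartRep c α := by
    intro y hy
    filter_upwards [e.open_target.mem_nhds hy, eventually_orientSign_eq hμ hy] with z hz hz'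
    rw [Pi.smul_apply, ← hz']
    exact if_pos hz
  have ha0 : ∀ y, y ∉ e '' L → a y = 0 := by
    intro y hy
    by_cases h : y ∈ e.target
    · have : chartRep c α y = 0 := chartRep_eq_zero (h0 _ (symm_notMem h hy))
      simp only [a, this, smul_zero, ite_self]
    · exact if_neg h
  have ha2 : ∀ y, y ∉ e.target → a =ᶠ[𝓝 y] 0 := by
    intro y hy
    have : y ∉ e '' L := by
      rintro ⟨x, hx, rfl⟩
      exact hy (e.map_source (hLc hx))
    filter_upwards [hK.isClosed.isOpen_compl.mem_nhds this] with z hz using ha0 z hz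
  have hcα : ∀ y ∈ e.target, ContDiffAt ℝ ∞ (chartRep c α) y := fun y hy =>
    hα.contDiffAt isOpen_univ hy (Set.mem_univ _)
  have hsmooth : ContDiff ℝ 1 a := by
    refine contDiff_iff_contDiffAt.mpr fun y => ?_
    by_cases hy : y ∈ e.target
    · have h1 : ContDiffAt ℝ ∞ (orientSign μ c y • chartRep c α) y :=
        contDiffAt_const.smul (hcα y hy)
      exact (h1.congr_of_eventuallyEq (ha1 y hy)).of_le (by simp)
    · exact contDiffAt_const.congr_of_eventuallyEq (ha2 y hy)
  have hcomp : HasCompactSupport a := HasCompactSupport.intro hK ha0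
  have h3 : ∫ y in e.target, topValue (k + 1) (extDeriv a y) = 0 := by
    rw [setIntegral_eq_integral_of_forall_compl_eq_zero,
      integral_topValue_extDeriv hsmooth hcomp]
    intro y hy
    rw [(ha2 y hy).extDeriv_eq]
    have : extDeriv (0 : E (k + 1) → E (k + 1) [⋀^Fin k]→L[ℝ] ℝ) y = 0 := by
      simpa using extDeriv_smul (x := y) (0 : ℝ) (0 : E (k + 1) → E (k + 1) [⋀^Fin k]→L[ℝ] ℝ)
    rw [this, map_zero]
  rw [chartIntegral, ← h3]
  refine setIntegral_congr_fun e.open_target.measurableSet fun y hy => ?_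
  have h1 : chartRep c (extd α) y = extDeriv (chartRep c α) y :=
    chartRep_extd isOpen_univ hα hy (Set.mem_univ _)
  have h2 : extDeriv a y = orientSign μ c y • extDeriv (chartRep c α) y := by
    rw [(ha1 y hy).extDeriv_eq]
    exact extDeriv_smul _ _
  simp only [h1, h2, map_smul, smul_eq_mul]

end LocalStokes

end TwistedDH
end

open scoped Manifold ContDiff Topology
noncomputable section
namespace TwistedDH

/-! ### The integral over the manifold and Stokes' theorem. -/

section GlobalIntegral

open MeasureTheory

variable {m : ℕ} {M : Type*} [TopologicalSpace M] [ChartedSpace (E m) M] [IsManifold (𝓡 m) ∞ M]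
  [T2Space M] [SecondCountableTopology M]

open Classical in
-- Integrals over different open sets are compared by extending the forms by zero; no smoothness is
-- involved.
lemma integralOn_eq_of_forall {μ : DForm m m M} {U U' : Set M} {τ τ' : DForm m m M}
    (h : ∀ x, (if x ∈ U then τ x else 0) = if x ∈ U' then τ' x else 0) :
    integralOn μ U τ = integralOn μ U' τ' := by
  have : ∀ (x : M) (u : Fin m → TangentSpace (𝓡 m) x) (a b : ℝ),
      (if x ∈ U then a * (b * τ x u) else 0) = if x ∈ U' then a * (b * τ' x u) else 0 := by
    intro x u a b
    have hx := h x
    by_cases h1 : x ∈ U <;> by_cases h2 : x ∈ U' <;> simp only [h1, h2, if_true, if_false] at hx ⊢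
    · rw [hx]
    · rw [hx]; simp
    · rw [← hx]; simp
  simp only [integralOn, this]

lemma integralOn_univ (μ τ : DForm m m M) : integralOn μ Set.univ τ =
    ∑ᶠ c, chartIntegral μ c (smulForm (partUnity m M c) τ) := by
  refine finsum_congr fun c => ?_
  simp only [Set.mem_univ, if_true, chartIntegral]
  refine integral_congr_ae (Filter.Eventually.of_forall fun y => ?_)
  have h1 : topValue m (chartRep c (smulForm (partUnity m M c) τ) y) =
      partUnity m M c ((chartAt (E m) c).symm y) *
        τ ((chartAt (E m) c).symm y) (coordFrame c y) := rfl
  have h2 : orientSign μ c y = Real.sign (μ ((chartAt (E m) c).symm y) (coordFrame c y)) := rfl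
  simp only [h1, h2]
  ring

lemma finite_partUnity {L : Set M} (hL : IsCompact L) :
    {c | (Function.support (partUnity m M c) ∩ L).Nonempty}.Finite :=
  (partUnity m M).locallyFinite.finite_nonempty_inter_compact hL

lemma chartIntegral_zero (μ : DForm m m M) (c : M) {τ : DForm m m M} (h : ∀ x, τ x = 0) :
    chartIntegral μ c τ = 0 := by
  have : ∀ y, topValue m (chartRep c τ y) = 0 := fun y => by
    rw [chartRep_eq_zero (h _), map_zero]
  simp [chartIntegral, this]

/-- Local finiteness of the partition of unity leaves finitely many indices that meet the compact
set `L`, independently of the form. -/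
lemma integralOn_univ_eq_sum (μ : DForm m m M) {τ : DForm m m M} {L : Set M} (hL : IsCompact L)
    (h0 : ∀ x, x ∉ L → τ x = 0) : integralOn μ Set.univ τ =
      ∑ c ∈ (finite_partUnity (m := m) hL).toFinset,
        chartIntegral μ c (smulForm (partUnity m M c) τ) := by
  rw [integralOn_univ]
  refine finsum_eq_sum_of_support_subset _ fun c hc => ?_
  by_contra h
  refine hc (chartIntegral_zero μ c fun x => ?_)
  by_cases hx : x ∈ L
  · have : partUnity m M c x = 0 := by
      by_contra hne
      exact h (by simpa using ⟨x, hne, hx⟩)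
    rw [smulForm, this]
    exact zero_smul ℝ (τ x)
  · rw [smulForm, h0 x hx]
    exact smul_zero (A := E m [⋀^Fin m]→L[ℝ] ℝ) _

lemma partUnity_subordinate (c : M) :
    tsupport (partUnity m M c) ⊆ (chartAt (E m) c).source :=
  (exists_subordinate m M).choose_spec c

lemma contMDiff_partUnity (c : M) : ContMDiff (𝓡 m) 𝓘(ℝ, ℝ) ∞ (partUnity m M c) :=
  (partUnity m M c).contMDiff

lemma SmoothFormOn.smul_partUnity {k : ℕ} {U : Set M} {τ : DForm m k M} (hτ : SmoothFormOn U τ)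
    (c : M) : SmoothFormOn U (TwistedDH.smulForm (partUnity m M c) τ) :=
  SmoothFormOn.smulForm (contMDiff_partUnity c).contMDiffOn hτ

lemma smul_partUnity_eq_zero {k : ℕ} {τ : DForm m k M} {L : Set M}
    (h0 : ∀ x, x ∉ L → τ x = 0) (c : M) :
    ∀ x, x ∉ tsupport (partUnity m M c) ∩ L → smulForm (partUnity m M c) τ x = 0 := by
  intro x hx
  by_cases hxL : x ∈ L
  · have : partUnity m M c x = 0 := image_eq_zero_of_notMem_tsupport fun h => hx ⟨h, hxL⟩
    rw [smulForm, this]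
    exact zero_smul ℝ (τ x)
  · rw [smulForm, h0 x hxL]
    exact smul_zero (A := E m [⋀^Fin k]→L[ℝ] ℝ) _

lemma chartIntegral_sum {μ : DForm m m M} (hμ : IsOrientationForm μ) (c : M) {ι : Type*}
    (s : Finset ι) {τ : ι → DForm m m M} (hτ : ∀ i ∈ s, SmoothFormOn Set.univ (τ i))
    {L : ι → Set M} (hL : ∀ i ∈ s, IsCompact (L i))
    (hLc : ∀ i ∈ s, L i ⊆ (chartAt (E m) c).source) (h0 : ∀ i ∈ s, ∀ x, x ∉ L i → τ i x = 0) :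
    chartIntegral μ c (fun x => ∑ i ∈ s, τ i x) = ∑ i ∈ s, chartIntegral μ c (τ i) := by
  simp only [chartIntegral]
  rw [← integral_finsetSum s fun i hi =>
    integrableOn_chart hμ (hτ i hi) (hL i hi) (hLc i hi) (h0 i hi)]
  refine integral_congr_ae (Filter.Eventually.of_forall fun y => ?_)
  have : topValue m (chartRep c (fun x => ∑ i ∈ s, τ i x) y) =
      ∑ i ∈ s, topValue m (chartRep c (τ i) y) :=
    ContinuousAlternatingMap.sum_apply _ _
  simp only [this, Finset.mul_sum]

lemma integralOn_univ_sum {μ : DForm m m M} (hμ : IsOrientationForm μ) {ι : Type*}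
    (s : Finset ι) {τ : ι → DForm m m M} (hτ : ∀ i ∈ s, SmoothFormOn Set.univ (τ i))
    {L : Set M} (hL : IsCompact L) (h0 : ∀ i ∈ s, ∀ x, x ∉ L → τ i x = 0) :
    integralOn μ Set.univ (fun x => ∑ i ∈ s, τ i x) = ∑ i ∈ s, integralOn μ Set.univ (τ i) := by
  rw [integralOn_univ_eq_sum μ hL fun x hx => Finset.sum_eq_zero fun i hi => h0 i hi x hx,
    Finset.sum_congr rfl fun i hi => integralOn_univ_eq_sum μ hL (h0 i hi), Finset.sum_comm]
  refine Finset.sum_congr rfl fun c _ => ?_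
  have hLc : IsCompact (tsupport (partUnity m M c) ∩ L) := hL.inter_left (isClosed_tsupport _)
  rw [← chartIntegral_sum hμ c s (fun i hi => (hτ i hi).smul_partUnity c) (fun i hi => hLc)
    (fun i hi => Set.inter_subset_left.trans (partUnity_subordinate c))
    (fun i hi => smul_partUnity_eq_zero (h0 i hi) c)]
  congr 1
  funext x
  exact Finset.smul_sum (N := E m [⋀^Fin m]→L[ℝ] ℝ)

lemma sum_partUnity {L : Set M} (hL : IsCompact L) {x : M} (hx : x ∈ L) :
    ∑ c ∈ (finite_partUnity (m := m) hL).toFinset, partUnity m M c x = 1 := by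
  rw [← (partUnity m M).sum_eq_one (Set.mem_univ x)]
  refine (finsum_eq_sum_of_support_subset _ fun c hc => ?_).symm
  simpa using ⟨x, hc, hx⟩

lemma sum_smulForm_partUnity {k : ℕ} {τ : DForm m k M} {L : Set M} (hL : IsCompact L)
    (h0 : ∀ x, x ∉ L → τ x = 0) (x : M) :
    ∑ c ∈ (finite_partUnity (m := m) hL).toFinset, smulForm (partUnity m M c) τ x = τ x := by
  have h1 : ∑ c ∈ (finite_partUnity (m := m) hL).toFinset, smulForm (partUnity m M c) τ x =
      (∑ c ∈ (finite_partUnity (m := m) hL).toFinset, partUnity m M c x) • τ x :=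
    (Finset.sum_smul (M := E m [⋀^Fin k]→L[ℝ] ℝ)).symm
  rw [h1]
  by_cases hx : x ∈ L
  · rw [sum_partUnity hL hx]
    exact one_smul ℝ (τ x)
  · rw [h0 x hx]
    exact smul_zero (A := E m [⋀^Fin k]→L[ℝ] ℝ) _

/-- Each piece `ρ τ` is supported in the overlap of its own chart with the given one, so it can be
transferred there; the pieces then add up to `τ`. -/
lemma integralOn_univ_eq_chartIntegral {μ : DForm m m M} (hμ : IsOrientationForm μ) (c : M)
    {τ : DForm m m M} (hτ : SmoothFormOn Set.univ τ) {L : Set M} (hL : IsCompact L)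
    (hLc : L ⊆ (chartAt (E m) c).source) (h0 : ∀ x, x ∉ L → τ x = 0) :
    integralOn μ Set.univ τ = chartIntegral μ c τ := by
  rw [integralOn_univ_eq_sum μ hL h0]
  have h1 : ∀ c', chartIntegral μ c' (smulForm (partUnity m M c') τ) =
      chartIntegral μ c (smulForm (partUnity m M c') τ) := fun c' =>
    chartIntegral_eq_chartIntegral μ fun x hx => smul_partUnity_eq_zero h0 c' x fun h =>
      hx ⟨partUnity_subordinate c' h.1, hLc h.2⟩
  rw [Finset.sum_congr rfl fun c' _ => h1 c',
    ← chartIntegral_sum hμ c _ (fun c' _ => hτ.smul_partUnity c')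
      (fun c' _ => hL.inter_left (isClosed_tsupport (partUnity m M c')))
      (fun c' _ => Set.inter_subset_right.trans hLc)
      (fun c' _ => smul_partUnity_eq_zero h0 c')]
  congr 1
  funext x
  exact sum_smulForm_partUnity hL h0 x

end GlobalIntegral

section Stokes

variable {k : ℕ} {M : Type*} [TopologicalSpace M] [ChartedSpace (E (k + 1)) M]
  [IsManifold (𝓡 (k + 1)) ∞ M] [T2Space M] [SecondCountableTopology M]

lemma extd_sum {n j : ℕ} {M : Type*} [TopologicalSpace M] [ChartedSpace (E n) M] {ι : Type*}
    (s : Finset ι) {α : ι → DForm n j M} (h : ∀ i ∈ s, SmoothFormOn Set.univ (α i)) (x : M) :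
    extd (fun x => ∑ i ∈ s, α i x) x = ∑ i ∈ s, extd (α i) x := by
  classical
  induction s using Finset.induction_on with
  | empty =>
    simp only [Finset.sum_empty]
    exact extd_zero x
  | insert i s hi ih =>
    have h1 : ∀ t : Finset ι, (fun x => ∑ i ∈ t, α i x : DForm n j M) = ∑ i ∈ t, α i := fun t =>
      (Finset.sum_fn t α).symm
    have hs : SmoothFormOn Set.univ (∑ i ∈ s, α i) :=
      Finset.sum_induction _ (SmoothFormOn Set.univ) (fun _ _ h h' => h.add h')
        SmoothFormOn.zero fun i hi => h i (Finset.mem_insert_of_mem hi)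
    rw [h1, Finset.sum_insert hi, extd_add isOpen_univ (h i (Finset.mem_insert_self i s)) hs
      (Set.mem_univ x), Finset.sum_insert hi, ← ih fun i hi => h i (Finset.mem_insert_of_mem hi),
      h1]

lemma extd_eq_zero {n j : ℕ} {M : Type*} [TopologicalSpace M] [ChartedSpace (E n) M]
    {α : DForm n j M} {U : Set M} (hU : IsOpen U)
    (h : ∀ y ∈ U, α y = 0) {x : M} (hx : x ∈ U) [IsManifold (𝓡 n) ∞ M] : extd α x = 0 := by
  rw [extd_congr (τ := 0) hU h hx, extd_zero]

lemma integralOn_univ_extd {μ : DForm (k + 1) (k + 1) M} (hμ : IsOrientationForm μ)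
    {α : DForm (k + 1) k M} (hα : SmoothFormOn Set.univ α) {L : Set M} (hL : IsCompact L)
    (h0 : ∀ x, x ∉ L → α x = 0) : integralOn μ Set.univ (extd α) = 0 := by
  -- The partition of unity is applied to the primitive and not to its differential, so that every
  -- piece is exact with a primitive supported in a single chart.
  have h1 : extd α = fun x => ∑ c ∈ (finite_partUnity (m := k + 1) hL).toFinset,
      extd (smulForm (partUnity (k + 1) M c) α) x := by
    funext x
    rw [← extd_sum _ (fun c _ => hα.smul_partUnity c)]
    congr 1
    funext y
    exact (sum_smulForm_partUnity hL h0 y).symm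
  have h2 : ∀ c x, x ∉ tsupport (partUnity (k + 1) M c) ∩ L →
      extd (smulForm (partUnity (k + 1) M c) α) x = 0 := fun c x hx =>
    extd_eq_zero (hL.inter_left (isClosed_tsupport (partUnity (k + 1) M c))).isClosed.isOpen_compl
      (fun y hy => smul_partUnity_eq_zero h0 c y hy) hx
  rw [h1, integralOn_univ_sum hμ _ (fun c _ => (hα.smul_partUnity c).extd isOpen_univ) hL
    (fun c _ x hx => h2 c x fun h => hx h.2)]
  refine Finset.sum_eq_zero fun c _ => ?_
  have hLc := hL.inter_left (isClosed_tsupport (partUnity (k + 1) M c))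
  rw [integralOn_univ_eq_chartIntegral hμ c ((hα.smul_partUnity c).extd isOpen_univ) hLc
    (Set.inter_subset_left.trans (partUnity_subordinate c)) (h2 c)]
  exact chartIntegral_extd hμ (hα.smul_partUnity c) hLc
    (Set.inter_subset_left.trans (partUnity_subordinate c)) (smul_partUnity_eq_zero h0 c)

end Stokes

/-! ### Integrals over open subsets. -/

section IntegralOverOpenSets

variable {m : ℕ} {M : Type*} [TopologicalSpace M] [ChartedSpace (E m) M] [IsManifold (𝓡 m) ∞ M]
  [T2Space M]

open Classical in
/-- The restriction of a form to `L`, extended by zero. -/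
def cutOff {k : ℕ} (L : Set M) (τ : DForm m k M) : DForm m k M := fun x =>
  if x ∈ L then τ x else 0

omit [IsManifold (𝓡 m) ∞ M] [T2Space M] in
lemma cutOff_of_mem {k : ℕ} {L : Set M} (τ : DForm m k M) {x : M} (hx : x ∈ L) :
    cutOff L τ x = τ x := if_pos hx

omit [IsManifold (𝓡 m) ∞ M] [T2Space M] in
lemma cutOff_of_notMem {k : ℕ} {L : Set M} (τ : DForm m k M) {x : M} (hx : x ∉ L) :
    cutOff L τ x = 0 := if_neg hx

omit [IsManifold (𝓡 m) ∞ M] [T2Space M] in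
lemma cutOff_eq {k : ℕ} {U L : Set M} {τ : DForm m k M} (h0 : ∀ x ∈ U, x ∉ L → τ x = 0) {x : M}
    (hx : x ∈ U) : cutOff L τ x = τ x := by
  by_cases h : x ∈ L
  · exact cutOff_of_mem τ h
  · rw [cutOff_of_notMem τ h, h0 x hx h]

/-- The open sets `U` and the complement of `L` cover `M`; on the former the form is unchanged and
on the latter it is zero. -/
lemma SmoothFormOn.cutOff {k : ℕ} {U L : Set M} (hU : IsOpen U) (hL : IsCompact L) (hLU : L ⊆ U)
    {τ : DForm m k M} (hτ : SmoothFormOn U τ) (h0 : ∀ x ∈ U, x ∉ L → τ x = 0) :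
    SmoothFormOn Set.univ (cutOff L τ) := by
  refine SmoothFormOn.of_locally fun x _ => ?_
  by_cases hx : x ∈ U
  · exact ⟨U, hU, hx, hτ.congr fun y hy => cutOff_eq h0 hy⟩
  · exact ⟨Lᶜ, hL.isClosed.isOpen_compl, fun h => hx (hLU h),
      (SmoothFormOn.zero (k := k)).congr fun y hy => cutOff_of_notMem τ hy⟩

omit [T2Space M] in
lemma SmoothFormOn.extdM {U : Set M} (hU : IsOpen U) {α : MForm m M}
    (hα : ∀ k, SmoothFormOn U (α k)) (k : ℕ) : SmoothFormOn U (extdM α k) := by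
  cases k with
  | zero => exact SmoothFormOn.zero
  | succ k => exact (hα k).extd hU

variable [SecondCountableTopology M]

lemma integralOn_eq_cutOff (μ : DForm m m M) {U L : Set M} (hLU : L ⊆ U) {τ : DForm m m M}
    (h0 : ∀ x ∈ U, x ∉ L → τ x = 0) :
    integralOn μ U τ = integralOn μ Set.univ (cutOff L τ) := by
  refine integralOn_eq_of_forall fun x => ?_
  simp only [Set.mem_univ, if_true]
  by_cases hx : x ∈ U
  · rw [if_pos hx, cutOff_eq h0 hx]
  · rw [if_neg hx, cutOff_of_notMem τ fun h => hx (hLU h)]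

lemma integralOn_univ_extdM {μ : DForm m m M} (hμ : IsOrientationForm μ) {α : MForm m M}
    (hα : ∀ k, SmoothFormOn Set.univ (α k)) {L : Set M} (hL : IsCompact L)
    (h0 : ∀ k x, x ∉ L → α k x = 0) : integralOn μ Set.univ (extdM α m) = 0 := by
  cases m with
  -- In dimension zero there are no exact forms of top degree, as `extdM` is zero in degree `0`.
  | zero =>
    have hz : ∀ x, extdM α 0 x = 0 := fun x => rfl
    rw [integralOn_univ_eq_sum μ hL fun x _ => hz x]
    exact Finset.sum_eq_zero fun c _ => chartIntegral_zero μ c fun x =>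
      smul_zero (A := E 0 [⋀^Fin 0]→L[ℝ] ℝ) _
  | succ k => exact integralOn_univ_extd hμ (hα k) hL (h0 k)

/-- Integrals of forms with compact support that differ by an exact form coincide. -/
lemma integralOn_eq_of_extdM {μ : DForm m m M} (hμ : IsOrientationForm μ) {U L : Set M}
    (hU : IsOpen U) (hL : IsCompact L) (hLU : L ⊆ U) {τ₀ τ₁ : DForm m m M}
    (h₀ : SmoothFormOn U τ₀) (h₀' : ∀ x ∈ U, x ∉ L → τ₀ x = 0) 
    (h₁' : ∀ x ∈ U, x ∉ L → τ₁ x = 0) {α : MForm m M} (hα : ∀ k, SmoothFormOn U (α k))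
    (hα' : ∀ k, ∀ x ∈ U, x ∉ L → α k x = 0) (h : ∀ x ∈ U, τ₁ x = τ₀ x + extdM α m x) :
    integralOn μ U τ₁ = integralOn μ U τ₀ := by
  rw [integralOn_eq_cutOff μ hLU h₀', integralOn_eq_cutOff μ hLU h₁']
  let α' : MForm m M := fun k => cutOff L (α k)
  have hs : ∀ k, SmoothFormOn Set.univ (α' k) := fun k => (hα k).cutOff hU hL hLU (hα' k)
  have hz : ∀ k x, x ∉ L → α' k x = 0 := fun k x hx => cutOff_of_notMem (α k) hx
  have hd0 : ∀ k x, x ∉ L → extdM α' k x = 0 := by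
    intro k x hx
    cases k with
    | zero => rfl
    | succ k => exact extd_eq_zero hL.isClosed.isOpen_compl (hz k) hx
  have hd1 : ∀ k, ∀ x ∈ U, extdM α' k x = extdM α k x := by
    intro k x hx
    cases k with
    | zero => rfl
    | succ k => exact extd_congr hU (fun y hy => cutOff_eq (hα' k) hy) hx
  have hds : SmoothFormOn Set.univ (extdM α' m) := SmoothFormOn.extdM isOpen_univ hs m
  -- The two summands are indexed by `Bool` in order to use additivity for finite sums.
  have key : cutOff L τ₁ = fun x => ∑ b : Bool, (if b then cutOff L τ₀ else extdM α' m) x := by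
    funext x
    rw [Fintype.sum_bool]
    by_cases hx : x ∈ L
    · simp only [if_true, cutOff_of_mem _ hx, h x (hLU hx)]
      rw [← hd1 m x (hLU hx)]
      rfl
    · simp only [if_true, cutOff_of_notMem _ hx]
      rw [if_neg (by simp), hd0 m x hx, add_zero]
  rw [key, integralOn_univ_sum hμ _ (L := L) _ hL, Fintype.sum_bool]
  · simp [integralOn_univ_extdM hμ hs hL hz]
  · rintro (_ | _) - x hx
    · exact hd0 m x hx
    · exact cutOff_of_notMem _ hx
  · rintro (_ | _) -
    · exact hds
    · exact h₀.cutOff hU hL hLU h₀'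

/-- Additivity of the integral for disjoint unions of open sets. -/
lemma integralOn_iUnion {μ : DForm m m M} (hμ : IsOrientationForm μ) {ι : Type*} (s : Finset ι)
    {W : ι → Set M} (hW : ∀ i ∈ s, IsOpen (W i))
    (hd : (s : Set ι).PairwiseDisjoint W) {U L : Set M} (hU : U = ⋃ i ∈ s, W i)
    (hL : IsCompact L) (hLU : L ⊆ U) {τ : DForm m m M} (hτ : SmoothFormOn U τ)
    (h0 : ∀ x ∈ U, x ∉ L → τ x = 0) :
    integralOn μ U τ = ∑ i ∈ s, integralOn μ (W i) τ := by
  have hWU : ∀ i ∈ s, W i ⊆ U := fun i hi => hU ▸ Set.subset_biUnion_of_mem (u := W) hi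
  have hLi : ∀ i ∈ s, IsCompact (L ∩ W i) := by
    intro i hi
    -- Since the `W j` are disjoint and cover `L`, the part of `L` in `W i` is obtained by removing
    -- the open sets `W j` with `j ≠ i`. Hence it is compact.
    have : L ∩ W i = L \ ⋃ j ∈ (s : Set ι) \ {i}, W j := by
      ext x
      constructor
      · rintro ⟨hx, hxi⟩
        refine ⟨hx, fun h => ?_⟩
        simp only [Set.mem_iUnion] at h
        obtain ⟨j, ⟨hj, hji⟩, hxj⟩ := h
        exact Set.disjoint_left.mp (hd hj hi hji) hxj hxi
      · rintro ⟨hx, hxn⟩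
        have hxU := hLU hx
        rw [hU] at hxU
        simp only [Set.mem_iUnion] at hxU
        obtain ⟨j, hj, hxj⟩ := hxU
        refine ⟨hx, ?_⟩
        by_cases hji : j = i
        · exact hji ▸ hxj
        · exact absurd (Set.mem_biUnion (show j ∈ (s : Set ι) \ {i} from ⟨hj, hji⟩) hxj) hxn
    rw [this]
    exact hL.diff (isOpen_biUnion fun j hj => hW j hj.1)
  have h0i : ∀ i ∈ s, ∀ x ∈ W i, x ∉ L ∩ W i → τ x = 0 := fun i hi x hx hxn =>
    h0 x (hWU i hi hx) fun h => hxn ⟨h, hx⟩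
  rw [integralOn_eq_cutOff μ hLU h0, Finset.sum_congr rfl fun i hi =>
    integralOn_eq_cutOff μ Set.inter_subset_right (h0i i hi),
    ← integralOn_univ_sum hμ s (fun i hi => (hτ.mono (hWU i hi)).cutOff (hW i hi) (hLi i hi)
      Set.inter_subset_right (h0i i hi)) hL
      (fun i hi x hx => cutOff_of_notMem τ fun h => hx h.1)]
  congr 1
  funext x
  by_cases hx : x ∈ L
  · have hxU := hLU hx
    rw [hU] at hxU
    simp only [Set.mem_iUnion] at hxU
    obtain ⟨i, hi, hxi⟩ := hxU
    have hm : x ∈ L ∩ W i := ⟨hx, hxi⟩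
    rw [cutOff_of_mem τ hx, Finset.sum_eq_single_of_mem i hi, cutOff_of_mem τ hm]
    intro j hj hji
    exact cutOff_of_notMem τ fun h => Set.disjoint_left.mp (hd hj hi hji) h.2 hxi
  · rw [cutOff_of_notMem τ hx]
    exact (Finset.sum_eq_zero fun i _ => cutOff_of_notMem τ fun h => hx h.1).symm

end IntegralOverOpenSets

end TwistedDH
end

open scoped Manifold ContDiff Topology
noncomputable section
namespace TwistedDH

/-! ### Derivatives in charts and of the group action. -/

section ChartDerivative

variable {m : ℕ} {M : Type*} [TopologicalSpace M] [ChartedSpace (E m) M] [IsManifold (𝓡 m) ∞ M]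

lemma mfderiv_chartAt_symm_self (x : M) :
    (mfderiv (𝓡 m) (𝓡 m) (chartAt (E m) x).symm (chartAt (E m) x x) : E m →L[ℝ] E m) =
      ContinuousLinearMap.id ℝ _ := by
  have hx : (chartAt (E m) x).symm (chartAt (E m) x x) = x := by simp
  have h4 : (mfderiv (𝓡 m) (𝓡 m) (chartAt (E m) x)
    ((chartAt (E m) x).symm (chartAt (E m) x x)) : E m →L[ℝ] E m) =
      ContinuousLinearMap.id ℝ _ := by rw [hx]; exact mfderiv_chartAt_self x
  have h5 : ((mfderiv (𝓡 m) (𝓡 m) (chartAt (E m) x)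
    ((chartAt (E m) x).symm (chartAt (E m) x x)) : E m →L[ℝ] E m)).comp
    (mfderiv (𝓡 m) (𝓡 m) (chartAt (E m) x).symm (chartAt (E m) x x) : E m →L[ℝ] E m) =
      ContinuousLinearMap.id ℝ _ :=
    (mdifferentiable_chart (I := 𝓡 m) x).comp_symm_deriv (mem_chart_target (E m) x)
  rw [h4] at h5
  exact h5

lemma extDeriv_one_apply {N : Type*} [NormedAddCommGroup N] [NormedSpace ℝ N]
    {a : N → N [⋀^Fin 1]→L[ℝ] ℝ} {y : N} (w w' : N) :
    extDeriv a y ![w, w'] = fderiv ℝ a y w ![w'] - fderiv ℝ a y w' ![w] := by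
  have h0 : Fin.removeNth (0 : Fin 2) ![w, w'] = ![w'] := by ext i; fin_cases i; rfl
  have h1 : Fin.removeNth (1 : Fin 2) ![w, w'] = ![w] := by ext i; fin_cases i; rfl
  rw [extDeriv, ContinuousAlternatingMap.alternatizeUncurryFin_apply]
  refine (Fin.sum_univ_two (M := ℝ) _).trans ?_
  rw [h0, h1]
  simp [sub_eq_add_neg]

lemma fderiv_apply_comp {N N' : Type*} [NormedAddCommGroup N] [NormedSpace ℝ N]
    [FiniteDimensional ℝ N] [NormedAddCommGroup N'] [NormedSpace ℝ N'] {k : ℕ}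
    {a : N → N [⋀^Fin k]→L[ℝ] ℝ} {ψ : N' → N} {L : N' →L[ℝ] N} {y : N'}
    (ha : DifferentiableAt ℝ a (ψ y)) (hψ : HasFDerivAt ψ L y) (u : Fin k → N) (w : N') :
    fderiv ℝ a (ψ y) (L w) u = fderiv ℝ (fun z => a (ψ z) u) y w := by
  let T : (N [⋀^Fin k]→L[ℝ] ℝ) →ₗ[ℝ] ℝ :=
    { toFun := fun b => b u
      map_add' := fun _ _ => rfl
      map_smul' := fun _ _ => rfl }
  have h := (T.toContinuousLinearMap.hasFDerivAt.comp y (ha.hasFDerivAt.comp y hψ)).fderiv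
  exact (congrArg (fun f : N' →L[ℝ] ℝ => f w) h).symm

lemma mfderiv_eq_fderiv_chart {F : Type*} [NormedAddCommGroup F] [NormedSpace ℝ F] {f : M → F}
    {x : M} (hf : MDifferentiableAt (𝓡 m) 𝓘(ℝ, F) f x) :
    (mfderiv (𝓡 m) 𝓘(ℝ, F) f x : E m →L[ℝ] F) =
      fderiv ℝ (f ∘ (chartAt (E m) x).symm) (chartAt (E m) x x) := by
  have hx : (chartAt (E m) x).symm (chartAt (E m) x x) = x := by simp
  have h1 : mfderiv (𝓡 m) 𝓘(ℝ, F) (f ∘ (chartAt (E m) x).symm) (chartAt (E m) x x) =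
      (mfderiv (𝓡 m) 𝓘(ℝ, F) f ((chartAt (E m) x).symm (chartAt (E m) x x))).comp
        (mfderiv (𝓡 m) (𝓡 m) (chartAt (E m) x).symm (chartAt (E m) x x)) :=
    mfderiv_comp _ (by rw [hx]; exact hf)
      ((contMDiffAt_chart_symm (mem_chart_target (E m) x)).mdifferentiableAt (by simp))
  have h2 : (mfderiv (𝓡 m) 𝓘(ℝ, F) f ((chartAt (E m) x).symm (chartAt (E m) x x)) :
      E m →L[ℝ] F) = mfderiv (𝓡 m) 𝓘(ℝ, F) f x := by rw [hx]
  have h3 : fderiv ℝ (f ∘ (chartAt (E m) x).symm) (chartAt (E m) x x) =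
      (mfderiv (𝓡 m) 𝓘(ℝ, F) f ((chartAt (E m) x).symm (chartAt (E m) x x)) : E m →L[ℝ] F).comp
        (mfderiv (𝓡 m) (𝓡 m) (chartAt (E m) x).symm (chartAt (E m) x x) : E m →L[ℝ] E m) := by
    rw [← mfderiv_eq_fderiv]; exact h1
  rw [h3, h2, mfderiv_chartAt_symm_self]
  rfl

end ChartDerivative

section Action

variable {r m : ℕ} {G : Type*} [TopologicalSpace G] [ChartedSpace (E r) G] [Group G]
  [LieGroup (𝓡 r) ∞ G]
  {M : Type*} [TopologicalSpace M] [ChartedSpace (E m) M] [IsManifold (𝓡 m) ∞ M]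
  [MulAction G M] [ContMDiffSMul (𝓡 r) (𝓡 m) ∞ G M]

omit [LieGroup (𝓡 r) ∞ G] [IsManifold (𝓡 m) ∞ M] in
variable (G M) in
lemma contMDiff_action :
    ContMDiff ((𝓡 r).prod (𝓡 m)) (𝓡 m) ∞ (fun p : G × M => p.1 • p.2) :=
  ContMDiffSMul.contMDiff_smul

lemma contMDiff_smul_const (x : M) : ContMDiff (𝓡 r) (𝓡 m) ∞ (fun g : G => g • x) :=
  (contMDiff_action G M).comp (contMDiff_id.prodMk contMDiff_const)

lemma contMDiff_const_smul' (r : ℕ) {m : ℕ} {G : Type*} [TopologicalSpace G] [ChartedSpace (E r) G] [Group G]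
    {M : Type*} [TopologicalSpace M] [ChartedSpace (E m) M]
    [MulAction G M] [ContMDiffSMul (𝓡 r) (𝓡 m) ∞ G M]
    (g : G) : ContMDiff (𝓡 m) (𝓡 m) ∞ (fun x : M => g • x) :=
  (contMDiff_action (r := r) G M).comp (contMDiff_const.prodMk contMDiff_id)

lemma mdifferentiableAt_const_smul (r : ℕ) {m : ℕ} {G : Type*} [TopologicalSpace G] [ChartedSpace (E r) G] [Group G]
    {M : Type*} [TopologicalSpace M] [ChartedSpace (E m) M]
    [MulAction G M] [ContMDiffSMul (𝓡 r) (𝓡 m) ∞ G M]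
    (g : G) (x : M) :
    MDifferentiableAt (𝓡 m) (𝓡 m) (fun x : M => g • x) x :=
  (contMDiff_const_smul' r g).mdifferentiableAt (by simp)

lemma mdifferentiableAt_smul_const (x : M) (g : G) :
    MDifferentiableAt (𝓡 r) (𝓡 m) (fun g : G => g • x) g :=
  (contMDiff_smul_const x).mdifferentiableAt (by simp)

lemma contMDiff_conj (g : G) : ContMDiff (𝓡 r) (𝓡 r) ∞ (fun h : G => g * h * g⁻¹) :=
  (contMDiff_const.mul contMDiff_id).mul contMDiff_const

lemma mfderiv_congr_point' {n n' : ℕ} {X Y : Type*} [TopologicalSpace X] [ChartedSpace (E n) X]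
    [TopologicalSpace Y] [ChartedSpace (E n') Y] {f : X → Y} {x x' : X} (h : x = x') :
    (mfderiv (𝓡 n) (𝓡 n') f x : E n →L[ℝ] E n') = mfderiv (𝓡 n) (𝓡 n') f x' := by
  rw [h]

/-- The fundamental vector fields are equivariant. -/
lemma sharp_Ad (g : G) (X : E r) (x : M) :
    (sharp G (Ad g X) (g • x) : E m) =
      (mfderiv (𝓡 m) (𝓡 m) (fun y : M => g • y) x : E m →L[ℝ] E m) (sharp G X x) := by
  -- `(g h g⁻¹) • (g • x) = g • (h • x)`; the claim is the derivative of this identity at `h = 1`.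
  have h1 : (fun h : G => h • (g • x)) ∘ (fun h : G => g * h * g⁻¹) =
      (fun y : M => g • y) ∘ fun h : G => h • x := by
    funext h; simp [mul_smul]
  have h2 : mfderiv (𝓡 r) (𝓡 m) ((fun h : G => h • (g • x)) ∘ (fun h : G => g * h * g⁻¹)) 1 =
      (mfderiv (𝓡 r) (𝓡 m) (fun h : G => h • (g • x)) (g * 1 * g⁻¹)).comp
        (mfderiv (𝓡 r) (𝓡 r) (fun h : G => g * h * g⁻¹) 1) :=
    mfderiv_comp 1 (mdifferentiableAt_smul_const _ _)
      ((contMDiff_conj g).mdifferentiableAt (by simp))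
  have h3 : mfderiv (𝓡 r) (𝓡 m) ((fun y : M => g • y) ∘ fun h : G => h • x) 1 =
      (mfderiv (𝓡 m) (𝓡 m) (fun y : M => g • y) ((1 : G) • x)).comp
        (mfderiv (𝓡 r) (𝓡 m) (fun h : G => h • x) 1) :=
    mfderiv_comp 1 (mdifferentiableAt_const_smul r _ _) (mdifferentiableAt_smul_const _ _)
  have h4 : (mfderiv (𝓡 r) (𝓡 m) (fun h : G => h • (g • x)) (g * 1 * g⁻¹) : E r →L[ℝ] E m) =
      mfderiv (𝓡 r) (𝓡 m) (fun h : G => h • (g • x)) 1 := mfderiv_congr_point' (by simp)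
  have h5 : (mfderiv (𝓡 m) (𝓡 m) (fun y : M => g • y) ((1 : G) • x) : E m →L[ℝ] E m) =
      mfderiv (𝓡 m) (𝓡 m) (fun y : M => g • y) x := mfderiv_congr_point' (one_smul G x)
  have h6 : ((mfderiv (𝓡 r) (𝓡 m) (fun h : G => h • (g • x)) (g * 1 * g⁻¹) :
      E r →L[ℝ] E m)).comp (mfderiv (𝓡 r) (𝓡 r) (fun h : G => g * h * g⁻¹) 1 : E r →L[ℝ] E r) =
      (mfderiv (𝓡 m) (𝓡 m) (fun y : M => g • y) ((1 : G) • x) : E m →L[ℝ] E m).comp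
        (mfderiv (𝓡 r) (𝓡 m) (fun h : G => h • x) 1 : E r →L[ℝ] E m) := by
    refine Eq.trans h2.symm (Eq.trans ?_ h3)
    rw [h1]
  rw [h4, h5] at h6
  exact congrArg (fun f : E r →L[ℝ] E m => f X) h6

lemma Ad_comp (g h : G) (X : E r) : Ad g (Ad h X) = Ad (g * h) X := by
  have h1 : (fun k : G => g * k * g⁻¹) ∘ (fun k : G => h * k * h⁻¹) =
      fun k : G => g * h * k * (g * h)⁻¹ := by
    funext k; simp [mul_assoc]
  have h2 : mfderiv (𝓡 r) (𝓡 r) ((fun k : G => g * k * g⁻¹) ∘ (fun k : G => h * k * h⁻¹)) 1 =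
      (mfderiv (𝓡 r) (𝓡 r) (fun k : G => g * k * g⁻¹) (h * 1 * h⁻¹)).comp
        (mfderiv (𝓡 r) (𝓡 r) (fun k : G => h * k * h⁻¹) 1) :=
    mfderiv_comp 1 ((contMDiff_conj g).mdifferentiableAt (by simp))
      ((contMDiff_conj h).mdifferentiableAt (by simp))
  have h4 : (mfderiv (𝓡 r) (𝓡 r) (fun k : G => g * k * g⁻¹) (h * 1 * h⁻¹) : E r →L[ℝ] E r) =
      mfderiv (𝓡 r) (𝓡 r) (fun k : G => g * k * g⁻¹) 1 := mfderiv_congr_point' (by simp)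
  have h6 : (mfderiv (𝓡 r) (𝓡 r) (fun k : G => g * k * g⁻¹) (h * 1 * h⁻¹) :
      E r →L[ℝ] E r).comp (Ad h) = Ad (g * h) := by
    refine Eq.trans h2.symm ?_
    rw [h1]
    rfl
  rw [h4] at h6
  exact congrArg (fun f : E r →L[ℝ] E r => f X) h6

lemma Ad_one (X : E r) : Ad (1 : G) X = X := by
  have h1 : (fun k : G => 1 * k * (1 : G)⁻¹) = id := by funext k; simp
  have h2 : (Ad (1 : G) : E r →L[ℝ] E r) = mfderiv (𝓡 r) (𝓡 r) (fun k : G => 1 * k * 1⁻¹) 1 := rfl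
  have h3 : (mfderiv (𝓡 r) (𝓡 r) (fun k : G => 1 * k * 1⁻¹) 1 : E r →L[ℝ] E r) =
    mfderiv (𝓡 r) (𝓡 r) (id : G → G) 1 := by rw [h1]
  rw [h2, h3, mfderiv_id]
  rfl

lemma Ad_Ad_inv (g : G) (X : E r) : Ad g (Ad g⁻¹ X) = X := by
  rw [Ad_comp, mul_inv_cancel, Ad_one]

variable (G) in
/-- The chart at `1 ∈ G`, centred at `0`, read backwards. -/
def groupChart (ξ : E r) : G := (chartAt (E r) (1 : G)).symm (chartAt (E r) (1 : G) 1 + ξ)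

lemma groupChart_zero : groupChart G (0 : E r) = 1 := by
  rw [groupChart, add_zero]
  exact (chartAt (E r) (1 : G)).left_inv (mem_chart_source _ _)

/-- The domain of `groupChart`. -/
def groupChartDomain (G : Type*) [TopologicalSpace G] [One G] (r : ℕ) [ChartedSpace (E r) G] :
    Set (E r) :=
  (fun ξ => chartAt (E r) (1 : G) 1 + ξ) ⁻¹' (chartAt (E r) (1 : G)).target

lemma isOpen_groupChartDomain : IsOpen (groupChartDomain G r) :=
  (chartAt (E r) (1 : G)).open_target.preimage (by fun_prop)

lemma zero_mem_groupChartDomain : (0 : E r) ∈ groupChartDomain G r := by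
  simp [groupChartDomain]

lemma contMDiffOn_groupChart :
    ContMDiffOn (𝓡 r) (𝓡 r) ∞ (groupChart G : E r → G) (groupChartDomain G r) := by
  have : IsManifold (𝓡 r) ∞ G := ContMDiffMul.toIsManifold
  have h : ContMDiff (𝓡 r) (𝓡 r) ∞ (fun ξ : E r => chartAt (E r) (1 : G) 1 + ξ) :=
    (contDiff_const.add contDiff_id).contMDiff
  exact (contMDiffOn_chart_symm (I := 𝓡 r) (n := ∞) (x := (1 : G))).comp h.contMDiffOn
    fun ξ hξ => hξ

/-- By this the chart at `1` can play the role of the exponential map: `t ↦ groupChart G (t • X)`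
has velocity `X` at `t = 0`, which is all that `X♯` requires. -/
lemma mfderiv_groupChart :
    (mfderiv (𝓡 r) (𝓡 r) (groupChart G) (0 : E r) : E r →L[ℝ] E r) =
      ContinuousLinearMap.id ℝ _ := by
  have : IsManifold (𝓡 r) ∞ G := ContMDiffMul.toIsManifold
  have h0 : MDifferentiableAt (𝓡 r) (𝓡 r) (fun ξ : E r => chartAt (E r) (1 : G) 1 + ξ) 0 :=
    ((contDiff_const.add contDiff_id).contMDiff (n := ∞)).mdifferentiableAt (by simp)
  have h1 : mfderiv (𝓡 r) (𝓡 r) ((chartAt (E r) (1 : G)).symm ∘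
      fun ξ : E r => chartAt (E r) (1 : G) 1 + ξ) 0 =
      (mfderiv (𝓡 r) (𝓡 r) (chartAt (E r) (1 : G)).symm (chartAt (E r) (1 : G) 1 + 0)).comp
        (mfderiv (𝓡 r) (𝓡 r) (fun ξ : E r => chartAt (E r) (1 : G) 1 + ξ) 0) :=
    mfderiv_comp 0 ((contMDiffAt_chart_symm (by simp)).mdifferentiableAt (by simp)) h0
  have h2 : (mfderiv (𝓡 r) (𝓡 r) (chartAt (E r) (1 : G)).symm (chartAt (E r) (1 : G) 1 + 0) :
      E r →L[ℝ] E r) = ContinuousLinearMap.id ℝ _ :=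
    (mfderiv_congr_point' (add_zero _)).trans (mfderiv_chartAt_symm_self (1 : G))
  have h3 : (mfderiv (𝓡 r) (𝓡 r) (fun ξ : E r => chartAt (E r) (1 : G) 1 + ξ) 0 :
      E r →L[ℝ] E r) = ContinuousLinearMap.id ℝ _ := by
    rw [mfderiv_eq_fderiv, fderiv_const_add, fderiv_fun_id]
    rfl
  have h4 : (mfderiv (𝓡 r) (𝓡 r) (groupChart G) (0 : E r) : E r →L[ℝ] E r) =
      (mfderiv (𝓡 r) (𝓡 r) (chartAt (E r) (1 : G)).symm (chartAt (E r) (1 : G) 1 + 0) :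
        E r →L[ℝ] E r).comp
        (mfderiv (𝓡 r) (𝓡 r) (fun ξ : E r => chartAt (E r) (1 : G) 1 + ξ) 0 : E r →L[ℝ] E r) := h1
  rw [h4, h2, h3]
  rfl

lemma sharp_eq_mfderiv (X : E r) (x : M) :
    (sharp G X x : E m) =
      (mfderiv (𝓡 r) (𝓡 m) (fun ξ : E r => groupChart G ξ • x) 0 : E r →L[ℝ] E m) X := by
  have h1 : mfderiv (𝓡 r) (𝓡 m) ((fun g : G => g • x) ∘ groupChart G) (0 : E r) =
      (mfderiv (𝓡 r) (𝓡 m) (fun g : G => g • x) (groupChart G (0 : E r))).comp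
        (mfderiv (𝓡 r) (𝓡 r) (groupChart G) (0 : E r)) :=
    mfderiv_comp 0 (mdifferentiableAt_smul_const _ _)
      ((contMDiffOn_groupChart.contMDiffAt (isOpen_groupChartDomain.mem_nhds
        zero_mem_groupChartDomain)).mdifferentiableAt (by simp))
  have h2 : (mfderiv (𝓡 r) (𝓡 m) (fun g : G => g • x) (groupChart G (0 : E r)) :
      E r →L[ℝ] E m) = mfderiv (𝓡 r) (𝓡 m) (fun g : G => g • x) 1 :=
    mfderiv_congr_point' groupChart_zero
  have h3 : (mfderiv (𝓡 r) (𝓡 m) (fun ξ : E r => groupChart G ξ • x) 0 : E r →L[ℝ] E m) =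
      (mfderiv (𝓡 r) (𝓡 m) (fun g : G => g • x) (groupChart G (0 : E r)) : E r →L[ℝ] E m).comp
        (mfderiv (𝓡 r) (𝓡 r) (groupChart G) (0 : E r) : E r →L[ℝ] E r) := h1
  rw [h3, h2, mfderiv_groupChart]
  rfl

end Action

end TwistedDH
end

open scoped Manifold ContDiff Topology
noncomputable section
namespace TwistedDH

/-! ### Fundamental vector fields in coordinates, and Cartan's formula for invariant forms. -/

section FundamentalFields

variable {r m : ℕ} {G : Type*} [TopologicalSpace G] [ChartedSpace (E r) G] [Group G]
  [LieGroup (𝓡 r) ∞ G]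
  {M : Type*} [TopologicalSpace M] [ChartedSpace (E m) M] [IsManifold (𝓡 m) ∞ M]
  [MulAction G M] [ContMDiffSMul (𝓡 r) (𝓡 m) ∞ G M]

variable (G) in
/-- The coordinate expression of the vector field `X♯` in the preferred chart at `c`. -/
def vecRep (c : M) (X : E r) (y : E m) : E m :=
  fderiv ℝ (fun ξ : E r => chartAt (E m) c (groupChart G ξ • (chartAt (E m) c).symm y)) 0 X

lemma contMDiffAt_groupChart_smul {c : M} {y : E m} (hy : y ∈ (chartAt (E m) c).target)
    {ξ : E r} (hξ : ξ ∈ groupChartDomain G r) :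
    ContMDiffAt ((𝓡 m).prod (𝓡 r)) (𝓡 m) ∞
      (fun q : E m × E r => groupChart G q.2 • (chartAt (E m) c).symm q.1) (y, ξ) := by
  have h1 : ContMDiffAt ((𝓡 m).prod (𝓡 r)) (𝓡 r) ∞ (fun q : E m × E r => groupChart G q.2)
      (y, ξ) :=
    ContMDiffAt.comp (f := Prod.snd) (y, ξ)
      (contMDiffOn_groupChart.contMDiffAt (isOpen_groupChartDomain.mem_nhds hξ)) contMDiffAt_snd
  have h2 : ContMDiffAt ((𝓡 m).prod (𝓡 r)) (𝓡 m) ∞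
      (fun q : E m × E r => (chartAt (E m) c).symm q.1) (y, ξ) :=
    ContMDiffAt.comp (f := Prod.fst) (y, ξ) (contMDiffAt_chart_symm hy) contMDiffAt_fst
  exact ((contMDiff_action G M).contMDiffAt).comp (y, ξ) (h1.prodMk h2)

lemma contDiffOn_vecRep (c : M) (X : E r) :
    ContDiffOn ℝ ∞ (vecRep G c X) (chartAt (E m) c).target := by
  intro y hy
  refine ContDiffAt.contDiffWithinAt ?_
  have h1 := contMDiffAt_groupChart_smul (G := G) hy (zero_mem_groupChartDomain (r := r))
  have h2 : ContMDiffAt (𝓘(ℝ, E m).prod 𝓘(ℝ, E r)) 𝓘(ℝ, E m) ∞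
      (fun q : E m × E r => chartAt (E m) c (groupChart G q.2 • (chartAt (E m) c).symm q.1))
      (y, 0) := by
    refine ContMDiffAt.comp (y, (0 : E r)) (contMDiffAt_chart ?_) h1
    simp only [groupChart_zero, one_smul]
    exact (chartAt (E m) c).map_target hy
  have h3 := contMDiffAt_fderiv_family
    (f := fun (z : E m) (ξ : E r) => chartAt (E m) c (groupChart G ξ • (chartAt (E m) c).symm z)) h2
  have h4 : ContMDiffAt 𝓘(ℝ, E m) 𝓘(ℝ, E r →L[ℝ] E m) ∞ (fun z : E m =>
      fderiv ℝ (fun ξ : E r => chartAt (E m) c (groupChart G ξ • (chartAt (E m) c).symm z)) 0) y :=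
    h3.comp y (contMDiffAt_id.prodMk contMDiffAt_const)
  exact h4.contDiffAt.clm_apply contDiffAt_const

lemma mfderiv_symm_vecRep {c : M} {y : E m} (hy : y ∈ (chartAt (E m) c).target) (X : E r) :
    (mfderiv (𝓡 m) (𝓡 m) (chartAt (E m) c).symm y : E m →L[ℝ] E m) (vecRep G c X y) =
      (sharp G X ((chartAt (E m) c).symm y) : E m) := by
  set e := chartAt (E m) c with he
  have hx : e.symm y ∈ e.source := e.map_target hy
  have h0 : ContMDiffAt (𝓡 r) (𝓡 m) ∞ (fun ξ : E r => groupChart G ξ • e.symm y) 0 :=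
    (contMDiffAt_groupChart_smul (G := G) hy zero_mem_groupChartDomain).comp (0 : E r)
      (f := fun ξ : E r => (y, ξ)) (contMDiffAt_const.prodMk contMDiffAt_id)
  have hval : groupChart G (0 : E r) • e.symm y = e.symm y := by rw [groupChart_zero, one_smul]
  have h1 : ContDiffAt ℝ ∞ (fun ξ : E r => e (groupChart G ξ • e.symm y)) 0 :=
    contDiffAt_chart_comp (F := fun ξ : E r => groupChart G ξ • e.symm y) h0
      (by rw [hval]; exact hx)
  have h2 : (fun ξ : E r => groupChart G ξ • e.symm y) =ᶠ[𝓝 0]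
      e.symm ∘ fun ξ : E r => e (groupChart G ξ • e.symm y) := by
    filter_upwards [h0.continuousAt.preimage_mem_nhds
      (e.open_source.mem_nhds (by rw [hval]; exact hx))] with ξ hξ
    exact (e.left_inv hξ).symm
  have hy0 : e (groupChart G (0 : E r) • e.symm y) = y := by rw [hval, e.right_inv hy]
  have h3 : mfderiv (𝓡 r) (𝓡 m) (e.symm ∘ fun ξ : E r => e (groupChart G ξ • e.symm y)) 0 =
      (mfderiv (𝓡 m) (𝓡 m) e.symm (e (groupChart G (0 : E r) • e.symm y))).comp
        (mfderiv (𝓡 r) (𝓡 m) (fun ξ : E r => e (groupChart G ξ • e.symm y)) 0) :=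
    mfderiv_comp 0 ((contMDiffAt_chart_symm (by rw [hy0]; exact hy)).mdifferentiableAt (by simp))
      (h1.differentiableAt (by simp)).mdifferentiableAt
  have h4 : (mfderiv (𝓡 m) (𝓡 m) e.symm (e (groupChart G (0 : E r) • e.symm y)) :
      E m →L[ℝ] E m) = mfderiv (𝓡 m) (𝓡 m) e.symm y := mfderiv_congr_point' hy0
  rw [mfderiv_eq_fderiv] at h3
  have h5 : (mfderiv (𝓡 r) (𝓡 m) (fun ξ : E r => groupChart G ξ • e.symm y) 0 : E r →L[ℝ] E m) =
      (mfderiv (𝓡 m) (𝓡 m) e.symm (e (groupChart G (0 : E r) • e.symm y)) : E m →L[ℝ] E m).comp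
        (fderiv ℝ (fun ξ : E r => e (groupChart G ξ • e.symm y)) 0) := h2.mfderiv_eq.trans h3
  rw [sharp_eq_mfderiv, h5, h4]
  rfl

/-- The contraction of a `1`-form with `X♯` in coordinates. -/
lemma apply_sharp_chart {c : M} {y : E m} (hy : y ∈ (chartAt (E m) c).target) (X : E r)
    (γ : DForm m 1 M) : γ ((chartAt (E m) c).symm y) ![sharp G X ((chartAt (E m) c).symm y)] =
      chartRep c γ y ![vecRep G c X y] := by
  have h : chartRep c γ y ![vecRep G c X y] = (γ ((chartAt (E m) c).symm y) :
      E m [⋀^Fin 1]→L[ℝ] ℝ) ![(mfderiv (𝓡 m) (𝓡 m) (chartAt (E m) c).symm y : E m →L[ℝ] E m)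
        (vecRep G c X y)] :=
    congrArg (γ ((chartAt (E m) c).symm y) : E m [⋀^Fin 1]→L[ℝ] ℝ)
      (funext fun i => by fin_cases i; rfl)
  rw [h, mfderiv_symm_vecRep hy]

/-- Near `x` the map is its coordinate expression composed with the chart at `x`. -/
lemma contMDiffOn_of_chart {F : Type*} [NormedAddCommGroup F] [NormedSpace ℝ F] {U : Set M}
    (hU : IsOpen U) {f : M → F}
    (h : ∀ c : M, ContDiffOn ℝ ∞ (f ∘ (chartAt (E m) c).symm)
      ((chartAt (E m) c).target ∩ (chartAt (E m) c).symm ⁻¹' U)) :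
    ContMDiffOn (𝓡 m) 𝓘(ℝ, F) ∞ f U := by
  intro x hx
  have hm : chartAt (E m) x x ∈ (chartAt (E m) x).target ∩ (chartAt (E m) x).symm ⁻¹' U :=
    ⟨mem_chart_target (E m) x, by simpa using hx⟩
  have h1 : ContMDiffAt (𝓡 m) 𝓘(ℝ, F) ∞ (f ∘ (chartAt (E m) x).symm) (chartAt (E m) x x) :=
    ((h x).contDiffAt (((chartAt (E m) x).isOpen_inter_preimage_symm hU).mem_nhds hm)).contMDiffAt
  refine ContMDiffAt.contMDiffWithinAt ((h1.comp x
    (contMDiffAt_chart (mem_chart_source (E m) x))).congr_of_eventuallyEq ?_)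
  filter_upwards [(chartAt (E m) x).open_source.mem_nhds (mem_chart_source (E m) x)] with z hz
  exact congrArg f ((chartAt (E m) x).left_inv hz).symm

lemma contMDiffOn_apply_sharp {U : Set M} (hU : IsOpen U) {γ : DForm m 1 M}
    (hγ : SmoothFormOn U γ) (X : E r) :
    ContMDiffOn (𝓡 m) 𝓘(ℝ, ℝ) ∞ (fun x => γ x ![sharp G X x]) U := by
  refine contMDiffOn_of_chart hU fun c => ?_
  have h1 : ContDiffOn ℝ ∞ (fun y => chartRep c γ y ![vecRep G c X y])
      ((chartAt (E m) c).target ∩ (chartAt (E m) c).symm ⁻¹' U) := fun y hy =>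
    ContDiffWithinAt.alternating_apply (u := fun z => ![vecRep G c X z]) (hγ c y hy) fun i => by
      fin_cases i
      exact ((contDiffOn_vecRep c X).mono Set.inter_subset_left) y hy
  exact h1.congr fun y hy => apply_sharp_chart hy.1 X γ

/-- `d (γ(X♯)) = -ι(X♯) dγ` for invariant `γ`. -/
lemma mfderiv_apply_sharp {U : Set M} (hU : IsOpen U) (hUG : IsInvariant G U) {γ : DForm m 1 M}
    (hγ : SmoothFormOn U γ) (hinv : ∀ g : G, ∀ x ∈ U, pullback (fun y => g • y) γ x = γ x)
    (X : E r) {x : M} (hx : x ∈ U) (u : E m) :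
    (mfderiv (𝓡 m) 𝓘(ℝ, ℝ) (fun y => γ y ![sharp G X y]) x : E m →L[ℝ] ℝ) u =
      - (extd γ x : E m [⋀^Fin 2]→L[ℝ] ℝ) ![(sharp G X x : E m), u] := by
  set e := chartAt (E m) x with he
  set V := e.target ∩ e.symm ⁻¹' U with hV
  have hVo : IsOpen V := e.isOpen_inter_preimage_symm hU
  set y₀ := e x with hy₀
  have hxy : e.symm y₀ = x := e.left_inv (mem_chart_source (E m) x)
  have hm : y₀ ∈ V := ⟨mem_chart_target (E m) x, by rw [Set.mem_preimage, hxy]; exact hx⟩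
  let T : Set ℝ := (fun t : ℝ => t • X) ⁻¹' groupChartDomain G r
  have hT : IsOpen T := isOpen_groupChartDomain.preimage (by fun_prop)
  have h0T : (0 : ℝ) ∈ T := by
    change (0 : ℝ) • X ∈ groupChartDomain G r
    rw [zero_smul]
    exact zero_mem_groupChartDomain
  -- Instead of Lie derivatives, `γ` is pulled back to `ℝ × ℝᵐ` under this motion along a curve in
  -- `G` with velocity `X`. Invariance makes the component along `ℝᵐ` independent of `t`, and the
  -- `dt`-component at `t = 0` is `γ(X♯)`.
  let F : ℝ × E m → M := fun q => groupChart G (q.1 • X) • e.symm q.2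
  have hF : ContMDiffOn 𝓘(ℝ, ℝ × E m) (𝓡 m) ∞ F (T ×ˢ V) := by
    rintro ⟨t, y⟩ ⟨ht, hy⟩
    refine ContMDiffAt.contMDiffWithinAt ?_
    have h1 : ContMDiffAt 𝓘(ℝ, ℝ × E m) ((𝓡 m).prod (𝓡 r)) ∞
        (fun q : ℝ × E m => (q.2, q.1 • X)) (t, y) := by
      refine ContMDiffAt.prodMk ?_ ?_
      · exact contDiff_snd.contMDiff.contMDiffAt
      · exact (contDiff_fst.smul contDiff_const).contMDiff.contMDiffAt
    exact ContMDiffAt.comp (t, y) (contMDiffAt_groupChart_smul (G := G) hy.1 ht) h1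
  have hWo : IsOpen (T ×ˢ V) := hT.prod hVo
  have hFU : Set.MapsTo F (T ×ˢ V) U := fun q hq => hUG _ _ hq.2.2
  have hFm : ∀ q ∈ T ×ˢ V, MDifferentiableAt 𝓘(ℝ, ℝ × E m) (𝓡 m) F q := fun q hq =>
    (hF.contMDiffAt (hWo.mem_nhds hq)).mdifferentiableAt (by simp)
  have hB := contDiffOn_pb hU hγ hWo hF hFU
  have hm0 : ((0 : ℝ), y₀) ∈ T ×ˢ V := ⟨h0T, hm⟩
  have hBd : DifferentiableAt ℝ (pb F γ) (0, y₀) :=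
    (hB.contDiffAt (hWo.mem_nhds hm0)).differentiableAt (by simp)
  -- the component of the pullback along the fibres
  have h1 : ∀ t ∈ T, ∀ y ∈ V, ∀ w : E m, pb F γ (t, y) ![(0, w)] = chartRep x γ y ![w] := by
    intro t ht y hy w
    have hψ : HasFDerivAt (fun z : E m => (t, z)) (ContinuousLinearMap.inr ℝ ℝ (E m)) y :=
      hasFDerivAt_prodMk_right t y
    have e1 := pb_comp (σ := γ) (ψ := fun z : E m => (t, z)) (hFm (t, y) ⟨ht, hy⟩)
      hψ.differentiableAt
    rw [hψ.fderiv] at e1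
    have e2 : pb (F ∘ fun z : E m => (t, z)) γ y =
        pb e.symm (pullback (fun z : M => groupChart G (t • X) • z) γ) y :=
      (pb_pullback (mdifferentiableAt_const_smul r _ _)
        ((contMDiffAt_chart_symm hy.1).mdifferentiableAt (by simp))).symm
    have e3 : chartRep x (pullback (fun z : M => groupChart G (t • X) • z) γ) y =
        chartRep x γ y := chartRep_congr_apply (hinv _ _ hy.2)
    rw [chartRep_eq_pb, ← e2, e1] at e3
    rw [← e3]
    exact congrArg (pb F γ (t, y)) (funext fun i => by fin_cases i; rfl)
  -- the component in the direction of the parameter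
  have hDF : ∀ y ∈ V, (mfderiv 𝓘(ℝ, ℝ × E m) (𝓡 m) F (0, y) : ℝ × E m →L[ℝ] E m) (1, 0) =
      (sharp G X (e.symm y) : E m) := by
    intro y hy
    have hψ : HasFDerivAt (fun t : ℝ => (t, y)) (ContinuousLinearMap.inl ℝ ℝ (E m)) 0 :=
      hasFDerivAt_prodMk_left 0 y
    have e1 : mfderiv 𝓘(ℝ, ℝ) (𝓡 m) (F ∘ fun t : ℝ => (t, y)) 0 =
        (mfderiv 𝓘(ℝ, ℝ × E m) (𝓡 m) F (0, y)).comp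
          (mfderiv 𝓘(ℝ, ℝ) 𝓘(ℝ, ℝ × E m) (fun t : ℝ => (t, y)) 0) :=
      mfderiv_comp 0 (hFm (0, y) ⟨h0T, hy⟩) hψ.differentiableAt.mdifferentiableAt
    rw [mfderiv_eq_fderiv, hψ.fderiv] at e1
    have hs : HasFDerivAt (fun t : ℝ => t • X) (ContinuousLinearMap.toSpanSingleton ℝ X) 0 :=
      (ContinuousLinearMap.toSpanSingleton ℝ X).hasFDerivAt
    have hg : MDifferentiableAt (𝓡 r) (𝓡 m) (fun ξ : E r => groupChart G ξ • e.symm y)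
        ((0 : ℝ) • X) := by
      rw [zero_smul]
      exact ((contMDiffAt_groupChart_smul (G := G) hy.1 zero_mem_groupChartDomain).comp (0 : E r)
        (f := fun ξ : E r => (y, ξ))
        (contMDiffAt_const.prodMk contMDiffAt_id)).mdifferentiableAt (by simp)
    have e2 : mfderiv 𝓘(ℝ, ℝ) (𝓡 m)
        ((fun ξ : E r => groupChart G ξ • e.symm y) ∘ fun t : ℝ => t • X) 0 =
        (mfderiv (𝓡 r) (𝓡 m) (fun ξ : E r => groupChart G ξ • e.symm y) ((0 : ℝ) • X)).comp
          (mfderiv 𝓘(ℝ, ℝ) (𝓡 r) (fun t : ℝ => t • X) 0) :=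
      mfderiv_comp 0 hg hs.differentiableAt.mdifferentiableAt
    rw [mfderiv_eq_fderiv, hs.fderiv] at e2
    have e3 : (mfderiv (𝓡 r) (𝓡 m) (fun ξ : E r => groupChart G ξ • e.symm y) ((0 : ℝ) • X) :
        E r →L[ℝ] E m) = mfderiv (𝓡 r) (𝓡 m) (fun ξ : E r => groupChart G ξ • e.symm y) 0 :=
      mfderiv_congr_point' (zero_smul ℝ X)
    have e4 : ((mfderiv 𝓘(ℝ, ℝ × E m) (𝓡 m) F (0, y) : ℝ × E m →L[ℝ] E m)).comp
        (ContinuousLinearMap.inl ℝ ℝ (E m)) =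
        (mfderiv (𝓡 r) (𝓡 m) (fun ξ : E r => groupChart G ξ • e.symm y) ((0 : ℝ) • X) :
        E r →L[ℝ] E m).comp (ContinuousLinearMap.toSpanSingleton ℝ X) := e1.symm.trans e2
    rw [e3] at e4
    rw [sharp_eq_mfderiv]
    have := congrArg (fun f : ℝ →L[ℝ] E m => f 1) e4
    have e5 : (ContinuousLinearMap.toSpanSingleton ℝ X) 1 = X := by simp
    have e6 : (mfderiv 𝓘(ℝ, ℝ × E m) (𝓡 m) F (0, y) : ℝ × E m →L[ℝ] E m) (1, 0) =
      (mfderiv (𝓡 r) (𝓡 m) (fun ξ : E r => groupChart G ξ • e.symm y) 0 : E r →L[ℝ] E m)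
        (ContinuousLinearMap.toSpanSingleton ℝ X 1) := this
    rw [e5] at e6
    exact e6
  have h2 : ∀ y ∈ V, pb F γ (0, y) ![(1, 0)] = γ (e.symm y) ![sharp G X (e.symm y)] := by
    intro y hy
    have e1 : pb F γ (0, y) ![(1, 0)] = (γ (F (0, y)) : E m [⋀^Fin 1]→L[ℝ] ℝ)
        ![(mfderiv 𝓘(ℝ, ℝ × E m) (𝓡 m) F (0, y) : ℝ × E m →L[ℝ] E m) (1, 0)] :=
      congrArg (γ (F (0, y)) : E m [⋀^Fin 1]→L[ℝ] ℝ) (funext fun i => by fin_cases i; rfl)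
    have e2 : F (0, y) = e.symm y := by
      change groupChart G ((0 : ℝ) • X) • e.symm y = _
      rw [zero_smul, groupChart_zero, one_smul]
    rw [e1, hDF y hy, e2]
  -- The fibre component is constant in `t`, so its derivative in `t` vanishes.
  have h3 : fderiv ℝ (pb F γ) (0, y₀) (1, 0) ![(0, u)] = 0 := by
    have e1 := fderiv_apply_comp (ψ := fun t : ℝ => (t, y₀)) hBd (hasFDerivAt_prodMk_left 0 y₀)
      ![(0, u)] 1
    have e2 : (fun t : ℝ => pb F γ (t, y₀) ![(0, u)]) =ᶠ[𝓝 0] fun _ => chartRep x γ y₀ ![u] := by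
      filter_upwards [hT.mem_nhds h0T] with t ht using h1 t ht y₀ hm u
    rw [e2.fderiv_eq, fderiv_fun_const] at e1
    exact e1
  have h4 : fderiv ℝ (pb F γ) (0, y₀) (0, u) ![(1, 0)] =
      fderiv ℝ (fun y => γ (e.symm y) ![sharp G X (e.symm y)]) y₀ u := by
    have e1 := fderiv_apply_comp (ψ := fun y : E m => ((0 : ℝ), y)) hBd
      (hasFDerivAt_prodMk_right 0 y₀) ![(1, 0)] u
    have e2 : (fun y => pb F γ (0, y) ![(1, 0)]) =ᶠ[𝓝 y₀]
        fun y => γ (e.symm y) ![sharp G X (e.symm y)] := by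
      filter_upwards [hVo.mem_nhds hm] with y hy using h2 y hy
    rw [e2.fderiv_eq] at e1
    exact e1
  have hF0 : F (0, y₀) = x := by
    change groupChart G ((0 : ℝ) • X) • e.symm y₀ = _
    rw [zero_smul, groupChart_zero, one_smul, hxy]
  have hDF' : (mfderiv 𝓘(ℝ, ℝ × E m) (𝓡 m) F (0, y₀) : ℝ × E m →L[ℝ] E m) (0, u) = u := by
    have e1 : mfderiv 𝓘(ℝ, E m) (𝓡 m) (F ∘ fun y : E m => ((0 : ℝ), y)) y₀ =
        (mfderiv 𝓘(ℝ, ℝ × E m) (𝓡 m) F (0, y₀)).comp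
          (mfderiv 𝓘(ℝ, E m) 𝓘(ℝ, ℝ × E m) (fun y : E m => ((0 : ℝ), y)) y₀) :=
      mfderiv_comp y₀ (hFm (0, y₀) hm0)
        (hasFDerivAt_prodMk_right (0 : ℝ) y₀).differentiableAt.mdifferentiableAt
    rw [mfderiv_eq_fderiv, (hasFDerivAt_prodMk_right (0 : ℝ) y₀).fderiv] at e1
    have e2 : F ∘ (fun y : E m => ((0 : ℝ), y)) = e.symm := by
      funext y
      change groupChart G ((0 : ℝ) • X) • e.symm y = _
      rw [zero_smul, groupChart_zero, one_smul]
    rw [e2] at e1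
    have e3 := congrArg (fun f : E m →L[ℝ] E m => f u)
      ((mfderiv_chartAt_symm_self x).symm.trans e1)
    exact e3.symm
  -- Evaluate the differential of the pullback on `(∂ₜ, u)`: only the derivative of the
  -- `dt`-component is left, with a minus sign. By naturality the same number is `dγ(X♯, u)`.
  have h5 := extDeriv_one_apply (a := pb F γ) (y := (0, y₀)) (1, 0) (0, u)
  rw [h3, h4, extDeriv_pb hU hγ hWo hF hFU hm0, zero_sub] at h5
  have h6 : pb F (extd γ) (0, y₀) ![(1, 0), (0, u)] =
      (extd γ (F (0, y₀)) : E m [⋀^Fin 2]→L[ℝ] ℝ)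
        ![(mfderiv 𝓘(ℝ, ℝ × E m) (𝓡 m) F (0, y₀) : ℝ × E m →L[ℝ] E m) (1, 0),
          (mfderiv 𝓘(ℝ, ℝ × E m) (𝓡 m) F (0, y₀) : ℝ × E m →L[ℝ] E m) (0, u)] :=
    congrArg (extd γ (F (0, y₀)) : E m [⋀^Fin 2]→L[ℝ] ℝ)
      (funext fun i => by fin_cases i <;> rfl)
  rw [h6, hDF y₀ hm, hDF', hF0, hxy] at h5
  rw [mfderiv_eq_fderiv_chart (((contMDiffOn_apply_sharp hU hγ X).contMDiffAt
    (hU.mem_nhds hx)).mdifferentiableAt (by simp)), h5, neg_neg]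
  rfl

end FundamentalFields

end TwistedDH
end

open scoped Manifold ContDiff Topology
noncomputable section
namespace TwistedDH

/-! ### Twists and segments of Hamiltonian structures. -/

section Twist

variable {r m : ℕ} {G : Type*} [TopologicalSpace G] [ChartedSpace (E r) G] [Group G]
  [LieGroup (𝓡 r) ∞ G]
  {M : Type*} [TopologicalSpace M] [ChartedSpace (E m) M] [IsManifold (𝓡 m) ∞ M]
  [MulAction G M] [ContMDiffSMul (𝓡 r) (𝓡 m) ∞ G M]

/-- Invariance of the form `τ` on `U`. -/
def InvariantFormOn (G : Type*) [Group G] [MulAction G M] {k : ℕ} (U : Set M) (τ : DForm m k M) :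
    Prop := ∀ g : G, ∀ x ∈ U, pullback (fun y => g • y) τ x = τ x

variable (G) in
/-- The map `x ↦ (X ↦ γ(X♯)(x))` from `M` to `𝔤⁎`. -/
def contract (γ : DForm m 1 M) (x : M) : E r →L[ℝ] ℝ :=
  (covOf (γ x : E m [⋀^Fin 1]→L[ℝ] ℝ)).comp
    (mfderiv (𝓡 r) (𝓡 m) (fun g : G => g • x) 1 : E r →L[ℝ] E m)

lemma contract_apply (γ : DForm m 1 M) (x : M) (X : E r) :
    contract G γ x X = γ x ![sharp G X x] := rfl

lemma contract_smul (t : ℝ) (γ : DForm m 1 M) (x : M) :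
    contract (r := r) G (t • γ) x = t • contract G γ x := rfl

lemma contMDiffOn_contract {U : Set M} (hU : IsOpen U) {γ : DForm m 1 M}
    (hγ : SmoothFormOn U γ) :
    ContMDiffOn (𝓡 m) 𝓘(ℝ, E r →L[ℝ] ℝ) ∞ (contract (r := r) G γ) U := by
  refine contMDiffOn_of_chart hU fun c => contDiffOn_clm_apply.mpr fun X => ?_
  exact ((contMDiffOn_apply_sharp hU hγ X).comp
    (contMDiffOn_chart_symm.mono Set.inter_subset_left) fun z hz => hz.2).contDiffOn

lemma pullback_one_apply (f : M → M) (γ : DForm m 1 M) (x : M) (w : E m) :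
    (pullback f γ x : E m [⋀^Fin 1]→L[ℝ] ℝ) ![w] = (γ (f x) : E m [⋀^Fin 1]→L[ℝ] ℝ)
      ![(mfderiv (𝓡 m) (𝓡 m) f x : E m →L[ℝ] E m) w] :=
  congrArg (γ (f x) : E m [⋀^Fin 1]→L[ℝ] ℝ) (funext fun i => by fin_cases i; rfl)

lemma contract_equivariant {U : Set M} {γ : DForm m 1 M} (hγ : InvariantFormOn G U γ) (g : G)
    {x : M} (hx : x ∈ U) : contract (r := r) G γ (g • x) = coAd g (contract G γ x) := by
  ext X
  have h1 : coAd g (contract G γ x) X = (γ x : E m [⋀^Fin 1]→L[ℝ] ℝ)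
    ![(sharp G (Ad g⁻¹ X) x : E m)] := rfl
  have h2 : (γ x : E m [⋀^Fin 1]→L[ℝ] ℝ) ![(sharp G (Ad g⁻¹ X) x : E m)] =
      (γ (g • x) : E m [⋀^Fin 1]→L[ℝ] ℝ) ![(mfderiv (𝓡 m) (𝓡 m) (fun y : M => g • y) x :
        E m →L[ℝ] E m) (sharp G (Ad g⁻¹ X) x)] :=
    (congrArg (fun b : E m [⋀^Fin 1]→L[ℝ] ℝ => b ![(sharp G (Ad g⁻¹ X) x : E m)])
      (hγ g x hx).symm).trans (pullback_one_apply _ γ x _)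
  rw [h1, h2, ← sharp_Ad, Ad_Ad_inv]
  rfl

lemma mfderiv_linearCombination {f g : M → ℝ} {x : M} (hf : MDifferentiableAt (𝓡 m) 𝓘(ℝ, ℝ) f x)
    (hg : MDifferentiableAt (𝓡 m) 𝓘(ℝ, ℝ) g x) (s t : ℝ) {u : E m} {a b : ℝ}
    (ha : (mfderiv (𝓡 m) 𝓘(ℝ, ℝ) f x : E m →L[ℝ] ℝ) u = a)
    (hb : (mfderiv (𝓡 m) 𝓘(ℝ, ℝ) g x : E m →L[ℝ] ℝ) u = b) :
    (mfderiv (𝓡 m) 𝓘(ℝ, ℝ) (fun y => s * f y + t * g y) x : E m →L[ℝ] ℝ) u = s * a + t * b := by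
  have hx : (chartAt (E m) x).symm (chartAt (E m) x x) = x := by simp
  have hd : ∀ {f : M → ℝ}, MDifferentiableAt (𝓡 m) 𝓘(ℝ, ℝ) f x →
      DifferentiableAt ℝ (f ∘ (chartAt (E m) x).symm) (chartAt (E m) x x) := fun {f} hf =>
    (MDifferentiableAt.comp (chartAt (E m) x x) (by rw [hx]; exact hf)
      ((contMDiffAt_chart_symm (mem_chart_target (E m) x)).mdifferentiableAt
        (by simp))).differentiableAt
  have h1 := (((hd hf).hasFDerivAt.const_mul s).add ((hd hg).hasFDerivAt.const_mul t))
  have hM : MDifferentiableAt (𝓡 m) 𝓘(ℝ, ℝ) (fun y => s * f y + t * g y) x :=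
    (hf.const_smul s).add (hg.const_smul t)
  rw [mfderiv_eq_fderiv_chart hf] at ha
  rw [mfderiv_eq_fderiv_chart hg] at hb
  rw [mfderiv_eq_fderiv_chart hM, ← ha, ← hb]
  exact congrArg (fun l : E m →L[ℝ] ℝ => l u) h1.fderiv

/-- The twist `σ - dγ` of a closed form. -/
def twistForm (σ : DForm m 2 M) (γ : DForm m 1 M) : DForm m 2 M := σ + (-1 : ℝ) • extd γ

variable (G) in
/-- The twist of a moment map. -/
def twistMap (Φ : M → E r →L[ℝ] ℝ) (γ : DForm m 1 M) (x : M) : E r →L[ℝ] ℝ :=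
  Φ x + contract G γ x

lemma pullback_add {k : ℕ} (f : M → M) (σ τ : DForm m k M) (x : M) :
    pullback f (σ + τ) x = pullback f σ x + pullback f τ x := rfl

lemma pullback_smul {k : ℕ} (f : M → M) (t : ℝ) (τ : DForm m k M) (x : M) :
    pullback f (t • τ) x = t • pullback f τ x := rfl

lemma IsHamiltonian.mdifferentiableAt {U : Set M} (hU : IsOpen U) {σ : DForm m 2 M}
    {Φ : M → E r →L[ℝ] ℝ} (h : IsHamiltonian G U σ Φ) (X : E r) {x : M} (hx : x ∈ U) :
    MDifferentiableAt (𝓡 m) 𝓘(ℝ, ℝ) (fun y => Φ y X) x :=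
  ((ContinuousLinearMap.apply ℝ ℝ X).hasFDerivAt.hasMFDerivAt.mdifferentiableAt).comp x
    ((h.smooth_map.contMDiffAt (hU.mem_nhds hx)).mdifferentiableAt (by simp))

lemma InvariantFormOn.extd {r m : ℕ} {G : Type*} [TopologicalSpace G] [ChartedSpace (E r) G]
    [Group G] {M : Type*} [TopologicalSpace M] [ChartedSpace (E m) M] [IsManifold (𝓡 m) ∞ M]
    [MulAction G M] [ContMDiffSMul (𝓡 r) (𝓡 m) ∞ G M] {U : Set M} (hU : IsOpen U) (hUG : IsInvariant G U) {k : ℕ}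
    {γ : DForm m k M} (hγ : SmoothFormOn U γ) (hinv : InvariantFormOn G U γ) :
    InvariantFormOn G U (extd γ) := by
  intro g x hx
  rw [← extd_pullback hU hU (contMDiff_const_smul' r g).contMDiffOn (fun y hy => hUG g y hy) hγ hx]
  exact extd_congr hU (hinv g) hx

/-- This is the replacement of `σ + Φ` by `σ + Φ - d_G γ`. Hamilton's equation is preserved because
`d(γ(X♯)) = -ι(X♯)dγ` for invariant `γ`. -/
lemma IsHamiltonian.twist {U : Set M} (hU : IsOpen U) (hUG : IsInvariant G U) {σ : DForm m 2 M}
    {Φ : M → E r →L[ℝ] ℝ} (h : IsHamiltonian G U σ Φ) {γ : DForm m 1 M}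
    (hγ : SmoothFormOn U γ) (hinv : InvariantFormOn G U γ) :
    IsHamiltonian G U (twistForm σ γ) (twistMap G Φ γ) where
  smooth_form := h.smooth_form.add ((hγ.extd hU).smul _)
  closed x hx := by
    rw [twistForm, extd_add hU h.smooth_form ((hγ.extd hU).smul _) hx, extd_smul, h.closed x hx,
      extd_extd hU hγ hx, smul_zero, add_zero]
  invariant g x hx := by
    rw [twistForm, pullback_add, pullback_smul, h.invariant g x hx,
      InvariantFormOn.extd (r := r) hU hUG hγ hinv g x hx]
    rfl
  smooth_map := h.smooth_map.add (contMDiffOn_contract hU hγ)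
  equivariant g x hx := by
    rw [twistMap, h.equivariant g x hx, contract_equivariant hinv g hx]
    rfl
  hamilton X x hx u := by
    have h2 : MDifferentiableAt (𝓡 m) 𝓘(ℝ, ℝ) (fun y => γ y ![sharp G X y]) x :=
      ((contMDiffOn_apply_sharp hU hγ X).contMDiffAt (hU.mem_nhds hx)).mdifferentiableAt (by simp)
    have h3 := mfderiv_linearCombination (h.mdifferentiableAt hU X hx) h2 1 1
      (h.hamilton X x hx u) (mfderiv_apply_sharp hU hUG hγ hinv X hx u)
    have h4 : (twistForm σ γ x : E m [⋀^Fin 2]→L[ℝ] ℝ) ![(sharp G X x : E m), u] =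
      (σ x : E m [⋀^Fin 2]→L[ℝ] ℝ) ![(sharp G X x : E m), u] +
      (-1) * (extd γ x : E m [⋀^Fin 2]→L[ℝ] ℝ) ![(sharp G X x : E m), u] := rfl
    have h5 : (fun y => twistMap G Φ γ y X) =
        fun y => 1 * Φ y X + 1 * γ y ![sharp G X y] := by
      funext y
      rw [one_mul, one_mul]
      rfl
    rw [h5]
    have h6 : ∀ a b : ℝ, 1 * a + 1 * (-b) = a + (-1) * b := fun a b => by ring
    exact h3.trans ((h6 _ _).trans h4.symm)

/-- The segment between two closed forms. -/
def segForm (σ₀ σ₁ : DForm m 2 M) (t : ℝ) : DForm m 2 M := (1 - t) • σ₀ + t • σ₁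

/-- The segment between two moment maps. -/
def segMap (Φ₀ Φ₁ : M → E r →L[ℝ] ℝ) (t : ℝ) (x : M) : E r →L[ℝ] ℝ :=
  (1 - t) • Φ₀ x + t • Φ₁ x

/-- All the conditions are affine in `(σ, Φ)`; in particular nondegeneracy is not among them. -/
lemma IsHamiltonian.segment {U : Set M} (hU : IsOpen U) {σ₀ σ₁ : DForm m 2 M}
    {Φ₀ Φ₁ : M → E r →L[ℝ] ℝ} (h₀ : IsHamiltonian G U σ₀ Φ₀) (h₁ : IsHamiltonian G U σ₁ Φ₁)
    (t : ℝ) : IsHamiltonian G U (segForm σ₀ σ₁ t) (segMap Φ₀ Φ₁ t) where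
  smooth_form := (h₀.smooth_form.smul _).add (h₁.smooth_form.smul _)
  closed x hx := by
    rw [segForm, extd_add hU (h₀.smooth_form.smul _) (h₁.smooth_form.smul _) hx, extd_smul,
      extd_smul, h₀.closed x hx, h₁.closed x hx, smul_zero, smul_zero, add_zero]
  invariant g x hx := by
    rw [segForm, pullback_add, pullback_smul, pullback_smul, h₀.invariant g x hx,
      h₁.invariant g x hx]
    rfl
  smooth_map := by
    have h : ContMDiffOn (𝓡 m) 𝓘(ℝ, E r →L[ℝ] ℝ) ∞
        ((fun _ : M => 1 - t) • Φ₀ + (fun _ : M => t) • Φ₁) U :=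
      ((contMDiffOn_const (I' := 𝓘(ℝ, ℝ))).smul h₀.smooth_map).add
        ((contMDiffOn_const (I' := 𝓘(ℝ, ℝ))).smul h₁.smooth_map)
    exact h
  equivariant g x hx := by
    rw [segMap, h₀.equivariant g x hx, h₁.equivariant g x hx]
    rfl
  hamilton X x hx u := by
    exact mfderiv_linearCombination (h₀.mdifferentiableAt hU X hx) (h₁.mdifferentiableAt hU X hx)
      (1 - t) t (h₀.hamilton X x hx u) (h₁.hamilton X x hx u)

end Twist

end TwistedDH
end

open scoped Manifold ContDiff Topology
noncomputable section
namespace TwistedDH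

/-! ### Coordinate expressions of `e^σ D_{η,Φ}(φ)` and of the equivariant differential. -/

section PullbackOfCovectors

variable {n n' : ℕ}

/-- The pullback of covectors of mixed degree. -/
def compM (f : E n' →L[ℝ] E n) : Cov (E n) →ₗ[ℝ] Cov (E n') where
  toFun b := fun k => (b k).compContinuousLinearMap f
  map_add' _ _ := rfl
  map_smul' _ _ := rfl

lemma compM_apply (f : E n' →L[ℝ] E n) (b : Cov (E n)) (k : ℕ) :
    compM f b k = (b k).compContinuousLinearMap f := rfl

lemma compM_mulTwo (f : E n' →L[ℝ] E n) (σ : E n [⋀^Fin 2]→L[ℝ] ℝ) (b : Cov (E n)) :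
    compM f (mulTwo σ b) = mulTwo (σ.compContinuousLinearMap f) (compM f b) := by
  funext k
  rw [compM_apply]
  rcases lt_or_ge k 2 with hk | hk
  · rw [mulTwo_of_lt_two _ _ hk, mulTwo_of_lt_two _ _ hk]
    rfl
  · obtain ⟨k, rfl⟩ := Nat.exists_eq_add_of_le' hk
    rw [mulTwo_succ_succ, mulTwo_succ_succ, wedge_compContinuousLinearMap]
    rfl

lemma compM_mulExp (f : E n →L[ℝ] E n) (σ : E n [⋀^Fin 2]→L[ℝ] ℝ) (b : Cov (E n)) :
    compM f (mulExp σ b) = mulExp (σ.compContinuousLinearMap f) (compM f b) := by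
  have hp : ∀ p, compM f ((mulTwo σ ^ p) b) =
      (mulTwo (σ.compContinuousLinearMap f) ^ p) (compM f b) := by
    intro p
    induction p with
    | zero => rfl
    | succ p ih =>
      rw [pow_succ', pow_succ', Module.End.mul_apply, Module.End.mul_apply, compM_mulTwo, ih]
  rw [mulExp_apply, mulExp_apply, map_sum]
  exact Finset.sum_congr rfl fun p _ => by rw [map_smul, hp]

end PullbackOfCovectors

section DHForm

variable {r m : ℕ} {M : Type*} [TopologicalSpace M] [ChartedSpace (E m) M]

/-- The form of mixed degree `e^σ ∧ D_{η,Φ}(φ)`. -/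
def dhForm (σ : DForm m 2 M) (Φ : M → E r →L[ℝ] ℝ) (η : EForm r m M)
    (φ : (E r →L[ℝ] ℝ) → ℝ) : MForm m M := fun k x => wedgeM (expM m (σ x)) (DetaPhi η Φ φ x) k

/-- The coordinate expression of a form of mixed degree. -/
def chartRepM (c : M) (α : MForm m M) (y : E m) : Cov (E m) := fun k => chartRep c (α k) y

lemma dhForm_apply (σ : DForm m 2 M) (Φ : M → E r →L[ℝ] ℝ) (η : EForm r m M)
    (φ : (E r →L[ℝ] ℝ) → ℝ) (x : M) (k : ℕ) : (dhForm σ Φ η φ k x : E m [⋀^Fin k]→L[ℝ] ℝ) =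
      mulExp (σ x : E m [⋀^Fin 2]→L[ℝ] ℝ)
        (∑ a ∈ η.support, multiD a φ (Φ x) • (fun k => η a k x : Cov (E m))) k :=
  congrFun (wedgeM_expM (σ x : E m [⋀^Fin 2]→L[ℝ] ℝ) _) k

lemma chartRepM_dhForm (σ : DForm m 2 M) (Φ : M → E r →L[ℝ] ℝ) (η : EForm r m M)
    (φ : (E r →L[ℝ] ℝ) → ℝ) (c : M) (y : E m) :
    chartRepM c (dhForm σ Φ η φ) y = mulExp (chartRep c σ y)
      (twistSum η.support (Φ ∘ (chartAt (E m) c).symm) (fun a => chartRepM c (η a)) φ y) := by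
  let f : E m →L[ℝ] E m := mfderiv (𝓡 m) (𝓡 m) (chartAt (E m) c).symm y
  set x := (chartAt (E m) c).symm y with hx
  have h1 : chartRepM c (dhForm σ Φ η φ) y = compM f (mulExp (σ x : E m [⋀^Fin 2]→L[ℝ] ℝ)
        (∑ a ∈ η.support, multiD a φ (Φ x) • (fun k => η a k x : Cov (E m)))) := by
    funext k
    exact congrArg (fun b : E m [⋀^Fin k]→L[ℝ] ℝ => b.compContinuousLinearMap f)
      (dhForm_apply σ Φ η φ x k)
  let b : ((Fin r) →₀ ℕ) → Cov (E m) := fun a k => η a k x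
  have h2 : compM f (∑ a ∈ η.support, multiD a φ (Φ x) • b a) =
      ∑ a ∈ η.support, multiD a φ (Φ x) • compM f (b a) := by
    rw [map_sum]
    exact Finset.sum_congr rfl fun a _ => map_smul _ _ _
  exact h1.trans ((compM_mulExp f _ _).trans (congrArg (mulExp (chartRep c σ y)) h2))

/-- Every coefficient is a derivative of `φ` at `Φ x`, and derivatives vanish off the topological
support. All statements on compactness of supports rest on this. -/
lemma dhForm_eq_zero {σ : DForm m 2 M} {Φ : M → E r →L[ℝ] ℝ} {η : EForm r m M}
    {φ : (E r →L[ℝ] ℝ) → ℝ} {x : M} (h : Φ x ∉ tsupport φ) (k : ℕ) : dhForm σ Φ η φ k x = 0 := by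
  have : (dhForm σ Φ η φ k x : E m [⋀^Fin k]→L[ℝ] ℝ) = 0 := by
    let s : E m [⋀^Fin 2]→L[ℝ] ℝ := σ x
    let b : ((Fin r) →₀ ℕ) → Cov (E m) := fun a k => η a k x
    have h1 : ∑ a ∈ η.support, multiD a φ (Φ x) • b a = 0 :=
      Finset.sum_eq_zero fun a _ => by rw [multiD_eq_zero a h, zero_smul]
    have h2 : mulExp s (∑ a ∈ η.support, multiD a φ (Φ x) • b a) k = 0 := by
      rw [h1, map_zero]; rfl
    exact (dhForm_apply σ Φ η φ x k).trans h2
  exact this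

end DHForm

section ClosedEquivariantForms

variable {r m : ℕ} {G : Type*} [TopologicalSpace G] [ChartedSpace (E r) G] [Group G]
  [LieGroup (𝓡 r) ∞ G]
  {M : Type*} [TopologicalSpace M] [ChartedSpace (E m) M] [IsManifold (𝓡 m) ∞ M]
  [MulAction G M] [ContMDiffSMul (𝓡 r) (𝓡 m) ∞ G M]

lemma vecRep_eq_sum (c : M) (X : E r) (y : E m) :
    vecRep G c X y = ∑ i, X i • vecRep G c (coordVec i) y := by
  have h : X = ∑ i, X i • coordVec i := (sum_coord X).symm
  conv_lhs => rw [h]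
  rw [vecRep, map_sum]
  exact Finset.sum_congr rfl fun i _ => map_smul _ _ _

lemma interiorL_sum_smul {n : ℕ} {ι : Type*} (s : Finset ι) (t : ι → ℝ) (w : ι → E n)
    (b : Cov (E n)) : interiorL (∑ i ∈ s, t i • w i) b = ∑ i ∈ s, t i • interiorL (w i) b := by
  let T : E n →ₗ[ℝ] Cov (E n) :=
    { toFun := fun w => interiorL w b
      map_add' := fun w w' => funext fun k => interior_add_left w w' (b (k + 1))
      map_smul' := fun t w => funext fun k => interior_smul_left t w (b (k + 1)) }
  change T _ = _
  rw [map_sum]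
  exact Finset.sum_congr rfl fun i _ => map_smul T _ _

lemma chartRepM_eval (η : EForm r m M) (X : E r) (c : M) (y : E m) :
    chartRepM c (η.eval X) y = ∑ a ∈ η.support, (∏ i, X i ^ a i) • chartRepM c (η a) y := by
  let T : MForm m M →ₗ[ℝ] Cov (E m) :=
    { toFun := fun α => chartRepM c α y
      map_add' := fun _ _ => rfl
      map_smul' := fun _ _ => rfl }
  change T _ = _
  rw [EForm.eval, Finsupp.sum, map_sum]
  exact Finset.sum_congr rfl fun a _ => map_smul T _ _

lemma chartRep_interior {k : ℕ} (α : DForm m (k + 1) M) {c : M} {y : E m}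
    (hy : y ∈ (chartAt (E m) c).target) (X : E r) :
    chartRep c (fun x => interior (sharp G X x) (α x)) y =
      interior (vecRep G c X y) (chartRep c α y) := by
  let f : E m →L[ℝ] E m := mfderiv (𝓡 m) (𝓡 m) (chartAt (E m) c).symm y
  set x := (chartAt (E m) c).symm y with hx
  have h1 : f (vecRep G c X y) = (sharp G X x : E m) := mfderiv_symm_vecRep hy X
  ext u
  have h2 : chartRep c (fun x => interior (sharp G X x) (α x)) y u =
      (α x : E m [⋀^Fin (k + 1)]→L[ℝ] ℝ) (Matrix.vecCons (sharp G X x : E m) (f ∘ u)) := rfl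
  have h3 : interior (vecRep G c X y) (chartRep c α y) u =
      (α x : E m [⋀^Fin (k + 1)]→L[ℝ] ℝ) (f ∘ Matrix.vecCons (vecRep G c X y) u) := rfl
  rw [h2, h3, ← h1]
  congr 1
  funext i
  refine Fin.cases ?_ (fun i => ?_) i <;> rfl

lemma diffM_chartRepM {U : Set M} (hU : IsOpen U) {α : MForm m M}
    (hα : ∀ k, SmoothFormOn U (α k)) {c : M} {y : E m} (hy : y ∈ (chartAt (E m) c).target)
    (hyU : (chartAt (E m) c).symm y ∈ U) : DiffM (chartRepM c α) y := fun k =>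
  ((hα k).contDiffAt hU hy hyU).differentiableAt (by simp)

lemma chartRepM_extdM {U : Set M} (hU : IsOpen U) {α : MForm m M}
    (hα : ∀ k, SmoothFormOn U (α k)) {c : M} {y : E m} (hy : y ∈ (chartAt (E m) c).target)
    (hyU : (chartAt (E m) c).symm y ∈ U) :
    chartRepM c (extdM α) y = extDerivM (chartRepM c α) y := by
  funext k
  cases k with
  | zero => rw [extDerivM_zero]; exact chartRep_eq_zero rfl
  | succ k =>
    rw [extDerivM_succ]
    exact chartRep_extd hU (hα k) hy hyU

/-- The coordinate expression of `d_G`. -/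
lemma chartRepM_dG {U : Set M} (hU : IsOpen U) {η : EForm r m M}
    (hη : ∀ a k, SmoothFormOn U (η a k)) (X : E r) {c : M} {y : E m}
    (hy : y ∈ (chartAt (E m) c).target) (hyU : (chartAt (E m) c).symm y ∈ U) :
    chartRepM c (dG G η X) y =
      ∑ a ∈ η.support, (∏ i, X i ^ a i) • extDerivM (chartRepM c (η a)) y -
      ∑ i, X i • ∑ a ∈ η.support, (∏ i, X i ^ a i) •
        interiorL (vecRep G c (coordVec i) y) (chartRepM c (η a) y) := by
  have hs : ∀ k, SmoothFormOn U (η.eval X k) := fun k => EForm.smooth_eval hη X k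
  have h1 : chartRepM c (dG G η X) y = chartRepM c (extdM (η.eval X)) y -
      interiorL (vecRep G c X y) (chartRepM c (η.eval X) y) := by
    funext k
    have e1 := chartRep_interior (G := G) (η.eval X (k + 1)) hy X
    have e2 : chartRepM c (dG G η X) y k = chartRep c (extdM (η.eval X) k) y -
      chartRep c (fun x => interior (sharp G X x) (η.eval X (k + 1) x)) y := rfl
    rw [e2, e1]
    rfl
  have h2 : extDerivM (chartRepM c (η.eval X)) y =
      ∑ a ∈ η.support, (∏ i, X i ^ a i) • extDerivM (chartRepM c (η a)) y := by
    have e1 : chartRepM c (η.eval X) = fun z =>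
      ∑ a ∈ η.support, (∏ i, X i ^ a i) • chartRepM c (η a) z := funext fun z => chartRepM_eval _ _ _ _
    have hd : ∀ a ∈ η.support, DiffM (fun z => (∏ i, X i ^ a i) • chartRepM c (η a) z) y :=
      fun a _ => (diffM_chartRepM hU (hη a) hy hyU).const_smul _
    rw [e1, extDerivM]
    simp only [derivM_sum hd, map_sum]
    rw [Finset.sum_comm]
    refine Finset.sum_congr rfl fun a _ => ?_
    rw [extDerivM, Finset.smul_sum]
    refine Finset.sum_congr rfl fun j _ => ?_
    rw [derivM_const_smul _ (diffM_chartRepM hU (hη a) hy hyU), map_smul]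
  rw [h1, chartRepM_extdM hU hs hy hyU, h2, vecRep_eq_sum, interiorL_sum_smul]
  congr 1
  refine Finset.sum_congr rfl fun i _ => ?_
  rw [chartRepM_eval, map_sum]
  simp only [map_smul]

/-- Hamilton's equation in coordinates. -/
lemma IsHamiltonian.hamilton_chart {U : Set M} (hU : IsOpen U) {σ : DForm m 2 M}
    {Φ : M → E r →L[ℝ] ℝ} (h : IsHamiltonian G U σ Φ) {c : M} {y : E m}
    (hy : y ∈ (chartAt (E m) c).target) (hyU : (chartAt (E m) c).symm y ∈ U) (X : E r) (w : E m) :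
    fderiv ℝ (Φ ∘ (chartAt (E m) c).symm) y w X = chartRep c σ y ![vecRep G c X y, w] := by
  let f : E m →L[ℝ] E m := mfderiv (𝓡 m) (𝓡 m) (chartAt (E m) c).symm y
  set x := (chartAt (E m) c).symm y with hx
  have hΦ := h.smooth_map.contMDiffAt (hU.mem_nhds hyU)
  have hΦX : MDifferentiableAt (𝓡 m) 𝓘(ℝ, ℝ) (fun y => Φ y X) x :=
    ((ContinuousLinearMap.apply ℝ ℝ X).hasFDerivAt.hasMFDerivAt.mdifferentiableAt).comp x
      (hΦ.mdifferentiableAt (by simp))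
  have he : MDifferentiableAt (𝓡 m) (𝓡 m) (chartAt (E m) c).symm y :=
    (contMDiffAt_chart_symm hy).mdifferentiableAt (by simp)
  have h1 : mfderiv (𝓡 m) 𝓘(ℝ, ℝ) ((fun y => Φ y X) ∘ (chartAt (E m) c).symm) y =
      (mfderiv (𝓡 m) 𝓘(ℝ, ℝ) (fun y => Φ y X) x).comp
        (mfderiv (𝓡 m) (𝓡 m) (chartAt (E m) c).symm y) := mfderiv_comp y hΦX he
  rw [mfderiv_eq_fderiv] at h1
  have h2 : DifferentiableAt ℝ (Φ ∘ (chartAt (E m) c).symm) y :=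
    ((hΦ.mdifferentiableAt (by simp)).comp y he).differentiableAt
  have h3 : fderiv ℝ ((fun y => Φ y X) ∘ (chartAt (E m) c).symm) y w =
      fderiv ℝ (Φ ∘ (chartAt (E m) c).symm) y w X := by
    have := ((ContinuousLinearMap.apply ℝ ℝ X).hasFDerivAt.comp y h2.hasFDerivAt).fderiv
    exact congrArg (fun g : E m →L[ℝ] ℝ => g w) this
  have h4 : chartRep c σ y ![vecRep G c X y, w] =
      (σ x : E m [⋀^Fin 2]→L[ℝ] ℝ) ![f (vecRep G c X y), f w] :=
    congrArg (σ x : E m [⋀^Fin 2]→L[ℝ] ℝ) (funext fun i => by fin_cases i <;> rfl)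
  have h5 : f (vecRep G c X y) = (sharp G X x : E m) := mfderiv_symm_vecRep hy X
  rw [← h3, h4, h5]
  exact (congrArg (fun g : E m →L[ℝ] ℝ => g w) h1).trans (h.hamilton X x hyU (f w))

lemma contDiffAt_moment_chart {U : Set M} (hU : IsOpen U) {Φ : M → E r →L[ℝ] ℝ}
    (h : ContMDiffOn (𝓡 m) 𝓘(ℝ, E r →L[ℝ] ℝ) ∞ Φ U) {c : M} {y : E m}
    (hy : y ∈ (chartAt (E m) c).target) (hyU : (chartAt (E m) c).symm y ∈ U) :
    ContDiffAt ℝ ∞ (Φ ∘ (chartAt (E m) c).symm) y :=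
  ((h.contMDiffAt (hU.mem_nhds hyU)).comp y (contMDiffAt_chart_symm hy)).contDiffAt

end ClosedEquivariantForms

end TwistedDH
end

open scoped Manifold ContDiff Topology
noncomputable section
namespace TwistedDH

/-! ### Smooth families of covectors and integration over a parameter. -/

section SmoothFamiliesOfCovectors

open MeasureTheory

variable {W : Type*} [NormedAddCommGroup W] [NormedSpace ℝ W] {n r : ℕ}

/-- Smoothness of all the homogeneous components. -/
def CDM (b : W → Cov (E n)) (y : W) : Prop := ∀ k, ContDiffAt ℝ ∞ (fun z => b z k) y

lemma contDiffAt_bilin {X Y Z : Type*} [NormedAddCommGroup X] [NormedSpace ℝ X]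
    [NormedAddCommGroup Y] [NormedSpace ℝ Y] [NormedAddCommGroup Z] [NormedSpace ℝ Z]
    (B : X →L[ℝ] Y →L[ℝ] Z) {f : W → X} {g : W → Y} {y : W}
    (hf : ContDiffAt ℝ ∞ f y) (hg : ContDiffAt ℝ ∞ g y) :
    ContDiffAt ℝ ∞ (fun z => B (f z) (g z)) y :=
  contDiffWithinAt_bilin (s := Set.univ) B hf.contDiffWithinAt hg.contDiffWithinAt

lemma CDM.mulTwo {s : W → E n [⋀^Fin 2]→L[ℝ] ℝ} {b : W → Cov (E n)} {y : W}
    (hs : ContDiffAt ℝ ∞ s y) (hb : CDM b y) : CDM (fun z => TwistedDH.mulTwo (s z) (b z)) y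
  | 0 => by simp only [mulTwo_of_lt_two _ _ (Nat.zero_lt_two)]; exact contDiffAt_const
  | 1 => by simp only [mulTwo_of_lt_two _ _ (Nat.one_lt_two)]; exact contDiffAt_const
  | k + 2 => by
    simp only [mulTwo_succ_succ]
    exact contDiffAt_bilin (wedgeCL (V := E n) (Nat.add_comm 2 k)) hs (hb k)

lemma CDM.mulTwo_pow {s : W → E n [⋀^Fin 2]→L[ℝ] ℝ} {b : W → Cov (E n)} {y : W}
    (hs : ContDiffAt ℝ ∞ s y) (hb : CDM b y) (p : ℕ) :
    CDM (fun z => (TwistedDH.mulTwo (s z) ^ p) (b z)) y := by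
  induction p with
  | zero => exact hb
  | succ p ih =>
    simp only [mulTwo_pow_succ]
    exact CDM.mulTwo hs ih

lemma CDM.extMulM {l : W → E n →L[ℝ] ℝ} {b : W → Cov (E n)} {y : W}
    (hl : ContDiffAt ℝ ∞ l y) (hb : CDM b y) : CDM (fun z => TwistedDH.extMulM (l z) (b z)) y
  | 0 => contDiffAt_const
  | k + 1 => by
    simp only [extMulM_succ]
    exact contDiffAt_bilin (extMulCL (V := E n) k) hl (hb k)

lemma CDM.smul {f : W → ℝ} {b : W → Cov (E n)} {y : W} (hf : ContDiffAt ℝ ∞ f y)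
    (hb : CDM b y) : CDM (fun z => f z • b z) y := fun k => hf.smul (hb k)

lemma CDM.sum {ι : Type*} {s : Finset ι} {b : ι → W → Cov (E n)} {y : W}
    (hb : ∀ i ∈ s, CDM (b i) y) : CDM (fun z => ∑ i ∈ s, b i z) y := fun k => by
  simp only [Finset.sum_apply]
  exact ContDiffAt.sum fun i hi => hb i hi k

lemma CDM.mulExp {s : W → E n [⋀^Fin 2]→L[ℝ] ℝ} {b : W → Cov (E n)} {y : W}
    (hs : ContDiffAt ℝ ∞ s y) (hb : CDM b y) :
    CDM (fun z => TwistedDH.mulExp (s z) (b z)) y := by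
  simp only [mulExp_apply]
  exact CDM.sum fun p _ => CDM.smul contDiffAt_const (hb.mulTwo_pow hs p)

lemma CDM.twistSum {S : Finset (Fin r →₀ ℕ)} {f : W → E r →L[ℝ] ℝ}
    {N : (Fin r →₀ ℕ) → W → Cov (E n)} {φ : (E r →L[ℝ] ℝ) → ℝ} {y : W} (hφ : ContDiff ℝ ∞ φ)
    (hf : ContDiffAt ℝ ∞ f y) (hN : ∀ a ∈ S, CDM (N a) y) :
    CDM (TwistedDH.twistSum S f N φ) y :=
  CDM.sum fun a ha => CDM.smul ((contDiff_multiD a hφ).contDiffAt.comp y hf) (hN a ha)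

lemma cdm_mulExp_segment {φ : (E r →L[ℝ] ℝ) → ℝ} (hφ : ContDiff ℝ ∞ φ)
    (s₀ s₁ : E n [⋀^Fin 2]→L[ℝ] ℝ) (ξ₀ ξ₁ : E r →L[ℝ] ℝ) (S : Finset (Fin r →₀ ℕ))
    (N : (Fin r →₀ ℕ) → Cov (E n)) (t : ℝ) :
    CDM (fun t : ℝ => TwistedDH.mulExp ((1 - t) • s₀ + t • s₁) (TwistedDH.twistSum S
      (fun t => (1 - t) • ξ₀ + t • ξ₁) (fun a _ => N a) φ t)) t := by
  have hs : ContDiffAt ℝ ∞ (fun s : ℝ => 1 - s) t := contDiffAt_const.sub contDiffAt_id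
  exact CDM.mulExp ((hs.smul contDiffAt_const).add (contDiffAt_id.smul contDiffAt_const))
    (CDM.twistSum hφ ((hs.smul contDiffAt_const).add (contDiffAt_id.smul contDiffAt_const))
      fun a _ k => contDiffAt_const)

lemma CDM.comp {W' : Type*} [NormedAddCommGroup W'] [NormedSpace ℝ W'] {b : W → Cov (E n)}
    {f : W' → W} {y : W'} (hb : CDM b (f y)) (hf : ContDiffAt ℝ ∞ f y) :
    CDM (fun z => b (f z)) y := fun k => (hb k).comp y hf

lemma smoothFamily_of_contDiffAt {N F : Type} [NormedAddCommGroup N] [NormedSpace ℝ N]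
    [NormedAddCommGroup F] [NormedSpace ℝ F] {V : Set N} {f : ℝ → N → F}
    (h : ∀ t, ∀ y ∈ V, ContDiffAt ℝ ∞ (fun q : ℝ × N => f q.1 q.2) (t, y)) :
    SmoothFamily (H := ℝ) V f := by
  rintro ⟨t, y⟩ ⟨-, hy⟩
  have h1 : ContMDiff (𝓘(ℝ, ℝ).prod 𝓘(ℝ, N)) 𝓘(ℝ, ℝ × N) ∞ (fun q : ℝ × N => (q.1, q.2)) :=
    contMDiff_fst.prodMk_space contMDiff_snd
  exact ((h t y hy).contMDiffAt.comp (f := fun q : ℝ × N => (q.1, q.2)) (t, y)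
    h1.contMDiffAt).contMDiffWithinAt

/-- The exterior derivative is a continuous linear function of the Fréchet derivative, which may be
taken under the integral. -/
lemma extDerivM_integral {V : Set (E n)} (hV : IsOpen V) {B : ℝ → E n → Cov (E n)}
    (hB : ∀ k, SmoothFamily (H := ℝ) V fun t y => B t y k) {y : E n} (hy : y ∈ V) (k : ℕ) :
    extDerivM (fun z k => ∫ t in Set.Icc 0 1, B t z k) y k =
      ∫ t in Set.Icc (0 : ℝ) 1, extDerivM (B t) y k := by
  cases k with
  | zero => simp only [extDerivM_zero, integral_zero]
  | succ k =>
    simp only [extDerivM_succ]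
    have h1 := (hB k).hasFDerivAt_integral (ν := volume) (isCompact_Icc (a := (0 : ℝ)) (b := 1))
      hV hy
    have h2 := ((hB k).fderiv hV).integrableOn (ν := volume)
      (isCompact_Icc (a := (0 : ℝ)) (b := 1)) hy
    rw [extDeriv, h1.fderiv]
    exact ((ContinuousAlternatingMap.alternatizeUncurryFinCLM ℝ (E n) ℝ
      (n := k)).integral_comp_comm h2).symm

lemma compM_extMulM {n' : ℕ} (f : E n' →L[ℝ] E n) (l : E n →L[ℝ] ℝ) (b : Cov (E n)) :
    compM f (extMulM l b) = extMulM (l.comp f) (compM f b) := by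
  funext k
  cases k with
  | zero => rfl
  | succ k =>
    rw [extMulM_succ, compM_apply, extMulM_succ]
    ext u
    rw [ContinuousAlternatingMap.compContinuousLinearMap_apply, extMul_apply, extMul_apply]
    rfl

end SmoothFamiliesOfCovectors

/-! ### Integrating the variation formula along a segment. -/

section Homotopy

open MeasureTheory

variable {r m : ℕ} {G : Type*} [TopologicalSpace G] [ChartedSpace (E r) G] [Group G]
  [LieGroup (𝓡 r) ∞ G]
  {M : Type*} [TopologicalSpace M] [ChartedSpace (E m) M] [IsManifold (𝓡 m) ∞ M]
  [MulAction G M] [ContMDiffSMul (𝓡 r) (𝓡 m) ∞ G M]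

omit [IsManifold (𝓡 m) ∞ M] in
lemma chartRepM_self (α : MForm m M) (x : M) (k : ℕ) [IsManifold (𝓡 m) ∞ M] :
    chartRepM x α (chartAt (E m) x x) k = α k x := chartRep_self (α k) x

lemma cdm_chartRepM {U : Set M} (hU : IsOpen U) {α : MForm m M}
    (hα : ∀ k, SmoothFormOn U (α k)) {c : M} {y : E m} (hy : y ∈ (chartAt (E m) c).target)
    (hyU : (chartAt (E m) c).symm y ∈ U) : CDM (chartRepM c α) y := fun k =>
  (hα k).contDiffAt hU hy hyU

omit [LieGroup (𝓡 r) ∞ G] [ContMDiffSMul (𝓡 r) (𝓡 m) ∞ G M] in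
lemma cdm_dhForm {U : Set M} (hU : IsOpen U) {σ : DForm m 2 M} {Φ : M → E r →L[ℝ] ℝ}
    (h : IsHamiltonian G U σ Φ) {η : EForm r m M} (hη : ∀ a k, SmoothFormOn U (η a k))
    {φ : (E r →L[ℝ] ℝ) → ℝ} (hφ : ContDiff ℝ ∞ φ) {c : M} {y : E m}
    (hy : y ∈ (chartAt (E m) c).target) (hyU : (chartAt (E m) c).symm y ∈ U) :
    CDM (chartRepM c (dhForm σ Φ η φ)) y := by
  have h1 : CDM (fun y => mulExp (chartRep c σ y) (twistSum η.support
      (Φ ∘ (chartAt (E m) c).symm) (fun a => chartRepM c (η a)) φ y)) y :=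
    CDM.mulExp (h.smooth_form.contDiffAt hU hy hyU) (CDM.twistSum hφ
      (contDiffAt_moment_chart hU h.smooth_map hy hyU) fun a _ => cdm_chartRepM hU (hη a) hy hyU)
  exact fun k => (h1 k).congr_of_eventuallyEq (Filter.Eventually.of_forall fun z =>
    congrFun (chartRepM_dhForm σ Φ η φ c z) k)

omit [LieGroup (𝓡 r) ∞ G] [ContMDiffSMul (𝓡 r) (𝓡 m) ∞ G M] in
lemma smoothFormOn_dhForm {U : Set M} (hU : IsOpen U) {σ : DForm m 2 M} {Φ : M → E r →L[ℝ] ℝ}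
    (h : IsHamiltonian G U σ Φ) {η : EForm r m M} (hη : ∀ a k, SmoothFormOn U (η a k))
    {φ : (E r →L[ℝ] ℝ) → ℝ} (hφ : ContDiff ℝ ∞ φ) (k : ℕ) :
    SmoothFormOn U (dhForm σ Φ η φ k) := fun _ _ hy =>
  (cdm_dhForm hU h hη hφ hy.1 hy.2 k).contDiffWithinAt

/-- The primitive of the variation of `e^σ D_{η,Φ}(φ)` along a segment. -/
def homotopyForm (σ₀ σ₁ : DForm m 2 M) (Φ₀ Φ₁ : M → E r →L[ℝ] ℝ) (η : EForm r m M)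
    (φ : (E r →L[ℝ] ℝ) → ℝ) (γ : DForm m 1 M) : MForm m M := fun k x =>
  (∫ t in Set.Icc (0 : ℝ) 1, extMulM (covOf (γ x : E m [⋀^Fin 1]→L[ℝ] ℝ))
    (fun k => (dhForm (segForm σ₀ σ₁ t) (segMap Φ₀ Φ₁ t) η φ k x : E m [⋀^Fin k]→L[ℝ] ℝ)) k :
      E m [⋀^Fin k]→L[ℝ] ℝ)

variable {σ₀ σ₁ : DForm m 2 M} {Φ₀ Φ₁ : M → E r →L[ℝ] ℝ} {η : EForm r m M}
  {φ : (E r →L[ℝ] ℝ) → ℝ} {γ : DForm m 1 M}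

omit [IsManifold (𝓡 m) ∞ M] in
-- For the primitive to have compact support it is not enough to know the two endpoints: the whole
-- segment of values has to avoid the support of `φ`.
lemma homotopyForm_eq_zero {x : M} (h : ∀ t ∈ Set.Icc (0 : ℝ) 1, segMap Φ₀ Φ₁ t x ∉ tsupport φ)
    (k : ℕ) : homotopyForm σ₀ σ₁ Φ₀ Φ₁ η φ γ k x = 0 := by
  refine setIntegral_eq_zero_of_forall_eq_zero (X := ℝ) (E := E m [⋀^Fin k]→L[ℝ] ℝ) fun t ht => ?_
  have : (fun k => (dhForm (segForm σ₀ σ₁ t) (segMap Φ₀ Φ₁ t) η φ k x :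
      E m [⋀^Fin k]→L[ℝ] ℝ) : Cov (E m)) = 0 := funext fun k => dhForm_eq_zero (h t ht) k
  exact congrFun ((congrArg (extMulM _) this).trans (map_zero _)) k

/-- The coordinate expression of the integrand of `homotopyForm`. -/
def homotopyRep (σ₀ σ₁ : DForm m 2 M) (Φ₀ Φ₁ : M → E r →L[ℝ] ℝ) (η : EForm r m M)
    (φ : (E r →L[ℝ] ℝ) → ℝ) (γ : DForm m 1 M) (c : M) (t : ℝ) (y : E m) : Cov (E m) :=
  extMulM (covOf (chartRep c γ y)) (mulExp (chartRep c (segForm σ₀ σ₁ t) y)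
    (twistSum η.support (segMap Φ₀ Φ₁ t ∘ (chartAt (E m) c).symm) (fun a => chartRepM c (η a)) φ y))

omit [IsManifold (𝓡 m) ∞ M] in
lemma contDiffAt_dhForm_segment (hφ : ContDiff ℝ ∞ φ) (x : M) (t : ℝ) :
    CDM (fun t => (fun k => (dhForm (segForm σ₀ σ₁ t) (segMap Φ₀ Φ₁ t) η φ k x :
      E m [⋀^Fin k]→L[ℝ] ℝ) : Cov (E m))) t := by
  have h1 : ∀ s, (fun k => (dhForm (segForm σ₀ σ₁ s) (segMap Φ₀ Φ₁ s) η φ k x :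
      E m [⋀^Fin k]→L[ℝ] ℝ) : Cov (E m)) = mulExp ((1 - s) • (σ₀ x : E m [⋀^Fin 2]→L[ℝ] ℝ) +
        s • (σ₁ x : E m [⋀^Fin 2]→L[ℝ] ℝ)) (twistSum η.support
        (fun s => (1 - s) • Φ₀ x + s • Φ₁ x) (fun a _ => (fun k => η a k x : Cov (E m))) φ s) :=
    fun s => funext fun k => dhForm_apply _ _ _ _ _ _
  exact fun k => (cdm_mulExp_segment hφ _ _ _ _ _ _ t k).congr_of_eventuallyEq
    (Filter.Eventually.of_forall fun s => congrFun (h1 s) k)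

omit [IsManifold (𝓡 m) ∞ M] in
lemma chartRepM_homotopyForm (hφ : ContDiff ℝ ∞ φ) (c : M) (y : E m) (k : ℕ) :
    chartRepM c (homotopyForm σ₀ σ₁ Φ₀ Φ₁ η φ γ) y k =
      ∫ t in Set.Icc (0 : ℝ) 1, homotopyRep σ₀ σ₁ Φ₀ Φ₁ η φ γ c t y k := by
  let f : E m →L[ℝ] E m := mfderiv (𝓡 m) (𝓡 m) (chartAt (E m) c).symm y
  set x := (chartAt (E m) c).symm y with hx
  let T : (E m [⋀^Fin k]→L[ℝ] ℝ) →L[ℝ] E m [⋀^Fin k]→L[ℝ] ℝ := LinearMap.toContinuousLinearMap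
    { toFun := fun a => a.compContinuousLinearMap f
      map_add' := fun _ _ => rfl
      map_smul' := fun _ _ => rfl }
  let B : ℝ → Cov (E m) := fun t =>
    (fun k => (dhForm (segForm σ₀ σ₁ t) (segMap Φ₀ Φ₁ t) η φ k x : E m [⋀^Fin k]→L[ℝ] ℝ))
  have hB : ∀ t, CDM (fun t => extMulM (covOf (γ x : E m [⋀^Fin 1]→L[ℝ] ℝ)) (B t)) t := fun t =>
    CDM.extMulM contDiffAt_const (contDiffAt_dhForm_segment hφ x t)
  have hi : IntegrableOn (fun t => extMulM (covOf (γ x : E m [⋀^Fin 1]→L[ℝ] ℝ)) (B t) k)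
      (Set.Icc 0 1) volume :=
    ContinuousOn.integrableOn_compact isCompact_Icc
      (continuous_iff_continuousAt.mpr fun t => (hB t k).continuousAt).continuousOn
  refine (T.integral_comp_comm hi).symm.trans (integral_congr_ae (Filter.Eventually.of_forall
    fun t => ?_))
  have h1 := congrFun (compM_extMulM f (covOf (γ x : E m [⋀^Fin 1]→L[ℝ] ℝ)) (B t)) k
  have h2 : (covOf (γ x : E m [⋀^Fin 1]→L[ℝ] ℝ)).comp f = covOf (chartRep c γ y) := by
    ext w
    exact congrArg (γ x : E m [⋀^Fin 1]→L[ℝ] ℝ) (funext fun i => by fin_cases i; rfl)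
  have h3 : compM f (B t) = mulExp (chartRep c (segForm σ₀ σ₁ t) y)
    (twistSum η.support (segMap Φ₀ Φ₁ t ∘ (chartAt (E m) c).symm) (fun a => chartRepM c (η a)) φ y) :=
    chartRepM_dhForm _ _ _ _ c y
  exact h1.trans (congrFun (congrArg₂ (fun (l : E m →L[ℝ] ℝ) (b : Cov (E m)) => extMulM l b)
    h2 h3) k)

omit [LieGroup (𝓡 r) ∞ G] [ContMDiffSMul (𝓡 r) (𝓡 m) ∞ G M] in
lemma smoothFamily_homotopyRep {U : Set M} (hU : IsOpen U) (h₀ : IsHamiltonian G U σ₀ Φ₀)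
    (h₁ : IsHamiltonian G U σ₁ Φ₁) (hη : ∀ a k, SmoothFormOn U (η a k)) (hφ : ContDiff ℝ ∞ φ)
    (hγ : SmoothFormOn U γ) (c : M) (k : ℕ) :
    SmoothFamily (H := ℝ) ((chartAt (E m) c).target ∩ (chartAt (E m) c).symm ⁻¹' U)
      fun t y => homotopyRep σ₀ σ₁ Φ₀ Φ₁ η φ γ c t y k := by
  refine smoothFamily_of_contDiffAt fun t y hy => ?_
  have hs : ContDiffAt ℝ ∞ (fun q : ℝ × E m => 1 - q.1) (t, y) := contDiffAt_const.sub contDiffAt_fst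
  have hf : ContDiffAt ℝ ∞ (fun q : ℝ × E m => q.1) (t, y) := contDiffAt_fst
  have hsnd : ContDiffAt ℝ ∞ (fun q : ℝ × E m => q.2) (t, y) := contDiffAt_snd
  have hc : ∀ {F : Type} [NormedAddCommGroup F] [NormedSpace ℝ F] {g : E m → F},
      ContDiffAt ℝ ∞ g y → ContDiffAt ℝ ∞ (fun q : ℝ × E m => g q.2) (t, y) := fun hg =>
    ContDiffAt.comp (t, y) hg hsnd
  have hγ' : ContDiffAt ℝ ∞ (fun y => covOf (chartRep c γ y)) y :=
    (covOfCL (E m)).contDiff.contDiffAt.comp y (hγ.contDiffAt hU hy.1 hy.2)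
  have hN : ∀ a ∈ η.support, CDM (fun q : ℝ × E m => chartRepM c (η a) q.2) (t, y) := fun a _ =>
    CDM.comp (f := fun q : ℝ × E m => q.2) (cdm_chartRepM hU (hη a) hy.1 hy.2) hsnd
  exact CDM.extMulM (hc hγ') (CDM.mulExp
    ((hs.smul (hc (h₀.smooth_form.contDiffAt hU hy.1 hy.2))).add
      (hf.smul (hc (h₁.smooth_form.contDiffAt hU hy.1 hy.2))))
    (CDM.twistSum hφ ((hs.smul (hc (contDiffAt_moment_chart hU h₀.smooth_map hy.1 hy.2))).add
      (hf.smul (hc (contDiffAt_moment_chart hU h₁.smooth_map hy.1 hy.2)))) hN)) k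

omit [LieGroup (𝓡 r) ∞ G] [ContMDiffSMul (𝓡 r) (𝓡 m) ∞ G M] in
lemma smoothFormOn_homotopyForm {U : Set M} (hU : IsOpen U) (h₀ : IsHamiltonian G U σ₀ Φ₀)
    (h₁ : IsHamiltonian G U σ₁ Φ₁) (hη : ∀ a k, SmoothFormOn U (η a k)) (hφ : ContDiff ℝ ∞ φ)
    (hγ : SmoothFormOn U γ) (k : ℕ) :
    SmoothFormOn U (homotopyForm σ₀ σ₁ Φ₀ Φ₁ η φ γ k) := fun c =>
  ((smoothFamily_homotopyRep hU h₀ h₁ hη hφ hγ c k).contDiffOn_integral (ν := volume)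
    (isCompact_Icc (a := (0 : ℝ)) (b := 1))
      ((chartAt (E m) c).isOpen_inter_preimage_symm hU)).congr fun y _ =>
    chartRepM_homotopyForm hφ c y k

/-- The coordinate expression of `e^σ D_{η,Φ}(φ)` in top degree, along a segment. -/
def segmentRep (σ₀ σ₁ : DForm m 2 M) (Φ₀ Φ₁ : M → E r →L[ℝ] ℝ) (η : EForm r m M)
    (φ : (E r →L[ℝ] ℝ) → ℝ) (c : M) (y : E m) (t : ℝ) : Cov (E m) :=
  mulExp ((1 - t) • chartRep c σ₀ y + t • chartRep c σ₁ y) (twistSum η.support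
    (fun t : ℝ => (1 - t) • Φ₀ ((chartAt (E m) c).symm y) + t • Φ₁ ((chartAt (E m) c).symm y))
    (fun a _ => chartRepM c (η a) y) φ t)

/-- For every `t` the structure at parameter `t` is again Hamiltonian, so `derivM_homotopy_top`
applies to it with `s = σ_t` and `f = Φ_t`. The velocity of the segment is `dγ` on the form and
minus the contraction with `γ` on the moment map, independently of `t`. -/
lemma hasDerivAt_segmentRep {U : Set M} (hU : IsOpen U) (h₀ : IsHamiltonian G U σ₀ Φ₀)
    (h₁ : IsHamiltonian G U σ₁ Φ₁) (hη : ∀ a k, SmoothFormOn U (η a k))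
    (hcl : ∀ (X : E r) (k : ℕ), ∀ x ∈ U, dG G η X k x = 0) (hφ : ContDiff ℝ ∞ φ)
    (hγ : SmoothFormOn U γ) (hσ : ∀ x ∈ U, σ₁ x = σ₀ x + extd γ x)
    (hΦ : ∀ x ∈ U, Φ₁ x = Φ₀ x - contract G γ x) {c : M} {y : E m}
    (hy : y ∈ (chartAt (E m) c).target) (hyU : (chartAt (E m) c).symm y ∈ U) (t : ℝ) :
    HasDerivAt (fun t => segmentRep σ₀ σ₁ Φ₀ Φ₁ η φ c y t m)
      (extDerivM (homotopyRep σ₀ σ₁ Φ₀ Φ₁ η φ γ c t) y m) t := by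
  have hS : HasDerivAt (fun t : ℝ => (1 - t) • chartRep c σ₀ y + t • chartRep c σ₁ y)
      (extDeriv (chartRep c γ) y) t := by
    have e1 : chartRep c σ₁ y = chartRep c σ₀ y + extDeriv (chartRep c γ) y := by
      rw [← chartRep_extd hU hγ hy hyU]
      exact chartRep_congr_apply (τ := σ₀ + extd γ) (hσ _ hyU)
    have e2 : (fun t : ℝ => (1 - t) • chartRep c σ₀ y + t • chartRep c σ₁ y) =
        fun t => chartRep c σ₀ y + t • extDeriv (chartRep c γ) y := by
      funext t
      rw [e1]
      module
    rw [e2]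
    simpa using ((hasDerivAt_id t).smul_const (extDeriv (chartRep c γ) y)).const_add
      (chartRep c σ₀ y)
  have hF : HasDerivAt (fun t : ℝ => (1 - t) • Φ₀ ((chartAt (E m) c).symm y) +
      t • Φ₁ ((chartAt (E m) c).symm y)) (- contract G γ ((chartAt (E m) c).symm y)) t := by
    have e2 : (fun t : ℝ => (1 - t) • Φ₀ ((chartAt (E m) c).symm y) +
        t • Φ₁ ((chartAt (E m) c).symm y)) = fun t => Φ₀ ((chartAt (E m) c).symm y) +
          t • (- contract G γ ((chartAt (E m) c).symm y)) := by
      funext t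
      rw [hΦ _ hyU]
      module
    rw [e2]
    simpa using ((hasDerivAt_id t).smul_const
      (- contract G γ ((chartAt (E m) c).symm y))).const_add (Φ₀ ((chartAt (E m) c).symm y))
  have ht := h₀.segment hU h₁ t
  have e1 := derivM_homotopy_top (S := η.support) (N := fun a => chartRepM c (η a)) (y := y)
    (f := segMap Φ₀ Φ₁ t ∘ (chartAt (E m) c).symm) (s := chartRep c (segForm σ₀ σ₁ t))
    (ξ := fun i => vecRep G c (coordVec i) y) hφ
    ((contDiffAt_moment_chart hU ht.smooth_map hy hyU).differentiableAt (by simp))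
    (fun a _ => diffM_chartRepM hU (hη a) hy hyU)
    ((ht.smooth_form.contDiffAt hU hy hyU).differentiableAt (by simp))
    (by
      rw [← chartRep_extd hU ht.smooth_form hy hyU]
      exact chartRep_eq_zero (ht.closed _ hyU))
    (fun i w => ht.hamilton_chart hU hy hyU _ w)
    (fun X => by
      rw [← chartRepM_dG hU hη X hy hyU]
      exact funext fun k => chartRep_eq_zero (hcl X k _ hyU))
    ((hγ.contDiffAt hU hy hyU).differentiableAt (by simp))
    (fun i => by
      rw [← apply_sharp_chart hy, ← contract_apply]
      rfl)
    hS rfl hF rfl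
  have hD : CDM (segmentRep σ₀ σ₁ Φ₀ Φ₁ η φ c y) t := cdm_mulExp_segment hφ _ _ _ _ _ _ t
  have e2 := ((hD m).differentiableAt (by simp)).hasDerivAt
  rw [← fderiv_apply_one_eq_deriv] at e2
  exact (congrArg (fun b => HasDerivAt (fun t => segmentRep σ₀ σ₁ Φ₀ Φ₁ η φ c y t m) b t) e1).mp e2

/-- The fundamental theorem of calculus in `t`, after `d` is moved under the integral. -/
lemma segmentRep_sub {U : Set M} (hU : IsOpen U) (h₀ : IsHamiltonian G U σ₀ Φ₀)
    (h₁ : IsHamiltonian G U σ₁ Φ₁) (hη : ∀ a k, SmoothFormOn U (η a k))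
    (hcl : ∀ (X : E r) (k : ℕ), ∀ x ∈ U, dG G η X k x = 0) (hφ : ContDiff ℝ ∞ φ)
    (hγ : SmoothFormOn U γ) (hσ : ∀ x ∈ U, σ₁ x = σ₀ x + extd γ x)
    (hΦ : ∀ x ∈ U, Φ₁ x = Φ₀ x - contract G γ x) {c : M} {y : E m}
    (hy : y ∈ (chartAt (E m) c).target) (hyU : (chartAt (E m) c).symm y ∈ U) :
    chartRepM c (extdM (homotopyForm σ₀ σ₁ Φ₀ Φ₁ η φ γ)) y m =
      segmentRep σ₀ σ₁ Φ₀ Φ₁ η φ c y 1 m - segmentRep σ₀ σ₁ Φ₀ Φ₁ η φ c y 0 m := by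
  have key := hasDerivAt_segmentRep hU h₀ h₁ hη hcl hφ hγ hσ hΦ hy hyU
  have h5 : chartRepM c (extdM (homotopyForm σ₀ σ₁ Φ₀ Φ₁ η φ γ)) y m =
      ∫ t in Set.Icc (0 : ℝ) 1, extDerivM (homotopyRep σ₀ σ₁ Φ₀ Φ₁ η φ γ c t) y m := by
    rw [← extDerivM_integral ((chartAt (E m) c).isOpen_inter_preimage_symm hU)
      (smoothFamily_homotopyRep hU h₀ h₁ hη hφ hγ c) ⟨hy, hyU⟩,
      chartRepM_extdM hU (smoothFormOn_homotopyForm hU h₀ h₁ hη hφ hγ) hy hyU]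
    exact congrArg (fun b => extDerivM b y m) (funext fun z => funext fun k =>
      chartRepM_homotopyForm hφ c z k)
  rw [h5, integral_Icc_eq_integral_Ioc, ← intervalIntegral.integral_of_le zero_le_one]
  refine intervalIntegral.integral_eq_sub_of_hasDerivAt (fun t _ => key t) ?_
  refine ContinuousOn.intervalIntegrable ?_
  have e : (fun t => extDerivM (homotopyRep σ₀ σ₁ Φ₀ Φ₁ η φ γ c t) y m) =
      deriv (fun t => segmentRep σ₀ σ₁ Φ₀ Φ₁ η φ c y t m) := funext fun t => (key t).deriv.symm
  rw [e]
  have : ContDiff ℝ ∞ (fun t => segmentRep σ₀ σ₁ Φ₀ Φ₁ η φ c y t m) :=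
    contDiff_iff_contDiffAt.mpr fun t => cdm_mulExp_segment hφ _ _ _ _ _ _ t m
  exact (this.continuous_deriv (by simp)).continuousOn

omit [IsManifold (𝓡 m) ∞ M] in
lemma segmentRep_one (c : M) (y : E m) :
    segmentRep σ₀ σ₁ Φ₀ Φ₁ η φ c y 1 = chartRepM c (dhForm σ₁ Φ₁ η φ) y := by
  rw [chartRepM_dhForm, segmentRep]
  simp [twistSum]

omit [IsManifold (𝓡 m) ∞ M] in
lemma segmentRep_zero (c : M) (y : E m) :
    segmentRep σ₀ σ₁ Φ₀ Φ₁ η φ c y 0 = chartRepM c (dhForm σ₀ Φ₀ η φ) y := by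
  rw [chartRepM_dhForm, segmentRep]
  simp [twistSum]

/-- The top degree part of `e^σ D_{η,Φ}(φ)` changes by an exact form if the equivariant
differential of a `1`-form is added to `σ + Φ`. -/
lemma dhForm_eq_add_extdM {U : Set M} (hU : IsOpen U) (h₀ : IsHamiltonian G U σ₀ Φ₀)
    (h₁ : IsHamiltonian G U σ₁ Φ₁) (hη : ∀ a k, SmoothFormOn U (η a k))
    (hcl : ∀ (X : E r) (k : ℕ), ∀ x ∈ U, dG G η X k x = 0) (hφ : ContDiff ℝ ∞ φ)
    (hγ : SmoothFormOn U γ) (hσ : ∀ x ∈ U, σ₁ x = σ₀ x + extd γ x)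
    (hΦ : ∀ x ∈ U, Φ₁ x = Φ₀ x - contract G γ x) {x : M} (hx : x ∈ U) :
    dhForm σ₁ Φ₁ η φ m x =
      dhForm σ₀ Φ₀ η φ m x + extdM (homotopyForm σ₀ σ₁ Φ₀ Φ₁ η φ γ) m x := by
  have hyU : (chartAt (E m) x).symm (chartAt (E m) x x) ∈ U := by simpa using hx
  have h := segmentRep_sub hU h₀ h₁ hη hcl hφ hγ hσ hΦ (mem_chart_target (E m) x) hyU
  rw [segmentRep_one, segmentRep_zero] at h
  exact (chartRepM_self _ x m).symm.trans ((eq_add_of_sub_eq' h.symm).trans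
    (congrArg₂ (fun a b : E m [⋀^Fin m]→L[ℝ] ℝ => a + b) (chartRepM_self _ x m)
      (chartRepM_self _ x m)))

end Homotopy

end TwistedDH
end

open scoped Manifold ContDiff Topology
noncomputable section
namespace TwistedDH

/-! ### Invariance of the twisted Duistermaat–Heckman integrals. -/

section Invariance

open MeasureTheory

variable {r m : ℕ} {G : Type*} [TopologicalSpace G] [ChartedSpace (E r) G] [Group G]
  [LieGroup (𝓡 r) ∞ G]
  {M : Type*} [TopologicalSpace M] [ChartedSpace (E m) M] [IsManifold (𝓡 m) ∞ M]
  [MulAction G M] [ContMDiffSMul (𝓡 r) (𝓡 m) ∞ G M] [T2Space M] [SecondCountableTopology M]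

variable {μ : DForm m m M} {U L : Set M} {σ₀ σ₁ : DForm m 2 M} {Φ₀ Φ₁ : M → E r →L[ℝ] ℝ}
  {η η₀ η₁ ζ : EForm r m M} {φ : (E r →L[ℝ] ℝ) → ℝ} {γ : DForm m 1 M}

/-- Invariance of twisted Duistermaat–Heckman integrals under homotopies with compact support. -/
theorem DH_eq_of_homotopy (hμ : IsOrientationForm μ) (hU : IsOpen U)
    (h₀ : IsHamiltonian G U σ₀ Φ₀) (h₁ : IsHamiltonian G U σ₁ Φ₁)
    (hη : ∀ a k, SmoothFormOn U (η a k))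
    (hcl : ∀ (X : E r) (k : ℕ), ∀ x ∈ U, dG G η X k x = 0) (hφ : ContDiff ℝ ∞ φ)
    (hγ : SmoothFormOn U γ) (hσ : ∀ x ∈ U, σ₁ x = σ₀ x + extd γ x)
    (hΦ : ∀ x ∈ U, Φ₁ x = Φ₀ x - contract G γ x) (hL : IsCompact L) (hLU : L ⊆ U)
    (hsupp : ∀ x ∈ U, x ∉ L → ∀ t ∈ Set.Icc (0 : ℝ) 1, segMap Φ₀ Φ₁ t x ∉ tsupport φ) :
    DH μ U σ₁ Φ₁ η φ = DH μ U σ₀ Φ₀ η φ := by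
  refine integralOn_eq_of_extdM hμ hU hL hLU (smoothFormOn_dhForm hU h₀ hη hφ m) ?_ ?_
    (smoothFormOn_homotopyForm hU h₀ h₁ hη hφ hγ) ?_
    fun x hx => dhForm_eq_add_extdM hU h₀ h₁ hη hcl hφ hγ hσ hΦ hx
  · intro x hx hxL
    refine dhForm_eq_zero ?_ m
    have := hsupp x hx hxL 0 (by simp)
    simpa [segMap] using this
  · intro x hx hxL
    refine dhForm_eq_zero ?_ m
    have := hsupp x hx hxL 1 (by simp)
    simpa [segMap] using this
  · exact fun k x hx hxL => homotopyForm_eq_zero (hsupp x hx hxL) k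

section

omit [T2Space M] [SecondCountableTopology M]

lemma chartRepM_coeff_eq_zero {a : Fin r →₀ ℕ} (h : a ∉ η.support) (c : M) (y : E m) :
    chartRepM c (η a) y = 0 := by
  rw [Finsupp.notMem_support_iff.mp h]
  rfl

/-- Different equivariant forms have different sets of nonzero coefficients; to compare them, all
sums are extended to one finite set of exponents. -/
lemma twistSum_chartRepM_subset {S : Finset (Fin r →₀ ℕ)} (hS : η.support ⊆ S)
    (f : E m → E r →L[ℝ] ℝ) (c : M) (y : E m) :
    twistSum η.support f (fun a => chartRepM c (η a)) φ y =
      twistSum S f (fun a => chartRepM c (η a)) φ y :=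
  Finset.sum_subset hS fun a _ ha =>
    (congrArg _ (chartRepM_coeff_eq_zero ha c y)).trans (smul_zero _)

lemma chartRepM_eval_subset {S : Finset (Fin r →₀ ℕ)} (hS : η.support ⊆ S) (X : E r) (c : M)
    (y : E m) : chartRepM c (η.eval X) y = ∑ a ∈ S, (∏ i, X i ^ a i) • chartRepM c (η a) y := by
  rw [chartRepM_eval]
  exact Finset.sum_subset hS fun a _ ha => by rw [chartRepM_coeff_eq_zero ha, smul_zero]

lemma extDerivM_coeff_eq_zero {a : Fin r →₀ ℕ} (h : a ∉ η.support) (c : M) (y : E m) :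
    extDerivM (chartRepM c (η a)) y = 0 := by
  have : chartRepM c (η a) = fun _ => 0 := funext fun y => chartRepM_coeff_eq_zero h c y
  rw [this, extDerivM]
  refine Finset.sum_eq_zero fun j _ => ?_
  have h0 : derivM (fun _ : E m => (0 : Cov (E m))) y (coordVec j) = 0 := funext fun k => by
    simp [derivM]
  rw [h0, map_zero]

end

omit [T2Space M] [SecondCountableTopology M] in
lemma chartRepM_dG_subset (hU : IsOpen U) (hη : ∀ a k, SmoothFormOn U (η a k))
    {S : Finset (Fin r →₀ ℕ)} (hS : η.support ⊆ S) (X : E r) {c : M} {y : E m}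
    (hy : y ∈ (chartAt (E m) c).target) (hyU : (chartAt (E m) c).symm y ∈ U) :
    chartRepM c (dG G η X) y =
      ∑ a ∈ S, (∏ i, X i ^ a i) • extDerivM (chartRepM c (η a)) y -
      ∑ i, X i • ∑ a ∈ S, (∏ i, X i ^ a i) •
        interiorL (vecRep G c (coordVec i) y) (chartRepM c (η a) y) := by
  rw [chartRepM_dG hU hη X hy hyU]
  congr 1
  · exact Finset.sum_subset hS fun a _ ha => by rw [extDerivM_coeff_eq_zero ha, smul_zero]
  · refine Finset.sum_congr rfl fun i _ => congrArg _ ?_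
    exact Finset.sum_subset hS fun a _ ha => by
      rw [chartRepM_coeff_eq_zero ha, map_zero, smul_zero]

omit [T2Space M] [SecondCountableTopology M] in
/-- The form `e^σ D_{η,Φ}(φ)` changes by an exact form if an exact form is added to `η`. -/
lemma dhForm_eq_add_extdM_dhForm (hU : IsOpen U) (h₀ : IsHamiltonian G U σ₀ Φ₀)
    (hζ : ∀ a k, SmoothFormOn U (ζ a k))
    (hex : ∀ (X : E r) (k : ℕ), ∀ x ∈ U, η₁.eval X k x = η₀.eval X k x + dG G ζ X k x)
    (hφ : ContDiff ℝ ∞ φ) {x : M} (hx : x ∈ U) :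
    dhForm σ₀ Φ₀ η₁ φ m x = dhForm σ₀ Φ₀ η₀ φ m x + extdM (dhForm σ₀ Φ₀ ζ φ) m x := by
  classical
  obtain ⟨c, hc⟩ : ∃ c, c = x := ⟨x, rfl⟩
  obtain ⟨y, hyx⟩ : ∃ y, y = chartAt (E m) c x := ⟨_, rfl⟩
  have hy : y ∈ (chartAt (E m) c).target := by rw [hyx, hc]; exact mem_chart_target (E m) x
  have hyU : (chartAt (E m) c).symm y ∈ U := by rw [hyx, hc]; simpa using hx
  let S := ζ.support ∪ (η₀.support ∪ η₁.support)
  have hSζ : ζ.support ⊆ S := Finset.subset_union_left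
  have hS0 : η₀.support ⊆ S := Finset.subset_union_left.trans Finset.subset_union_right
  have hS1 : η₁.support ⊆ S := Finset.subset_union_right.trans Finset.subset_union_right
  -- The remainder in the local formula is the difference of the two representatives. The formula
  -- only needs this identity for polynomial maps in `X`, not for single coefficients.
  have hev : ∀ X : E r, chartRepM c (dG G ζ X) y =
      chartRepM c (η₁.eval X) y - chartRepM c (η₀.eval X) y := by
    intro X
    refine eq_sub_of_add_eq' (funext fun k => ?_)
    exact (chartRep_congr_apply (τ := η₀.eval X k + dG G ζ X k) (hex X k _ hyU)).symm
  have e1 := extDerivM_mulExp_twistSum (S := S) (N := fun a => chartRepM c (ζ a)) (y := y)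
    (f := Φ₀ ∘ (chartAt (E m) c).symm) (s := chartRep c σ₀)
    (R := fun a => chartRepM c (η₁ a) y - chartRepM c (η₀ a) y)
    (ξ := fun i => vecRep G c (coordVec i) y) hφ
    ((contDiffAt_moment_chart hU h₀.smooth_map hy hyU).differentiableAt (by simp))
    (fun a _ => diffM_chartRepM hU (hζ a) hy hyU)
    ((h₀.smooth_form.contDiffAt hU hy hyU).differentiableAt (by simp))
    (by
      rw [← chartRep_extd hU h₀.smooth_form hy hyU]
      exact chartRep_eq_zero (h₀.closed _ hyU))
    (fun i w => h₀.hamilton_chart hU hy hyU _ w)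
    (fun X => by
      rw [← chartRepM_dG_subset hU hζ hSζ X hy hyU, hev, chartRepM_eval_subset hS0,
        chartRepM_eval_subset hS1, ← Finset.sum_sub_distrib]
      exact Finset.sum_congr rfl fun a _ => (smul_sub _ _ _).symm)
  have e2 : extDerivM (chartRepM c (dhForm σ₀ Φ₀ ζ φ)) y m =
      chartRepM c (dhForm σ₀ Φ₀ η₁ φ) y m - chartRepM c (dhForm σ₀ Φ₀ η₀ φ) y m := by
    have : chartRepM c (dhForm σ₀ Φ₀ ζ φ) = fun z => mulExp (chartRep c σ₀ z)
        (twistSum S (Φ₀ ∘ (chartAt (E m) c).symm) (fun a => chartRepM c (ζ a)) φ z) :=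
      funext fun z => by rw [chartRepM_dhForm, twistSum_chartRepM_subset hSζ]
    -- In degree `m` the contractions vanish and only the difference of the two integrands is left.
    rw [this, e1, chartRepM_dhForm, chartRepM_dhForm, twistSum_chartRepM_subset hS0,
      twistSum_chartRepM_subset hS1, Pi.add_apply, Finset.sum_apply,
      Finset.sum_eq_zero fun i _ => interiorL_top _ _, zero_add, ← Pi.sub_apply, ← map_sub]
    rw [twistSum, twistSum, ← Finset.sum_sub_distrib]
    simp only [smul_sub]
  have e3 := congrFun (chartRepM_extdM hU (smoothFormOn_dhForm hU h₀ hζ hφ) hy hyU) m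
  have e4 := e3.trans e2
  subst hyx hc
  exact (chartRepM_self _ c m).symm.trans ((eq_add_of_sub_eq' e4.symm).trans
    (congrArg₂ (fun a b : E m [⋀^Fin m]→L[ℝ] ℝ => a + b) (chartRepM_self _ c m)
      (chartRepM_self _ c m)))

/-- Twisted Duistermaat–Heckman integrals depend only on the equivariant cohomology class. -/
theorem DH_eq_of_exact (hμ : IsOrientationForm μ) (hU : IsOpen U)
    (h₀ : IsHamiltonian G U σ₀ Φ₀) (hη₀ : ∀ a k, SmoothFormOn U (η₀ a k))
    (hζ : ∀ a k, SmoothFormOn U (ζ a k))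
    (hex : ∀ (X : E r) (k : ℕ), ∀ x ∈ U, η₁.eval X k x = η₀.eval X k x + dG G ζ X k x)
    (hφ : ContDiff ℝ ∞ φ) (hL : IsCompact L) (hLU : L ⊆ U)
    (hsupp : ∀ x ∈ U, x ∉ L → Φ₀ x ∉ tsupport φ) :
    DH μ U σ₀ Φ₀ η₁ φ = DH μ U σ₀ Φ₀ η₀ φ :=
  integralOn_eq_of_extdM hμ hU hL hLU (smoothFormOn_dhForm hU h₀ hη₀ hφ m)
    (fun x hx hxL => dhForm_eq_zero (hsupp x hx hxL) m)
    (fun x hx hxL => dhForm_eq_zero (hsupp x hx hxL) m)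
    (smoothFormOn_dhForm hU h₀ hζ hφ)
    (fun k x hx hxL => dhForm_eq_zero (hsupp x hx hxL) k)
    fun x hx => dhForm_eq_add_extdM_dhForm hU h₀ hζ hex hφ hx

end Invariance

end TwistedDH
end

open scoped Manifold ContDiff Topology
noncomputable section
namespace TwistedDH

/-! ### Construction of the taming form. -/

section FormsFromCharts

variable {m : ℕ} {M : Type*} [TopologicalSpace M] [ChartedSpace (E m) M]

/-- The form on the domain of the preferred chart at `c` with coordinate expression `a`. -/
def chartForm {k : ℕ} (c : M) (a : E m → E m [⋀^Fin k]→L[ℝ] ℝ) : DForm m k M := fun x =>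
  (a (chartAt (E m) c x)).compContinuousLinearMap
    (mfderiv (𝓡 m) (𝓡 m) (chartAt (E m) c) x : TangentSpace (𝓡 m) x →L[ℝ] E m)

variable [IsManifold (𝓡 m) ∞ M]

lemma smoothFormOn_chartForm {k : ℕ} {c : M} {a : E m → E m [⋀^Fin k]→L[ℝ] ℝ}
    (ha : ContDiffOn ℝ ∞ a (chartAt (E m) c).target) :
    SmoothFormOn (chartAt (E m) c).source (chartForm c a) := by
  intro c' y hy
  have h1 : ∀ z ∈ (chartAt (E m) c').target ∩ (chartAt (E m) c').symm ⁻¹' (chartAt (E m) c).source,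
      chartRep c' (chartForm c a) z =
        (a ((chartAt (E m) c ∘ (chartAt (E m) c').symm) z)).compContinuousLinearMap
          (fderiv ℝ (chartAt (E m) c ∘ (chartAt (E m) c').symm) z) := by
    intro z hz
    have h2 : mfderiv (𝓡 m) (𝓡 m) (chartAt (E m) c ∘ (chartAt (E m) c').symm) z =
        (mfderiv (𝓡 m) (𝓡 m) (chartAt (E m) c) ((chartAt (E m) c').symm z)).comp
          (mfderiv (𝓡 m) (𝓡 m) (chartAt (E m) c').symm z) :=
      mfderiv_comp z ((contMDiffAt_chart hz.2).mdifferentiableAt (by simp))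
        ((contMDiffAt_chart_symm hz.1).mdifferentiableAt (by simp))
    rw [mfderiv_eq_fderiv] at h2
    rw [h2]
    rfl
  have h3 : ContDiffAt ℝ ∞ (chartAt (E m) c ∘ (chartAt (E m) c').symm) y :=
    contDiffAt_chart_comp (contMDiffAt_chart_symm hy.1) hy.2
  have h4 : ContDiffAt ℝ ∞ a ((chartAt (E m) c ∘ (chartAt (E m) c').symm) y) :=
    ha.contDiffAt ((chartAt (E m) c).open_target.mem_nhds ((chartAt (E m) c).map_source hy.2))
  have h5 : ContDiffAt ℝ ∞ (fun z =>
      (a ((chartAt (E m) c ∘ (chartAt (E m) c').symm) z)).compContinuousLinearMap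
          (fderiv ℝ (chartAt (E m) c ∘ (chartAt (E m) c').symm) z)) y :=
    ContDiffWithinAt.compContinuousLinearMap (s := Set.univ) (h4.comp y h3).contDiffWithinAt
      (h3.fderiv_right (m := ∞) (by simp)).contDiffWithinAt
  exact h5.contDiffWithinAt.congr h1 (h1 y hy)

lemma mfderiv_chart_symm_apply {c : M} {y : E m} (hy : y ∈ (chartAt (E m) c).target) (w : E m) :
    (mfderiv (𝓡 m) (𝓡 m) (chartAt (E m) c) ((chartAt (E m) c).symm y) : E m →L[ℝ] E m)
      ((mfderiv (𝓡 m) (𝓡 m) (chartAt (E m) c).symm y : E m →L[ℝ] E m) w) = w := by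
  have h2 : mfderiv (𝓡 m) (𝓡 m) (chartAt (E m) c ∘ (chartAt (E m) c).symm) y =
      (mfderiv (𝓡 m) (𝓡 m) (chartAt (E m) c) ((chartAt (E m) c).symm y)).comp
        (mfderiv (𝓡 m) (𝓡 m) (chartAt (E m) c).symm y) :=
    mfderiv_comp y ((contMDiffAt_chart ((chartAt (E m) c).map_target hy)).mdifferentiableAt
      (by simp)) ((contMDiffAt_chart_symm hy).mdifferentiableAt (by simp))
  have h3 : fderiv ℝ (chartAt (E m) c ∘ (chartAt (E m) c).symm) y = ContinuousLinearMap.id ℝ _ := by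
    have : (chartAt (E m) c ∘ (chartAt (E m) c).symm) =ᶠ[𝓝 y] id := by
      filter_upwards [(chartAt (E m) c).open_target.mem_nhds hy] with z hz
      exact (chartAt (E m) c).right_inv hz
    rw [this.fderiv_eq, fderiv_id]
  rw [mfderiv_eq_fderiv, h3] at h2
  exact (congrArg (fun f : E m →L[ℝ] E m => f w) h2).symm

end FormsFromCharts

section TamingForm

variable {r m : ℕ} {G : Type*} [TopologicalSpace G] [ChartedSpace (E r) G] [Group G]
  [LieGroup (𝓡 r) ∞ G]
  {M : Type*} [TopologicalSpace M] [ChartedSpace (E m) M] [IsManifold (𝓡 m) ∞ M]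
  [MulAction G M] [ContMDiffSMul (𝓡 r) (𝓡 m) ∞ G M]

/-- The `1`-form `⟨V, ·⟩` on `ℝⁿ`. -/
def innerForm {n : ℕ} (V : E n) : E n [⋀^Fin 1]→L[ℝ] ℝ := oneCov (E n) (innerSL ℝ V)

lemma innerForm_apply {n : ℕ} (V : E n) (u : Fin 1 → E n) : innerForm V u = inner ℝ V (u 0) := by
  rw [innerForm, oneCov, extMul_apply]
  simp

lemma contDiffAt_vecRep_taming {v : M → E r} (hv : ContMDiff (𝓡 m) (𝓡 r) ∞ v) (c : M) {y : E m}
    (hy : y ∈ (chartAt (E m) c).target) :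
    ContDiffAt ℝ ∞ (fun y => vecRep G c (v ((chartAt (E m) c).symm y)) y) y := by
  have h : (fun y => vecRep G c (v ((chartAt (E m) c).symm y)) y) = fun y =>
      ∑ i, v ((chartAt (E m) c).symm y) i • vecRep G c (coordVec i) y :=
    funext fun y => vecRep_eq_sum c _ y
  have h1 : ContDiffAt ℝ ∞ (v ∘ (chartAt (E m) c).symm) y :=
    (hv.contMDiffAt.comp y (contMDiffAt_chart_symm hy)).contDiffAt
  rw [h]
  refine ContDiffAt.sum fun i _ => ?_
  have h2 : ContDiffAt ℝ ∞ (fun y => v ((chartAt (E m) c).symm y) i) y :=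
    (coordCov i).contDiff.contDiffAt.comp y h1
  exact h2.smul ((contDiffOn_vecRep (G := G) c (coordVec i)).contDiffAt
    ((chartAt (E m) c).open_target.mem_nhds hy))

variable (G) in
/-- The `1`-form `⟨v♯, ·⟩` for the Euclidean metric in the preferred chart at `c`. -/
def tamingChartForm (v : M → E r) (c : M) : DForm m 1 M :=
  chartForm c fun y => innerForm (vecRep G c (v ((chartAt (E m) c).symm y)) y)

lemma smoothFormOn_tamingChartForm {v : M → E r} (hv : ContMDiff (𝓡 m) (𝓡 r) ∞ v) (c : M) :
    SmoothFormOn (chartAt (E m) c).source (tamingChartForm (m := m) G v c) := by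
  refine smoothFormOn_chartForm fun y hy => ContDiffAt.contDiffWithinAt ?_
  refine contDiffWithinAt_univ.mp (contDiffWithinAt_alternating fun u => ?_)
  simp only [innerForm_apply]
  exact (((contDiffAt_vecRep_taming hv c hy).inner ℝ contDiffAt_const)).contDiffWithinAt

/-- The chart carries `v♯` to its coordinate expression, so the pairing is the Euclidean inner
product of that vector with itself. -/
lemma tamingChartForm_apply_sharp (v : M → E r) {c x : M} (hx : x ∈ (chartAt (E m) c).source) :
    (tamingChartForm (m := m) G v c x : E m [⋀^Fin 1]→L[ℝ] ℝ) ![(sharp G (v x) x : E m)] =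
      ‖vecRep G c (v x) (chartAt (E m) c x)‖ ^ 2 := by
  obtain ⟨y, hy, rfl⟩ : ∃ y ∈ (chartAt (E m) c).target, x = (chartAt (E m) c).symm y :=
    ⟨_, (chartAt (E m) c).map_source hx, ((chartAt (E m) c).left_inv hx).symm⟩
  have h1 := mfderiv_chart_symm_apply hy (vecRep G c (v ((chartAt (E m) c).symm y)) y)
  rw [mfderiv_symm_vecRep hy] at h1
  refine (innerForm_apply _ _).trans ?_
  have h2 := (chartAt (E m) c).right_inv hy
  rw [h2, ← real_inner_self_eq_norm_sq]
  exact congrArg (fun w : E m => inner ℝ (vecRep G c (v ((chartAt (E m) c).symm y)) y) w) h1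

lemma vecRep_eq_zero_iff (X : E r) {c x : M} (hx : x ∈ (chartAt (E m) c).source) :
    vecRep G c X (chartAt (E m) c x) = 0 ↔ sharp G (m := m) X x = 0 := by
  obtain ⟨y, hy, rfl⟩ : ∃ y ∈ (chartAt (E m) c).target, x = (chartAt (E m) c).symm y :=
    ⟨_, (chartAt (E m) c).map_source hx, ((chartAt (E m) c).left_inv hx).symm⟩
  rw [(chartAt (E m) c).right_inv hy]
  have h1 := mfderiv_symm_vecRep (G := G) hy X
  have h2 := mfderiv_chart_symm_apply hy (vecRep G c X y)
  constructor
  · intro h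
    rw [h] at h1
    exact h1.symm.trans (map_zero _)
  · intro h
    rw [h1] at h2
    exact h2.symm.trans ((congrArg _ h).trans (map_zero _))

lemma tamingChartForm_eq_zero {v : M → E r} {c x : M} (hx : x ∈ (chartAt (E m) c).source)
    (h : sharp G (m := m) (v x) x = 0) : tamingChartForm (m := m) G v c x = 0 := by
  have h1 : vecRep G c (v ((chartAt (E m) c).symm (chartAt (E m) c x))) (chartAt (E m) c x) = 0 := by
    rw [(chartAt (E m) c).left_inv hx]
    exact (vecRep_eq_zero_iff _ hx).mpr h
  have h2 : innerForm (vecRep G c (v ((chartAt (E m) c).symm (chartAt (E m) c x)))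
      (chartAt (E m) c x)) = 0 := by
    ext u
    rw [h1, innerForm_apply, inner_zero_left]
    rfl
  exact congrArg (fun a : E m [⋀^Fin 1]→L[ℝ] ℝ => a.compContinuousLinearMap
    (mfderiv (𝓡 m) (𝓡 m) (chartAt (E m) c) x : E m →L[ℝ] E m)) h2

variable [T2Space M] [SecondCountableTopology M]

/-- There is a smooth `1`-form `θ` with `θ(v♯) ≥ 0`, with equality exactly where `v♯` vanishes, that
vanishes at the zeros of `v♯`. -/
lemma exists_tamingForm {v : M → E r} (hv : ContMDiff (𝓡 m) (𝓡 r) ∞ v) :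
    ∃ θ : DForm m 1 M, SmoothFormOn Set.univ θ ∧
      (∀ x, 0 ≤ (θ x : E m [⋀^Fin 1]→L[ℝ] ℝ) ![(sharp G (v x) x : E m)]) ∧
      (∀ x, (θ x : E m [⋀^Fin 1]→L[ℝ] ℝ) ![(sharp G (v x) x : E m)] = 0 →
        x ∈ localizingSet G (m := m) v) ∧
      ∀ x ∈ localizingSet G (m := m) v, θ x = 0 := by
  let ρ := partUnity m M
  let τ : M → DForm m 1 M := fun c => smulForm (ρ c) (tamingChartForm (m := m) G v c)
  have hsupp : ∀ c x, x ∉ tsupport (ρ c) → τ c x = 0 := by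
    intro c x hx
    have : ρ c x = 0 := image_eq_zero_of_notMem_tsupport hx
    exact (congrArg (fun t : ℝ => t • (tamingChartForm (m := m) G v c x : E m [⋀^Fin 1]→L[ℝ] ℝ)) this).trans
      (zero_smul _ _)
  have hτ : ∀ c, SmoothFormOn Set.univ (τ c) := by
    intro c
    refine SmoothFormOn.of_locally fun x _ => ?_
    by_cases hx : x ∈ tsupport (ρ c)
    · exact ⟨(chartAt (E m) c).source, (chartAt (E m) c).open_source, partUnity_subordinate c hx,
        (smoothFormOn_tamingChartForm hv c).smul_partUnity c⟩
    · exact ⟨(tsupport (ρ c))ᶜ, (isClosed_tsupport _).isOpen_compl, hx,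
        SmoothFormOn.zero.congr fun y hy => hsupp c y hy⟩
  let θ : DForm m 1 M := fun x => ∑ᶠ c, (τ c x : E m [⋀^Fin 1]→L[ℝ] ℝ)
  have hfin : ∀ x, (Function.support fun c => (τ c x : E m [⋀^Fin 1]→L[ℝ] ℝ)).Finite := by
    intro x
    refine (ρ.locallyFinite.point_finite x).subset fun c hc => ?_
    intro h0
    exact hc ((congrArg (fun t : ℝ => t • (tamingChartForm (m := m) G v c x : E m [⋀^Fin 1]→L[ℝ] ℝ)) h0).trans
      (zero_smul _ _))
  have hval : ∀ x (u : Fin 1 → E m), (θ x : E m [⋀^Fin 1]→L[ℝ] ℝ) u =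
      ∑ᶠ c, ρ c x * (tamingChartForm (m := m) G v c x : E m [⋀^Fin 1]→L[ℝ] ℝ) u := by
    intro x u
    let T : (E m [⋀^Fin 1]→L[ℝ] ℝ) →+ ℝ :=
      { toFun := fun a => a u
        map_zero' := rfl
        map_add' := fun _ _ => rfl }
    exact T.map_finsum (hfin x)
  -- The local forms carry information only in their charts; elsewhere the cut-off function is zero.
  have hterm : ∀ c x, 0 ≤ ρ c x *
      (tamingChartForm (m := m) G v c x : E m [⋀^Fin 1]→L[ℝ] ℝ) ![(sharp G (v x) x : E m)] := by
    intro c x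
    by_cases hx : x ∈ tsupport (ρ c)
    · rw [tamingChartForm_apply_sharp v (partUnity_subordinate c hx)]
      exact mul_nonneg (ρ.nonneg c x) (sq_nonneg _)
    · rw [image_eq_zero_of_notMem_tsupport hx, zero_mul]
  refine ⟨θ, ?_, ?_, ?_, ?_⟩
  · refine SmoothFormOn.of_locally fun x _ => ?_
    obtain ⟨V, hV, hfV⟩ := ρ.locallyFinite x
    obtain ⟨V', hV'V, hV', hxV'⟩ := mem_nhds_iff.mp hV
    refine ⟨V', hV', hxV', ?_⟩
    have h1 : SmoothFormOn V' (∑ c ∈ hfV.toFinset, τ c) :=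
      Finset.sum_induction _ (fun α : DForm m 1 M => SmoothFormOn V' α)
        (fun _ _ h h' => h.add h') SmoothFormOn.zero fun c _ => (hτ c).mono (Set.subset_univ _)
    refine h1.congr fun y hy => ?_
    have h2 : θ y = ∑ c ∈ hfV.toFinset, (τ c y : E m [⋀^Fin 1]→L[ℝ] ℝ) := by
      refine finsum_eq_sum_of_support_subset _ fun c hc => ?_
      rw [Set.Finite.coe_toFinset]
      refine ⟨y, fun h0 => hc ?_, hV'V hy⟩
      exact (congrArg (fun t : ℝ => t • (tamingChartForm G v c y : E m [⋀^Fin 1]→L[ℝ] ℝ)) h0).trans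
        (zero_smul _ _)
    rw [h2, Finset.sum_apply]
  · intro x
    exact (finsum_nonneg fun c => hterm c x).trans_eq (hval x ![(sharp G (v x) x : E m)]).symm
  · intro x hx
    replace hx := (hval x ![(sharp G (v x) x : E m)]).symm.trans hx
    by_contra hxZ
    -- All terms are nonnegative, so one positive term suffices. Some `ρ c` is positive at `x`, and
    -- in that chart the coordinate vector of `v♯` is nonzero.
    obtain ⟨c, hc⟩ := ρ.exists_pos_of_mem (Set.mem_univ x)
    have hcs : x ∈ (chartAt (E m) c).source :=
      partUnity_subordinate c (subset_tsupport _ hc.ne')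
    have hpos : 0 < ρ c x *
        (tamingChartForm (m := m) G v c x : E m [⋀^Fin 1]→L[ℝ] ℝ) ![(sharp G (v x) x : E m)] := by
      rw [tamingChartForm_apply_sharp v hcs]
      refine mul_pos hc (pow_pos (norm_pos_iff.mpr fun h => hxZ ?_) 2)
      exact (vecRep_eq_zero_iff _ hcs).mp h
    refine (finsum_pos (fun c => hterm c x) ⟨c, hpos⟩ ?_).ne' hx
    refine (ρ.locallyFinite.point_finite x).subset fun c hc h0 => hc ?_
    simp only [h0, zero_mul]
  · intro x hx
    have : ∀ c, (τ c x : E m [⋀^Fin 1]→L[ℝ] ℝ) = 0 := by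
      intro c
      by_cases hxc : x ∈ tsupport (ρ c)
      · exact (congrArg (fun a : E m [⋀^Fin 1]→L[ℝ] ℝ => ρ c x • a)
          (tamingChartForm_eq_zero (partUnity_subordinate c hxc) hx)).trans (smul_zero (A := E m [⋀^Fin 1]→L[ℝ] ℝ) (ρ c x))
      · exact hsupp c x hxc
    exact (finsum_congr this).trans finsum_zero

end TamingForm

end TwistedDH
end

open scoped Manifold ContDiff Topology
noncomputable section
namespace TwistedDH

/-! ### Averaging over the compact group. -/

section Average

open MeasureTheory

variable {r m : ℕ} {G : Type*} [TopologicalSpace G] [ChartedSpace (E r) G] [Group G]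
  [LieGroup (𝓡 r) ∞ G] [T2Space G] [CompactSpace G]
  {M : Type*} [TopologicalSpace M] [ChartedSpace (E m) M] [IsManifold (𝓡 m) ∞ M]
  [MulAction G M] [ContMDiffSMul (𝓡 r) (𝓡 m) ∞ G M]

variable (r m) in
lemma contMDiff_inv_smul_symm (c : M) :
    ContMDiffOn (𝓘(ℝ, E r).prod 𝓘(ℝ, E m)) (𝓡 m) ∞
      (fun q : G × E m => q.1⁻¹ • (chartAt (E m) c).symm q.2)
      (Set.univ ×ˢ (chartAt (E m) c).target) := by
  intro q hq
  have h1 : ContMDiffAt (𝓘(ℝ, E r).prod 𝓘(ℝ, E m)) (𝓡 m) ∞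
      (fun q : G × E m => (chartAt (E m) c).symm q.2) q :=
    (contMDiffAt_chart_symm hq.2).comp q contMDiffAt_snd
  have h2 : ContMDiffAt (𝓘(ℝ, E r).prod 𝓘(ℝ, E m)) (𝓡 r) ∞ (fun q : G × E m => q.1⁻¹) q :=
    ((contMDiff_inv (𝓡 r) ∞).contMDiffAt).comp q contMDiffAt_fst
  exact ((contMDiff_action G M).contMDiffAt.comp q (h2.prodMk h1)).contMDiffWithinAt

lemma pullback_pullback_smul {k : ℕ} (g h : G) (θ : DForm m k M) (x : M) (r : ℕ)
    [ChartedSpace (E r) G] [ContMDiffSMul (𝓡 r) (𝓡 m) ∞ G M] :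
    pullback (fun y => h • y) (pullback (fun y => g • y) θ) x =
      pullback (fun y => (g * h) • y) θ x := by
  have h1 : (fun y : M => (g * h) • y) = (fun y => g • y) ∘ fun y => h • y :=
    funext fun y => mul_smul g h y
  have h2 : mfderiv (𝓡 m) (𝓡 m) ((fun y : M => g • y) ∘ fun y => h • y) x =
      (mfderiv (𝓡 m) (𝓡 m) (fun y : M => g • y) (h • x)).comp
        (mfderiv (𝓡 m) (𝓡 m) (fun y : M => h • y) x) :=
    mfderiv_comp x (mdifferentiableAt_const_smul r g _) (mdifferentiableAt_const_smul r h x)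
  rw [h1]
  exact congrArg (fun f : E m →L[ℝ] E m =>
    (θ (g • h • x) : E m [⋀^Fin k]→L[ℝ] ℝ).compContinuousLinearMap f) h2.symm

lemma pb_smul_eq_chartRep {k : ℕ} (g : G) (θ : DForm m k M) {c : M} {y : E m} (r : ℕ)
    [ChartedSpace (E r) G] [ContMDiffSMul (𝓡 r) (𝓡 m) ∞ G M]
    (hy : y ∈ (chartAt (E m) c).target) :
    pb (fun z => g • (chartAt (E m) c).symm z) θ y =
      chartRep c (pullback (fun y => g • y) θ) y :=
  (pb_pullback (mdifferentiableAt_const_smul r g _)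
    ((contMDiffAt_chart_symm hy).mdifferentiableAt (by simp))).symm

instance : IsManifold 𝓘(ℝ, E r) ∞ G := ContMDiffMul.toIsManifold (I := 𝓡 r) (G := G) (n := ∞)

lemma smoothFamily_pb_smul {k : ℕ} {θ : DForm m k M} (hθ : SmoothFormOn Set.univ θ) (c : M) :
    SmoothFamily (X := G) (H := E r) (chartAt (E m) c).target
      fun g y => pb (fun z => g⁻¹ • (chartAt (E m) c).symm z) θ y := fun q hq =>
  (contMDiffAt_pb_family (H := E r) (f := fun (g : G) z => g⁻¹ • (chartAt (E m) c).symm z)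
    isOpen_univ hθ (isOpen_univ.prod (chartAt (E m) c).open_target)
    (contMDiff_inv_smul_symm r m c) (x := q.1) (y := q.2) hq (Set.mem_univ _)).contMDiffWithinAt

/-- The translates `(g⁻¹)⁎θ` of a form, at the point `x`. -/
def translate {k : ℕ} (θ : DForm m k M) (x : M) (g : G) : E m [⋀^Fin k]→L[ℝ] ℝ :=
  pullback (fun y => g⁻¹ • y) θ x

variable [MeasurableSpace G] [BorelSpace G] (ν : Measure G) [IsFiniteMeasureOnCompacts ν]

/-- The average of the translates of a form. -/
def averageForm {k : ℕ} (θ : DForm m k M) : DForm m k M := fun x =>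
  -- The `id` has no mathematical content: it presents the value as a covector on the model space,
  -- where the integral is formed.
  id (α := E m [⋀^Fin k]→L[ℝ] ℝ) (∫ g in (Set.univ : Set G), translate θ x g ∂ν : E m [⋀^Fin k]→L[ℝ] ℝ)

/-- The pullback of covectors as a continuous linear map. -/
def compCL (k : ℕ) (f : E m →L[ℝ] E m) :
    (E m [⋀^Fin k]→L[ℝ] ℝ) →L[ℝ] E m [⋀^Fin k]→L[ℝ] ℝ := LinearMap.toContinuousLinearMap
  { toFun := fun a => a.compContinuousLinearMap f
    map_add' := fun _ _ => rfl
    map_smul' := fun _ _ => rfl }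

/-- The evaluation of covectors as a continuous linear map. -/
def evalCL {k : ℕ} (u : Fin k → E m) : (E m [⋀^Fin k]→L[ℝ] ℝ) →L[ℝ] ℝ :=
  LinearMap.toContinuousLinearMap
  { toFun := fun a => a u
    map_add' := fun _ _ => rfl
    map_smul' := fun _ _ => rfl }

variable (r)

include r

omit [MeasurableSpace G] [BorelSpace G] in
-- The chart at `x` expresses the translates through a family that is jointly smooth in the group
-- element and the point.
lemma continuous_translate {k : ℕ} {θ : DForm m k M} (hθ : SmoothFormOn Set.univ θ)
    (x : M) : Continuous fun g : G => translate θ x g := by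
  have h1 : (fun g : G => translate θ x g) =
      fun g => pb (fun z => g⁻¹ • (chartAt (E m) x).symm z) θ (chartAt (E m) x x) :=
    funext fun g => ((pb_smul_eq_chartRep g⁻¹ θ r (mem_chart_target (E m) x)).trans
      (chartRep_self _ x)).symm
  have h : SmoothFamily (X := G) (H := E r) (chartAt (E m) x).target
      fun g y => pb (fun z => g⁻¹ • (chartAt (E m) x).symm z) θ y := smoothFamily_pb_smul hθ x
  rw [h1, ← continuousOn_univ]
  exact h.continuousOn.comp
    (f := fun g : G => (g, chartAt (E m) x x)) (by fun_prop)
    fun g hg => ⟨hg, mem_chart_target (E m) x⟩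

lemma map_averageForm {k : ℕ} {θ : DForm m k M} (hθ : SmoothFormOn Set.univ θ) (x : M)
    {F : Type*} [NormedAddCommGroup F] [NormedSpace ℝ F] [CompleteSpace F]
    (T : (E m [⋀^Fin k]→L[ℝ] ℝ) →L[ℝ] F) :
    T (averageForm ν θ x) = ∫ g in (Set.univ : Set G), T (translate θ x g) ∂ν :=
  (T.integral_comp_comm ((continuous_translate r hθ x).continuousOn.integrableOn_compact
    isCompact_univ)).symm

lemma smoothFormOn_averageForm {k : ℕ} {θ : DForm m k M} (hθ : SmoothFormOn Set.univ θ) :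
    SmoothFormOn Set.univ (averageForm ν θ) := by
  intro c
  have h : SmoothFamily (X := G) (H := E r) (chartAt (E m) c).target
      fun g y => pb (fun z => g⁻¹ • (chartAt (E m) c).symm z) θ y := smoothFamily_pb_smul hθ c
  refine ((h.contDiffOn_integral (ν := ν) isCompact_univ
    (chartAt (E m) c).open_target).congr fun y hy => ?_).mono Set.inter_subset_left
  refine (map_averageForm r ν hθ _ (compCL k (mfderiv (𝓡 m) (𝓡 m) (chartAt (E m) c).symm y))).trans
    (integral_congr_ae (Filter.Eventually.of_forall fun g => ?_))
  exact (pb_smul_eq_chartRep g⁻¹ θ r hy).symm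

/-- Pulling back under `h` turns the translate by `g` into the one by `h⁻¹ g`. Because `translate`
uses `g⁻¹`, this is a left translation of the integration variable. -/
lemma invariantFormOn_averageForm [ν.IsMulLeftInvariant] {k : ℕ} {θ : DForm m k M}
    (hθ : SmoothFormOn Set.univ θ) : InvariantFormOn G Set.univ (averageForm ν θ) := by
  have : IsTopologicalGroup G := topologicalGroup_of_lieGroup (𝓡 r) ∞
  intro h x _
  have h1 := map_averageForm r ν hθ (h • x) (compCL k (mfderiv (𝓡 m) (𝓡 m) (fun y => h • y) x))
  have h2 : ∀ g : G, compCL k (mfderiv (𝓡 m) (𝓡 m) (fun y => h • y) x)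
      (translate θ (h • x) g) = translate θ x (h⁻¹ * g) := by
    intro g
    refine (pullback_pullback_smul g⁻¹ h θ x r).trans ?_
    rw [translate, mul_inv_rev, inv_inv]
  simp only [h2, setIntegral_univ] at h1
  exact h1.trans ((integral_mul_left_eq_self (fun g : G => translate θ x g) h⁻¹).trans
    setIntegral_univ.symm)

end Average

section InvariantTamingForm

open MeasureTheory

variable {r m : ℕ} {G : Type*} [TopologicalSpace G] [ChartedSpace (E r) G] [Group G]
  [LieGroup (𝓡 r) ∞ G] [T2Space G] [CompactSpace G]
  {M : Type*} [TopologicalSpace M] [ChartedSpace (E m) M] [IsManifold (𝓡 m) ∞ M]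
  [MulAction G M] [ContMDiffSMul (𝓡 r) (𝓡 m) ∞ G M] [T2Space M] [SecondCountableTopology M]

omit [T2Space G] [CompactSpace G] [T2Space M] [SecondCountableTopology M] in
-- Equivariance of `v` and of `X ↦ X♯` makes `v♯` an invariant vector field. Hence pairings with
-- `v♯` and the zero set of `v♯` are compatible with averaging.
lemma IsTamingMap.mfderiv_sharp {v : M → E r} (hv : IsTamingMap G (m := m) v) (g : G) (x : M) :
    (mfderiv (𝓡 m) (𝓡 m) (fun y : M => g • y) x : E m →L[ℝ] E m) (sharp G (v x) x) =
      (sharp G (v (g • x)) (g • x) : E m) := by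
  rw [hv.equivariant, sharp_Ad]

omit [T2Space G] [CompactSpace G] [T2Space M] [SecondCountableTopology M] in
lemma IsTamingMap.smul_mem {v : M → E r} (hv : IsTamingMap G (m := m) v) (g : G) {x : M}
    (hx : x ∈ localizingSet G (m := m) v) : g • x ∈ localizingSet G (m := m) v :=
  (hv.mfderiv_sharp g x).symm.trans ((congrArg _ hx).trans (map_zero _))

/-- There is an invariant smooth `1`-form `Θ` with `Θ(v♯) ≥ 0`, with equality exactly where `v♯`
vanishes, that vanishes at the zeros of `v♯`. -/
theorem exists_invariant_tamingForm {v : M → E r} (hv : IsTamingMap G (m := m) v) :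
    ∃ Θ : DForm m 1 M, SmoothFormOn Set.univ Θ ∧ InvariantFormOn G Set.univ Θ ∧
      (∀ x, 0 ≤ contract G Θ x (v x)) ∧
      (∀ x, contract G Θ x (v x) = 0 → x ∈ localizingSet G (m := m) v) ∧
      ∀ x ∈ localizingSet G (m := m) v, Θ x = 0 := by
  obtain ⟨θ, hθ, hpos, hzero, hZ⟩ := exists_tamingForm (G := G) hv.smooth
  have : IsTopologicalGroup G := topologicalGroup_of_lieGroup (𝓡 r) ∞
  let : MeasurableSpace G := borel G
  have : BorelSpace G := ⟨rfl⟩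
  let ν : Measure G := Measure.haar
  let p : M → G → ℝ := fun x g => (θ (g⁻¹ • x) : E m [⋀^Fin 1]→L[ℝ] ℝ)
    ![(sharp G (v (g⁻¹ • x)) (g⁻¹ • x) : E m)]
  have hp : ∀ x g, evalCL ![(sharp G (v x) x : E m)] (translate θ x g) = p x g := by
    intro x g
    refine (pullback_one_apply _ θ x _).trans ?_
    exact congrArg (fun w : E m => (θ (g⁻¹ • x) : E m [⋀^Fin 1]→L[ℝ] ℝ) ![w])
      (hv.mfderiv_sharp g⁻¹ x)
  have hw : ∀ x, contract G (averageForm ν θ) x (v x) = ∫ g, p x g ∂ν := by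
    intro x
    have := map_averageForm r ν hθ x (evalCL ![(sharp G (v x) x : E m)])
    simp only [hp, setIntegral_univ] at this
    exact this
  have hc : ∀ x, Continuous (p x) := by
    intro x
    have h4 : p x = fun g => evalCL ![(sharp G (v x) x : E m)] (translate θ x g) :=
      funext fun g => (hp x g).symm
    rw [h4]
    exact (evalCL _).continuous.comp (continuous_translate r hθ x)
  refine ⟨averageForm ν θ, smoothFormOn_averageForm r ν hθ, invariantFormOn_averageForm r ν hθ,
    ?_, ?_, ?_⟩
  · intro x
    rw [hw]
    exact integral_nonneg fun g => hpos _
  · intro x hx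
    rw [hw] at hx
    -- A continuous nonnegative function with vanishing Haar integral is zero, in particular at `1`,
    -- where it is the pairing before averaging.
    have h1 : p x 1 = 0 := by
      by_contra h1
      exact ((hc x).integral_pos_of_hasCompactSupport_nonneg_nonzero (μ := ν)
        (HasCompactSupport.of_compactSpace _) (fun g => hpos _) h1).ne' hx
    refine hzero x ?_
    have h2 : ∀ y, y = x → (θ y : E m [⋀^Fin 1]→L[ℝ] ℝ) ![(sharp G (v y) y : E m)] = 0 →
      (θ x : E m [⋀^Fin 1]→L[ℝ] ℝ) ![(sharp G (v x) x : E m)] = 0 := by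
      rintro y rfl h
      exact h
    exact h2 _ (by rw [inv_one, one_smul]) h1
  · intro x hx
    -- The localizing set is invariant, so all translates of `θ` vanish at its points.
    have h1 : ∀ g : G, translate θ x g = 0 := fun g =>
      congrArg (fun a : E m [⋀^Fin 1]→L[ℝ] ℝ => a.compContinuousLinearMap
        (mfderiv (𝓡 m) (𝓡 m) (fun y : M => g⁻¹ • y) x : E m →L[ℝ] E m))
        (hZ _ (hv.smul_mem g⁻¹ hx))
    exact setIntegral_eq_zero_of_forall_eq_zero (E := E m [⋀^Fin 1]→L[ℝ] ℝ) (t := Set.univ)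
      fun g _ => h1 g

include r in
variable (r) in
/-- An invariant open set is the set where some invariant smooth nonnegative function is positive. -/
theorem exists_invariant_function {U : Set M} (hU : IsOpen U) (hUG : IsInvariant G U) :
    ∃ u : M → ℝ, ContMDiff (𝓡 m) 𝓘(ℝ, ℝ) ∞ u ∧ (∀ (g : G) x, u (g • x) = u x) ∧
      (∀ x, 0 ≤ u x) ∧ (∀ x ∈ U, 0 < u x) ∧ ∀ x ∉ U, u x = 0 := by
  have : LocallyCompactSpace M := Manifold.locallyCompact_of_finiteDimensional (𝓡 m)
  -- The function `f` is positive exactly on `U`, but need not be invariant. As `U` is invariant,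
  -- averaging keeps this property.
  obtain ⟨f, hfU, hf, hf0⟩ := hU.exists_contMDiff_support_eq (𝓡 m) (n := ⊤)
  have : IsTopologicalGroup G := topologicalGroup_of_lieGroup (𝓡 r) ∞
  let : MeasurableSpace G := borel G
  have : BorelSpace G := ⟨rfl⟩
  let ν : Measure G := Measure.haar
  have hc : ∀ x, Continuous fun g : G => f (g⁻¹ • x) := fun x =>
    (hf.comp ((contMDiff_smul_const (r := r) (G := G) x).comp (contMDiff_inv (𝓡 r) ∞))).continuous
  refine ⟨fun x => ∫ g in (Set.univ : Set G), f (g⁻¹ • x) ∂ν, ?_, ?_, ?_, ?_, ?_⟩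
  · rw [← contMDiffOn_univ]
    refine contMDiffOn_of_chart isOpen_univ fun c => ?_
    have h1 : SmoothFamily (X := G) (H := E r) (chartAt (E m) c).target
        fun g y => f (g⁻¹ • (chartAt (E m) c).symm y) :=
      hf.comp_contMDiffOn (contMDiff_inv_smul_symm r m c)
    exact (h1.contDiffOn_integral (ν := ν) isCompact_univ
      (chartAt (E m) c).open_target).mono Set.inter_subset_left
  · intro h x
    simp only [setIntegral_univ]
    have h1 : ∀ g : G, f (g⁻¹ • h • x) = f ((h⁻¹ * g)⁻¹ • x) := fun g => by
      rw [mul_inv_rev, inv_inv, mul_smul]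
    simp only [h1]
    exact integral_mul_left_eq_self (fun g : G => f (g⁻¹ • x)) h⁻¹
  · exact fun x => integral_nonneg fun g => hf0 _
  · intro x hx
    have h1 : f x ≠ 0 := by rwa [← Function.mem_support, hfU]
    simp only [setIntegral_univ]
    refine (hc x).integral_pos_of_hasCompactSupport_nonneg_nonzero
      (HasCompactSupport.of_compactSpace _) (fun g => hf0 _) (x := 1) ?_
    simpa using h1
  · intro x hx
    refine setIntegral_eq_zero_of_forall_eq_zero fun g _ => ?_
    by_contra h
    have : g⁻¹ • x ∈ U := by rwa [← hfU, Function.mem_support]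
    exact hx (by simpa using hUG g _ this)

end InvariantTamingForm

end TwistedDH
end

open scoped Manifold ContDiff Topology
noncomputable section
namespace TwistedDH

/-! ### The chain homotopy formula for closed two-forms. -/

section LocalHomotopyFormula

open MeasureTheory

variable {n : ℕ}

/-- The inclusion of `ℝⁿ` as a slice of `ℝ × ℝⁿ`. -/
abbrev sliceIncl (n : ℕ) : E n →L[ℝ] ℝ × E n := ContinuousLinearMap.inr ℝ ℝ (E n)

/-- The contraction of a `2`-covector on `ℝ × ℝⁿ` with `∂ₜ`, restricted to a slice. -/
def sliceContract (n : ℕ) : ((ℝ × E n) [⋀^Fin 2]→L[ℝ] ℝ) →L[ℝ] E n [⋀^Fin 1]→L[ℝ] ℝ :=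
  LinearMap.toContinuousLinearMap
    { toFun := fun a => (interior ((1 : ℝ), (0 : E n)) a).compContinuousLinearMap (sliceIncl n)
      map_add' := fun _ _ => rfl
      map_smul' := fun _ _ => rfl }

lemma sliceContract_apply (a : (ℝ × E n) [⋀^Fin 2]→L[ℝ] ℝ) (w : E n) :
    sliceContract n a ![w] = a ![(1, 0), (0, w)] :=
  congrArg a (funext fun i => by fin_cases i <;> rfl)

/-- Closedness of `A` expresses the differential of `ι(∂ₜ)A` along a slice as the `t`-derivative of
the restriction of `A` to the slice. Integration over `t` gives the difference of the restrictions
at the ends. -/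
lemma extDeriv_integral_slice {V : Set (E n)} (hV : IsOpen V)
    {A : ℝ × E n → (ℝ × E n) [⋀^Fin 2]→L[ℝ] ℝ} (hA : ContDiffOn ℝ ∞ A (Set.univ ×ˢ V))
    (hcl : ∀ q ∈ Set.univ ×ˢ V, extDeriv A q = 0) {y : E n} (hy : y ∈ V) :
    extDeriv (fun z => ∫ t in Set.Icc (0 : ℝ) 1, sliceContract n (A (t, z))) y =
      (A (1, y)).compContinuousLinearMap (sliceIncl n) -
        (A (0, y)).compContinuousLinearMap (sliceIncl n) := by
  have hAt : ∀ t, ∀ z ∈ V, ContDiffAt ℝ ∞ A (t, z) := fun t z hz =>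
    hA.contDiffAt ((isOpen_univ.prod hV).mem_nhds ⟨Set.mem_univ _, hz⟩)
  have hAd : ∀ t, DifferentiableAt ℝ A (t, y) := fun t => (hAt t y hy).differentiableAt (by simp)
  have hf : SmoothFamily (H := ℝ) V fun t z => sliceContract n (A (t, z)) :=
    smoothFamily_of_contDiffAt fun t z hz =>
      (sliceContract n).contDiff.contDiffAt.comp (t, z) (hAt t z hz)
  have hd := hf.hasFDerivAt_integral (ν := volume) (isCompact_Icc (a := (0 : ℝ)) (b := 1)) hV hy
  have hi := (hf.fderiv hV).integrableOn (ν := volume) (isCompact_Icc (a := (0 : ℝ)) (b := 1)) hy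
  have hfd : ∀ t u w, fderiv ℝ (fun z => sliceContract n (A (t, z))) y u ![w] =
      fderiv ℝ A (t, y) (0, u) ![(1, 0), (0, w)] := by
    intro t u w
    have h1 : HasFDerivAt (fun z : E n => (t, z)) (ContinuousLinearMap.inr ℝ ℝ (E n)) y :=
      hasFDerivAt_prodMk_right t y
    have h2 := ((sliceContract n).hasFDerivAt.comp y ((hAd t).hasFDerivAt.comp y h1)).fderiv
    have h3 := congrArg (fun f : E n →L[ℝ] E n [⋀^Fin 1]→L[ℝ] ℝ => f u ![w]) h2
    exact h3.trans (sliceContract_apply _ w)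
  ext u
  obtain ⟨u, w, rfl⟩ : ∃ u₀ u₁, u = ![u₀, u₁] :=
    ⟨u 0, u 1, funext fun i => by fin_cases i <;> rfl⟩
  let T : E n → E n → (E n →L[ℝ] E n [⋀^Fin 1]→L[ℝ] ℝ) →L[ℝ] ℝ := fun u w =>
    (evalCL ![w]).comp (ContinuousLinearMap.apply ℝ _ u)
  have hT : ∀ u w, (∫ t in Set.Icc (0 : ℝ) 1, fderiv ℝ (fun z => sliceContract n (A (t, z))) y)
      u ![w] = ∫ t in Set.Icc (0 : ℝ) 1, fderiv ℝ A (t, y) (0, u) ![(1, 0), (0, w)] := by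
    intro u w
    refine ((T u w).integral_comp_comm hi).symm.trans ?_
    exact integral_congr_ae (Filter.Eventually.of_forall fun t => hfd t u w)
  have hTi : ∀ u w, IntegrableOn (fun t => fderiv ℝ A (t, y) (0, u) ![(1, 0), (0, w)])
      (Set.Icc (0 : ℝ) 1) volume := by
    intro u w
    refine ((T u w).integrable_comp hi).congr (Filter.Eventually.of_forall fun t => hfd t u w)
  -- The equation `dA = 0`, evaluated on `(∂ₜ, u, w)`.
  have hcl' : ∀ t, fderiv ℝ A (t, y) (0, u) ![(1, 0), (0, w)] -
      fderiv ℝ A (t, y) (0, w) ![(1, 0), (0, u)] =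
        fderiv ℝ A (t, y) (1, 0) ![(0, u), (0, w)] := by
    intro t
    have h := congrArg (fun a : (ℝ × E n) [⋀^Fin 3]→L[ℝ] ℝ => a ![(1, 0), (0, u), (0, w)])
      (hcl (t, y) ⟨Set.mem_univ _, hy⟩)
    simp only [extDeriv, ContinuousAlternatingMap.alternatizeUncurryFin_apply] at h
    replace h := (Fin.sum_univ_three fun i : Fin 3 => (-1 : ℤ) ^ (i : ℕ) • fderiv ℝ A (t, y)
      (![((1 : ℝ), (0 : E n)), (0, u), (0, w)] i)
      (i.removeNth ![((1 : ℝ), (0 : E n)), (0, u), (0, w)])).symm.trans h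
    have e0 : (0 : Fin 3).removeNth ![((1 : ℝ), (0 : E n)), (0, u), (0, w)] =
      ![(0, u), (0, w)] := funext fun i => by fin_cases i <;> rfl
    have e1 : (1 : Fin 3).removeNth ![((1 : ℝ), (0 : E n)), (0, u), (0, w)] =
      ![(1, 0), (0, w)] := funext fun i => by fin_cases i <;> rfl
    have e2 : (2 : Fin 3).removeNth ![((1 : ℝ), (0 : E n)), (0, u), (0, w)] =
      ![(1, 0), (0, u)] := funext fun i => by fin_cases i <;> rfl
    rw [e0, e1, e2] at h
    simp at h
    linarith
  have hder : ∀ t, HasDerivAt (fun t => A (t, y) ![(0, u), (0, w)])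
      (fderiv ℝ A (t, y) (1, 0) ![(0, u), (0, w)]) t := by
    intro t
    have h1 : HasFDerivAt (fun s : ℝ => (s, y)) (ContinuousLinearMap.inl ℝ ℝ (E n)) t :=
      hasFDerivAt_prodMk_left t y
    let ev : ((ℝ × E n) [⋀^Fin 2]→L[ℝ] ℝ) →L[ℝ] ℝ := LinearMap.toContinuousLinearMap
      { toFun := fun a => a ![(0, u), (0, w)]
        map_add' := fun _ _ => rfl
        map_smul' := fun _ _ => rfl }
    exact (ev.hasFDerivAt.comp t ((hAd t).hasFDerivAt.comp t h1)).hasDerivAt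
  rw [extDeriv_one_apply, hd.fderiv, hT, hT, ← integral_sub (hTi u w) (hTi w u)]
  simp only [hcl']
  rw [integral_Icc_eq_integral_Ioc, ← intervalIntegral.integral_of_le zero_le_one,
    intervalIntegral.integral_eq_sub_of_hasDerivAt (fun t _ => hder t)]
  · have e : ∀ s : ℝ, (A (s, y)).compContinuousLinearMap (sliceIncl n) ![u, w] =
        A (s, y) ![(0, u), (0, w)] := fun s =>
      congrArg (A (s, y)) (funext fun i => by fin_cases i <;> rfl)
    rw [ContinuousAlternatingMap.sub_apply, e, e]
  · refine (intervalIntegrable_iff_integrableOn_Icc_of_le zero_le_one).mpr ?_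
    have := (hTi u w).sub (hTi w u)
    exact this.congr (Filter.Eventually.of_forall fun t => hcl' t)

end LocalHomotopyFormula

/-! ### The homotopy operator on the manifold. -/

section SmoothHomotopies

open MeasureTheory

variable {m : ℕ} {M : Type*} [TopologicalSpace M] [ChartedSpace (E m) M]

/-- A smooth homotopy `q_t : U → U`, `t ∈ ℝ`. -/
structure IsSmoothHomotopy (m : ℕ) {M : Type*} [TopologicalSpace M] [ChartedSpace (E m) M]
    (U : Set M) (q : ℝ → M → M) : Prop where
  smooth : ContMDiffOn (𝓘(ℝ, ℝ).prod (𝓡 m)) (𝓡 m) ∞ (fun p : ℝ × M => q p.1 p.2) (Set.univ ×ˢ U)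
  mapsTo : ∀ t, Set.MapsTo (q t) U U

/-- The contraction of the pullback of a `2`-form under a homotopy with `∂ₜ`, at `(t, x)`. -/
def homotopyContract (q : ℝ → M → M) (δ : DForm m 2 M) (x : M) (t : ℝ) : E m [⋀^Fin 1]→L[ℝ] ℝ :=
  (interior ((mfderiv 𝓘(ℝ, ℝ) (𝓡 m) (fun s => q s x) t : ℝ →L[ℝ] E m) 1)
    (δ (q t x) : E m [⋀^Fin 2]→L[ℝ] ℝ)).compContinuousLinearMap
      (mfderiv (𝓡 m) (𝓡 m) (q t) x : E m →L[ℝ] E m)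

/-- The `1`-form `∫₀¹ ι(∂ₜ) q⁎δ dt`. -/
def homotopyIntegral (q : ℝ → M → M) (δ : DForm m 2 M) : DForm m 1 M := fun x =>
  id (α := E m [⋀^Fin 1]→L[ℝ] ℝ) (∫ t in Set.Icc (0 : ℝ) 1, homotopyContract q δ x t)

variable {U : Set M} {q : ℝ → M → M}

lemma IsSmoothHomotopy.contMDiffAt (h : IsSmoothHomotopy m U q) (hU : IsOpen U) (t : ℝ) {x : M}
    (hx : x ∈ U) :
    ContMDiffAt (𝓘(ℝ, ℝ).prod (𝓡 m)) (𝓡 m) ∞ (fun p : ℝ × M => q p.1 p.2) (t, x) :=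
  h.smooth.contMDiffAt ((isOpen_univ.prod hU).mem_nhds ⟨Set.mem_univ _, hx⟩)

lemma IsSmoothHomotopy.contMDiffAt_right (h : IsSmoothHomotopy m U q) (hU : IsOpen U) (t : ℝ) {x : M}
    (hx : x ∈ U) : ContMDiffAt (𝓡 m) (𝓡 m) ∞ (q t) x :=
  (h.contMDiffAt hU t hx).comp x (f := fun x => (t, x)) (contMDiffAt_const.prodMk contMDiffAt_id)

lemma IsSmoothHomotopy.contMDiffAt_left (h : IsSmoothHomotopy m U q) (hU : IsOpen U) (t : ℝ) {x : M}
    (hx : x ∈ U) : ContMDiffAt 𝓘(ℝ, ℝ) (𝓡 m) ∞ (fun s => q s x) t :=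
  (h.contMDiffAt hU t hx).comp t (f := fun s => (s, x)) (contMDiffAt_id.prodMk contMDiffAt_const)

variable [IsManifold (𝓡 m) ∞ M]

/-- The coordinate expression of a homotopy. -/
def homotopyChart (q : ℝ → M → M) (c : M) (p : ℝ × E m) : M := q p.1 ((chartAt (E m) c).symm p.2)

lemma IsSmoothHomotopy.contMDiffAt_chart (h : IsSmoothHomotopy m U q) (hU : IsOpen U) {c : M} (t : ℝ)
    {y : E m} (hy : y ∈ (chartAt (E m) c).target) (hyU : (chartAt (E m) c).symm y ∈ U) :
    ContMDiffAt 𝓘(ℝ, ℝ × E m) (𝓡 m) ∞ (homotopyChart q c) (t, y) := by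
  have h1 : ContMDiffAt 𝓘(ℝ, ℝ × E m) (𝓡 m) ∞
      (fun p : ℝ × E m => (chartAt (E m) c).symm p.2) (t, y) :=
    (contMDiffAt_chart_symm hy).comp (t, y) contDiffAt_snd.contMDiffAt
  have h2 : ContMDiffAt 𝓘(ℝ, ℝ × E m) 𝓘(ℝ, ℝ) ∞ (fun p : ℝ × E m => p.1) (t, y) :=
    contDiffAt_fst.contMDiffAt
  exact (h.contMDiffAt hU t hyU).comp (t, y) (h2.prodMk h1)

lemma IsSmoothHomotopy.contMDiffOn_chart (h : IsSmoothHomotopy m U q) (hU : IsOpen U) (c : M) :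
    ContMDiffOn 𝓘(ℝ, ℝ × E m) (𝓡 m) ∞ (homotopyChart q c)
      (Set.univ ×ˢ ((chartAt (E m) c).target ∩ (chartAt (E m) c).symm ⁻¹' U)) := fun p hp =>
  (h.contMDiffAt_chart hU p.1 hp.2.1 hp.2.2).contMDiffWithinAt

/-- Identifies the intrinsic integrand with its expression on `ℝ × ℝᵐ`; the derivative of the
homotopy in coordinates splits into the velocity in `t` and the derivative of the map at time `t`.
-/
lemma IsSmoothHomotopy.sliceContract_pb (h : IsSmoothHomotopy m U q) (hU : IsOpen U)
    (δ : DForm m 2 M) {c : M} (t : ℝ)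
    {y : E m} (hy : y ∈ (chartAt (E m) c).target) (hyU : (chartAt (E m) c).symm y ∈ U) :
    sliceContract m (pb (homotopyChart q c) δ (t, y)) =
      (homotopyContract q δ ((chartAt (E m) c).symm y) t).compContinuousLinearMap
        (mfderiv (𝓡 m) (𝓡 m) (chartAt (E m) c).symm y : E m →L[ℝ] E m) := by
  set x := (chartAt (E m) c).symm y with hx
  have hQ : MDifferentiableAt 𝓘(ℝ, ℝ × E m) (𝓡 m) (homotopyChart q c) (t, y) :=
    (h.contMDiffAt_chart hU t hy hyU).mdifferentiableAt (by simp)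
  have h1 : mfderiv 𝓘(ℝ, ℝ) (𝓡 m) (homotopyChart q c ∘ fun s => (s, y)) t =
      (mfderiv 𝓘(ℝ, ℝ × E m) (𝓡 m) (homotopyChart q c) (t, y)).comp
        (mfderiv 𝓘(ℝ, ℝ) 𝓘(ℝ, ℝ × E m) (fun s => (s, y)) t) :=
    mfderiv_comp t hQ (hasFDerivAt_prodMk_left t y).differentiableAt.mdifferentiableAt
  have h2 : mfderiv (𝓡 m) (𝓡 m) (homotopyChart q c ∘ fun z => (t, z)) y =
      (mfderiv 𝓘(ℝ, ℝ × E m) (𝓡 m) (homotopyChart q c) (t, y)).comp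
        (mfderiv (𝓡 m) 𝓘(ℝ, ℝ × E m) (fun z => (t, z)) y) :=
    mfderiv_comp y hQ (hasFDerivAt_prodMk_right t y).differentiableAt.mdifferentiableAt
  have h3 : mfderiv (𝓡 m) (𝓡 m) (q t ∘ (chartAt (E m) c).symm) y =
      (mfderiv (𝓡 m) (𝓡 m) (q t) x).comp (mfderiv (𝓡 m) (𝓡 m) (chartAt (E m) c).symm y) :=
    mfderiv_comp y ((h.contMDiffAt_right hU t hyU).mdifferentiableAt (by simp))
      ((contMDiffAt_chart_symm hy).mdifferentiableAt (by simp))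
  rw [mfderiv_eq_fderiv, (hasFDerivAt_prodMk_left t y).fderiv] at h1
  rw [mfderiv_eq_fderiv, (hasFDerivAt_prodMk_right t y).fderiv] at h2
  ext u
  have e1 : (mfderiv 𝓘(ℝ, ℝ × E m) (𝓡 m) (homotopyChart q c) (t, y) : ℝ × E m →L[ℝ] E m) (1, 0) =
      (mfderiv 𝓘(ℝ, ℝ) (𝓡 m) (fun s => q s x) t : ℝ →L[ℝ] E m) 1 :=
    (congrArg (fun f : ℝ →L[ℝ] E m => f 1) h1).symm
  have e2 : ∀ w, (mfderiv 𝓘(ℝ, ℝ × E m) (𝓡 m) (homotopyChart q c) (t, y) : ℝ × E m →L[ℝ] E m)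
      (0, w) = (mfderiv (𝓡 m) (𝓡 m) (q t) x : E m →L[ℝ] E m)
        ((mfderiv (𝓡 m) (𝓡 m) (chartAt (E m) c).symm y : E m →L[ℝ] E m) w) := fun w =>
    congrArg (fun f : E m →L[ℝ] E m => f w) (h2.symm.trans h3)
  obtain ⟨w, rfl⟩ : ∃ w, u = ![w] := ⟨u 0, funext fun i => by fin_cases i; rfl⟩
  rw [sliceContract_apply]
  refine congrArg (δ (q t x) : E m [⋀^Fin 2]→L[ℝ] ℝ) (funext fun i => ?_)
  fin_cases i
  · exact e1
  · exact e2 w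

lemma homotopyContract_eq (h : IsSmoothHomotopy m U q) (hU : IsOpen U) (δ : DForm m 2 M) {x : M}
    (hx : x ∈ U) (t : ℝ) : homotopyContract q δ x t =
      sliceContract m (pb (homotopyChart q x) δ (t, chartAt (E m) x x)) := by
  have hxe : (chartAt (E m) x).symm (chartAt (E m) x x) = x :=
    (chartAt (E m) x).left_inv (mem_chart_source _ x)
  rw [h.sliceContract_pb hU δ t (mem_chart_target (E m) x) (by rwa [hxe]),
    mfderiv_chartAt_symm_self, hxe]
  rfl

variable {δ : DForm m 2 M}

lemma contDiffOn_pb_homotopyChart (h : IsSmoothHomotopy m U q) (hU : IsOpen U)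
    (hδ : SmoothFormOn U δ) (c : M) : ContDiffOn ℝ ∞ (pb (homotopyChart q c) δ)
      (Set.univ ×ˢ ((chartAt (E m) c).target ∩ (chartAt (E m) c).symm ⁻¹' U)) :=
  contDiffOn_pb hU hδ (isOpen_univ.prod ((chartAt (E m) c).isOpen_inter_preimage_symm hU))
    (h.contMDiffOn_chart hU c) fun p hp => h.mapsTo p.1 hp.2.2

lemma continuous_homotopyContract (h : IsSmoothHomotopy m U q) (hU : IsOpen U)
    (hδ : SmoothFormOn U δ) {x : M} (hx : x ∈ U) : Continuous (homotopyContract q δ x) := by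
  have h1 : homotopyContract q δ x = fun t =>
      sliceContract m (pb (homotopyChart q x) δ (t, chartAt (E m) x x)) :=
    funext fun t => homotopyContract_eq h hU δ hx t
  rw [h1]
  refine (sliceContract m).continuous.comp ?_
  rw [← continuousOn_univ]
  exact (contDiffOn_pb_homotopyChart h hU hδ x).continuousOn.comp
    (f := fun t : ℝ => (t, chartAt (E m) x x)) (by fun_prop) fun t ht =>
      ⟨ht, mem_chart_target (E m) x, by simpa using hx⟩

lemma map_homotopyIntegral (h : IsSmoothHomotopy m U q) (hU : IsOpen U)
    (hδ : SmoothFormOn U δ) {x : M} (hx : x ∈ U) {F : Type*} [NormedAddCommGroup F]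
    [NormedSpace ℝ F] [CompleteSpace F] (T : (E m [⋀^Fin 1]→L[ℝ] ℝ) →L[ℝ] F) :
    T (homotopyIntegral q δ x) = ∫ t in Set.Icc (0 : ℝ) 1, T (homotopyContract q δ x t) :=
  (T.integral_comp_comm ((continuous_homotopyContract h hU hδ hx).continuousOn.integrableOn_compact
    isCompact_Icc)).symm

lemma chartRep_homotopyIntegral (h : IsSmoothHomotopy m U q) (hU : IsOpen U)
    (hδ : SmoothFormOn U δ) {c : M} {y : E m} (hy : y ∈ (chartAt (E m) c).target)
    (hyU : (chartAt (E m) c).symm y ∈ U) : chartRep c (homotopyIntegral q δ) y =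
      ∫ t in Set.Icc (0 : ℝ) 1, sliceContract m (pb (homotopyChart q c) δ (t, y)) := by
  refine (map_homotopyIntegral h hU hδ hyU
    (compCL 1 (mfderiv (𝓡 m) (𝓡 m) (chartAt (E m) c).symm y))).trans ?_
  exact integral_congr_ae (Filter.Eventually.of_forall fun t =>
    (h.sliceContract_pb hU δ t hy hyU).symm)

lemma smoothFormOn_homotopyIntegral (h : IsSmoothHomotopy m U q) (hU : IsOpen U)
    (hδ : SmoothFormOn U δ) : SmoothFormOn U (homotopyIntegral q δ) := by
  intro c
  have hV := (chartAt (E m) c).isOpen_inter_preimage_symm hU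
  have hf : SmoothFamily (H := ℝ) ((chartAt (E m) c).target ∩ (chartAt (E m) c).symm ⁻¹' U)
      fun t z => sliceContract m (pb (homotopyChart q c) δ (t, z)) :=
    smoothFamily_of_contDiffAt fun t z hz =>
      (sliceContract m).contDiff.contDiffAt.comp (t, z) ((contDiffOn_pb_homotopyChart h hU
        hδ c).contDiffAt ((isOpen_univ.prod hV).mem_nhds ⟨Set.mem_univ _, hz⟩))
  exact (hf.contDiffOn_integral (ν := volume) (isCompact_Icc (a := (0 : ℝ)) (b := 1)) hV).congr
    fun y hy => chartRep_homotopyIntegral h hU hδ hy.1 hy.2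

/-- The chain homotopy formula: `d ∫₀¹ ι(∂ₜ) q⁎δ dt = q₁⁎δ - q₀⁎δ` for closed `δ`. -/
lemma extDeriv_chartRep_homotopyIntegral (h : IsSmoothHomotopy m U q) (hU : IsOpen U)
    (hδ : SmoothFormOn U δ) (hcl : ∀ x ∈ U, extd δ x = 0) {c : M} {y : E m}
    (hy : y ∈ (chartAt (E m) c).target) (hyU : (chartAt (E m) c).symm y ∈ U) :
    extDeriv (chartRep c (homotopyIntegral q δ)) y =
      pb (q 1 ∘ (chartAt (E m) c).symm) δ y - pb (q 0 ∘ (chartAt (E m) c).symm) δ y := by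
  have hV := (chartAt (E m) c).isOpen_inter_preimage_symm hU
  have h1 : chartRep c (homotopyIntegral q δ) =ᶠ[𝓝 y] fun z =>
      ∫ t in Set.Icc (0 : ℝ) 1, sliceContract m (pb (homotopyChart q c) δ (t, z)) := by
    filter_upwards [hV.mem_nhds ⟨hy, hyU⟩] with z hz
    exact chartRep_homotopyIntegral h hU hδ hz.1 hz.2
  rw [h1.extDeriv_eq, extDeriv_integral_slice hV (contDiffOn_pb_homotopyChart h hU hδ c) ?_
    ⟨hy, hyU⟩]
  · have h2 : ∀ t, pb (q t ∘ (chartAt (E m) c).symm) δ y =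
        (pb (homotopyChart q c) δ (t, y)).compContinuousLinearMap (sliceIncl m) := by
      intro t
      have h3 := pb_comp (F := homotopyChart q c) (ψ := fun z : E m => (t, z)) (σ := δ) (y := y)
        ((h.contMDiffAt_chart hU t hy hyU).mdifferentiableAt (by simp))
        (hasFDerivAt_prodMk_right t y).differentiableAt
      rw [(hasFDerivAt_prodMk_right t y).fderiv] at h3
      exact h3
    rw [h2, h2]
  · intro p hp
    rw [extDeriv_pb hU hδ (isOpen_univ.prod hV) (h.contMDiffOn_chart hU c)
      (fun p hp => h.mapsTo p.1 hp.2.2) hp]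
    exact congrArg (fun a : E m [⋀^Fin 3]→L[ℝ] ℝ => a.compContinuousLinearMap
      (mfderiv 𝓘(ℝ, ℝ × E m) (𝓡 m) (homotopyChart q c) p : ℝ × E m →L[ℝ] E m))
      (hcl _ (h.mapsTo p.1 hp.2.2))

end SmoothHomotopies

end TwistedDH
end

open scoped Manifold ContDiff Topology
noncomputable section
namespace TwistedDH

/-! ### Structures that agree on a subset; an equivariant Poincaré lemma. -/

section AgreeOn

variable {m : ℕ} {M : Type*} [TopologicalSpace M] [ChartedSpace (E m) M] {F : Type*}

lemma AgreeOn.symm {Y : Set M} {σ₀ σ₁ : DForm m 2 M} {Φ₀ Φ₁ : M → F}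
    (h : AgreeOn Y σ₀ Φ₀ σ₁ Φ₁) : AgreeOn Y σ₁ Φ₁ σ₀ Φ₀ := fun l hl V p hV hp hY q hq =>
  ⟨(h l hl V p hV hp hY q hq).1.symm, (h l hl V p hV hp hY q hq).2.symm⟩

lemma AgreeOn.trans {Y : Set M} {σ₀ σ₁ σ₂ : DForm m 2 M} {Φ₀ Φ₁ Φ₂ : M → F}
    (h : AgreeOn Y σ₀ Φ₀ σ₁ Φ₁) (h' : AgreeOn Y σ₁ Φ₁ σ₂ Φ₂) : AgreeOn Y σ₀ Φ₀ σ₂ Φ₂ :=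
  fun l hl V p hV hp hY q hq =>
    ⟨(h l hl V p hV hp hY q hq).1.trans (h' l hl V p hV hp hY q hq).1,
      (h l hl V p hV hp hY q hq).2.trans (h' l hl V p hV hp hY q hq).2⟩

/-- Test with a constant map from `ℝ¹`; test maps from `ℝ⁰` are excluded. -/
lemma AgreeOn.map_eq {Y : Set M} {σ₀ σ₁ : DForm m 2 M} {Φ₀ Φ₁ : M → F}
    (h : AgreeOn Y σ₀ Φ₀ σ₁ Φ₁) {x : M} (hx : x ∈ Y) : Φ₀ x = Φ₁ x :=
  (h 1 one_pos Set.univ (fun _ => x) isOpen_univ contMDiffOn_const (fun _ _ => hx) 0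
    (Set.mem_univ _)).1

/-- The pullbacks of two forms that agree on `Y` under a smooth map `ℝᵐ → Y` agree. -/
lemma AgreeOn.pb_eq {Y : Set M} {σ₀ σ₁ : DForm m 2 M} {Φ₀ Φ₁ : M → F}
    (h : AgreeOn Y σ₀ Φ₀ σ₁ Φ₁) {V : Set (E m)} {p : E m → M} (hV : IsOpen V)
    (hp : ContMDiffOn (𝓡 m) (𝓡 m) ∞ p V) (hY : Set.MapsTo p V Y) {y : E m} (hy : y ∈ V) :
    pb p σ₀ y = pb p σ₁ y := by
  -- For `m = 0` no test map on `ℝᵐ` is available, but there are no nonzero `2`-forms either.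
  rcases Nat.eq_zero_or_pos m with rfl | hm
  · rw [eq_zero_of_lt (by norm_num) (pb p σ₀ y), eq_zero_of_lt (by norm_num) (pb p σ₁ y)]
  · exact (h m hm V p hV hp hY y hy).2

end AgreeOn

/-! ### Equivariant homotopies and primitives. -/

section EquivariantHomotopies

open MeasureTheory

variable {r m : ℕ} {G : Type*} [TopologicalSpace G] [ChartedSpace (E r) G] [Group G]
  [LieGroup (𝓡 r) ∞ G]
  {M : Type*} [TopologicalSpace M] [ChartedSpace (E m) M] [IsManifold (𝓡 m) ∞ M]
  [MulAction G M] [ContMDiffSMul (𝓡 r) (𝓡 m) ∞ G M]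

omit [TopologicalSpace G] [ChartedSpace (E r) G] [LieGroup (𝓡 r) ∞ G] [IsManifold (𝓡 m) ∞ M]
  [ContMDiffSMul (𝓡 r) (𝓡 m) ∞ G M] in
-- Reparametrizing the time by a smooth transition function extends the homotopy to all real times.
-- So it is smooth on the open set `ℝ × U` and no boundary has to be considered.
lemma HasWeakRetraction.exists_smoothHomotopy {U C : Set M}
    (h : HasWeakRetraction G (m := m) U C) :
    ∃ q : ℝ → M → M, IsSmoothHomotopy m U q ∧ (∀ t (g : G), ∀ x ∈ U, q t (g • x) = g • q t x) ∧
      (∀ x ∈ U, q 0 x = x) ∧ Set.MapsTo (q 1) U C := by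
  obtain ⟨p, hp, hpU, hpG, hp0, hp1, -⟩ := h
  have hχ : ∀ t, Real.smoothTransition t ∈ Set.Icc (0 : ℝ) 1 := fun t =>
    ⟨Real.smoothTransition.nonneg t, Real.smoothTransition.le_one t⟩
  refine ⟨fun t => p (Real.smoothTransition t), ⟨?_, fun t => hpU _ (hχ t)⟩,
    fun t => hpG _ (hχ t), ?_, ?_⟩
  · refine hp.comp (f := fun q : ℝ × M => (Real.smoothTransition q.1, q.2)) ?_
      fun q hq => ⟨hχ _, hq.2⟩
    exact ((Real.smoothTransition.contDiff.contMDiff.comp contMDiff_fst).prodMk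
      contMDiff_snd).contMDiffOn
  · intro x hx
    simpa only [Real.smoothTransition.zero] using hp0 x hx
  · simpa only [Real.smoothTransition.one] using hp1

variable {U : Set M} {q : ℝ → M → M}

lemma map_pair_swap (a : E m [⋀^Fin 2]→L[ℝ] ℝ) (u w : E m) : a ![u, w] = -a ![w, u] := by
  have h : a (![w, u] ∘ Equiv.swap 0 1) = -a ![w, u] :=
    a.toAlternatingMap.map_swap ![w, u] (by simp)
  exact (congrArg a (funext fun i => by fin_cases i <;> rfl)).trans h

lemma mfderiv_equivariant_sharp (h : IsSmoothHomotopy m U q) (hU : IsOpen U) (hUG : IsInvariant G U)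
    (hG : ∀ t (g : G), ∀ x ∈ U, q t (g • x) = g • q t x) (t : ℝ) (X : E r) {x : M} (hx : x ∈ U) :
    (mfderiv (𝓡 m) (𝓡 m) (q t) x : E m →L[ℝ] E m) (sharp G X x) = (sharp G X (q t x) : E m) := by
  have h1 : (fun g : G => g • q t x) = q t ∘ fun g : G => g • x :=
    funext fun g => (hG t g x hx).symm
  have h1x : (1 : G) • x ∈ U := hUG 1 x hx
  have h2 : mfderiv (𝓡 r) (𝓡 m) (q t ∘ fun g : G => g • x) 1 =
      (mfderiv (𝓡 m) (𝓡 m) (q t) ((1 : G) • x)).comp (mfderiv (𝓡 r) (𝓡 m) (fun g : G => g • x) 1) :=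
    mfderiv_comp (1 : G) ((h.contMDiffAt_right hU t h1x).mdifferentiableAt (by simp))
      (mdifferentiableAt_smul_const x 1)
  have h3 : (mfderiv (𝓡 m) (𝓡 m) (q t) ((1 : G) • x) : E m →L[ℝ] E m) =
      mfderiv (𝓡 m) (𝓡 m) (q t) x := mfderiv_congr_point' (one_smul G x)
  have h4 : (mfderiv (𝓡 r) (𝓡 m) (fun g : G => g • q t x) 1 : E r →L[ℝ] E m) =
      (mfderiv (𝓡 m) (𝓡 m) (q t) x : E m →L[ℝ] E m).comp
        (mfderiv (𝓡 r) (𝓡 m) (fun g : G => g • x) 1 : E r →L[ℝ] E m) := by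
    rw [h1]
    exact h2.trans (congrArg (fun f : E m →L[ℝ] E m =>
      f.comp (mfderiv (𝓡 r) (𝓡 m) (fun g : G => g • x) 1 : E r →L[ℝ] E m)) h3)
  exact (congrArg (fun f : E r →L[ℝ] E m => f X) h4).symm

lemma IsHamiltonian.hasDerivAt_homotopy {σ : DForm m 2 M} {Φ : M → E r →L[ℝ] ℝ}
    (hσ : IsHamiltonian G U σ Φ) (h : IsSmoothHomotopy m U q) (hU : IsOpen U) (t : ℝ) (X : E r)
    {x : M} (hx : x ∈ U) : HasDerivAt (fun s => Φ (q s x) X)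
      ((σ (q t x) : E m [⋀^Fin 2]→L[ℝ] ℝ) ![(sharp G X (q t x) : E m),
        (mfderiv 𝓘(ℝ, ℝ) (𝓡 m) (fun s => q s x) t : ℝ →L[ℝ] E m) 1]) t := by
  have hq : MDifferentiableAt 𝓘(ℝ, ℝ) (𝓡 m) (fun s => q s x) t :=
    (h.contMDiffAt_left hU t hx).mdifferentiableAt (by simp)
  have hΦ := hσ.mdifferentiableAt hU X (h.mapsTo t hx)
  have h1 : mfderiv 𝓘(ℝ, ℝ) 𝓘(ℝ, ℝ) ((fun y => Φ y X) ∘ fun s => q s x) t =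
      (mfderiv (𝓡 m) 𝓘(ℝ, ℝ) (fun y => Φ y X) (q t x)).comp
        (mfderiv 𝓘(ℝ, ℝ) (𝓡 m) (fun s => q s x) t) := mfderiv_comp t hΦ hq
  rw [mfderiv_eq_fderiv] at h1
  have h2 : DifferentiableAt ℝ ((fun y => Φ y X) ∘ fun s => q s x) t :=
    (MDifferentiableAt.comp t hΦ hq).differentiableAt
  have h3 := h2.hasDerivAt
  rw [← fderiv_apply_one_eq_deriv] at h3
  have h4 := (congrArg (fun f : ℝ →L[ℝ] ℝ => f 1) h1).trans
    (hσ.hamilton X (q t x) (h.mapsTo t hx)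
      ((mfderiv 𝓘(ℝ, ℝ) (𝓡 m) (fun s => q s x) t : ℝ →L[ℝ] E m) 1))
  exact (congrArg (fun b : ℝ => HasDerivAt ((fun y => Φ y X) ∘ fun s => q s x) b t) h4).mp h3

/-- Two Hamiltonian structures on `U` that agree on a weak deformation retract `C` of `U` differ by
an equivariantly exact form. -/
theorem exists_primitive_of_agreeOn {C : Set M} (hU : IsOpen U) (hUG : IsInvariant G U)
    (hret : HasWeakRetraction G (m := m) U C) {σ₀ σ₁ : DForm m 2 M} {Φ₀ Φ₁ : M → E r →L[ℝ] ℝ}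
    (h₀ : IsHamiltonian G U σ₀ Φ₀) (h₁ : IsHamiltonian G U σ₁ Φ₁)
    (hC : AgreeOn C σ₀ Φ₀ σ₁ Φ₁) :
    ∃ γ : DForm m 1 M, SmoothFormOn U γ ∧ (∀ x ∈ U, σ₁ x = σ₀ x + extd γ x) ∧
      ∀ x ∈ U, Φ₁ x = Φ₀ x - contract G γ x := by
  obtain ⟨q, hq, hqG, hq0, hq1⟩ := hret.exists_smoothHomotopy
  -- The homotopy operator is applied to the difference of the two closed forms. At time `1` its
  -- pullback vanishes, as the structures agree on `C`, and at time `0` it is `δ`.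
  let δ : DForm m 2 M := σ₁ + (-1 : ℝ) • σ₀
  have hδ : SmoothFormOn U δ := h₁.smooth_form.add (h₀.smooth_form.smul _)
  have hcl : ∀ x ∈ U, extd δ x = 0 := by
    intro x hx
    rw [extd_add hU h₁.smooth_form (h₀.smooth_form.smul _) hx, extd_smul, h₁.closed x hx,
      h₀.closed x hx, smul_zero, add_zero]
  have hδx : ∀ x, (δ x : E m [⋀^Fin 2]→L[ℝ] ℝ) =
      (σ₁ x : E m [⋀^Fin 2]→L[ℝ] ℝ) - (σ₀ x : E m [⋀^Fin 2]→L[ℝ] ℝ) := by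
    intro x
    change (σ₁ x : E m [⋀^Fin 2]→L[ℝ] ℝ) + (-1 : ℝ) • (σ₀ x : E m [⋀^Fin 2]→L[ℝ] ℝ) = _
    module
  let γ := homotopyIntegral q δ
  have hγ : SmoothFormOn U γ := smoothFormOn_homotopyIntegral hq hU hδ
  -- The sign: `dγ = q₁⁎δ - q₀⁎δ = -δ`.
  refine ⟨(-1 : ℝ) • γ, hγ.smul _, fun x hx => ?_, fun x hx => ?_⟩
  · have hy := mem_chart_target (E m) x
    have hyx : (chartAt (E m) x).symm (chartAt (E m) x x) = x :=
      (chartAt (E m) x).left_inv (mem_chart_source _ x)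
    have hyU : (chartAt (E m) x).symm (chartAt (E m) x x) ∈ U := by rwa [hyx]
    have hV := (chartAt (E m) x).isOpen_inter_preimage_symm hU
    have e1 := extDeriv_chartRep_homotopyIntegral hq hU hδ hcl hy hyU
    -- The map `q 1` takes values in `C`, and its coordinate expression is an admissible test map.
    -- This is what agreement on `C` is designed for, although `C` need not be a submanifold.
    have e2 : pb (q 1 ∘ (chartAt (E m) x).symm) δ (chartAt (E m) x x) = 0 := by
      have hp : ContMDiffOn (𝓡 m) (𝓡 m) ∞ (q 1 ∘ (chartAt (E m) x).symm)
          ((chartAt (E m) x).target ∩ (chartAt (E m) x).symm ⁻¹' U) := fun y hy =>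
        ((hq.contMDiffAt_right hU 1 hy.2).comp y (contMDiffAt_chart_symm hy.1)).contMDiffWithinAt
      have h := hC.pb_eq hV hp (fun y hy => hq1 hy.2) ⟨hy, hyU⟩
      have h' : pb (q 1 ∘ (chartAt (E m) x).symm) δ (chartAt (E m) x x) =
          pb (q 1 ∘ (chartAt (E m) x).symm) σ₁ (chartAt (E m) x x) +
          (-1 : ℝ) • pb (q 1 ∘ (chartAt (E m) x).symm) σ₀ (chartAt (E m) x x) := rfl
      rw [h', h]
      module
    have e3 : pb (q 0 ∘ (chartAt (E m) x).symm) δ (chartAt (E m) x x) = δ x := by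
      refine Eq.trans ?_ (chartRep_self δ x)
      rw [chartRep_eq_pb]
      refine pb_congr ?_
      filter_upwards [hV.mem_nhds ⟨hy, hyU⟩] with y hy
      exact hq0 _ hy.2
    rw [e2, e3] at e1
    have e4 : (extd γ x : E m [⋀^Fin 2]→L[ℝ] ℝ) = 0 - (δ x : E m [⋀^Fin 2]→L[ℝ] ℝ) :=
      (extd_eq γ x).trans e1
    have e5 : (extd ((-1 : ℝ) • γ) x : E m [⋀^Fin 2]→L[ℝ] ℝ) =
        (-1 : ℝ) • (extd γ x : E m [⋀^Fin 2]→L[ℝ] ℝ) := extd_smul _ γ x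
    have e6 : (σ₁ x : E m [⋀^Fin 2]→L[ℝ] ℝ) =
        (σ₀ x : E m [⋀^Fin 2]→L[ℝ] ℝ) + (extd ((-1 : ℝ) • γ) x : E m [⋀^Fin 2]→L[ℝ] ℝ) := by
      rw [e5, e4, hδx]
      module
    exact e6
  · ext X
    -- Equivariance of the homotopy carries `X♯` to `X♯`, so by Hamilton's equation the contraction
    -- of the integrand with `X♯` is the derivative of `Φ₀ - Φ₁` along the path of `x`. At the end
    -- of the path this difference vanishes.
    have hder : ∀ t, HasDerivAt (fun s => Φ₀ (q s x) X - Φ₁ (q s x) X)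
        (homotopyContract q δ x t ![(sharp G X x : E m)]) t := by
      intro t
      have e := (h₀.hasDerivAt_homotopy hq hU t X hx).sub (h₁.hasDerivAt_homotopy hq hU t X hx)
      refine (congrArg (fun b : ℝ => HasDerivAt (fun s => Φ₀ (q s x) X - Φ₁ (q s x) X) b t) ?_).mp e
      have e1 : homotopyContract q δ x t ![(sharp G X x : E m)] =
          (δ (q t x) : E m [⋀^Fin 2]→L[ℝ] ℝ)
            ![(mfderiv 𝓘(ℝ, ℝ) (𝓡 m) (fun s => q s x) t : ℝ →L[ℝ] E m) 1,
              (sharp G X (q t x) : E m)] := by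
        refine congrArg (δ (q t x) : E m [⋀^Fin 2]→L[ℝ] ℝ) (funext fun i => ?_)
        fin_cases i
        · rfl
        · exact mfderiv_equivariant_sharp hq hU hUG hqG t X hx
      let s₁ : E m [⋀^Fin 2]→L[ℝ] ℝ := σ₁ (q t x)
      let s₀ : E m [⋀^Fin 2]→L[ℝ] ℝ := σ₀ (q t x)
      let X' : E m := sharp G X (q t x)
      let w : E m := (mfderiv 𝓘(ℝ, ℝ) (𝓡 m) (fun s => q s x) t : ℝ →L[ℝ] E m) 1
      have e2 : (δ (q t x) : E m [⋀^Fin 2]→L[ℝ] ℝ) ![w, X'] = s₁ ![w, X'] - s₀ ![w, X'] :=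
        congrArg (fun f : E m [⋀^Fin 2]→L[ℝ] ℝ => f ![w, X']) (hδx (q t x))
      have e3 : s₀ ![X', w] - s₁ ![X', w] = s₁ ![w, X'] - s₀ ![w, X'] := by
        rw [map_pair_swap s₀ X' w, map_pair_swap s₁ X' w]
        ring
      exact e3.trans (e1.trans e2).symm
    have hint := map_homotopyIntegral hq hU hδ hx (evalCL ![(sharp G X x : E m)])
    rw [integral_Icc_eq_integral_Ioc, ← intervalIntegral.integral_of_le zero_le_one] at hint
    have hftc := intervalIntegral.integral_eq_sub_of_hasDerivAt (a := 0) (b := 1)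
      (fun t _ => hder t) (((evalCL ![(sharp G X x : E m)]).continuous.comp
        (continuous_homotopyContract hq hU hδ hx)).intervalIntegrable 0 1)
    have hval : contract G γ x X = Φ₁ x X - Φ₀ x X := by
      refine (hint.trans hftc).trans ?_
      rw [hq0 x hx, hC.map_eq (hq1 hx)]
      ring
    have hneg : contract G ((-1 : ℝ) • γ) x X = - contract G γ x X := by
      rw [contract_smul]
      simp
    rw [sub_apply, hneg, hval]
    ring

end EquivariantHomotopies

end TwistedDH
end

open scoped Manifold ContDiff Topology
noncomputable section
namespace TwistedDH

/-! ### Localization by large twists. -/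

section Localization

open Filter

variable {r m : ℕ} {G : Type*} [TopologicalSpace G] [ChartedSpace (E r) G] [Group G]
  [LieGroup (𝓡 r) ∞ G]
  {M : Type*} [TopologicalSpace M] [ChartedSpace (E m) M] [IsManifold (𝓡 m) ∞ M]
  [MulAction G M] [ContMDiffSMul (𝓡 r) (𝓡 m) ∞ G M]

/-- An invariant `1`-form `Θ` with `Θ(v♯) ≥ 0` that vanishes exactly where `v♯` does. -/
structure IsTamingForm (G : Type*) [TopologicalSpace G] [ChartedSpace (E r) G] [Group G]
    [MulAction G M] (v : M → E r) (Θ : DForm m 1 M) : Prop where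
  smooth : SmoothFormOn Set.univ Θ
  invariant : InvariantFormOn G Set.univ Θ
  nonneg : ∀ x, 0 ≤ contract G Θ x (v x)
  mem : ∀ x, contract G Θ x (v x) = 0 → x ∈ localizingSet G (m := m) v
  eq_zero : ∀ x ∈ localizingSet G (m := m) v, Θ x = 0

section

variable {v : M → E r} {Θ : DForm m 1 M}

lemma continuous_pair {F : M → E r →L[ℝ] ℝ} {v : M → E r} (hF : Continuous F)
    (hv : Continuous v) : Continuous fun x => F x (v x) := hF.clm_apply hv

lemma IsTamingForm.continuous (hΘ : IsTamingForm G v Θ) (hv : IsTamingMap G (m := m) v) :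
    Continuous fun x => contract G Θ x (v x) :=
  continuous_pair (contMDiffOn_univ.mp (contMDiffOn_contract isOpen_univ hΘ.smooth)).continuous
    hv.smooth.continuous

lemma IsTamingForm.contract_eq_zero (hΘ : IsTamingForm G v Θ) {x : M}
    (hx : x ∈ localizingSet G (m := m) v) : contract (r := r) G Θ x = 0 := by
  ext X
  exact congrArg (fun a : E m [⋀^Fin 1]→L[ℝ] ℝ => a ![(sharp G X x : E m)]) (hΘ.eq_zero x hx)

lemma IsTamingForm.isClosed (hΘ : IsTamingForm G v Θ) (hv : IsTamingMap G (m := m) v) :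
    IsClosed (localizingSet G (m := m) v) := by
  have : localizingSet G (m := m) v = {x | contract G Θ x (v x) = 0} :=
    Set.ext fun x => ⟨fun hx => by
      change contract G Θ x (v x) = 0
      rw [hΘ.contract_eq_zero hx]; rfl, hΘ.mem x⟩
  rw [this]
  exact isClosed_eq (hΘ.continuous hv) continuous_const

lemma IsHamiltonian.mono {U V : Set M} {σ : DForm m 2 M} {Φ : M → E r →L[ℝ] ℝ}
    (h : IsHamiltonian G V σ Φ) (hUV : U ⊆ V) : IsHamiltonian G U σ Φ where
  smooth_form := h.smooth_form.mono hUV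
  closed x hx := h.closed x (hUV hx)
  invariant g x hx := h.invariant g x (hUV hx)
  smooth_map := h.smooth_map.mono hUV
  equivariant g x hx := h.equivariant g x (hUV hx)
  hamilton X x hx := h.hamilton X x (hUV hx)

lemma InvariantFormOn.mono {U V : Set M} {k : ℕ} {τ : DForm m k M} (h : InvariantFormOn G V τ)
    (hUV : U ⊆ V) : InvariantFormOn G U τ := fun g x hx => h g x (hUV hx)

lemma InvariantFormOn.smul {U : Set M} {k : ℕ} {τ : DForm m k M} (t : ℝ)
    (h : InvariantFormOn G U τ) : InvariantFormOn G U (t • τ) := fun g x hx =>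
  (pullback_smul _ t τ x).trans
    (congrArg (fun a : E m [⋀^Fin k]→L[ℝ] ℝ => t • a) (h g x hx))

lemma IsHamiltonian.twist_smul {U : Set M} (hU : IsOpen U) (hUG : IsInvariant G U)
    {σ : DForm m 2 M} {Φ : M → E r →L[ℝ] ℝ} (h : IsHamiltonian G U σ Φ)
    (hΘ : IsTamingForm G v Θ) (s : ℝ) :
    IsHamiltonian G U (twistForm σ (s • Θ)) (twistMap G Φ (s • Θ)) :=
  h.twist hU hUG ((hΘ.smooth.mono (Set.subset_univ _)).smul s)
    ((hΘ.invariant.mono (Set.subset_univ _)).smul s)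

lemma twistMap_smul_apply (Φ : M → E r →L[ℝ] ℝ) (s : ℝ) (x : M) :
    twistMap G Φ (s • Θ) x (v x) = Φ x (v x) + s * contract G Θ x (v x) := rfl

/-- The part of `U` where `⟨Φ, v⟩ ≤ c`. -/
def sublevel (U : Set M) (v : M → E r) (Φ : M → E r →L[ℝ] ℝ) (c : ℝ) : Set M :=
  {x | x ∈ U ∧ Φ x (v x) ≤ c}

/-- By the lower bound the sublevel set is the preimage of a compact interval under a proper map. -/
lemma IsPolarizedOn.isCompact_sublevel {U : Set M} {Φ : M → E r →L[ℝ] ℝ}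
    (h : IsPolarizedOn U v Φ) (c : ℝ) : IsCompact (sublevel U v Φ c) := by
  obtain ⟨b, hb⟩ := h.2
  have h1 := (h.1.isCompact_preimage (isCompact_Icc (a := b) (b := c))).image
    continuous_subtype_val
  convert h1 using 1
  ext x
  constructor
  · rintro ⟨hx, hc⟩
    exact ⟨⟨x, hx⟩, ⟨hb ⟨⟨x, hx⟩, rfl⟩, hc⟩, rfl⟩
  · rintro ⟨y, hy, rfl⟩
    exact ⟨y.2, hy.2⟩

lemma IsPolarizedOn.exists_le {U : Set M} {Φ : M → E r →L[ℝ] ℝ}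
    (h : IsPolarizedOn U v Φ) : ∃ b, ∀ x ∈ U, b ≤ Φ x (v x) := by
  obtain ⟨b, hb⟩ := h.2
  exact ⟨b, fun x hx => hb ⟨⟨x, hx⟩, rfl⟩⟩

/-- A bound for the pairing of the support of `φ` with the values of `v`. -/
def BoundsPairing (v : M → E r) (φ : (E r →L[ℝ] ℝ) → ℝ) (c : ℝ) : Prop :=
  ∀ ξ ∈ tsupport φ, ∀ x, ξ (v x) ≤ c

/-- The place where boundedness of `v` enters: the support of `φ` is bounded in `𝔤⁎`, so its pairing
with all values of `v` is bounded. -/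
lemma exists_boundsPairing (hvb : ∃ K : ℝ, ∀ x, ‖v x‖ ≤ K) {φ : (E r →L[ℝ] ℝ) → ℝ}
    (hφ : HasCompactSupport φ) : ∃ c, BoundsPairing v φ c := by
  obtain ⟨K, hK⟩ := hvb
  obtain ⟨R, hR⟩ := hφ.isCompact.isBounded.exists_norm_le
  refine ⟨R * K, fun ξ hξ x => (le_abs_self _).trans ((ξ.le_opNorm (v x)).trans ?_)⟩
  exact mul_le_mul (hR ξ hξ) (hK x) (norm_nonneg _) ((norm_nonneg _).trans (hR ξ hξ))

/-- Away from a neighbourhood `W` of the relevant part of the localizing set, a large twist moves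
`⟨Φ, v⟩` above any given level. -/
lemma IsTamingForm.eventually_lt_twist (hΘ : IsTamingForm G v Θ) (hv : IsTamingMap G (m := m) v)
    {S L W : Set M} {Φ : M → E r →L[ℝ] ℝ} {b c : ℝ} (hL : IsCompact L) (hW : IsOpen W)
    (hLW : L ∩ localizingSet G (m := m) v ⊆ W) (hb : ∀ x ∈ S, b ≤ Φ x (v x))
    (hc : ∀ x ∈ S, Φ x (v x) ≤ c → x ∈ L) :
    ∀ᶠ s : ℝ in atTop, ∀ x ∈ S, x ∉ W → c < twistMap G Φ (s • Θ) x (v x) := by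
  -- On the compact set `L \ W`, which does not meet the localizing set, `Θ(v♯)` has a positive
  -- lower bound.
  obtain ⟨ε, hε, h⟩ := (hL.diff hW).exists_forall_le' (hΘ.continuous hv).continuousOn (a := 0)
    fun x hx => lt_of_le_of_ne (hΘ.nonneg x) fun h0 => hx.2 (hLW ⟨hx.1, hΘ.mem x h0.symm⟩)
  -- Beyond `(c - b) / ε` the added term exceeds the gap between the lower bound `b` and the level
  -- `c`. Where `⟨Φ, v⟩` is above `c` already, a nonnegative twist leaves it there.
  filter_upwards [eventually_gt_atTop ((c - b) / ε), eventually_ge_atTop 0] with s hs hs0 x hx hxW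
  rw [twistMap_smul_apply]
  by_cases hxc : Φ x (v x) ≤ c
  · have h1 := h x ⟨hc x hx hxc, hxW⟩
    have h2 : c - b < s * ε := (div_lt_iff₀ hε).mp hs
    have h3 := mul_le_mul_of_nonneg_left h1 hs0
    have h4 := hb x hx
    linarith
  · have := mul_nonneg hs0 (hΘ.nonneg x)
    linarith

end

variable [T2Space M] [SecondCountableTopology M]

variable {μ : DForm m m M} {U : Set M} {σ : DForm m 2 M} {Φ : M → E r →L[ℝ] ℝ}
  {η η' ζ : EForm r m M} {φ : (E r →L[ℝ] ℝ) → ℝ} {v : M → E r} {Θ : DForm m 1 M} {c : ℝ}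

/-- For `s ≥ 0` twisting only raises `⟨Φ, v⟩`. So along the whole segment the integrands are
supported in the compact sublevel set of the original moment map, and homotopy invariance applies
with `γ = -sΘ`. -/
lemma IsTamingForm.DH_twist (hΘ : IsTamingForm G v Θ) (hμ : IsOrientationForm μ) (hU : IsOpen U)
    (hUG : IsInvariant G U) (h : IsHamiltonian G U σ Φ) (hpol : IsPolarizedOn U v Φ)
    (hη : η ∈ closedForms (m := m) G hU) (hφ : ContDiff ℝ ∞ φ) (hc : BoundsPairing v φ c)
    {s : ℝ} (hs : 0 ≤ s) :
    DH μ U (twistForm σ (s • Θ)) (twistMap G Φ (s • Θ)) η φ = DH μ U σ Φ η φ := by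
  refine DH_eq_of_homotopy (γ := (-s) • Θ) (L := sublevel U v Φ c) hμ hU h
    (h.twist_smul hU hUG hΘ s) hη.1.1 hη.2 hφ ((hΘ.smooth.mono (Set.subset_univ _)).smul _) ?_ ?_
    (hpol.isCompact_sublevel c) (fun x hx => hx.1) ?_
  · intro x _
    have h1 : (extd (s • Θ) x : E m [⋀^Fin 2]→L[ℝ] ℝ) =
        s • (extd Θ x : E m [⋀^Fin 2]→L[ℝ] ℝ) := extd_smul s Θ x
    have h2 : (extd ((-s) • Θ) x : E m [⋀^Fin 2]→L[ℝ] ℝ) =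
        (-s) • (extd Θ x : E m [⋀^Fin 2]→L[ℝ] ℝ) := extd_smul (-s) Θ x
    have h3 : (σ x : E m [⋀^Fin 2]→L[ℝ] ℝ) + (-1 : ℝ) • (extd (s • Θ) x : E m [⋀^Fin 2]→L[ℝ] ℝ) =
        (σ x : E m [⋀^Fin 2]→L[ℝ] ℝ) + (extd ((-s) • Θ) x : E m [⋀^Fin 2]→L[ℝ] ℝ) := by
      rw [h1, h2]
      module
    exact h3
  · intro x _
    rw [twistMap, contract_smul, contract_smul]
    module
  · intro x hx hxL t ht hmem
    refine hxL ⟨hx, ?_⟩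
    have h1 := hc _ hmem x
    have h2 : segMap Φ (twistMap G Φ (s • Θ)) t x (v x) =
        (1 - t) * Φ x (v x) + t * (Φ x (v x) + s * contract G Θ x (v x)) := rfl
    have h3 := mul_nonneg ht.1 (mul_nonneg hs (hΘ.nonneg x))
    rw [h2] at h1
    linarith

/-- The integral of a polarized Hamiltonian manifold is concentrated near the localizing set. -/
theorem IsTamingForm.eventually_DH_eq (hΘ : IsTamingForm G v Θ) (hv : IsTamingMap G (m := m) v)
    (hμ : IsOrientationForm μ) (hU : IsOpen U) (hUG : IsInvariant G U)
    (h : IsHamiltonian G U σ Φ) (hpol : IsPolarizedOn U v Φ)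
    (hη : η ∈ closedForms (m := m) G hU) (hφ : ContDiff ℝ ∞ φ) (hc : BoundsPairing v φ c)
    {W : Set M} (hW : IsOpen W) (hWU : W ⊆ U)
    (hLW : sublevel U v Φ c ∩ localizingSet G (m := m) v ⊆ W) :
    ∀ᶠ s : ℝ in atTop, DH μ U σ Φ η φ =
      DH μ W (twistForm σ (s • Θ)) (twistMap G Φ (s • Θ)) η φ := by
  obtain ⟨b, hb⟩ := hpol.exists_le
  filter_upwards [hΘ.eventually_lt_twist hv (hpol.isCompact_sublevel c) hW hLW hb
    fun x hx hxc => ⟨hx, hxc⟩, eventually_ge_atTop 0] with s hs hs0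
  rw [← hΘ.DH_twist hμ hU hUG h hpol hη hφ hc hs0]
  refine integralOn_eq_of_forall fun x => ?_
  by_cases hxW : x ∈ W
  · rw [if_pos hxW, if_pos (hWU hxW)]
  · rw [if_neg hxW]
    by_cases hxU : x ∈ U
    · rw [if_pos hxU]
      exact dhForm_eq_zero (fun hmem => not_le.mpr (hs x hxU hxW) (hc _ hmem x)) m
    · rw [if_neg hxU]

/-- The contributions near `C` of two Hamiltonian structures that agree on a weak deformation
retract `C` coincide. -/
theorem IsTamingForm.eventually_DH_eq_of_agreeOn (hΘ : IsTamingForm G v Θ)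
    (hv : IsTamingMap G (m := m) v) (hμ : IsOrientationForm μ) (hU : IsOpen U)
    (hUG : IsInvariant G U) {C : Set M} (hret : HasWeakRetraction G (m := m) U C)
    {σ₀ σ₁ : DForm m 2 M} {Φ₀ Φ₁ : M → E r →L[ℝ] ℝ}
    (h₀ : IsHamiltonian G U σ₀ Φ₀) (h₁ : IsHamiltonian G U σ₁ Φ₁) (hC : AgreeOn C σ₀ Φ₀ σ₁ Φ₁)
    {b₀ b₁ : ℝ} (hb₀ : ∀ x ∈ U, b₀ ≤ Φ₀ x (v x)) (hb₁ : ∀ x ∈ U, b₁ ≤ Φ₁ x (v x))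
    (hη : η ∈ closedForms (m := m) G hU) (hζ : ζ ∈ equivariantForms (m := m) G U)
    (hex : ∀ (X : E r) (k : ℕ), ∀ x ∈ U, η'.eval X k x = η.eval X k x + dG G ζ X k x)
    (hφ : ContDiff ℝ ∞ φ) (hc : BoundsPairing v φ c) {L : Set M} (hL : IsCompact L)
    (hL₀ : ∀ x ∈ U, Φ₀ x (v x) ≤ c → x ∈ L) (hL₁ : ∀ x ∈ U, Φ₁ x (v x) ≤ c → x ∈ L)
    (hLU : L ∩ localizingSet G (m := m) v ⊆ U) :
    ∀ᶠ s : ℝ in atTop, DH μ U (twistForm σ₁ (s • Θ)) (twistMap G Φ₁ (s • Θ)) η' φ =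
      DH μ U (twistForm σ₀ (s • Θ)) (twistMap G Φ₀ (s • Θ)) η φ := by
  have : LocallyCompactSpace M := Manifold.locallyCompact_of_finiteDimensional (𝓡 m)
  -- A compact subset of `U` whose interior contains the relevant part of the localizing set. After
  -- a large twist it contains the supports of all forms involved.
  obtain ⟨K, hK, hLK, hKU⟩ := exists_compact_between (hL.inter_right (hΘ.isClosed hv)) hU hLU
  obtain ⟨γ, hγ, hγσ, hγΦ⟩ := exists_primitive_of_agreeOn hU hUG hret h₀ h₁ hC
  filter_upwards [hΘ.eventually_lt_twist hv hL isOpen_interior hLK hb₀ hL₀,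
    hΘ.eventually_lt_twist hv hL isOpen_interior hLK hb₁ hL₁] with s hs₀ hs₁
  have hK' : ∀ x, x ∉ K → x ∉ _root_.interior K := fun x hx h => hx (interior_subset h)
  have e₀ := h₀.twist_smul hU hUG hΘ s
  have e₁ := h₁.twist_smul hU hUG hΘ s
  -- First the representative of the cohomology class is changed, then the Hamiltonian structure.
  refine (DH_eq_of_exact hμ hU e₁ hη.1.1 hζ.1 hex hφ hK hKU fun x hx hxK hmem =>
    not_le.mpr (hs₁ x hx (hK' x hxK)) (hc _ hmem x)).trans ?_
  refine DH_eq_of_homotopy hμ hU e₀ e₁ hη.1.1 hη.2 hφ hγ ?_ ?_ hK hKU ?_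
  · intro x hx
    have h1 : (σ₁ x : E m [⋀^Fin 2]→L[ℝ] ℝ) =
      (σ₀ x : E m [⋀^Fin 2]→L[ℝ] ℝ) + (extd γ x : E m [⋀^Fin 2]→L[ℝ] ℝ) := hγσ x hx
    have h2 : (σ₁ x : E m [⋀^Fin 2]→L[ℝ] ℝ) + (-1 : ℝ) • (extd (s • Θ) x : E m [⋀^Fin 2]→L[ℝ] ℝ) =
        (σ₀ x : E m [⋀^Fin 2]→L[ℝ] ℝ) + (-1 : ℝ) • (extd (s • Θ) x : E m [⋀^Fin 2]→L[ℝ] ℝ) +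
        (extd γ x : E m [⋀^Fin 2]→L[ℝ] ℝ) := by
      rw [h1]
      module
    exact h2
  · intro x hx
    rw [twistMap, twistMap, hγΦ x hx]
    abel
  · intro x hx hxK t ht hmem
    have h1 := hc _ hmem x
    have h2 : segMap (twistMap G Φ₀ (s • Θ)) (twistMap G Φ₁ (s • Θ)) t x (v x) =
        (1 - t) * twistMap G Φ₀ (s • Θ) x (v x) + t * twistMap G Φ₁ (s • Θ) x (v x) := rfl
    rw [h2] at h1
    -- Both twisted moment maps pair with `v` to more than `c` off `K`, hence so do their convex
    -- combinations.
    exact not_le.mpr (convex_Ioi c (hs₀ x hx (hK' x hxK)) (hs₁ x hx (hK' x hxK))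
      (sub_nonneg.mpr ht.2) ht.1 (sub_add_cancel 1 t)) h1

end Localization

end TwistedDH
end

open scoped Manifold ContDiff Topology
noncomputable section
namespace TwistedDH

/-! ### Existence of polarized completions. -/

section Completion

variable {r m : ℕ} {G : Type*} [TopologicalSpace G] [ChartedSpace (E r) G] [Group G]
  [LieGroup (𝓡 r) ∞ G]
  {M : Type*} [TopologicalSpace M] [ChartedSpace (E m) M] [IsManifold (𝓡 m) ∞ M]
  [MulAction G M] [ContMDiffSMul (𝓡 r) (𝓡 m) ∞ G M]
  {σ : DForm m 2 M} {Φ : M → E r →L[ℝ] ℝ} {v : M → E r} {Θ : DForm m 1 M}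

omit [IsManifold (𝓡 m) ∞ M] in
lemma component_subset {Z : Set M} (i : ConnectedComponents Z) : component i ⊆ Z := by
  rintro _ ⟨z, _, rfl⟩
  exact z.2

lemma diff_component {Z : Set M} (i : ConnectedComponents Z) :
    Z \ component i = Subtype.val '' {z : Z | (z : ConnectedComponents Z) = i}ᶜ := by
  ext x
  constructor
  · rintro ⟨hx, hxi⟩
    exact ⟨⟨x, hx⟩, fun h => hxi ⟨⟨x, hx⟩, h, rfl⟩, rfl⟩
  · rintro ⟨z, hz, rfl⟩
    refine ⟨z.2, ?_⟩
    rintro ⟨z', hz', h⟩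
    exact hz (Subtype.ext h ▸ hz')

lemma mem_component {Z : Set M} {x : M} (hx : x ∈ Z) :
    x ∈ component ((⟨x, hx⟩ : Z) : ConnectedComponents Z) := ⟨⟨x, hx⟩, rfl, rfl⟩

lemma component_subset_diff {Z : Set M} {i j : ConnectedComponents Z} (h : i ≠ j) :
    component i ⊆ Z \ component j := by
  rw [diff_component]
  rintro _ ⟨z, hz, rfl⟩
  exact ⟨z, fun hz' => h (hz.symm.trans hz'), rfl⟩

variable [T2Space M] [SecondCountableTopology M]

include m in
/-- A component of `Z` that is open in `Z` is separated from the remaining part of `Z`. -/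
lemma exists_separation {Z : Set M} (hZ : IsClosed Z) {i : ConnectedComponents Z}
    (hi : IsOpen {z : Z | (z : ConnectedComponents Z) = i}) :
    ∃ O W : Set M, IsOpen O ∧ IsOpen W ∧ component i ⊆ O ∧ Z \ component i ⊆ W ∧ Disjoint O W := by
  have : LocallyCompactSpace M := Manifold.locallyCompact_of_finiteDimensional (𝓡 m)
  have h1 : IsClosed (component i) := by
    refine hZ.isClosedEmbedding_subtypeVal.isClosedMap _ ?_
    exact isClosed_singleton.preimage ConnectedComponents.continuous_coe
  have h2 : IsClosed (Z \ component i) := by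
    rw [diff_component]
    exact hZ.isClosedEmbedding_subtypeVal.isClosedMap _ hi.isClosed_compl
  exact normal_separation h1 h2 Set.disjoint_sdiff_right

/-- The completion of `(U, σ, Φ)` by means of an invariant function `u` that is positive exactly on
`U`. -/
theorem exists_localCompletion [T2Space G] [CompactSpace G] (hΘ : IsTamingForm G v Θ)
    (hv : IsTamingMap G (m := m) v) (hΦ : IsHamiltonian G Set.univ σ Φ)
    (hpol : IsPolarizedOn Set.univ v Φ) {C U : Set M} (hU : IsOpen U) (hUG : IsInvariant G U)
    (hCU : C ⊆ U) (hCZ : C ⊆ localizingSet G (m := m) v)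
    (hUZ : closure U ∩ localizingSet G (m := m) v ⊆ C) (hret : HasWeakRetraction G (m := m) U C) :
    Nonempty (LocalCompletion G σ Φ v C) := by
  obtain ⟨u, hu, huG, hu0, hupos, huz⟩ := exists_invariant_function (m := m) r hU hUG
  -- The structure is twisted by `u⁻¹ Θ`, which is smooth on `U` only, so that `⟨Φ, v⟩` increases by
  -- `u⁻¹ Θ(v♯)`.
  have hγ : SmoothFormOn U (smulForm (fun x => (u x)⁻¹) Θ) := by
    refine SmoothFormOn.smulForm ?_ (hΘ.smooth.mono (Set.subset_univ _))
    intro x hx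
    exact ((contDiffAt_inv ℝ (hupos x hx).ne').contMDiffAt.comp x (hu x)).contMDiffWithinAt
  have hinv : InvariantFormOn G U (smulForm (fun x => (u x)⁻¹) Θ) := by
    intro g x hx
    have h1 : (pullback (fun y => g • y) (smulForm (fun x => (u x)⁻¹) Θ) x :
        E m [⋀^Fin 1]→L[ℝ] ℝ) = (u (g • x))⁻¹ •
          (pullback (fun y => g • y) Θ x : E m [⋀^Fin 1]→L[ℝ] ℝ) := rfl
    have h2 : (pullback (fun y => g • y) Θ x : E m [⋀^Fin 1]→L[ℝ] ℝ) = Θ x :=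
      hΘ.invariant g x trivial
    rw [huG, h2] at h1
    exact h1
  have hpair : ∀ x, twistMap G Φ (smulForm (fun x => (u x)⁻¹) Θ) x (v x) =
      Φ x (v x) + (u x)⁻¹ * contract G Θ x (v x) := fun x => rfl
  have hham := (hΦ.mono (Set.subset_univ U)).twist hU hUG hγ hinv
  have hΦc : Continuous fun x => Φ x (v x) :=
    continuous_pair (contMDiffOn_univ.mp hΦ.smooth_map).continuous hv.smooth.continuous
  have hle : ∀ x ∈ U, Φ x (v x) ≤ twistMap G Φ (smulForm (fun x => (u x)⁻¹) Θ) x (v x) := by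
    intro x hx
    have := mul_nonneg (inv_nonneg.mpr (hu0 x)) (hΘ.nonneg x)
    rw [hpair]
    linarith
  have hcont : Continuous fun x : U =>
      twistMap G Φ (smulForm (fun x => (u x)⁻¹) Θ) x (v x) :=
    continuous_pair (continuousOn_iff_continuous_domRestrict.mp hham.smooth_map.continuousOn)
      (hv.smooth.continuous.comp continuous_subtype_val)
  have hcomp : ∀ c, IsCompact
      (sublevel U v (twistMap G Φ (smulForm (fun x => (u x)⁻¹) Θ)) c) := by
    intro c
    -- Multiplied by `u`, the inequality makes sense on all of `M` and defines a closed set.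
    -- Together with `closure U` and the compact sublevel set of `Φ` it cuts out a compact set, and
    -- the point is that no boundary points are added.
    have h1 := ((hpol.isCompact_sublevel c).inter_right (isClosed_closure (s := U))).inter_right
      (isClosed_le ((hΘ.continuous hv).add (hΦc.mul hu.continuous))
        (continuous_const.mul hu.continuous) : IsClosed
          {x | contract G Θ x (v x) + Φ x (v x) * u x ≤ c * u x})
    convert h1 using 1
    ext x
    have key : ∀ y, 0 < u y → (Φ y (v y) + (u y)⁻¹ * contract G Θ y (v y) ≤ c ↔
        contract G Θ y (v y) + Φ y (v y) * u y ≤ c * u y) := by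
      intro y hy
      rw [← mul_le_mul_iff_left₀ hy, add_mul, mul_right_comm, inv_mul_cancel₀ hy.ne', one_mul,
        add_comm]
    constructor
    · rintro ⟨hx, hxc⟩
      refine ⟨⟨⟨trivial, (hle x hx).trans hxc⟩, subset_closure hx⟩, ?_⟩
      exact (key x (hupos x hx)).mp ((hpair x).symm.le.trans hxc)
    · rintro ⟨⟨_, hx⟩, hxc⟩
      have hxU : x ∈ U := by
        -- At a point of `closure U` outside `U` one has `u = 0`, and the inequality forces `Θ(v♯) =
        -- 0`. The point then lies in the localizing set, hence in `C ⊆ U`, a contradiction.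
        by_contra hxU
        have h2 : contract G Θ x (v x) + Φ x (v x) * u x ≤ c * u x := hxc
        rw [huz x hxU, mul_zero, mul_zero, add_zero] at h2
        exact hxU (hCU (hUZ ⟨hx, hΘ.mem x (le_antisymm h2 (hΘ.nonneg x))⟩))
      exact ⟨hxU, (hpair x).le.trans ((key x (hupos x hxU)).mpr hxc)⟩
  refine ⟨⟨U, hU, hUG, hCU, ?_, hret, _, _, hham, ⟨?_, ?_⟩, ?_⟩⟩
  · exact Set.Subset.antisymm (fun x hx => hUZ ⟨subset_closure hx.1, hx.2⟩)
      fun x hx => ⟨hCU hx, hCZ hx⟩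
  · refine isProperMap_iff_isCompact_preimage.mpr ⟨hcont, fun K hK => ?_⟩
    obtain ⟨c, hc⟩ := hK.bddAbove
    have h1 : IsCompact ((fun x : U => twistMap G Φ (smulForm (fun x => (u x)⁻¹) Θ) x (v x)) ⁻¹'
        Set.Iic c) := by
      rw [Subtype.isCompact_iff]
      convert hcomp c using 1
      ext x
      constructor
      · rintro ⟨y, hy, rfl⟩
        exact ⟨y.2, hy⟩
      · rintro ⟨hx, hxc⟩
        exact ⟨⟨x, hx⟩, hxc, rfl⟩
    exact h1.of_isClosed_subset (hK.isClosed.preimage hcont) fun x hx => hc hx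
  · obtain ⟨b, hb⟩ := hpol.exists_le
    refine ⟨b, ?_⟩
    rintro _ ⟨x, rfl⟩
    exact (hb x trivial).trans (hle x x.2)
  · intro l _ V p hV hp hpC y hy
    -- `Θ` vanishes on `C`, so the twisting form pulls back to zero under every test map; by
    -- naturality the same holds for its differential.
    have h0 : ∀ z ∈ V, (smulForm (fun x => (u x)⁻¹) Θ (p z) : E m [⋀^Fin 1]→L[ℝ] ℝ) = 0 :=
      fun z hz => (congrArg (fun a : E m [⋀^Fin 1]→L[ℝ] ℝ => (u (p z))⁻¹ • a)
        (hΘ.eq_zero _ (hCZ (hpC hz)))).trans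
          (smul_zero (A := E m [⋀^Fin 1]→L[ℝ] ℝ) (u (p z))⁻¹)
    have hpb : ∀ z ∈ V, pb p (smulForm (fun x => (u x)⁻¹) Θ) z = 0 := fun z hz =>
      congrArg (fun a : E m [⋀^Fin 1]→L[ℝ] ℝ => a.compContinuousLinearMap
        (mfderiv 𝓘(ℝ, E l) (𝓡 m) p z : E l →L[ℝ] E m)) (h0 z hz)
    have hext : pb p (extd (smulForm (fun x => (u x)⁻¹) Θ)) y = 0 := by
      rw [← extDeriv_pb hU hγ hV hp (fun z hz => hCU (hpC hz)) hy]
      have : pb p (smulForm (fun x => (u x)⁻¹) Θ) =ᶠ[𝓝 y] 0 := by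
        filter_upwards [hV.mem_nhds hy] with z hz using hpb z hz
      rw [this.extDeriv_eq]
      simpa using extDeriv_smul (x := y) (0 : ℝ) (0 : E l → E l [⋀^Fin 1]→L[ℝ] ℝ)
    constructor
    · rw [twistMap]
      have : contract (r := r) G (smulForm (fun x => (u x)⁻¹) Θ) (p y) = 0 := by
        ext X
        exact congrArg (fun a : E m [⋀^Fin 1]→L[ℝ] ℝ => a ![(sharp G X (p y) : E m)]) (h0 y hy)
      rw [this, add_zero]
    · have h1 : pb p (twistForm σ (smulForm (fun x => (u x)⁻¹) Θ)) y =
          pb p σ y + (-1 : ℝ) • pb p (extd (smulForm (fun x => (u x)⁻¹) Θ)) y := rfl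
      rw [hext, smul_zero, add_zero] at h1
      exact h1

end Completion

end TwistedDH
end

open scoped Manifold ContDiff Topology
noncomputable section
namespace TwistedDH

/-! ### Local contributions and their sum. -/

section LocalContributions

open Filter

variable {r m : ℕ} {G : Type*} [TopologicalSpace G] [ChartedSpace (E r) G] [Group G]
  {M : Type*} [TopologicalSpace M] [ChartedSpace (E m) M] [MulAction G M]

lemma EForm.eval_sub (η η' : EForm r m M) (X : E r) :
    EForm.eval (η - η') X = EForm.eval η X - EForm.eval η' X := by
  have h : η = (η - η') + η' := (sub_add_cancel η η').symm
  rw [eq_sub_iff_add_eq, ← EForm.eval_add, ← h]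

lemma Represents.exists_eval_eq {U V : Set M} {hU : IsOpen U} {hV : IsOpen V} {h : U ⊆ V}
    {A : EqCohomology (r := r) (m := m) G hV} {η α : EForm r m M}
    (hη : Represents η (EqCohomology.restrict hU hV h A)) (hα : Represents α A) :
    ∃ ζ ∈ equivariantForms (m := m) G U, ∀ (X : E r) (k : ℕ), ∀ x ∈ U,
      η.eval X k x = α.eval X k x + dG G ζ X k x := by
  obtain ⟨h1, h2⟩ := hη
  obtain ⟨h3, rfl⟩ := hα
  have h4 := (Submodule.Quotient.eq _).mp (h2.trans (Submodule.mapQ_apply _ _ _ _))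
  obtain ⟨ζ, hζ, hex⟩ := h4
  refine ⟨ζ, hζ, fun X k x hx => ?_⟩
  have h5 : (η - α).eval X k x = dG G ζ X k x := hex X k x hx
  rw [EForm.eval_sub] at h5
  exact eq_add_of_sub_eq' h5

/-- Both representatives are compared with a representative of the global class `A`, on the smaller
set where both comparisons are available. -/
lemma Represents.exists_eval_eq_of_restrict [IsManifold (𝓡 m) ∞ M] {U₀ U₁ V W : Set M}
    {hU₀ : IsOpen U₀} {hU₁ : IsOpen U₁} {hV : IsOpen V} {h₀ : U₀ ⊆ V} {h₁ : U₁ ⊆ V}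
    {A : EqCohomology (r := r) (m := m) G hV} {η₀ η₁ : EForm r m M}
    (hη₀ : Represents η₀ (EqCohomology.restrict hU₀ hV h₀ A))
    (hη₁ : Represents η₁ (EqCohomology.restrict hU₁ hV h₁ A)) (hW : IsOpen W) (hW₀ : W ⊆ U₀)
    (hW₁ : W ⊆ U₁) : ∃ ζ ∈ equivariantForms (m := m) G W, ∀ (X : E r) (k : ℕ), ∀ x ∈ W,
      η₁.eval X k x = η₀.eval X k x + dG G ζ X k x := by
  obtain ⟨⟨α, hα⟩, rfl⟩ := Submodule.Quotient.mk_surjective _ A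
  obtain ⟨ζ₀, hζ₀, hex₀⟩ := hη₀.exists_eval_eq ⟨hα, rfl⟩
  obtain ⟨ζ₁, hζ₁, hex₁⟩ := hη₁.exists_eval_eq ⟨hα, rfl⟩
  have e₀ := equivariantForms_mono G hW₀ hζ₀
  have e₁ := equivariantForms_mono G hW₁ hζ₁
  refine ⟨ζ₁ + (-1 : ℝ) • ζ₀, add_mem e₁ (Submodule.smul_mem _ _ e₀), fun X k x hx => ?_⟩
  rw [dG_add G hW e₁.1 (Submodule.smul_mem _ (-1 : ℝ) e₀).1 X k hx, dG_smul,
    hex₁ X k x (hW₁ hx), hex₀ X k x (hW₀ hx)]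
  module

lemma sublevel_inter_subset {v : M → E r} {σ : DForm m 2 M} {Φ : M → E r →L[ℝ] ℝ} {C : Set M}
    (D : LocalCompletion G σ Φ v C) (c : ℝ) :
    sublevel D.U v D.Φ' c ∩ localizingSet G (m := m) v ⊆ C := fun _ hx =>
  D.inter ▸ ⟨hx.1.1, hx.2⟩

variable [LieGroup (𝓡 r) ∞ G] [IsManifold (𝓡 m) ∞ M] [ContMDiffSMul (𝓡 r) (𝓡 m) ∞ G M]
  [T2Space M] [SecondCountableTopology M]
  {μ : DForm m m M} {σ : DForm m 2 M} {Φ : M → E r →L[ℝ] ℝ} {v : M → E r} {Θ : DForm m 1 M}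
  {A : EqCohomology (r := r) (m := m) G (isOpen_univ : IsOpen (Set.univ : Set M))}
  {φ : (E r →L[ℝ] ℝ) → ℝ} {c : ℝ}

/-- The local contributions do not depend on the choices made. -/
theorem LocalCompletion.DH_eq (hΘ : IsTamingForm G v Θ) (hv : IsTamingMap G (m := m) v)
    (hμ : IsOrientationForm μ) {C : Set M}
    (hretr : ∀ O : Set M, IsOpen O → C ⊆ O → ∃ U : Set M, IsOpen U ∧ IsInvariant G U ∧ C ⊆ U ∧
      U ⊆ O ∧ HasWeakRetraction G (m := m) U C)
    (D₀ D₁ : LocalCompletion G σ Φ v C) {η₀ η₁ : EForm r m M}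
    (hη₀ : Represents η₀ (EqCohomology.restrict D₀.isOpen isOpen_univ (Set.subset_univ _) A))
    (hη₁ : Represents η₁ (EqCohomology.restrict D₁.isOpen isOpen_univ (Set.subset_univ _) A))
    (hφ : ContDiff ℝ ∞ φ) (hc : BoundsPairing v φ c) :
    DH μ D₀.U D₀.σ' D₀.Φ' η₀ φ = DH μ D₁.U D₁.σ' D₁.Φ' η₁ φ := by
  -- The two completions live on different sets. For large twists both integrals equal integrals
  -- over this common smaller neighbourhood, which again retracts to `C`.
  obtain ⟨U, hU, hUG, hCU, hUO, hret⟩ := hretr (D₀.U ∩ D₁.U) (D₀.isOpen.inter D₁.isOpen)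
    (Set.subset_inter D₀.subset D₁.subset)
  have hU₀ : U ⊆ D₀.U := fun x hx => (hUO hx).1
  have hU₁ : U ⊆ D₁.U := fun x hx => (hUO hx).2
  obtain ⟨ζ, hζ, hex⟩ := hη₀.exists_eval_eq_of_restrict hη₁ hU hU₀ hU₁
  obtain ⟨b₀, hb₀⟩ := D₀.polarized.exists_le
  obtain ⟨b₁, hb₁⟩ := D₁.polarized.exists_le
  have e₀ := hΘ.eventually_DH_eq hv hμ D₀.isOpen D₀.invariant D₀.hamiltonian D₀.polarized hη₀.1 hφ
    hc hU hU₀ ((sublevel_inter_subset D₀ c).trans hCU)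
  have e₁ := hΘ.eventually_DH_eq hv hμ D₁.isOpen D₁.invariant D₁.hamiltonian D₁.polarized hη₁.1 hφ
    hc hU hU₁ ((sublevel_inter_subset D₁ c).trans hCU)
  have e₂ := hΘ.eventually_DH_eq_of_agreeOn hv hμ hU hUG hret (D₀.hamiltonian.mono hU₀)
    (D₁.hamiltonian.mono hU₁) (D₀.agree.trans D₁.agree.symm) (fun x hx => hb₀ x (hU₀ hx))
    (fun x hx => hb₁ x (hU₁ hx)) (closedForms_mono G hU D₀.isOpen hU₀ hη₀.1) hζ hex hφ hc
    ((D₀.polarized.isCompact_sublevel c).union (D₁.polarized.isCompact_sublevel c))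
    (fun x hx hxc => Or.inl ⟨hU₀ hx, hxc⟩) (fun x hx hxc => Or.inr ⟨hU₁ hx, hxc⟩)
    (by
      rw [Set.union_inter_distrib_right]
      exact Set.union_subset ((sublevel_inter_subset D₀ c).trans hCU)
        ((sublevel_inter_subset D₁ c).trans hCU))
  obtain ⟨s, h₀, h₁, h₂⟩ := (e₀.and (e₁.and e₂)).exists
  rw [h₀, h₁, h₂]

lemma integralOn_empty (τ : DForm m m M) : integralOn μ ∅ τ = 0 := by
  simp [integralOn]

/-- A component of the localizing set that does not meet the relevant part of `M` does not
contribute. -/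
theorem LocalCompletion.DH_eq_zero (hΘ : IsTamingForm G v Θ) (hv : IsTamingMap G (m := m) v)
    (hμ : IsOrientationForm μ) {C : Set M} (D : LocalCompletion G σ Φ v C) {η : EForm r m M}
    (hη : η ∈ closedForms G D.isOpen) (hφ : ContDiff ℝ ∞ φ) (hc : BoundsPairing v φ c)
    (hC : ∀ x ∈ C, c < Φ x (v x)) : DH μ D.U D.σ' D.Φ' η φ = 0 := by
  -- On `C` the completed moment map agrees with `Φ`, so the sublevel set misses the localizing set
  -- and even the empty neighbourhood is admissible.
  obtain ⟨s, hs⟩ := (hΘ.eventually_DH_eq hv hμ D.isOpen D.invariant D.hamiltonian D.polarized hη hφ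
    hc isOpen_empty (Set.empty_subset _) fun x hx => by
      have hxC := sublevel_inter_subset D c hx
      have := hx.1.2
      rw [D.agree.map_eq hxC] at this
      exact absurd this (not_le.mpr (hC x hxC))).exists
  rw [hs]
  exact integralOn_empty _

/-- Only finitely many components of `Z` meet a given compact set. -/
lemma finite_components {Z K : Set M} (hZ : IsClosed Z)
    (hisol : ∀ i : ConnectedComponents Z, IsOpen {z : Z | (z : ConnectedComponents Z) = i})
    (hK : IsCompact K) : {i : ConnectedComponents Z | (K ∩ component i).Nonempty}.Finite := by
  -- All components are open in `Z`, so the space of components is discrete and the image of a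
  -- compact set is finite.
  have : DiscreteTopology (ConnectedComponents Z) := discreteTopology_iff_isOpen_singleton.mpr
    fun i => ConnectedComponents.isQuotientMap_coe.isOpen_preimage.mp (hisol i)
  refine (((hZ.isClosedEmbedding_subtypeVal.isCompact_preimage hK).image
    ConnectedComponents.continuous_coe).finite_of_discrete).subset ?_
  rintro i ⟨_, hx, z, hz, rfl⟩
  exact ⟨z, hx, hz⟩

include m in
/-- Finitely many components of `Z` have disjoint open neighbourhoods, away from the remaining part
of `Z`. -/
lemma exists_disjoint_neighborhoods {Z : Set M} (hZ : IsClosed Z)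
    (hisol : ∀ i : ConnectedComponents Z, IsOpen {z : Z | (z : ConnectedComponents Z) = i})
    (I : Finset (ConnectedComponents Z)) :
    ∃ O : ConnectedComponents Z → Set M, (∀ i, IsOpen (O i)) ∧ (∀ i, component i ⊆ O i) ∧
      (∀ i, closure (O i) ∩ Z ⊆ component i) ∧ (I : Set (ConnectedComponents Z)).PairwiseDisjoint O := by
  classical
  choose P Q hP hQ hCP hCQ hPQ using fun i => exists_separation (m := m) hZ (hisol i)
  -- `P i` separates the component `i` from the open set `Q i` around the rest of `Z`. Intersecting
  -- with `Q j` for the other `j ∈ I` makes the sets disjoint.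
  refine ⟨fun i => P i ∩ ⋂ j ∈ I.erase i, Q j, fun i => ?_, fun i => ?_, fun i => ?_, ?_⟩
  · exact (hP i).inter (isOpen_biInter_finset fun j _ => hQ j)
  · refine Set.subset_inter (hCP i) (Set.subset_iInter₂ fun j hj => ?_)
    exact (component_subset_diff (Finset.ne_of_mem_erase hj).symm).trans (hCQ j)
  · rintro x ⟨hx, hxZ⟩
    by_contra hxi
    exact ((hPQ i).closure_left (hQ i)).notMem_of_mem_left
      (closure_mono Set.inter_subset_left hx) (hCQ i ⟨hxZ, hxi⟩)
  · intro i hi j hj hij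
    refine Set.disjoint_left.mpr fun x hx hx' => (hPQ j).notMem_of_mem_left hx'.1 ?_
    exact Set.mem_iInter₂.mp hx.2 j (Finset.mem_erase.mpr ⟨hij.symm, hj⟩)

/-- The localization formula. -/
theorem IsTamingForm.DH_eq_sum (hΘ : IsTamingForm G v Θ) (hv : IsTamingMap G (m := m) v)
    (hμ : IsOrientationForm μ) (hΦ : IsHamiltonian G Set.univ σ Φ)
    (hpol : IsPolarizedOn Set.univ v Φ)
    (hisol : ∀ i : ConnectedComponents (localizingSet G (m := m) v),
      IsOpen {z : localizingSet G (m := m) v | (z : ConnectedComponents _) = i})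
    (hretr : ∀ i : ConnectedComponents (localizingSet G (m := m) v),
      ∀ O : Set M, IsOpen O → component i ⊆ O →
        ∃ U : Set M, IsOpen U ∧ IsInvariant G U ∧ component i ⊆ U ∧ U ⊆ O ∧
          HasWeakRetraction G (m := m) U (component i))
    {η : EForm r m M} (hη : Represents η A)
    (D : ∀ i : ConnectedComponents (localizingSet G (m := m) v),
      LocalCompletion G σ Φ v (component i))
    {θ : ConnectedComponents (localizingSet G (m := m) v) → EForm r m M}
    (hθ : ∀ i, Represents (θ i)
      (EqCohomology.restrict (D i).isOpen isOpen_univ (Set.subset_univ _) A))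
    (hφ : ContDiff ℝ ∞ φ) (hc : BoundsPairing v φ c)
    (I : Finset (ConnectedComponents (localizingSet G (m := m) v)))
    (hI : ∀ i, (sublevel Set.univ v Φ c ∩ component i).Nonempty → i ∈ I) :
    DH μ Set.univ σ Φ η φ = ∑ i ∈ I, DH μ (D i).U (D i).σ' (D i).Φ' (θ i) φ := by
  have : LocallyCompactSpace M := Manifold.locallyCompact_of_finiteDimensional (𝓡 m)
  have hZ := hΘ.isClosed hv
  obtain ⟨O, hO, hCO, hOZ, hdisj⟩ := exists_disjoint_neighborhoods (m := m) hZ hisol I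
  choose U hU hUG hCU hUO hret using fun i => hretr i (O i ∩ (D i).U) ((hO i).inter (D i).isOpen)
    (Set.subset_inter (hCO i) (D i).subset)
  have hUD : ∀ i, U i ⊆ (D i).U := fun i x hx => (hUO i hx).2
  have hK := hpol.isCompact_sublevel c
  have hW : IsOpen (⋃ i ∈ I, U i) := isOpen_biUnion fun i _ => hU i
  have hKW : sublevel Set.univ v Φ c ∩ localizingSet G (m := m) v ⊆ ⋃ i ∈ I, U i := by
    rintro x ⟨hx, hxZ⟩
    have h1 := mem_component hxZ
    exact Set.mem_biUnion (hI _ ⟨x, hx, h1⟩) (hCU _ h1)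
  -- Compactness of the support in the union is needed in order to split the integral over the
  -- disjoint pieces.
  obtain ⟨K, hKc, hKK, hKW'⟩ := exists_compact_between (hK.inter_right hZ) hW hKW
  obtain ⟨b, hb⟩ := hpol.exists_le
  have e₀ := hΘ.eventually_DH_eq hv hμ isOpen_univ (fun _ _ _ => trivial) hΦ hpol hη.1 hφ hc hW
    (Set.subset_univ _) hKW
  have e₁ := hΘ.eventually_lt_twist hv hK isOpen_interior hKK hb fun x hx hxc => ⟨hx, hxc⟩
  have e₂ : ∀ i, ∀ᶠ s : ℝ in atTop, DH μ (D i).U (D i).σ' (D i).Φ' (θ i) φ =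
      DH μ (U i) (twistForm σ (s • Θ)) (twistMap G Φ (s • Θ)) η φ := by
    intro i
    obtain ⟨ζ, hζ, hex⟩ := (hθ i).exists_eval_eq hη
    obtain ⟨b', hb'⟩ := (D i).polarized.exists_le
    -- The global moment map need not be polarized on `U i`. Instead its global sublevel set is
    -- intersected with the closure of `U i`, which meets the localizing set only in the component
    -- `i`.
    have hL : (sublevel Set.univ v Φ c ∩ closure (U i) ∪ sublevel (D i).U v (D i).Φ' c) ∩
        localizingSet G (m := m) v ⊆ U i := by
      rintro x ⟨hx | hx, hxZ⟩
      · exact hCU i (hOZ i ⟨closure_mono (fun y hy => (hUO i hy).1) hx.2, hxZ⟩)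
      · exact hCU i (sublevel_inter_subset (D i) c ⟨hx, hxZ⟩)
    filter_upwards [hΘ.eventually_DH_eq hv hμ (D i).isOpen (D i).invariant (D i).hamiltonian
        (D i).polarized (hθ i).1 hφ hc (hU i) (hUD i)
        ((sublevel_inter_subset (D i) c).trans (hCU i)),
      hΘ.eventually_DH_eq_of_agreeOn hv hμ (hU i) (hUG i) (hret i)
        (hΦ.mono (Set.subset_univ _)) ((D i).hamiltonian.mono (hUD i)) (D i).agree.symm
        (fun x _ => hb x trivial) (fun x hx => hb' x (hUD i hx))
        (closedForms_mono G (hU i) isOpen_univ (Set.subset_univ _) hη.1)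
        (equivariantForms_mono G (hUD i) hζ) (fun X k x hx => hex X k x (hUD i hx)) hφ hc
        ((hK.inter_right isClosed_closure).union ((D i).polarized.isCompact_sublevel c))
        (fun x hx hxc => Or.inl ⟨⟨trivial, hxc⟩, subset_closure hx⟩)
        (fun x hx hxc => Or.inr ⟨hUD i hx, hxc⟩) hL] with s h1 h2
    rw [h1, h2]
  -- Finitely many eventual statements hold for a common `s`, at which the global integral and the
  -- local ones are integrals of one and the same form.
  obtain ⟨s, h₀, h₁, h₂⟩ := (e₀.and (e₁.and ((eventually_all_finset I).mpr fun i _ => e₂ i))).exists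
  rw [h₀, Finset.sum_congr rfl h₂]
  refine integralOn_iUnion (τ := dhForm (twistForm σ (s • Θ)) (twistMap G Φ (s • Θ)) η φ m) hμ I
    (fun i _ => hU i) (hdisj.mono fun i x hx => (hUO i hx).1) rfl hKc hKW'
    ((smoothFormOn_dhForm isOpen_univ (hΦ.twist_smul isOpen_univ (fun _ _ _ => trivial) hΘ s)
      hη.1.1.1 hφ m).mono (Set.subset_univ _)) ?_
  intro x _ hxK
  exact dhForm_eq_zero (fun hmem => not_le.mpr
    (h₁ x trivial fun h => hxK (interior_subset h)) (hc _ hmem x)) m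

end LocalContributions

end TwistedDH
end

/-! ### The theorem. -/

open scoped Manifold ContDiff Topology
open TwistedDH in
theorem mainTheorem2 {r m : ℕ}
    {G : Type*} [TopologicalSpace G] [ChartedSpace (E r) G] [Group G] [LieGroup (𝓡 r) ∞ G]
    [T2Space G] [CompactSpace G]
    {M : Type*} [TopologicalSpace M] [ChartedSpace (E m) M] [IsManifold (𝓡 m) ∞ M]
    [T2Space M] [SecondCountableTopology M]
    [MulAction G M] [ContMDiffSMul (𝓡 r) (𝓡 m) ∞ G M]
    (hm : Even m)
    (μ : DForm m m M) (hμ : IsOrientationForm μ)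
    (σ : DForm m 2 M) (Φ : M → E r →L[ℝ] ℝ) (hΦ : IsHamiltonian G Set.univ σ Φ)
    (A : EqCohomology (r := r) (m := m) G (isOpen_univ : IsOpen (Set.univ : Set M)))
    (v : M → E r) (hv : IsTamingMap G (m := m) v) (hvb : ∃ K : ℝ, ∀ x, ‖v x‖ ≤ K)
    (hpol : IsPolarizedOn Set.univ v Φ)
    (hisol : ∀ i : ConnectedComponents (localizingSet G (m := m) v),
      IsOpen {z : localizingSet G (m := m) v | (z : ConnectedComponents _) = i})
    (hretr : ∀ i : ConnectedComponents (localizingSet G (m := m) v),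
      ∀ O : Set M, IsOpen O → component i ⊆ O →
        ∃ U : Set M, IsOpen U ∧ IsInvariant G U ∧ component i ⊆ U ∧ U ⊆ O ∧
          HasWeakRetraction G (m := m) U (component i)) :
    -- each local contribution can be formed
    (∀ i : ConnectedComponents (localizingSet G (m := m) v),
      Nonempty (LocalCompletion G σ Φ v (component i))) ∧
    -- and does not depend on the choices made to form it
    (∀ (i : ConnectedComponents (localizingSet G (m := m) v))
      (D₀ D₁ : LocalCompletion G σ Φ v (component i)) (η₀ η₁ : EForm r m M),
      Represents η₀ (EqCohomology.restrict D₀.isOpen isOpen_univ (Set.subset_univ _) A) →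
      Represents η₁ (EqCohomology.restrict D₁.isOpen isOpen_univ (Set.subset_univ _) A) →
      ∀ φ : (E r →L[ℝ] ℝ) → ℝ, IsTestFunction φ →
        DH μ D₀.U D₀.σ' D₀.Φ' η₀ φ = DH μ D₁.U D₁.σ' D₁.Φ' η₁ φ) ∧
    -- and the (locally finite) sum of the local contributions is the global distribution
    (∀ (η : EForm r m M), Represents η A →
      ∀ (D : ∀ i : ConnectedComponents (localizingSet G (m := m) v),
          LocalCompletion G σ Φ v (component i))
        (θ : ConnectedComponents (localizingSet G (m := m) v) → EForm r m M),
      (∀ i, Represents (θ i)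
        (EqCohomology.restrict (D i).isOpen isOpen_univ (Set.subset_univ _) A)) →
      ∀ φ : (E r →L[ℝ] ℝ) → ℝ, IsTestFunction φ →
        (Function.support fun i => DH μ (D i).U (D i).σ' (D i).Φ' (θ i) φ).Finite ∧
        DH μ Set.univ σ Φ η φ = ∑ᶠ i, DH μ (D i).U (D i).σ' (D i).Φ' (θ i) φ) := by
  obtain ⟨Θ, h1, h2, h3, h4, h5⟩ := exists_invariant_tamingForm hv
  have hΘ : IsTamingForm G v Θ := ⟨h1, h2, h3, h4, h5⟩
  have hZ := hΘ.isClosed hv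
  refine ⟨fun i => ?_, fun i D₀ D₁ η₀ η₁ hη₀ hη₁ φ hφ => ?_, fun η hη D θ hθ φ hφ => ?_⟩
  -- The neighbourhood is taken inside a separating open set, so that its closure, and not only the
  -- set itself, meets `Z` in the component alone.
  · obtain ⟨O, W, hO, hW, hCO, hCW, hOW⟩ := exists_separation (m := m) hZ (hisol i)
    obtain ⟨U, hU, hUG, hCU, hUO, hret⟩ := hretr i O hO hCO
    refine exists_localCompletion hΘ hv hΦ hpol hU hUG hCU (component_subset i) ?_ hret
    rintro x ⟨hx, hxZ⟩
    by_contra hxi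
    exact (hOW.closure_left hW).notMem_of_mem_left (closure_mono hUO hx) (hCW ⟨hxZ, hxi⟩)
  · obtain ⟨c, hc⟩ := exists_boundsPairing hvb hφ.compact
    exact LocalCompletion.DH_eq hΘ hv hμ (hretr i) D₀ D₁ hη₀ hη₁ hφ.smooth hc
  · obtain ⟨c, hc⟩ := exists_boundsPairing hvb hφ.compact
    -- Only components meeting the compact sublevel set can contribute to this test function. The
    -- finite set depends on `φ` through `c`, but not on the completions or representatives.
    have hfin := finite_components hZ hisol (hpol.isCompact_sublevel c)
    have hI : (Function.support fun i => DH μ (D i).U (D i).σ' (D i).Φ' (θ i) φ) ⊆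
        hfin.toFinset := by
      intro i hi
      rw [Set.Finite.coe_toFinset]
      by_contra hn
      refine hi ((D i).DH_eq_zero hΘ hv hμ (hθ i).1 hφ.smooth hc fun x hx => ?_)
      by_contra hx'
      exact hn ⟨x, ⟨trivial, not_lt.mp hx'⟩, hx⟩
    refine ⟨(Finset.finite_toSet _).subset hI, ?_⟩
    rw [finsum_eq_sum_of_support_subset _ hI]
    exact hΘ.DH_eq_sum hv hμ hΦ hpol hisol hretr hη D hθ hφ.smooth hc _ fun i hi =>
      hfin.mem_toFinset.mpr hi
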